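/- **Setting.** A multigraph has finitely many labelled vertices and labelled, oriented edges (loops and multiple edges allowed); an $(n,m)$-multigraph has vertex set $\{1,\dots,n\}$ and edge set $\{1,\dots,m\}$. A subgraph consists of a set of vertices and a set of edges whose end points are among these vertices. Two multigraphs are isomorphic if there are bijections between their vertices and between their edges that respect incidences; one may require that they also respect the orientations of the edges, or allow that orientations are reversed: the theorem holds for each of these two conventions. $G[F]$ is the number of subgraphs of $G$ isomorphic to $F$. The density of $F$ is its number of edges divided by its number of vertices ($0$ for the empty multigraph), and $F$ is strictly balanced if it is strictly denser than each of its strict subgraphs. Let $\delta_0,\delta_1,\ldots\ge 0$ and $\Delta(x)=\sum_{j\ge0}\delta_j x^j/j!$. A random $(n,m,\Delta)$-multigraph is an $(n,m)$-multigraph $G$ chosen with probability proportional to $\prod_{v}\delta_{\deg(v)}$ (loops count twice in degrees). For a multigraph $F$ with $k$ vertices and $\ell$ edges put $$F(z,w,(y_j)_{j\ge0})=\sum_{G}\Big(\prod_{v\in V(G)}y_{\deg(v)}\Big)\frac{w^{\ell}}{2^{\ell}\,\ell!}\,\frac{z^{k}}{k!},$$ where $G$ runs over all $(k,\ell)$-multigraphs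 isomorphic to $F$. **Theorem.** Suppose that $\Delta$ has infinite radius of convergence, is not a polynomial, and that for every $j\ge 0$ the ratio $\Delta^{(j)}(x)/\Delta(x)$ has a finite positive limit as $x\to+\infty$. Let $F$ be a strictly balanced multigraph of density $d\ge 1$, let $m=m(n)$ be a sequence of nonnegative integers with $m=\Theta(n^{2-1/d})$, and let $\chi=\chi(n)$ be, for all large $n$, the positive solution of $$\frac{\chi\Delta'(\chi)}{\Delta(\chi)}=\frac{2m}{n}.$$ Assume condition (C3): for every $0<\varepsilon<\pi/2$, as $n\to\infty$, $$\int_{-\pi}^{\pi}\frac{\Delta(\chi e^{i\theta})^n}{e^{2mi\theta}}\,d\theta\;\sim\;\int_{-\varepsilon}^{\varepsilon}\frac{\Delta(\chi e^{i\theta})^n}{e^{2mi\theta}}\,d\theta .$$ Let $G_n$ be a random $(n,m,\Delta)$-multigraph and $$\alpha_n=F\Big(n,\frac1{2m},\Big(\frac{\chi^j\Delta^{(j)}(\chi)}{\Delta(\chi)}\Big)_{j\ge0}\Big).$$ Then $(\alpha_n)$ is bounded, and for every integer $t\ge0$ $$\mathbb P(G_n[F]=t)-e^{-\alpha_n}\frac{\alpha_n^t}{t!}\longrightarrow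 0 .$$ In particular, whenever $\lambda=\lim_{n\to\infty}\alpha_n$ exists, $G_n[F]$ has a limit Poisson law of parameter $\lambda$: $\mathbb P(G_n[F]=t)\to e^{-\lambda}\lambda^t/t!$ for every $t\ge 0$. This limit exists (and is finite) as soon as $m/n^{2-1/d}$ has a limit, and it is then positive if $d>1$. -/

import Mathlib

open Filter Topology Asymptotics
open scoped Nat

noncomputable section

/-- A multigraph with vertex set `V` and edge set `E` (loops and multiple edges allowed): every
edge `e` is a labelled oriented edge from `(G e).1` to `(G e).2`. The canonically labelled
`(n, m)`-multigraphs are the elements of `Multigraph (Fin n) (Fin m)`; there are `n ^ (2 * m)`. -/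
abbrev Multigraph (V E : Type*) := E → V × V

namespace Multigraph

variable {V E V' E' : Type*}

/-- A subgraph: a set of vertices and a set of edges whose end points are among these vertices. -/
structure Subgraph (G : Multigraph V E) where
  verts : Finset V
  edges : Finset E
  fst_mem : ∀ e ∈ edges, (G e).1 ∈ verts
  snd_mem : ∀ e ∈ edges, (G e).2 ∈ verts

/-- A subgraph seen as a multigraph of its own. -/
def Subgraph.toMultigraph {G : Multigraph V E} (H : G.Subgraph) :
    Multigraph {v // v ∈ H.verts} {e // e ∈ H.edges} :=
  fun e => (⟨(G e).1, H.fst_mem e e.2⟩, ⟨(G e).2, H.snd_mem e e.2⟩)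

/-- Isomorphism of multigraphs: bijections of the vertices and of the edges that respect the
incidences. For `oriented = true` they have to respect the orientations of the edges; for
`oriented = false` each edge may be sent to an edge with the same or the reversed orientation. -/
def Isomorphic (oriented : Bool) (G : Multigraph V E) (H : Multigraph V' E') : Prop :=
  ∃ (α : V ≃ V') (β : E ≃ E'), ∀ e,
    H (β e) = (α (G e).1, α (G e).2) ∨
      (oriented = false ∧ H (β e) = (α (G e).2, α (G e).1))

/-- `G[F]`, the number of `F`-subgraphs of `G`: subgraphs of `G` which are isomorphic to `F`. -/
def numCopies (oriented : Bool) (F : Multigraph V' E') (G : Multigraph V E) : ℕ :=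
  Nat.card {H : G.Subgraph // Isomorphic oriented F H.toMultigraph}

/-- Number of edges over number of vertices; the empty multigraph has density `0 / 0 = 0`. -/
def density [Fintype V] [Fintype E] (_G : Multigraph V E) : ℝ :=
  (Fintype.card E : ℝ) / (Fintype.card V : ℝ)

/-- `G` is strictly denser than each of its strict subgraphs. -/
def StrictlyBalanced [Fintype V] [Fintype E] (G : Multigraph V E) : Prop :=
  ∀ H : G.Subgraph, ¬ (H.verts = Finset.univ ∧ H.edges = Finset.univ) →
    H.toMultigraph.density < G.density

/-- The degree of a vertex; a loop counts twice. -/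
def degree [DecidableEq V] [Fintype E] (G : Multigraph V E) (v : V) : ℕ :=
  ∑ e, ((if (G e).1 = v then 1 else 0) + (if (G e).2 = v then 1 else 0))

/-- The weight `∏ v, δ (deg v)` of a multigraph. -/
def weight [Fintype V] [DecidableEq V] [Fintype E] (δ : ℕ → ℝ) (G : Multigraph V E) : ℝ :=
  ∏ v, δ (G.degree v)

/-- The total weight of all `(n, m)`-multigraphs. -/
def totalWeight (δ : ℕ → ℝ) (n m : ℕ) : ℝ :=
  ∑ G : Multigraph (Fin n) (Fin m), G.weight δ

open Classical in
/-- The probability that a random `(n, m, Δ)`-multigraph, i.e. an `(n, m)`-multigraph chosen with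
probability proportional to its weight, has exactly `t` subgraphs isomorphic to `F`. -/
def probCopies (oriented : Bool) (δ : ℕ → ℝ) (F : Multigraph V' E') (n m t : ℕ) : ℝ :=
  (∑ G : Multigraph (Fin n) (Fin m), if numCopies oriented F G = t then G.weight δ else 0) /
    totalWeight δ n m

open Classical in
/-- The generating function `F(z, w, y)` of the family of all canonically labelled multigraphs
isomorphic to `F`, with the vertices of degree `j` marked by `y j`. -/
def genFun (oriented : Bool) {k l : ℕ} (F : Multigraph (Fin k) (Fin l)) (z w : ℝ) (y : ℕ → ℝ) :
    ℝ :=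
  ∑ G : Multigraph (Fin k) (Fin l),
    if Isomorphic oriented F G then
      (∏ v, y (G.degree v)) * (w ^ l / (2 ^ l * (l ! : ℝ))) * (z ^ k / (k ! : ℝ))
    else 0

end Multigraph

/-- The exponential generating function `Δ(x) = ∑ δ_j x ^ j / j!` of the weights, used for real
and for complex `x`. -/
def weightGF {𝕜 : Type*} [RCLike 𝕜] (δ : ℕ → ℝ) (x : 𝕜) : 𝕜 :=
  ∑' j, ((δ j : ℝ) : 𝕜) * x ^ j / (j ! : 𝕜)

/-- The integral of `Δ(χ exp(iθ)) ^ n / exp(2 m i θ)` for `θ` from `-a` to `a`. -/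
def saddleIntegral (δ : ℕ → ℝ) (χ : ℝ) (n m : ℕ) (a : ℝ) : ℂ :=
  ∫ θ in (-a)..a, weightGF δ ((χ : ℂ) * Complex.exp (Complex.I * θ)) ^ n /
    Complex.exp (2 * m * Complex.I * θ)

/-- Condition (C3): for all `0 < ε < π / 2` the integral over the whole circle is asymptotically
equivalent to the one over the arc `|θ| ≤ ε`. -/
def ConditionC3 (δ : ℕ → ℝ) (χ : ℕ → ℝ) (m : ℕ → ℕ) : Prop :=
  ∀ ε : ℝ, 0 < ε → ε < Real.pi / 2 →
    (fun n => saddleIntegral δ (χ n) n (m n) Real.pi) ~[atTop]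
      (fun n => saddleIntegral δ (χ n) n (m n) ε)

/-- `F(n, 1 / (2 m), (χ ^ j Δ^(j)(χ) / Δ(χ))_j)`. -/
def poissonParam (oriented : Bool) (δ : ℕ → ℝ) {k l : ℕ} (F : Multigraph (Fin k) (Fin l))
    (χ : ℝ) (n m : ℕ) : ℝ :=
  F.genFun oriented n (1 / (2 * m))
    (fun j => χ ^ j * iteratedDeriv j (weightGF δ : ℝ → ℝ) χ / weightGF δ χ)

end

/-! Tilt the weights to the law `w j = δ j * χ ^ j / (j! * Δ(χ))`, whose mean is 2m/n by the saddle
point equation, and let S be the sum of n independent variables of this law. Seen from its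
half-edges, a multigraph is a map from 2m points to the vertices, so the total weight of the
multigraphs with b prescribed edges is a coefficient of a product of generating functions. Hence the
probability of b prescribed edges is (2(m-b))!/(2m)! times the conditional expectation, given S =
2m, of a product of falling factorials of independent degrees (`prob_prescribed`).

The rest of the combinatorics is the method of moments. The t-th binomial moment of the number of
copies is a sum over t-tuples of labelled copies. Separated tuples give α^t/t!, provided that
conditional factorial moments may be replaced by unconditional ones. In a tuple with an overlap,
strict balance forces k·(edges) > l·(vertices) for the union (`excess_pos_of_overlap`); by
integrality this costs a factor n^(-1/l). Bonferroni's inequalities turn convergence of binomial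
moments into Poisson approximation.

The comparison of moments uses exponential tilting: cut the n variables into m₀ blocks. If P(S = x)
≥ exp(-Q), conditioning on S = x changes the mean of a bounded function of one block by little,
because the entropy Q is shared by m₀ blocks (`coeff_tilt_le`). With M = 1 + χ = O(n^(1-κ)), κ =
k/l, it suffices that P(S = 2m) ≥ exp(-M n^c) for every c > 0.

This lower bound is the crux, because (C3) is only an asymptotic equivalence for each fixed arc,
without rate or uniformity. It says that every arc integral of the centred function ψ^n is at most
4π P(S = 2m). Suppose that this probability is far too small. By Baire's theorem the bound is
uniform over an interval [a, b] of arc lengths, and differences of arcs show that Re ψ^n is tiny on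
[a, b]. If |ψ|^n were not small at some θ₁ there, then ψ(θ)·conj ψ(θ₁) would be almost real for θ
near θ₁; extrapolating this exponential sum to θ = 0, where ψ = 1, makes ψ(θ₁) itself almost real,
so its n-th power is almost real and almost imaginary, hence tiny (`norm_charF_pow_lt`). Thus |ψ| is
bounded away from 1 on [a, b], and by Dirichlet approximation away from the zeros of 1 - exp(i u₀ θ)
for a fixed period u₀ (`exists_period`).

Consequently the law of a block, and by tilting the law of S wherever it is not tiny, is almost
invariant under shifts by u₀ (`shift_of_dichotomy`). A sum does not jump over its mean
(`exists_window`), so S has a value of decent probability just above x, and by almost invariance so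
has x + u₁ for some u₁ < u₀. But a law that varies slowly along progressions of difference u₀ has
arc integrals that are not all small: average the arc kernel over lengths, which makes it decay
fast, and compare with a Fejér kernel (`le_of_arc_le`). This is the contradiction. -/

noncomputable section

/-! ### Power series with nonnegative coefficients -/

namespace NonnegSeries

open PowerSeries Finset

/-- All coefficients are nonnegative and their sum is at most `C`. -/
def MassLE (A : PowerSeries ℝ) (C : ℝ) : Prop :=
  (∀ j, 0 ≤ coeff j A) ∧ ∀ N, ∑ j ∈ range N, coeff j A ≤ C

theorem coeff_mul_nonneg {A B : PowerSeries ℝ} (hA : ∀ j, 0 ≤ coeff j A)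
    (hB : ∀ j, 0 ≤ coeff j B) (j : ℕ) : 0 ≤ coeff j (A * B) := by
  rw [coeff_mul]
  exact sum_nonneg fun p _ => mul_nonneg (hA _) (hB _)

theorem coeff_one_nonneg (j : ℕ) : 0 ≤ coeff j (1 : PowerSeries ℝ) := by
  rw [coeff_one]; split_ifs <;> norm_num

theorem coeff_mul_mono_left {A B C : PowerSeries ℝ} (h : ∀ j, coeff j A ≤ coeff j B)
    (hC : ∀ j, 0 ≤ coeff j C) (j : ℕ) : coeff j (A * C) ≤ coeff j (B * C) := by
  rw [coeff_mul, coeff_mul]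
  exact sum_le_sum fun p _ => mul_le_mul_of_nonneg_right (h _) (hC _)

theorem MassLE.nonneg {A : PowerSeries ℝ} {C : ℝ} (h : MassLE A C) : 0 ≤ C := by
  simpa using h.2 0

theorem MassLE.coeff_le {A : PowerSeries ℝ} {C : ℝ} (h : MassLE A C) (j : ℕ) :
    coeff j A ≤ C :=
  (single_le_sum (f := fun i => coeff i A) (fun i _ => h.1 i) (self_mem_range_succ j)).trans
    (h.2 (j + 1))

theorem MassLE.mul {A B : PowerSeries ℝ} {C D : ℝ} (hA : MassLE A C) (hB : MassLE B D) :
    MassLE (A * B) (C * D) := by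
  refine ⟨coeff_mul_nonneg hA.1 hB.1, fun N => ?_⟩
  have h1 : ∑ j ∈ range N, coeff j (A * B) ≤
      ∑ p ∈ range N ×ˢ range N, coeff p.1 A * coeff p.2 B := by
    simp_rw [coeff_mul]
    rw [sum_sigma']
    have hinj : Set.InjOn (fun x : (_ : ℕ) × ℕ × ℕ => x.2)
        ((range N).sigma fun i => antidiagonal i) := by
      rintro ⟨a, p⟩ ha ⟨b, q⟩ hb (h : p = q)
      simp only [coe_sigma, Set.mem_sigma_iff, mem_coe, HasAntidiagonal.mem_antidiagonal] at ha hb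
      subst h
      have : a = b := by rw [← ha.2, ← hb.2]
      subst this; rfl
    rw [← sum_image (f := fun p : ℕ × ℕ => coeff p.1 A * coeff p.2 B) hinj]
    refine sum_le_sum_of_subset_of_nonneg ?_ fun p _ _ => mul_nonneg (hA.1 _) (hB.1 _)
    intro p hp
    simp only [mem_image, mem_sigma, mem_range,
      HasAntidiagonal.mem_antidiagonal, mem_product] at hp ⊢
    obtain ⟨⟨a, q⟩, ⟨h1, h2⟩, rfl⟩ := hp
    simp only at h1 h2 ⊢
    omega
  refine h1.trans ?_
  rw [sum_product, ← sum_mul_sum (range N) (range N) (fun i => coeff i A) fun j => coeff j B]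
  exact mul_le_mul (hA.2 N) (hB.2 N) (sum_nonneg fun i _ => hB.1 i) hA.nonneg

theorem massLE_one : MassLE (1 : PowerSeries ℝ) 1 := by
  refine ⟨coeff_one_nonneg, fun N => ?_⟩
  simp only [coeff_one]
  rw [sum_ite_eq']
  split_ifs <;> norm_num

theorem MassLE.pow {A : PowerSeries ℝ} {C : ℝ} (h : MassLE A C) (n : ℕ) :
    MassLE (A ^ n) (C ^ n) := by
  induction n with
  | zero => simpa using massLE_one
  | succ n ih => rw [pow_succ, pow_succ]; exact ih.mul h

theorem MassLE.mono {A : PowerSeries ℝ} {C D : ℝ} (h : MassLE A C) (hCD : C ≤ D) : MassLE A D :=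
  ⟨h.1, fun N => (h.2 N).trans hCD⟩

theorem massLE_mk {a : ℕ → ℝ} {C : ℝ} (ha : ∀ j, 0 ≤ a j) (h : HasSum a C) :
    MassLE (mk a) C :=
  ⟨fun j => by simpa using ha j, fun N => by
    simpa using sum_le_hasSum (range N) (fun i _ => ha i) h⟩

/-! ### Exponential tilting of one block among many -/

variable {α : Type*}

/-- The generating function of a family of configurations, graded by an integer. -/
def gradedSum (Ω : ℕ → Finset α) (F : α → ℝ) : PowerSeries ℝ := mk fun z => ∑ ω ∈ Ω z, F ω

theorem coeff_gradedSum (Ω : ℕ → Finset α) (F : α → ℝ) (z : ℕ) :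
    coeff z (gradedSum Ω F) = ∑ ω ∈ Ω z, F ω := by simp [gradedSum]

/-- The convexity bound exp(S) ≥ exp(t)(1 - t + S) for a sum S of m values of `Y`, averaged over the
configurations of total grade x; by exchangeability the linear term is m times one distinguished
block. The induction peels off a block ω and uses the hypothesis at t - Y ω, hence the quantifier
over t. -/
theorem exp_tilt_pow_ge (Ω : ℕ → Finset α) (ρ Y : α → ℝ) (hρ : ∀ ω, 0 ≤ ρ ω) (m : ℕ) :
    ∀ (t : ℝ) (x : ℕ), Real.exp t * ((1 - t) * coeff x (gradedSum Ω ρ ^ m) +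
        m * coeff x (gradedSum Ω (fun ω => ρ ω * Y ω) * gradedSum Ω ρ ^ (m - 1))) ≤
      coeff x (gradedSum Ω (fun ω => ρ ω * Real.exp (Y ω)) ^ m) := by
  induction m with
  | zero =>
    intro t x
    have h : Real.exp t * (1 - t) ≤ 1 := by
      have h1 := Real.add_one_le_exp (-t)
      have h2 : Real.exp t * Real.exp (-t) = 1 := by rw [← Real.exp_add]; simp
      nlinarith [Real.exp_pos t]
    have h0 := coeff_one_nonneg x
    simp only [pow_zero, CharP.cast_eq_zero, zero_mul, add_zero]
    nlinarith
  | succ m ih =>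
    intro t x
    set P := gradedSum Ω ρ with hP
    set D := gradedSum Ω (fun ω => ρ ω * Y ω) with hD
    set Q := gradedSum Ω (fun ω => ρ ω * Real.exp (Y ω)) with hQ
    have key : ∀ z y : ℕ, Real.exp t * ((1 - t) * (coeff z P * coeff y (P ^ m)) +
        (coeff z D * coeff y (P ^ m)) + m * (coeff z P * coeff y (D * P ^ (m - 1)))) ≤
        coeff z Q * coeff y (Q ^ m) := by
      intro z y
      simp only [hP, hD, hQ, coeff_gradedSum, sum_mul, mul_sum, ← sum_add_distrib]
      refine sum_le_sum fun ω _ => ?_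
      have h := mul_le_mul_of_nonneg_left (ih (t - Y ω) y)
        (mul_nonneg (hρ ω) (Real.exp_pos (Y ω)).le)
      refine le_trans (le_of_eq ?_) h
      have he : Real.exp t = Real.exp (Y ω) * Real.exp (t - Y ω) := by
        rw [← Real.exp_add]; ring_nf
      rw [he]
      ring
    have hm : (m : ℝ) * coeff x (P * (D * P ^ (m - 1))) = m * coeff x (D * P ^ m) := by
      rcases m with _ | m
      · simp
      · congr 2
        rw [Nat.add_sub_cancel, pow_succ]; ring
    have hsum := sum_le_sum fun (p : ℕ × ℕ) (_ : p ∈ antidiagonal x) => key p.1 p.2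
    rw [pow_succ' Q, coeff_mul x Q]
    refine le_trans (le_of_eq ?_) hsum
    rw [← mul_sum, sum_add_distrib, sum_add_distrib, ← mul_sum, ← mul_sum, ← coeff_mul,
      ← coeff_mul, ← coeff_mul, hm, Nat.add_sub_cancel, pow_succ' P]
    push_cast
    ring

/-- The conditional expectation of `Y`, given that the sum of many blocks takes a value which is
not too improbable, is controlled by the exponential moment of `Y`. -/
theorem coeff_tilt_le {Ω : ℕ → Finset α} {ρ Y : α → ℝ} (hρ : ∀ ω, 0 ≤ ρ ω) {R : PowerSeries ℝ}
    (hR : MassLE R 1) {a Q : ℝ} {m x : ℕ} (hm : 0 < m)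
    (hmass : MassLE (gradedSum Ω fun ω => ρ ω * Real.exp (Y ω)) (Real.exp a))
    (hc : Real.exp (-Q) ≤ coeff x (gradedSum Ω ρ ^ m * R)) :
    coeff x (gradedSum Ω (fun ω => ρ ω * Y ω) * gradedSum Ω ρ ^ (m - 1) * R) ≤
      (a + Q / m) * coeff x (gradedSum Ω ρ ^ m * R) := by
  set P := gradedSum Ω ρ with hP
  set D := gradedSum Ω (fun ω => ρ ω * Y ω) with hD
  -- This t makes exp(a)^m = exp(t) exp(-Q), which is at most exp(t) times the conditioning
  -- coefficient, so the factor exp(t) cancels and leaves t itself as the bound.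
  set t : ℝ := m * a + Q with ht
  have h1 : Real.exp t * ((1 - t) * coeff x (P ^ m * R) + m * coeff x (D * P ^ (m - 1) * R)) ≤
      coeff x (gradedSum Ω (fun ω => ρ ω * Real.exp (Y ω)) ^ m * R) := by
    have h := coeff_mul_mono_left
      (A := C (Real.exp t * (1 - t)) * P ^ m + C (Real.exp t * m) * (D * P ^ (m - 1)))
      (B := gradedSum Ω (fun ω => ρ ω * Real.exp (Y ω)) ^ m) (C := R) (fun j => ?_) hR.1 x
    · refine le_trans (le_of_eq ?_) h
      rw [add_mul, map_add, mul_assoc (C _) _ R, mul_assoc (C _) _ R, coeff_C_mul, coeff_C_mul]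
      ring
    · refine le_trans (le_of_eq ?_) (exp_tilt_pow_ge Ω ρ Y hρ m t j)
      rw [map_add, coeff_C_mul, coeff_C_mul]
      ring
  have h2 : coeff x (gradedSum Ω (fun ω => ρ ω * Real.exp (Y ω)) ^ m * R) ≤
      Real.exp a ^ m * 1 := ((hmass.pow m).mul hR).coeff_le x
  rw [mul_one, ← Real.exp_nat_mul] at h2
  have h3 : Real.exp (m * a) = Real.exp t * Real.exp (-Q) := by
    rw [← Real.exp_add]; congr 1; rw [ht]; ring
  have h4 : (1 - t) * coeff x (P ^ m * R) + m * coeff x (D * P ^ (m - 1) * R) ≤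
      Real.exp (-Q) := by
    have := h1.trans h2
    rw [h3] at this
    exact le_of_mul_le_mul_left this (Real.exp_pos t)
  have hm' : (0 : ℝ) < m := by exact_mod_cast hm
  have h5 : (m : ℝ) * coeff x (D * P ^ (m - 1) * R) ≤ t * coeff x (P ^ m * R) := by linarith
  have h6 : (a + Q / m) * coeff x (P ^ m * R) = t * coeff x (P ^ m * R) / m := by
    rw [ht]; field_simp
  rw [h6, le_div_iff₀ hm']
  linarith

end NonnegSeries

end

noncomputable section

/-! ### Probability laws on the natural numbers and their characteristic functions -/

namespace NatLaw

/-- A probability law on `ℕ`. -/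
structure IsLaw (w : ℕ → ℝ) : Prop where
  nonneg : ∀ j, 0 ≤ w j
  hasSum : HasSum w 1

/-- The law of a sum of two independent variables. -/
def convLaw (a b : ℕ → ℝ) (x : ℕ) : ℝ :=
  PowerSeries.coeff x (PowerSeries.mk a * PowerSeries.mk b)

/-- The law of a sum of `n` independent variables of law `w`. -/
def powLaw (w : ℕ → ℝ) (n x : ℕ) : ℝ := PowerSeries.coeff x (PowerSeries.mk w ^ n)

/-- The unit complex number of argument `t`. -/
def expI (t : ℝ) : ℂ := Complex.exp (t * Complex.I)

/-- The characteristic function. -/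
def charF (w : ℕ → ℝ) (θ : ℝ) : ℂ := ∑' j, (w j : ℂ) * expI (j * θ)

theorem expI_zero : expI 0 = 1 := by simp [expI]

theorem expI_add (s t : ℝ) : expI (s + t) = expI s * expI t := by
  simp [expI, add_mul, Complex.exp_add]

theorem expI_neg (s : ℝ) : expI (-s) = (expI s)⁻¹ := by
  simp [expI, Complex.exp_neg]

theorem expI_neg' (s : ℝ) : expI (-s) = (starRingEnd ℂ) (expI s) := by
  simp [expI, ← Complex.exp_conj]

@[simp] theorem norm_expI (t : ℝ) : ‖expI t‖ = 1 := Complex.norm_exp_ofReal_mul_I t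

theorem expI_ne_zero (t : ℝ) : expI t ≠ 0 := Complex.exp_ne_zero _

theorem expI_nat_mul (n : ℕ) (t : ℝ) : expI (n * t) = expI t ^ n := by
  simp only [expI, ← Complex.exp_nat_mul]; push_cast; ring_nf

theorem expI_re (t : ℝ) : (expI t).re = Real.cos t := by
  simp [expI, Complex.exp_ofReal_mul_I_re]

@[fun_prop] theorem continuous_expI : Continuous expI := by
  unfold expI; fun_prop

theorem norm_expI_sub_one_le (t : ℝ) : ‖expI t - 1‖ ≤ |t| := by
  have := Real.norm_exp_I_mul_ofReal_sub_one_le (x := t)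
  rw [expI, mul_comm]; simpa using this

theorem norm_expI_sub_le (s t : ℝ) : ‖expI s - expI t‖ ≤ |s - t| := by
  have h : expI s - expI t = expI t * (expI (s - t) - 1) := by
    rw [mul_sub, ← expI_add]; simp
  rw [h, norm_mul, norm_expI, one_mul]
  exact norm_expI_sub_one_le _

theorem expI_int_two_pi (z : ℤ) : expI (z * (2 * Real.pi)) = 1 := by
  rw [expI, Complex.exp_eq_one_iff]; exact ⟨z, by push_cast; ring⟩

theorem _root_.HasSum.congr_fun' {α ι : Type*} [AddCommMonoid α] [TopologicalSpace α] {f g : ι → α}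
    {s : α} (h : HasSum f s) (e : ∀ i, g i = f i) : HasSum g s := by
  rwa [funext e]

variable {w a b : ℕ → ℝ}

theorem summable_charF (hs : Summable w) (θ : ℝ) :
    Summable fun j => ‖(w j : ℂ) * expI (j * θ)‖ := by
  simpa using hs.abs

theorem hasSum_charF (hw : Summable w) (θ : ℝ) :
    HasSum (fun j => (w j : ℂ) * expI (j * θ)) (charF w θ) :=
  (summable_charF hw θ).of_norm.hasSum

theorem norm_charF_le (hw : IsLaw w) (θ : ℝ) : ‖charF w θ‖ ≤ 1 := by
  refine (norm_tsum_le_tsum_norm (summable_charF hw.hasSum.summable θ)).trans ?_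
  simp [abs_of_nonneg (hw.nonneg _), hw.hasSum.tsum_eq]

@[fun_prop] theorem continuous_charF (hw : Summable w) : Continuous (charF w) := by
  refine continuous_tsum (fun j => by fun_prop) hw.abs fun j θ => ?_
  simp

theorem IsLaw.convLaw (ha : IsLaw a) (hb : IsLaw b) : IsLaw (convLaw a b) := by
  refine ⟨NonnegSeries.coeff_mul_nonneg (by simpa using ha.nonneg) (by simpa using hb.nonneg), ?_⟩
  have hs := summable_norm_sum_mul_antidiagonal_of_summable_norm
    ha.hasSum.summable.norm hb.hasSum.summable.norm
  have h := tsum_mul_tsum_eq_tsum_sum_antidiagonal_of_summable_norm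
    ha.hasSum.summable.norm hb.hasSum.summable.norm
  rw [ha.hasSum.tsum_eq, hb.hasSum.tsum_eq, one_mul] at h
  rw [h]
  refine hs.of_norm.hasSum.congr_fun' fun x => ?_
  simp [NatLaw.convLaw, PowerSeries.coeff_mul]

theorem charF_conv (ha : Summable a) (hb : Summable b) (θ : ℝ) :
    charF (convLaw a b) θ = charF a θ * charF b θ := by
  rw [charF, charF, charF, tsum_mul_tsum_eq_tsum_sum_antidiagonal_of_summable_norm
    (summable_charF ha θ)
    (summable_charF hb θ)]
  refine tsum_congr fun x => ?_
  rw [convLaw, PowerSeries.coeff_mul]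
  push_cast
  rw [Finset.sum_mul]
  refine Finset.sum_congr rfl fun p hp => ?_
  rw [← Finset.HasAntidiagonal.mem_antidiagonal.1 hp]
  push_cast
  rw [add_mul, expI_add]; simp; ring

theorem powLaw_succ (w : ℕ → ℝ) (n : ℕ) : powLaw w (n + 1) = convLaw (powLaw w n) w := by
  ext x
  have : PowerSeries.mk (powLaw w n) = PowerSeries.mk w ^ n := by ext; simp [powLaw]
  rw [convLaw, this, powLaw, pow_succ]

theorem mk_powLaw (w : ℕ → ℝ) (n : ℕ) :
    PowerSeries.mk (powLaw w n) = PowerSeries.mk w ^ n := by ext; simp [powLaw]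

theorem powLaw_zero (w : ℕ → ℝ) : powLaw w 0 = fun x => if x = 0 then 1 else 0 := by
  ext x; simp [powLaw, PowerSeries.coeff_one]

theorem isLaw_ite : IsLaw fun x => if x = 0 then 1 else 0 :=
  ⟨fun j => by split_ifs <;> norm_num, hasSum_ite_eq 0 1⟩

theorem IsLaw.powLaw (hw : IsLaw w) (n : ℕ) : IsLaw (powLaw w n) := by
  induction n with
  | zero => rw [powLaw_zero]; exact isLaw_ite
  | succ n ih => rw [powLaw_succ]; exact ih.convLaw hw

theorem charF_powLaw (hw : IsLaw w) (n : ℕ) (θ : ℝ) :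
    charF (powLaw w n) θ = charF w θ ^ n := by
  induction n with
  | zero =>
    rw [powLaw_zero, charF, tsum_eq_single 0]
    · simp [expI_zero]
    · intro j hj; simp [hj]
  | succ n ih => rw [powLaw_succ, charF_conv (hw.powLaw n).hasSum.summable hw.hasSum.summable, ih, pow_succ]

/-! #### Expectations -/

theorem IsLaw.le_one (hw : IsLaw w) (j : ℕ) : w j ≤ 1 :=
  le_hasSum hw.hasSum j fun i _ => hw.nonneg i

/-- A law is determined on finite sets by partial sums at most one. -/
theorem IsLaw.sum_le_one (hw : IsLaw w) (s : Finset ℕ) : ∑ j ∈ s, w j ≤ 1 :=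
  sum_le_hasSum s (fun i _ => hw.nonneg i) hw.hasSum

theorem IsLaw.massLE (hw : IsLaw w) : NonnegSeries.MassLE (PowerSeries.mk w) 1 :=
  NonnegSeries.massLE_mk hw.nonneg hw.hasSum

/-- The identity `x P(S = x) = n E[X 1(S = x)]`. -/
theorem mul_powLaw (w : ℕ → ℝ) (n x : ℕ) :
    (x : ℝ) * powLaw w (n + 1) x = (n + 1) * convLaw (powLaw w n) (fun j => j * w j) x := by
  cases x with
  | zero => simp [convLaw, PowerSeries.coeff_mul]
  | succ x =>
    -- Differentiate the power and compare coefficients; multiplying by X turns the derivative of w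
    -- into the sequence j * w j.
    have h := congrArg (PowerSeries.coeff x)
      ((PowerSeries.derivative ℝ).leibniz_pow (PowerSeries.mk w) (n + 1))
    rw [PowerSeries.coeff_derivative] at h
    have e : (PowerSeries.mk fun j : ℕ => (j : ℝ) * w j) =
        PowerSeries.X * PowerSeries.derivative ℝ (PowerSeries.mk w) := by
      ext j
      cases j with
      | zero => simp
      | succ j => rw [PowerSeries.coeff_succ_X_mul, PowerSeries.coeff_derivative]; simp; ring
    rw [convLaw, e, mk_powLaw, ← mul_assoc, mul_comm _ PowerSeries.X, mul_assoc,
      PowerSeries.coeff_succ_X_mul, powLaw]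
    have e2 : ((n : PowerSeries ℝ) + 1) = PowerSeries.C ((n : ℝ) + 1) := by simp
    simp only [add_tsub_cancel_right, smul_eq_mul, nsmul_eq_mul, Nat.cast_add, Nat.cast_one,
      e2, PowerSeries.coeff_C_mul] at h
    push_cast
    rw [mul_comm, h]

theorem hasSum_conv {A B : ℝ} (hA : HasSum a A)
    (hB : HasSum b B) : HasSum (convLaw a b) (A * B) := by
  have hs := summable_norm_sum_mul_antidiagonal_of_summable_norm hA.summable.norm hB.summable.norm
  have h := tsum_mul_tsum_eq_tsum_sum_antidiagonal_of_summable_norm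
    hA.summable.norm hB.summable.norm
  rw [hA.tsum_eq, hB.tsum_eq] at h
  rw [h]
  refine hs.of_norm.hasSum.congr_fun' fun x => ?_
  simp [convLaw, PowerSeries.coeff_mul]

theorem hasSum_powLaw_mean (hw : IsLaw w) {μ : ℝ} (hμ : HasSum (fun j : ℕ => (j : ℝ) * w j) μ)
    (n : ℕ) : HasSum (fun j : ℕ => (j : ℝ) * powLaw w n j) (n * μ) := by
  cases n with
  | zero =>
    rw [Nat.cast_zero, zero_mul]
    refine (hasSum_zero (α := ℝ) (β := ℕ)).congr_fun' fun j => ?_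
    by_cases h : j = 0 <;> simp [powLaw_zero, h]
  | succ n =>
    simp_rw [mul_powLaw]
    have := (hasSum_conv (hw.powLaw n).hasSum hμ).mul_left ((n : ℝ) + 1)
    simpa using this

/-! #### Fourier inversion -/

theorem integral_expI (c : ℝ) (hc : c ≠ 0) (ε : ℝ) :
    ∫ θ in (-ε)..ε, expI (c * θ) = ((2 * Real.sin (c * ε) / c : ℝ) : ℂ) := by
  have h := integral_exp_mul_complex (a := -ε) (b := ε) (c := (c : ℂ) * Complex.I)
    (by simp [hc])
  have e : (fun θ : ℝ => expI (c * θ)) =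
      fun θ : ℝ => Complex.exp ((c : ℂ) * Complex.I * (θ : ℂ)) := by
    ext θ; simp only [expI]; push_cast; ring_nf
  rw [e, h]
  have hcc : (c : ℂ) ≠ 0 := by exact_mod_cast hc
  push_cast
  rw [Complex.sin]
  field_simp
  ring_nf
  simp [Complex.I_sq]
  ring_nf

/-- The kernel `∫ e^{iuθ} dθ` over `|θ| ≤ ε`. -/
def arcKernel (ε : ℝ) (u : ℝ) : ℝ := if u = 0 then 2 * ε else 2 * Real.sin (u * ε) / u

theorem integral_expI' (c ε : ℝ) :
    ∫ θ in (-ε)..ε, expI (c * θ) = (arcKernel ε c : ℂ) := by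
  rw [arcKernel]
  split_ifs with h
  · simp [h, expI_zero]; ring
  · exact integral_expI c h ε

/-- Integrated term by term, an arc integral is the law summed against a sinc-shaped kernel centred
at x. All later estimates of arcs pass through this form. -/
theorem hasSum_arc (hw : Summable w) (ε x : ℝ) :
    HasSum (fun j : ℕ => (w j : ℂ) * arcKernel ε (j - x))
      (∫ θ in (-ε)..ε, charF w θ * expI (-(x * θ))) := by
  have h := intervalIntegral.hasSum_integral_of_dominated_convergence (μ := MeasureTheory.volume)
    (a := -ε) (b := ε) (F := fun (j : ℕ) (θ : ℝ) => (w j : ℂ) * expI (j * θ) * expI (-(x * θ)))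
    (f := fun θ => charF w θ * expI (-(x * θ))) (fun j _ => |w j|)
    (fun j => Continuous.aestronglyMeasurable (by fun_prop))
    (fun j => by simp)
    (by simp [hw.abs])
    (by simp)
    (by
      refine Filter.Eventually.of_forall fun θ _ => ?_
      exact (hasSum_charF hw θ).mul_right _)
  refine h.congr_fun' fun j => ?_
  rw [← integral_expI', ← intervalIntegral.integral_const_mul]
  refine intervalIntegral.integral_congr fun θ _ => ?_
  rw [mul_assoc, ← expI_add]; ring_nf

theorem arcKernel_pi_int (z : ℤ) :
    arcKernel Real.pi z = if z = 0 then 2 * Real.pi else 0 := by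
  by_cases h : z = 0
  · simp [arcKernel, h]
  · simp [arcKernel, h, Real.sin_int_mul_pi]

/-- On the full circle the kernel vanishes at every nonzero integer, so only j = x survives. -/
theorem integral_full (hw : Summable w) (x : ℕ) :
    ∫ θ in (-Real.pi)..Real.pi, charF w θ * expI (-(x * θ)) = ((2 * Real.pi * w x : ℝ) : ℂ) := by
  refine (hasSum_arc hw Real.pi x).unique ?_
  have h : (fun j : ℕ => (w j : ℂ) * arcKernel Real.pi (j - x)) =
      fun j => if j = x then ((2 * Real.pi * w x : ℝ) : ℂ) else 0 := by
    ext j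
    have := arcKernel_pi_int ((j : ℤ) - x)
    push_cast at this
    rw [this]
    by_cases h : j = x
    · subst h; simp; ring
    · have : (j : ℤ) - x ≠ 0 := by omega
      simp [h, this]
  rw [h]
  exact hasSum_ite_eq x _

end NatLaw

end

noncomputable section

namespace NatLaw

/-! ### Consequences of a small integral over arcs -/

/-- A pointwise eventual bound for continuous functions is uniform on some interval. -/
theorem exists_uniform_interval {a : ℕ → ℝ → ℝ} {p : ℕ → ℝ} {β₀ : ℝ} (ha : ∀ n, Continuous (a n))
    (h : ∀ ε, 0 < ε → ε < β₀ → ∀ᶠ n in atTop, |a n ε| ≤ p n) {β : ℝ} (hβ : 0 < β)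
    (hβ' : β ≤ β₀) :
    ∃ a₀ b₀ : ℝ, ∃ N : ℕ, 0 < a₀ ∧ a₀ < b₀ ∧ b₀ < β ∧
      ∀ n ≥ N, ∀ ε ∈ Set.Icc a₀ b₀, |a n ε| ≤ p n := by
  -- Baire category: the closed sets of those ε whose bound holds from N on, padded by everything
  -- outside (0, β), cover the line. So the union of their interiors is dense and meets (0, β).
  let S : ℕ → Set ℝ := fun N => (Set.Ioo 0 β)ᶜ ∪ ⋂ n ≥ N, {ε | |a n ε| ≤ p n}
  have hcl : ∀ N, IsClosed (S N) := fun N =>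
    (isOpen_Ioo.isClosed_compl).union (isClosed_biInter fun n _ =>
      isClosed_le ((ha n).abs) continuous_const)
  have hU : ⋃ N, S N = Set.univ := by
    refine Set.eq_univ_of_forall fun t => Set.mem_iUnion.2 ?_
    by_cases ht : t ∈ Set.Ioo 0 β
    · obtain ⟨N, hN⟩ := eventually_atTop.1 (h t ht.1 (ht.2.trans_le hβ'))
      exact ⟨N, Or.inr (Set.mem_iInter₂.2 fun n hn => hN n hn)⟩
    · exact ⟨0, Or.inl ht⟩
  obtain ⟨t, ht, ht'⟩ := (dense_iUnion_interior_of_closed hcl hU).exists_mem_open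
    (isOpen_Ioo (a := 0) (b := β)) ⟨β / 2, by constructor <;> linarith⟩
  obtain ⟨N, hN⟩ := Set.mem_iUnion.1 ht
  obtain ⟨r, hr, hball⟩ := Metric.isOpen_iff.1 (isOpen_interior.inter (isOpen_Ioo (a := 0) (b := β)))
    t ⟨hN, ht'⟩
  refine ⟨t - r / 2, t + r / 2, N, ?_, by linarith, ?_, fun n hn ε hε => ?_⟩
  · have : t - r / 2 ∈ Metric.ball t r := by
      rw [Metric.mem_ball, Real.dist_eq, abs_lt]; constructor <;> linarith
    exact (hball this).2.1
  · have : t + r / 2 ∈ Metric.ball t r := by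
      rw [Metric.mem_ball, Real.dist_eq, abs_lt]; constructor <;> linarith
    exact (hball this).2.2
  · have : ε ∈ Metric.ball t r := by
      rw [Metric.mem_ball, Real.dist_eq, abs_lt]; constructor <;> linarith [hε.1, hε.2]
    have h2 := hball this
    rcases interior_subset h2.1 with h3 | h3
    · exact absurd h2.2 h3
    · exact Set.mem_iInter₂.1 h3 n hn

/-- On an interval of length h around θ the function stays within K h of f θ, and its mean there is
at most P / h. -/
theorem abs_le_of_integral_le {f : ℝ → ℝ} (hf : Continuous f) {a b K P h : ℝ}
    (hK : ∀ s t, |f s - f t| ≤ K * |s - t|) (hK0 : 0 ≤ K)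
    (hP : ∀ s ∈ Set.Icc a b, ∀ t ∈ Set.Icc a b, |∫ θ in s..t, f θ| ≤ P)
    (hh : 0 < h) (hab : h ≤ b - a) {θ : ℝ} (hθ : θ ∈ Set.Icc a b) : |f θ| ≤ P / h + K * h := by
  obtain ⟨s, hs1, hs2, hs3, hs4⟩ : ∃ s, a ≤ s ∧ s + h ≤ b ∧ s ≤ θ ∧ θ ≤ s + h := by
    by_cases hc : θ + h ≤ b
    · exact ⟨θ, hθ.1, hc, le_rfl, by linarith⟩
    · exact ⟨b - h, by linarith, by linarith, by linarith, by linarith [hθ.2]⟩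
  have h1 := hP s ⟨hs1, by linarith⟩ (s + h) ⟨by linarith, hs2⟩
  have h2 : |∫ t in s..(s + h), (f θ - f t)| ≤ K * h * |s + h - s| := by
    rw [← Real.norm_eq_abs]
    refine intervalIntegral.norm_integral_le_of_norm_le_const fun t ht => ?_
    rw [Set.uIoc_of_le (by linarith)] at ht
    rw [Real.norm_eq_abs]
    refine (hK θ t).trans (mul_le_mul_of_nonneg_left ?_ hK0)
    rw [abs_le]; constructor <;> linarith [ht.1, ht.2]
  rw [intervalIntegral.integral_sub (by simp) (hf.intervalIntegrable _ _),
    intervalIntegral.integral_const] at h2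
  simp only [add_sub_cancel_left, smul_eq_mul, abs_of_pos hh] at h2
  have h3 : h * |f θ| ≤ P + K * h * h := by
    rw [← abs_of_pos hh, ← abs_mul, abs_of_pos hh]
    calc |h * f θ| = |(h * f θ - ∫ t in s..(s + h), f t) + ∫ t in s..(s + h), f t| := by ring_nf
      _ ≤ _ := (abs_add_le _ _).trans (by linarith)
  have : |f θ| = h * |f θ| / h := by field_simp
  rw [this]
  calc h * |f θ| / h ≤ (P + K * h * h) / h := by gcongr
    _ = _ := by field_simp

variable {w : ℕ → ℝ}

theorem norm_charF_sub_le (hw : IsLaw w) {μ : ℝ} (hμ : HasSum (fun j : ℕ => (j : ℝ) * w j) μ)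
    (s t : ℝ) : ‖charF w s - charF w t‖ ≤ μ * |s - t| := by
  have h := (hasSum_charF hw.hasSum.summable s).sub (hasSum_charF hw.hasSum.summable t)
  rw [← h.tsum_eq]
  refine tsum_of_norm_bounded (hμ.mul_right |s - t|) fun j => ?_
  rw [← mul_sub, norm_mul]
  have := norm_expI_sub_le (j * s) (j * t)
  rw [← mul_sub, abs_mul, Nat.abs_cast] at this
  simp only [Complex.norm_real, Real.norm_eq_abs, abs_of_nonneg (hw.nonneg j)]
  calc w j * ‖expI (j * s) - expI (j * t)‖ ≤ w j * (j * |s - t|) :=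
        mul_le_mul_of_nonneg_left this (hw.nonneg j)
    _ = _ := by ring

theorem charF_neg (w : ℕ → ℝ) (θ : ℝ) : charF w (-θ) = (starRingEnd ℂ) (charF w θ) := by
  rw [charF, charF, Complex.conj_tsum]
  refine tsum_congr fun j => ?_
  rw [map_mul, Complex.conj_ofReal, ← expI_neg']; ring_nf

theorem mean_nonneg (hw : IsLaw w) {μ : ℝ} (hμ : HasSum (fun j : ℕ => (j : ℝ) * w j) μ) : 0 ≤ μ :=
  hμ.nonneg fun j => mul_nonneg j.cast_nonneg (hw.nonneg j)

/-- The centred characteristic function. -/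
def centF (w : ℕ → ℝ) (μ θ : ℝ) : ℂ := charF w θ * expI (-(μ * θ))

theorem norm_centF (w : ℕ → ℝ) (μ θ : ℝ) : ‖centF w μ θ‖ = ‖charF w θ‖ := by simp [centF]

theorem continuous_centF (hw : IsLaw w) (μ : ℝ) : Continuous (centF w μ) :=
  (continuous_charF hw.hasSum.summable).mul (by fun_prop)

theorem norm_centF_sub_le (hw : IsLaw w) {μ : ℝ} (hμ : HasSum (fun j : ℕ => (j : ℝ) * w j) μ)
    (s t : ℝ) : ‖centF w μ s - centF w μ t‖ ≤ 2 * μ * |s - t| := by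
  have e : centF w μ s - centF w μ t = (charF w s - charF w t) * expI (-(μ * s)) +
      charF w t * (expI (-(μ * s)) - expI (-(μ * t))) := by simp only [centF]; ring
  rw [e]
  refine (norm_add_le _ _).trans ?_
  rw [norm_mul, norm_mul, norm_expI, mul_one]
  have h1 := norm_charF_sub_le hw hμ s t
  have h2 := norm_expI_sub_le (-(μ * s)) (-(μ * t))
  have h3 : |-(μ * s) - -(μ * t)| = μ * |s - t| := by
    rw [← abs_of_nonneg (mean_nonneg hw hμ), ← abs_mul, abs_of_nonneg (mean_nonneg hw hμ),
      ← abs_neg]; ring_nf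
  have h4 := norm_charF_le hw t
  have h5 : ‖charF w t‖ * ‖expI (-(μ * s)) - expI (-(μ * t))‖ ≤ 1 * (μ * |s - t|) := by
    rw [← h3]; exact mul_le_mul h4 h2 (norm_nonneg _) zero_le_one
  linarith

theorem norm_pow_sub_pow_le {z z' : ℂ} (hz : ‖z‖ ≤ 1) (hz' : ‖z'‖ ≤ 1) (n : ℕ) :
    ‖z ^ n - z' ^ n‖ ≤ n * ‖z - z'‖ := by
  induction n with
  | zero => simp
  | succ n ih =>
    have e : z ^ (n + 1) - z' ^ (n + 1) = z ^ n * (z - z') + (z ^ n - z' ^ n) * z' := by ring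
    rw [e]
    refine (norm_add_le _ _).trans ?_
    rw [norm_mul, norm_mul, norm_pow]
    have h1 : ‖z‖ ^ n ≤ 1 := pow_le_one₀ (norm_nonneg _) hz
    have h2 : ‖z‖ ^ n * ‖z - z'‖ ≤ 1 * ‖z - z'‖ := by gcongr
    have h3 : ‖z ^ n - z' ^ n‖ * ‖z'‖ ≤ (n * ‖z - z'‖) * 1 := by gcongr
    push_cast; linarith

/-- The integrand of the inversion formula. -/
theorem centF_pow (w : ℕ → ℝ) (n : ℕ) {μ x : ℝ} (hx : n * μ = x) (θ : ℝ) :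
    centF w μ θ ^ n = charF w θ ^ n * expI (-(x * θ)) := by
  rw [centF, mul_pow, ← expI_nat_mul, ← hx]; ring_nf

/-- Replacing θ by -θ conjugates the integrand, so its real part is even. Thus two symmetric arcs
give the integral over an arbitrary interval, but of the real part only; nothing is learnt about the
imaginary part. -/
theorem re_arc (hw : IsLaw w) (n : ℕ) {μ : ℝ} (s t : ℝ) :
    2 * ∫ θ in s..t, (centF w μ θ ^ n).re =
      (∫ θ in (-t)..t, centF w μ θ ^ n).re - (∫ θ in (-s)..s, centF w μ θ ^ n).re := by
  have hc : Continuous fun θ => centF w μ θ ^ n := (continuous_centF hw μ).pow n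
  have hre : Continuous fun θ => (centF w μ θ ^ n).re := Complex.continuous_re.comp hc
  have h1 : ∀ a : ℝ, (∫ θ in (-a)..a, centF w μ θ ^ n).re =
      ∫ θ in (-a)..a, (centF w μ θ ^ n).re := fun a =>
    (Complex.reCLM.intervalIntegral_comp_comm (hc.intervalIntegrable _ _)).symm
  have h2 : ∀ a : ℝ, ∫ θ in (-a)..a, (centF w μ θ ^ n).re =
      2 * ∫ θ in (0 : ℝ)..a, (centF w μ θ ^ n).re := fun a => by
    rw [← intervalIntegral.integral_add_adjacent_intervals (b := 0)
      (hre.intervalIntegrable _ _) (hre.intervalIntegrable _ _)]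
    have h3 : ∫ θ in (-a)..0, (centF w μ θ ^ n).re = ∫ θ in (0 : ℝ)..a, (centF w μ θ ^ n).re := by
      have := intervalIntegral.integral_comp_neg (a := 0) (b := a)
        (fun θ => (centF w μ θ ^ n).re)
      rw [neg_zero] at this
      rw [← this]
      refine intervalIntegral.integral_congr fun θ _ => ?_
      have e : centF w μ (-θ) = (starRingEnd ℂ) (centF w μ θ) := by
        rw [centF, centF, map_mul, ← expI_neg', charF_neg w]; ring_nf
      simp only [e, ← map_pow, Complex.conj_re]
    rw [h3]; ring
  rw [h1, h1, h2, h2, ← mul_sub, intervalIntegral.integral_interval_sub_left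
    (hre.intervalIntegrable _ _) (hre.intervalIntegrable _ _)]

/-- If the integrals over the arcs are small then so is the real part of the integrand. -/
theorem abs_re_centF_pow_le (hw : IsLaw w) {n : ℕ} {μ x : ℝ}
    (hμ : HasSum (fun j : ℕ => (j : ℝ) * w j) μ) (hx : n * μ = x) {a b P h : ℝ}
    (hP : ∀ ε ∈ Set.Icc a b, ‖∫ θ in (-ε)..ε, centF w μ θ ^ n‖ ≤ P)
    (hh : 0 < h) (hab : h ≤ b - a) {θ : ℝ} (hθ : θ ∈ Set.Icc a b) :
    |(centF w μ θ ^ n).re| ≤ P / h + 2 * x * h := by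
  have hμ0 := mean_nonneg hw hμ
  have hx0 : 0 ≤ x := hx ▸ mul_nonneg n.cast_nonneg hμ0
  refine abs_le_of_integral_le (f := fun θ => (centF w μ θ ^ n).re)
    (Complex.continuous_re.comp ((continuous_centF hw μ).pow n)) (K := 2 * x)
    (fun s t => ?_) (by positivity) (fun s hs t ht => ?_) hh hab hθ
  · rw [← Complex.sub_re]
    refine (Complex.abs_re_le_norm _).trans ((norm_pow_sub_pow_le ?_ ?_ n).trans ?_)
    · rw [norm_centF]; exact norm_charF_le hw _
    · rw [norm_centF]; exact norm_charF_le hw _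
    · calc (n : ℝ) * ‖centF w μ s - centF w μ t‖ ≤ n * (2 * μ * |s - t|) := by
            gcongr; exact norm_centF_sub_le hw hμ s t
        _ = _ := by rw [← hx]; ring
  · have h1 := re_arc hw n (μ := μ) s t
    have h2 := (Complex.abs_re_le_norm _).trans (hP s hs)
    have h3 := (Complex.abs_re_le_norm _).trans (hP t ht)
    rw [abs_le] at *
    constructor <;> linarith [h2.1, h2.2, h3.1, h3.2]

end NatLaw

end

noncomputable section

namespace NatLaw

/-! ### Extrapolation of exponential sums -/

/-- The Taylor expansion of `u ^ (-L)` at `u = 1`. -/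
theorem norm_inv_pow_sub_le {u : ℂ} (hu : ‖u‖ = 1) (L r : ℕ) :
    ‖(u ^ L)⁻¹ - ∑ j ∈ Finset.range (r + 1), (Nat.multichoose L j : ℂ) * (1 - u) ^ j‖ ≤
      Nat.multichoose L (r + 1) * ‖1 - u‖ ^ (r + 1) := by
  have hu0 : u ≠ 0 := by rintro rfl; simp at hu
  induction L with
  | zero => rw [Finset.sum_range_succ']; simp
  | succ L ih =>
    have key : u * ((u ^ (L + 1))⁻¹ - ∑ j ∈ Finset.range (r + 1),
          (Nat.multichoose (L + 1) j : ℂ) * (1 - u) ^ j) =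
        ((u ^ L)⁻¹ - ∑ j ∈ Finset.range (r + 1), (Nat.multichoose L j : ℂ) * (1 - u) ^ j) +
          Nat.multichoose (L + 1) r * (1 - u) ^ (r + 1) := by
      have h1 : ∀ r : ℕ, u * ∑ j ∈ Finset.range (r + 1),
          (Nat.multichoose (L + 1) j : ℂ) * (1 - u) ^ j =
          ∑ j ∈ Finset.range (r + 1), (Nat.multichoose L j : ℂ) * (1 - u) ^ j -
          Nat.multichoose (L + 1) r * (1 - u) ^ (r + 1) := by
        intro r
        induction r with
        | zero => simp
        | succ r ihr =>
          rw [Finset.sum_range_succ, mul_add, ihr, Finset.sum_range_succ _ (r + 1),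
            Nat.multichoose_succ_succ]
          push_cast; ring
      rw [mul_sub, h1, pow_succ]
      field_simp
      ring
    have h2 := congrArg norm key
    rw [norm_mul, hu, one_mul] at h2
    rw [h2]
    refine (norm_add_le _ _).trans ?_
    rw [norm_mul, norm_pow, Nat.multichoose_succ_succ]
    simp only [Complex.norm_natCast]
    push_cast
    linarith

variable {w : ℕ → ℝ}

theorem hasSum_centF (hw : IsLaw w) (μ θ : ℝ) :
    HasSum (fun j : ℕ => (w j : ℂ) * expI ((j - μ) * θ)) (centF w μ θ) := by
  refine ((hasSum_charF hw.hasSum.summable θ).mul_right (expI (-(μ * θ)))).congr_fun' fun j => ?_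
  rw [mul_assoc, ← expI_add]; ring_nf

/-- Iterated differences of the centred characteristic function. -/
def diffF (w : ℕ → ℝ) (μ s : ℝ) (i : ℕ) (θ : ℝ) : ℂ :=
  ∑' j : ℕ, (w j : ℂ) * (1 - expI ((j - μ) * s)) ^ i * expI ((j - μ) * θ)

theorem summable_diffF (hw : IsLaw w) (μ s : ℝ) (i : ℕ) (θ : ℝ) :
    Summable fun j : ℕ => (w j : ℂ) * (1 - expI ((j - μ) * s)) ^ i * expI ((j - μ) * θ) := by
  refine Summable.of_norm_bounded (hw.hasSum.summable.mul_right (2 ^ i)) fun j => ?_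
  simp only [norm_mul, norm_pow, norm_expI, mul_one, Complex.norm_real, Real.norm_eq_abs,
    abs_of_nonneg (hw.nonneg j)]
  refine mul_le_mul_of_nonneg_left (pow_le_pow_left₀ (norm_nonneg _) ?_ i) (hw.nonneg j)
  refine (norm_sub_le _ _).trans ?_
  simp; norm_num

theorem diffF_succ (hw : IsLaw w) (μ s : ℝ) (i : ℕ) (θ : ℝ) :
    diffF w μ s (i + 1) θ = diffF w μ s i θ - diffF w μ s i (θ + s) := by
  rw [diffF, diffF, diffF, ← (summable_diffF hw μ s i θ).tsum_sub (summable_diffF hw μ s i (θ + s))]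
  refine tsum_congr fun j => ?_
  rw [mul_add, expI_add]; ring

theorem abs_im_diffF_le (hw : IsLaw w) {μ s e : ℝ} (c : ℂ) (i : ℕ) (θ : ℝ)
    (h : ∀ k ≤ i, |(centF w μ (θ + k * s) * c).im| ≤ e) :
    |(diffF w μ s i θ * c).im| ≤ 2 ^ i * e := by
  induction i generalizing θ with
  | zero =>
    have := h 0 le_rfl
    simp only [diffF, pow_zero, mul_one, (hasSum_centF hw μ θ).tsum_eq]
    simpa using this
  | succ i ih =>
    rw [diffF_succ hw, sub_mul, Complex.sub_im]
    have h1 := ih θ fun k hk => h k (hk.trans (Nat.le_succ i))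
    have h2 := ih (θ + s) fun k hk => by
      have := h (k + 1) (by omega)
      push_cast at this
      rwa [add_assoc, ← one_add_mul, add_comm 1]
    rw [pow_succ]
    refine (abs_sub _ _).trans ?_
    linarith

/-- With u = exp(i(j-μ)s), write 1 = u^L u^(-L) and expand u^(-L) at u = 1. Summed against w, this
expresses ψ(0) = 1 by the first r + 1 differences of ψ on the grid of step s from Ls on, so c is
controlled by the values ψ·c on the grid. The Taylor remainder is at most ((L+r+1) s
(j+μ))^(r+1)/(r+1)! ≤ 2^(-(r+1)) exp(4(j+μ)), because (L+r+1)s ≤ 2; this is where the exponential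
moment of order 4 comes from. -/
theorem extrapolate (hw : IsLaw w) {μ A s e : ℝ} (hμ : 0 ≤ μ) (hs : 0 ≤ s)
    (hA : HasSum (fun j : ℕ => w j * Real.exp (4 * j)) A) {c : ℂ} (hc : ‖c‖ ≤ 1) (L r : ℕ)
    (hL : (L + r + 1) * s ≤ 2)
    (h : ∀ k ≤ r, |(centF w μ ((L + k) * s) * c).im| ≤ e) :
    |c.im| ≤ (2 * (L + r + 1)) ^ (r + 1) * e + (1 / 2) ^ (r + 1) * (Real.exp (4 * μ) * A) := by
  have he : 0 ≤ e := (abs_nonneg _).trans (h 0 (Nat.zero_le r))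
  set S : ℂ := ∑ i ∈ Finset.range (r + 1), (Nat.multichoose L i : ℂ) * diffF w μ s i (L * s)
  have hS : HasSum (fun j : ℕ => (w j : ℂ) * ∑ i ∈ Finset.range (r + 1),
      (Nat.multichoose L i : ℂ) * (1 - expI ((j - μ) * s)) ^ i * expI ((j - μ) * (L * s))) S := by
    refine (hasSum_sum fun i _ => ((summable_diffF hw μ s i (L * s)).hasSum).mul_left
      (Nat.multichoose L i : ℂ)).congr_fun' fun j => ?_
    rw [Finset.mul_sum]
    refine Finset.sum_congr rfl fun i _ => ?_
    ring
  have h1 : HasSum (fun j : ℕ => (w j : ℂ)) 1 := by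
    simpa using (Complex.hasSum_ofReal (f := w)).2 hw.hasSum
  have hrem : ‖1 - S‖ ≤ (1 / 2) ^ (r + 1) * (Real.exp (4 * μ) * A) := by
    rw [← (h1.sub hS).tsum_eq]
    refine tsum_of_norm_bounded ((hA.mul_left (Real.exp (4 * μ))).mul_left ((1 / 2) ^ (r + 1)))
      fun j => ?_
    set u := expI ((j - μ) * s) with hu
    have hu1 : ‖u‖ = 1 := norm_expI _
    have hu0 : u ≠ 0 := expI_ne_zero _
    have e1 : expI ((j - μ) * (L * s)) = u ^ L := by rw [hu, ← expI_nat_mul]; ring_nf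
    have e2 : (w j : ℂ) - (w j : ℂ) * ∑ i ∈ Finset.range (r + 1),
        (Nat.multichoose L i : ℂ) * (1 - u) ^ i * expI ((j - μ) * (L * s)) =
        (w j : ℂ) * (u ^ L * ((u ^ L)⁻¹ - ∑ i ∈ Finset.range (r + 1),
          (Nat.multichoose L i : ℂ) * (1 - u) ^ i)) := by
      rw [e1, ← Finset.sum_mul, mul_sub (u ^ L), mul_inv_cancel₀ (pow_ne_zero _ hu0)]; ring
    rw [e2, norm_mul, norm_mul, norm_pow, hu1, one_pow, one_mul, Complex.norm_real,
      Real.norm_eq_abs, abs_of_nonneg (hw.nonneg j)]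
    have h3 := norm_inv_pow_sub_le hu1 L r
    have h4 : ‖1 - u‖ ≤ |(j : ℝ) - μ| * s := by
      rw [norm_sub_rev]
      refine (norm_expI_sub_one_le _).trans ?_
      rw [abs_mul, abs_of_nonneg hs]
    have h5 : (Nat.multichoose L (r + 1) : ℝ) ≤ ((L : ℝ) + r + 1) ^ (r + 1) / ((r + 1)! : ℝ) := by
      rw [Nat.multichoose_eq]
      refine (Nat.choose_le_pow_div _ _).trans ?_
      gcongr
      have : L + (r + 1) - 1 ≤ L + r + 1 := by omega
      exact_mod_cast this
    have h6 : |(j : ℝ) - μ| ≤ j + μ := by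
      rw [abs_le]; constructor <;> linarith [(Nat.cast_nonneg j : (0 : ℝ) ≤ j)]
    have h7 : (Nat.multichoose L (r + 1) : ℝ) * ‖1 - u‖ ^ (r + 1) ≤
        (1 / 2) ^ (r + 1) * Real.exp (4 * (j + μ)) := by
      calc (Nat.multichoose L (r + 1) : ℝ) * ‖1 - u‖ ^ (r + 1)
          ≤ ((L : ℝ) + r + 1) ^ (r + 1) / ((r + 1)! : ℝ) * ((j + μ) * s) ^ (r + 1) := by
            gcongr
            exact h4.trans (by gcongr)
        _ = (1 / 2) ^ (r + 1) * ((2 * (((L : ℝ) + r + 1) * s * (j + μ))) ^ (r + 1) /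
            ((r + 1)! : ℝ)) := by
          rw [mul_pow, mul_pow, mul_pow, mul_pow, one_div, inv_pow]; field_simp
        _ ≤ (1 / 2) ^ (r + 1) * Real.exp (2 * (((L : ℝ) + r + 1) * s * (j + μ))) := by
          gcongr
          exact Real.pow_div_factorial_le_exp _ (by positivity) _
        _ ≤ _ := by
          refine mul_le_mul_of_nonneg_left (Real.exp_le_exp.2 ?_) (by positivity)
          have : ((L : ℝ) + r + 1) * s * (j + μ) ≤ 2 * (j + μ) :=
            mul_le_mul_of_nonneg_right hL (by positivity)
          linarith
    calc w j * _ ≤ w j * ((1 / 2) ^ (r + 1) * Real.exp (4 * (j + μ))) :=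
          mul_le_mul_of_nonneg_left (h3.trans h7) (hw.nonneg j)
      _ = _ := by rw [mul_add, Real.exp_add]; ring
  have hmain : |(S * c).im| ≤ (2 * (L + r + 1)) ^ (r + 1) * e := by
    have e3 : (S * c).im = ∑ i ∈ Finset.range (r + 1),
        (Nat.multichoose L i : ℝ) * (diffF w μ s i (L * s) * c).im := by
      rw [Finset.sum_mul, Complex.im_sum]
      refine Finset.sum_congr rfl fun i _ => ?_
      rw [mul_assoc, ← Complex.ofReal_natCast, Complex.im_ofReal_mul]
    rw [e3]
    refine (Finset.abs_sum_le_sum_abs _ _).trans ?_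
    have h8 : ∀ i ∈ Finset.range (r + 1),
        |(Nat.multichoose L i : ℝ) * (diffF w μ s i (L * s) * c).im| ≤
          (2 * ((L : ℝ) + r + 1) ) ^ i * e := by
      intro i hi
      rw [Finset.mem_range] at hi
      rw [abs_mul, Nat.abs_cast]
      have h9 := abs_im_diffF_le hw (μ := μ) (s := s) (e := e) c i (L * s) fun k hk => by
        rw [← add_mul]; exact h k (by omega)
      have h10 : (Nat.multichoose L i : ℝ) ≤ ((L : ℝ) + r + 1) ^ i := by
        rw [Nat.multichoose_eq]
        have : (Nat.choose (L + i - 1) i) ≤ (L + r + 1) ^ i :=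
          (Nat.choose_le_pow _ _).trans (Nat.pow_le_pow_left (by omega) i)
        exact_mod_cast this
      calc _ ≤ ((L : ℝ) + r + 1) ^ i * (2 ^ i * e) := by gcongr
        _ = _ := by rw [mul_pow]; ring
    refine (Finset.sum_le_sum h8).trans ?_
    rw [← Finset.sum_mul]
    refine mul_le_mul_of_nonneg_right ?_ he
    have hb : (2 : ℝ) ≤ 2 * ((L : ℝ) + r + 1) := by
      have : (0 : ℝ) ≤ L + r := by positivity
      linarith
    have hg := mul_geom_sum (2 * ((L : ℝ) + r + 1)) (r + 1)
    have hpos : 0 ≤ ∑ i ∈ Finset.range (r + 1), (2 * ((L : ℝ) + r + 1)) ^ i := by positivity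
    nlinarith
  have e5 : c.im = ((1 - S) * c).im + (S * c).im := by rw [← Complex.add_im]; ring_nf
  rw [e5]
  refine (abs_add_le _ _).trans ?_
  have h11 : |((1 - S) * c).im| ≤ ‖1 - S‖ := by
    refine (Complex.abs_im_le_norm _).trans ?_
    rw [norm_mul]
    exact mul_le_of_le_one_right (norm_nonneg _) hc
  linarith

/-! ### The modulus of the characteristic function on an arc -/

/-- If β is the argument of z, the hypothesis keeps n|β| ≤ π/2, where the sine increases, so |sin β|
≤ |sin nβ|: the n-th power has not wrapped around and cannot hide an imaginary part of z. -/
theorem abs_im_mul_norm_pow_le {z : ℂ} (hz : 0 < z.re) {n : ℕ} (hn : 1 ≤ n)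
    (h : n * |z.im| ≤ ‖z‖) : |z.im| * ‖z‖ ^ n ≤ |(z ^ n).im| * ‖z‖ := by
  have hz0 : z ≠ 0 := by rintro rfl; simp at hz
  have hpos : 0 < ‖z‖ := norm_pos_iff.2 hz0
  set β := z.arg with hβ
  have hsin : Real.sin β = z.im / ‖z‖ := Complex.sin_arg z
  have hβ1 : |β| ≤ Real.pi / 2 := Complex.abs_arg_le_pi_div_two_iff.2 hz.le
  have hn0 : (1 : ℝ) ≤ n := by exact_mod_cast hn
  have hj := Real.mul_abs_le_abs_sin hβ1
  have hnb : n * |β| ≤ Real.pi / 2 := by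
    have h1 : |Real.sin β| = |z.im| / ‖z‖ := by rw [hsin, abs_div, abs_of_pos hpos]
    have h2 : n * |Real.sin β| ≤ 1 := by
      rw [h1, ← mul_div_assoc, div_le_one hpos]; exact h
    have h3 : n * (2 / Real.pi * |β|) ≤ 1 := (mul_le_mul_of_nonneg_left hj (by positivity)).trans h2
    have hpi := Real.pi_pos
    have h4 : (n * |β|) * (2 / Real.pi) ≤ 1 := by linarith
    calc n * |β| = (n * |β|) * (2 / Real.pi) * (Real.pi / 2) := by field_simp
      _ ≤ 1 * (Real.pi / 2) := by gcongr
      _ = _ := one_mul _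
  have hpow : (z ^ n).im = ‖z‖ ^ n * Real.sin (n * β) := by
    conv_lhs => rw [← Complex.norm_mul_exp_arg_mul_I z]
    rw [mul_pow, ← Complex.exp_nat_mul, ← Complex.ofReal_pow, Complex.im_ofReal_mul,
      ← mul_assoc, ← Complex.ofReal_natCast, ← Complex.ofReal_mul, Complex.exp_ofReal_mul_I_im]
  have hle : |Real.sin β| ≤ |Real.sin (n * β)| := by
    have hb0 := abs_nonneg β
    have hpi := Real.pi_pos
    have h5 : |(n : ℝ) * β| = n * |β| := by rw [abs_mul, Nat.abs_cast]
    rw [Real.abs_sin_eq_sin_abs_of_abs_le_pi (by linarith),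
      Real.abs_sin_eq_sin_abs_of_abs_le_pi (by rw [h5]; linarith), h5]
    exact Real.sin_le_sin_of_le_of_le_pi_div_two (by linarith) hnb
      (le_mul_of_one_le_left hb0 hn0)
  rw [hpow, abs_mul, abs_of_nonneg (a := ‖z‖ ^ n) (by positivity)]
  have h6 : |z.im| = ‖z‖ * |Real.sin β| := by
    rw [hsin, abs_div, abs_of_pos hpos]; field_simp
  rw [h6]
  calc ‖z‖ * |Real.sin β| * ‖z‖ ^ n ≤ ‖z‖ * |Real.sin (n * β)| * ‖z‖ ^ n := by gcongr
    _ = _ := by ring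

theorem abs_im_pow_le (z : ℂ) (n : ℕ) : |(z ^ (n + 1)).im| ≤ (n + 1) * ‖z‖ ^ n * |z.im| := by
  induction n with
  | zero => simp
  | succ n ih =>
    rw [pow_succ, Complex.mul_im]
    refine (abs_add_le _ _).trans ?_
    rw [abs_mul, abs_mul]
    have h1 : |(z ^ (n + 1)).re| ≤ ‖z‖ ^ (n + 1) := by
      rw [← norm_pow]; exact Complex.abs_re_le_norm _
    have h2 : |z.re| ≤ ‖z‖ := Complex.abs_re_le_norm _
    have h3 : |(z ^ (n + 1)).im| * |z.re| ≤ ((n + 1) * ‖z‖ ^ n * |z.im|) * ‖z‖ := by gcongr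
    have h4 : |(z ^ (n + 1)).re| * |z.im| ≤ ‖z‖ ^ (n + 1) * |z.im| := by gcongr
    rw [pow_succ ‖z‖ n] at h4 ⊢
    push_cast
    linarith

/-- By contradiction. Near θ₁ the powers ψ(θ)^n and ψ(θ₁)^n are both almost imaginary, so z^n is
almost real for z = ψ(θ)·conj ψ(θ₁). As z is close to the positive number |ψ(θ₁)|², z is almost real
too. `extrapolate` carries this to θ = 0, where z = conj ψ(θ₁). Hence ψ(θ₁)^n is almost real as well
as almost imaginary, and must be small. -/
theorem norm_charF_pow_lt (hw : IsLaw w) {n : ℕ} (hn : 1 ≤ n) {μ x A : ℝ}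
    (hμ : HasSum (fun j : ℕ => (j : ℝ) * w j) μ) (hx : n * μ = x) (hx1 : 1 ≤ x)
    (hA : HasSum (fun j : ℕ => w j * Real.exp (4 * j)) A) {a b τ ε₁ : ℝ} (ha : 0 < a) (hb : b ≤ 1)
    (hτ : ∀ θ ∈ Set.Icc a b, |(centF w μ θ ^ n).re| ≤ τ) (r : ℕ) (hab : 1 / (16 * x) ≤ b - a)
    (hε : (1 / 2) ^ n ≤ ε₁) (h2τ : 2 * τ < ε₁)
    (hnum : (36 * x * (r + 1)) ^ (r + 1) * (3 * τ / ε₁ ^ 2) +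
      (1 / 2) ^ (r + 1) * (Real.exp (4 * μ) * A) ≤ 1 / (4 * n))
    {θ₁ : ℝ} (hθ₁ : θ₁ ∈ Set.Icc a b) : ‖charF w θ₁‖ ^ n < ε₁ := by
  by_contra hcon
  rw [not_lt, ← norm_centF w μ] at hcon
  have hn0 : (1 : ℝ) ≤ n := by exact_mod_cast hn
  have hμ0 := mean_nonneg hw hμ
  have hε0 : 0 < ε₁ := lt_of_lt_of_le (by positivity) hε
  set ψ := centF w μ with hψ
  set ρ := ‖ψ θ₁‖ with hρ
  have hψ1 : ∀ θ, ‖ψ θ‖ ≤ 1 := fun θ => by rw [hψ, norm_centF]; exact norm_charF_le hw θ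
  have hρ1 : ρ ≤ 1 := hψ1 θ₁
  have hρ2 : 1 / 2 ≤ ρ := by
    by_contra hlt
    rw [not_le] at hlt
    exact absurd (hε.trans hcon) (not_le.2 (pow_lt_pow_left₀ hlt (norm_nonneg _) (by omega)))
  -- Over this length ψ moves by at most 2μh = 1/(8n), so the argument of z stays of order 1/n and
  -- z^n does not wrap.
  set h : ℝ := 1 / (16 * x) with hh
  have hh0 : 0 < h := by positivity
  obtain ⟨θ₀, hs1, hs2, hs3, hs4⟩ : ∃ s, a ≤ s ∧ s + h ≤ b ∧ s ≤ θ₁ ∧ θ₁ ≤ s + h := by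
    by_cases hc : θ₁ + h ≤ b
    · exact ⟨θ₁, hθ₁.1, hc, le_rfl, by linarith⟩
    · exact ⟨b - h, by linarith, by linarith, by linarith, by linarith [hθ₁.2]⟩
  have hθ0 : 0 < θ₀ := ha.trans_le hs1
  set c : ℂ := (starRingEnd ℂ) (ψ θ₁) with hc
  have hGim : ∀ θ ∈ Set.Icc θ₀ (θ₀ + h), |(ψ θ * c).im| ≤ 3 * τ / ε₁ ^ 2 := by
    intro θ hθ
    have hθab : θ ∈ Set.Icc a b := ⟨hs1.trans hθ.1, hθ.2.trans hs2⟩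
    set z := ψ θ * c with hz
    have hd : ‖z - (ρ ^ 2 : ℝ)‖ ≤ ρ / (8 * n) := by
      have e : z - (ρ ^ 2 : ℝ) = (ψ θ - ψ θ₁) * c := by
        rw [sub_mul, hz, hc, Complex.mul_conj, Complex.normSq_eq_norm_sq]
      rw [e, norm_mul, hc, RCLike.norm_conj]
      have h1 : ‖ψ θ - ψ θ₁‖ ≤ 2 * μ * h := by
        refine (norm_centF_sub_le hw hμ θ θ₁).trans ?_
        refine mul_le_mul_of_nonneg_left ?_ (by positivity)
        rw [abs_le]; constructor <;> linarith [hθ.1, hθ.2]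
      have h2 : 2 * μ * h = 1 / (8 * n) := by
        rw [hh]
        have : x ≠ 0 := by positivity
        field_simp
        linarith
      rw [h2] at h1
      calc _ ≤ 1 / (8 * (n : ℝ)) * ρ := by gcongr
        _ = _ := by ring
    have hρn : ρ / (8 * n) ≤ ρ ^ 2 * (1 / (4 * n)) := by
      rw [div_eq_mul_one_div, pow_two, mul_assoc]
      refine mul_le_mul_of_nonneg_left ?_ (by positivity)
      calc 1 / (8 * (n : ℝ)) = 1 / 2 * (1 / (4 * n)) := by field_simp; norm_num
        _ ≤ _ := by gcongr
    have him : |z.im| ≤ ρ / (8 * n) := by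
      have := (Complex.abs_im_le_norm (z - (ρ ^ 2 : ℝ))).trans hd
      rwa [Complex.sub_im, Complex.ofReal_im, sub_zero] at this
    have hre : ρ ^ 2 * (1 - 1 / (4 * n)) ≤ z.re := by
      have := (Complex.abs_re_le_norm (z - (ρ ^ 2 : ℝ))).trans hd
      rw [Complex.sub_re, Complex.ofReal_re, abs_le] at this
      linarith [this.1]
    have h4n : 1 / (4 * (n : ℝ)) ≤ 1 / 4 := by
      rw [div_le_div_iff₀ (by positivity) (by positivity)]; linarith
    have hre0 : ρ ^ 2 * (3 / 4) ≤ z.re :=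
      le_trans (mul_le_mul_of_nonneg_left (by linarith) (by positivity)) hre
    have hnorm : ρ ^ 2 * (1 - 1 / (4 * n)) ≤ ‖z‖ := hre.trans (Complex.re_le_norm z)
    have hz0 : 0 < z.re := lt_of_lt_of_le (by positivity) hre0
    have hsec := abs_im_mul_norm_pow_le hz0 hn (by
      calc (n : ℝ) * |z.im| ≤ n * (ρ / (8 * n)) := by gcongr
        _ = ρ / 8 := by field_simp
        _ ≤ ρ ^ 2 * (3 / 4) := by nlinarith
        _ ≤ z.re := hre0
        _ ≤ ‖z‖ := Complex.re_le_norm z)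
    -- Bernoulli's inequality: (1 - 1/(4n))^n ≥ 3/4.
    have hzn : ε₁ ^ 2 * (3 / 4) ≤ ‖z‖ ^ n := by
      calc ε₁ ^ 2 * (3 / 4) ≤ (ρ ^ n) ^ 2 * (1 - 1 / (4 * n)) ^ n := by
            have hB := one_add_mul_le_pow (a := -(1 / (4 * (n : ℝ)))) (by linarith) n
            have e : 1 + (n : ℝ) * -(1 / (4 * n)) = 3 / 4 := by field_simp; norm_num
            rw [e, ← sub_eq_add_neg] at hB
            gcongr
        _ = (ρ ^ 2 * (1 - 1 / (4 * n))) ^ n := by rw [mul_pow, ← pow_mul, ← pow_mul, mul_comm 2]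
        _ ≤ ‖z‖ ^ n := by
          refine pow_le_pow_left₀ (mul_nonneg (by positivity) (by linarith)) hnorm n
    have hzim : |(z ^ n).im| ≤ 2 * τ := by
      have e : z ^ n = ψ θ ^ n * (starRingEnd ℂ) (ψ θ₁ ^ n) := by rw [hz, mul_pow, hc, map_pow]
      rw [e, Complex.mul_im, Complex.conj_re, Complex.conj_im]
      have hnp : ∀ t, ‖ψ t ^ n‖ ≤ 1 := fun t => by
        rw [norm_pow]; exact pow_le_one₀ (norm_nonneg _) (hψ1 t)
      have i1 := (Complex.abs_im_le_norm (ψ θ ^ n)).trans (hnp θ)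
      have i2 := (Complex.abs_im_le_norm (ψ θ₁ ^ n)).trans (hnp θ₁)
      have i3 := hτ θ hθab
      have i4 := hτ θ₁ hθ₁
      refine (abs_add_le _ _).trans ?_
      rw [abs_mul, abs_mul, abs_neg]
      have j1 : |(ψ θ ^ n).re| * |(ψ θ₁ ^ n).im| ≤ τ * 1 :=
        mul_le_mul i3 i2 (abs_nonneg _) ((abs_nonneg _).trans i3)
      have j2 : |(ψ θ ^ n).im| * |(ψ θ₁ ^ n).re| ≤ 1 * τ :=
        mul_le_mul i1 i4 (abs_nonneg _) zero_le_one
      linarith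
    have hz1 : ‖z‖ ≤ 1 := by
      rw [hz, norm_mul, hc, RCLike.norm_conj]
      exact mul_le_one₀ (hψ1 θ) (norm_nonneg _) hρ1
    rw [le_div_iff₀ (by positivity)]
    have k1 : |z.im| * (ε₁ ^ 2 * (3 / 4)) ≤ |z.im| * ‖z‖ ^ n := by gcongr
    have k3 : 0 ≤ τ := (abs_nonneg _).trans (hτ θ hθab)
    have k2 : |(z ^ n).im| * ‖z‖ ≤ 2 * τ * 1 := by gcongr
    nlinarith
  have hr0 : (0 : ℝ) < r + 1 := by positivity
  -- The step s = θ₀ / L leads from 0 to θ₀ in exactly L steps, and the next r + 1 steps stay in the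
  -- window of length h where z is known to be almost real.
  set L : ℕ := ⌈θ₀ * (r + 1) / h⌉₊ with hLdef
  have hL1 : θ₀ * (r + 1) / h ≤ L := Nat.le_ceil _
  have hL2 : (L : ℝ) < θ₀ * (r + 1) / h + 1 := Nat.ceil_lt_add_one (by positivity)
  have hL0 : (0 : ℝ) < L := lt_of_lt_of_le (by positivity) hL1
  set s : ℝ := θ₀ / L with hs
  have hs0 : 0 < s := by positivity
  have hsr : (r + 1) * s ≤ h := by
    rw [hs, ← mul_div_assoc, div_le_iff₀ hL0]
    rw [div_le_iff₀ hh0] at hL1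
    linarith
  have hLs : L * s = θ₀ := by rw [hs]; field_simp
  have hext := extrapolate hw hμ0 hs0.le hA (c := c) (by rw [hc, RCLike.norm_conj]; exact hρ1) L r
    (e := 3 * τ / ε₁ ^ 2) (by
      have : (L + r + 1) * s = θ₀ + (r + 1) * s := by rw [← hLs]; ring
      rw [this]; linarith) (fun k hk => by
      refine hGim _ ?_
      rw [add_mul, hLs]
      have : k * s ≤ (r + 1) * s := by
        gcongr
        exact_mod_cast Nat.le_succ_of_le hk
      constructor
      · have : 0 ≤ k * s := by positivity
        linarith
      · linarith)
  have hτ0 : 0 ≤ τ := (abs_nonneg _).trans (hτ θ₁ hθ₁)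
  have hLr : 2 * ((L : ℝ) + r + 1) ≤ 36 * x * (r + 1) := by
    have h1 : θ₀ * (r + 1) / h = 16 * x * θ₀ * (r + 1) := by rw [hh]; field_simp
    have h2 : 16 * x * θ₀ * (r + 1) ≤ 16 * x * 1 * (r + 1) := by
      gcongr; linarith
    have h3 : (1 : ℝ) * (r + 1) ≤ x * (r + 1) := by gcongr
    have h4 : (0 : ℝ) ≤ r := r.cast_nonneg
    rw [h1] at hL2
    nlinarith
  have hcim : |c.im| ≤ 1 / (4 * n) := by
    refine hext.trans (le_trans ?_ hnum)
    gcongr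
  rw [hc, Complex.conj_im, abs_neg] at hcim
  obtain ⟨n', rfl⟩ : ∃ n', n = n' + 1 := ⟨n - 1, by omega⟩
  -- The imaginary part of ψ(θ₁) is at most 1/(4n), so that of its n-th power is at most half the
  -- modulus; the real part is at most τ. Hence the modulus is at most 2τ < ε₁.
  have h1 := abs_im_pow_le (ψ θ₁) n'
  have h2 : |(ψ θ₁ ^ (n' + 1)).im| ≤ ρ ^ (n' + 1) / 2 := by
    refine h1.trans ?_
    push_cast at hcim
    calc ((n' : ℝ) + 1) * ρ ^ n' * |(ψ θ₁).im| ≤ (n' + 1) * ρ ^ n' * (1 / (4 * (n' + 1))) := by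
          gcongr
      _ = ρ ^ n' * (1 / 2) / 2 := by field_simp; norm_num
      _ ≤ ρ ^ n' * ρ / 2 := by gcongr
      _ = _ := by rw [pow_succ]
  have h3 := Complex.norm_le_abs_re_add_abs_im (ψ θ₁ ^ (n' + 1))
  rw [norm_pow] at h3
  have h4 := hτ θ₁ hθ₁
  have h5 : ρ ^ (n' + 1) ≤ 2 * τ := by linarith
  linarith

end NatLaw

end

noncomputable section

namespace NatLaw

variable {w : ℕ → ℝ}

/-! ### The defect `1 - |φ|²` -/

theorem abs_sin_nat_mul_le (j : ℕ) (t : ℝ) : |Real.sin (j * t)| ≤ j * |Real.sin t| := by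
  induction j with
  | zero => simp
  | succ j ih =>
    push_cast
    rw [add_mul, one_mul, Real.sin_add]
    refine (abs_add_le _ _).trans ?_
    rw [abs_mul, abs_mul]
    have h1 : |Real.sin (j * t)| * |Real.cos t| ≤ (j * |Real.sin t|) * 1 :=
      mul_le_mul ih (Real.abs_cos_le_one t) (abs_nonneg _) (by positivity)
    have h2 : |Real.cos (j * t)| * |Real.sin t| ≤ 1 * |Real.sin t| :=
      mul_le_mul_of_nonneg_right (Real.abs_cos_le_one _) (abs_nonneg _)
    linarith

theorem one_sub_cos_nat_mul_le (j : ℕ) (t : ℝ) :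
    1 - Real.cos (j * t) ≤ j ^ 2 * (1 - Real.cos t) := by
  have h : ∀ s : ℝ, 1 - Real.cos s = 2 * |Real.sin (s / 2)| ^ 2 := fun s => by
    have := Real.cos_sq_add_sin_sq (s / 2)
    have e : Real.cos s = 2 * Real.cos (s / 2) ^ 2 - 1 := by rw [← Real.cos_two_mul]; ring_nf
    rw [sq_abs, e]; linarith
  rw [h, h, mul_div_assoc]
  have := pow_le_pow_left₀ (abs_nonneg _) (abs_sin_nat_mul_le j (t / 2)) 2
  rw [mul_pow] at this
  linarith

theorem hasSum_re_mul {f g : ℕ → ℂ} {z z' : ℂ} (hs : Summable fun j => ‖f j‖)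
    (hz : HasSum f z) (hs' : Summable fun j => ‖g j‖) (hz' : HasSum g z') :
    HasSum (fun q : ℕ × ℕ => (f q.1 * g q.2).re) (z * z').re := by
  have h := summable_mul_of_summable_norm hs hs'
  exact Complex.hasSum_re (hz.mul hz' h)

/-- |φ|² is the characteristic function of the difference of two independent copies. In this form
the inequality 1 - cos jt ≤ j²(1 - cos t) applies term by term and bounds the defect at jθ by j²
times the defect at θ. -/
theorem hasSum_defect (hw : IsLaw w) (θ : ℝ) :
    HasSum (fun q : ℕ × ℕ => w q.1 * w q.2 * (1 - Real.cos ((q.1 - q.2) * θ)))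
      (1 - ‖charF w θ‖ ^ 2) := by
  have hn : Summable fun j => ‖(starRingEnd ℂ) ((w j : ℂ) * expI (j * θ))‖ := by
    simpa only [RCLike.norm_conj] using summable_charF hw.hasSum.summable θ
  have h2 := hasSum_re_mul (summable_charF hw.hasSum.summable θ)
    (hasSum_charF hw.hasSum.summable θ) hn
    (Complex.hasSum_conj'.2 (hasSum_charF hw.hasSum.summable θ))
  rw [Complex.mul_conj, Complex.normSq_eq_norm_sq, Complex.ofReal_re] at h2
  have h3 : HasSum (fun q : ℕ × ℕ => w q.1 * w q.2) (1 * 1) :=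
    hw.hasSum.mul hw.hasSum (summable_mul_of_summable_norm hw.hasSum.summable.norm
      hw.hasSum.summable.norm)
  rw [one_mul] at h3
  refine (h3.sub h2).congr_fun' fun q => ?_
  have e2 : ((w q.1 : ℂ) * expI (q.1 * θ)) * (starRingEnd ℂ) ((w q.2 : ℂ) * expI (q.2 * θ)) =
      ((w q.1 * w q.2 : ℝ) : ℂ) * expI ((q.1 - q.2) * θ) := by
    rw [map_mul, Complex.conj_ofReal, ← expI_neg', sub_mul, sub_eq_add_neg, expI_add]
    push_cast; ring
  rw [e2, Complex.re_ofReal_mul, expI_re]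
  ring

theorem defect_nonneg (hw : IsLaw w) (θ : ℝ) : 0 ≤ 1 - ‖charF w θ‖ ^ 2 := by
  have := pow_le_one₀ (norm_nonneg _) (norm_charF_le hw θ) (n := 2)
  linarith

theorem defect_nat_mul_le (hw : IsLaw w) (j : ℕ) (θ : ℝ) :
    1 - ‖charF w (j * θ)‖ ^ 2 ≤ j ^ 2 * (1 - ‖charF w θ‖ ^ 2) := by
  refine hasSum_le (fun q => ?_) (hasSum_defect hw (j * θ))
    ((hasSum_defect hw θ).mul_left ((j : ℝ) ^ 2))
  have h := one_sub_cos_nat_mul_le j ((q.1 - q.2) * θ)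
  have e : ((q.1 : ℝ) - q.2) * (j * θ) = j * ((q.1 - q.2) * θ) := by ring
  rw [e]
  calc w q.1 * w q.2 * (1 - Real.cos (j * ((q.1 - q.2) * θ)))
      ≤ w q.1 * w q.2 * (j ^ 2 * (1 - Real.cos ((q.1 - q.2) * θ))) :=
        mul_le_mul_of_nonneg_left h (mul_nonneg (hw.nonneg _) (hw.nonneg _))
    _ = _ := by ring

theorem charF_sub_int_two_pi (w : ℕ → ℝ) (θ : ℝ) (z : ℤ) :
    charF w (θ - z * (2 * Real.pi)) = charF w θ := by
  refine tsum_congr fun j => ?_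
  have e : (j : ℝ) * (θ - z * (2 * Real.pi)) = j * θ + ((-(j * z) : ℤ) : ℝ) * (2 * Real.pi) := by
    push_cast; ring
  rw [e, expI_add, expI_int_two_pi, mul_one]

theorem norm_charF_abs (w : ℕ → ℝ) (θ : ℝ) : ‖charF w |θ|‖ = ‖charF w θ‖ := by
  rcases abs_choice θ with h | h
  · rw [h]
  · rw [h, charF_neg, RCLike.norm_conj]

/-- If the defect is bounded below on an interval then it is bounded below away from the
multiples of some fixed frequency. -/
theorem exists_period {a b : ℝ} (ha : 0 < a) (hab : a < b) (hb : b ≤ 1) :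
    ∃ u₀ : ℕ, 0 < u₀ ∧ ∃ c₁ : ℝ, 0 < c₁ ∧ ∀ (w : ℕ → ℝ), IsLaw w → ∀ q : ℝ, 0 ≤ q →
      (∀ θ ∈ Set.Icc a b, q ≤ 1 - ‖charF w θ‖ ^ 2) → ∀ η : ℝ, 0 < η → ∀ θ : ℝ,
      ‖1 - expI (u₀ * θ)‖ ≤ u₀ * η ∨ c₁ * q * η ^ 2 ≤ 1 - ‖charF w θ‖ ^ 2 := by
  have hpi := Real.pi_pos
  obtain ⟨K, hK⟩ := exists_nat_gt (2 * Real.pi / (b - a))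
  have hba : 0 < b - a := by linarith
  have hK0 : (0 : ℝ) < K := lt_trans (by positivity) hK
  have hKpos : 0 < K := by exact_mod_cast hK0
  -- Every denominator k ≤ K from Dirichlet's theorem divides K!, so one period serves all θ. It
  -- depends on the interval only, not on the law.
  refine ⟨K !, Nat.factorial_pos K, 1 / K ^ 2, by positivity, fun w hw q hq h η hη θ => ?_⟩
  obtain ⟨k, hk0, hkK, hk⟩ := Real.exists_nat_abs_mul_sub_round_le (θ / (2 * Real.pi)) hKpos
  set z := round ((k : ℝ) * (θ / (2 * Real.pi)))
  set ρ := k * θ - z * (2 * Real.pi) with hρ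
  have hρ1 : |ρ| ≤ b - a := by
    have e : ρ = (k * (θ / (2 * Real.pi)) - z) * (2 * Real.pi) := by rw [hρ]; field_simp
    rw [e, abs_mul, abs_of_pos (by positivity : 0 < 2 * Real.pi)]
    calc _ ≤ 1 / ((K : ℝ) + 1) * (2 * Real.pi) := by gcongr
      _ ≤ b - a := by
        rw [div_lt_iff₀ hba] at hK
        rw [one_div, inv_mul_le_iff₀ (by positivity)]; nlinarith
  have hDρ : 1 - ‖charF w |ρ|‖ ^ 2 ≤ K ^ 2 * (1 - ‖charF w θ‖ ^ 2) := by
    rw [norm_charF_abs, hρ, charF_sub_int_two_pi]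
    refine (defect_nat_mul_le hw k θ).trans ?_
    have := defect_nonneg hw θ
    gcongr
  rcases le_or_gt |ρ| η with hcase | hcase
  · left
    obtain ⟨t, ht⟩ := Nat.dvd_factorial hk0 hkK
    have e : ((K ! : ℕ) : ℝ) * θ = t * ρ + ((t * z : ℤ) : ℝ) * (2 * Real.pi) := by
      rw [ht, hρ]; push_cast; ring
    rw [e, expI_add, expI_int_two_pi, mul_one, norm_sub_rev]
    refine (norm_expI_sub_one_le _).trans ?_
    rw [abs_mul, Nat.abs_cast]
    have h1 : (t : ℝ) ≤ (K ! : ℕ) := by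
      rw [ht]; exact_mod_cast Nat.le_mul_of_pos_left t hk0
    gcongr
  · right
    have hρ0 : 0 < |ρ| := hη.trans hcase
    -- As |ρ| ≤ b - a, the multiples of |ρ| cannot jump over [a, b]; this j gives the first one at
    -- or beyond a.
    set j : ℕ := ⌈a / |ρ|⌉₊ with hj
    have hj1 : a / |ρ| ≤ j := Nat.le_ceil _
    have hj2 : (j : ℝ) < a / |ρ| + 1 := Nat.ceil_lt_add_one (by positivity)
    have hj3 : a ≤ j * |ρ| := (div_le_iff₀ hρ0).1 hj1
    have hj4 : j * |ρ| ≤ b := by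
      have : j * |ρ| ≤ (a / |ρ| + 1) * |ρ| := by gcongr
      have e : (a / |ρ| + 1) * |ρ| = a + |ρ| := by field_simp
      linarith
    have hq1 := (h _ ⟨hj3, hj4⟩).trans (defect_nat_mul_le hw j |ρ|)
    have hjη : (j : ℝ) * η ≤ 1 := by
      calc (j : ℝ) * η ≤ j * |ρ| := by gcongr
        _ ≤ 1 := hj4.trans hb
    have hD0 := defect_nonneg hw θ
    have hD1 := defect_nonneg hw |ρ|
    have h2 : q * η ^ 2 ≤ K ^ 2 * (1 - ‖charF w θ‖ ^ 2) := by
      calc q * η ^ 2 ≤ (j ^ 2 * (1 - ‖charF w |ρ|‖ ^ 2)) * η ^ 2 := by gcongr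
        _ = (j * η) ^ 2 * (1 - ‖charF w |ρ|‖ ^ 2) := by ring
        _ ≤ 1 ^ 2 * (1 - ‖charF w |ρ|‖ ^ 2) := by gcongr
        _ ≤ _ := by linarith
    rw [mul_assoc, one_div, inv_mul_le_iff₀ (by positivity)]
    exact h2

/-! ### Signed series -/

open PowerSeries in
/-- The sum of the absolute values of the coefficients is at most `C`. -/
def AbsMassLE (A : PowerSeries ℝ) (C : ℝ) : Prop :=
  ∀ N, ∑ j ∈ Finset.range N, |coeff j A| ≤ C

theorem AbsMassLE.summable {A : PowerSeries ℝ} {C : ℝ} (h : AbsMassLE A C) :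
    Summable fun j => PowerSeries.coeff j A :=
  (summable_of_sum_range_le (fun _ => abs_nonneg _) h).of_abs

theorem AbsMassLE.massLE {A : PowerSeries ℝ} {C : ℝ} (h : AbsMassLE A C) :
    NonnegSeries.MassLE (PowerSeries.mk fun j => |PowerSeries.coeff j A|) C :=
  ⟨fun j => by simp, fun N => by simpa using h N⟩

theorem AbsMassLE.mono {A : PowerSeries ℝ} {C D : ℝ} (h : AbsMassLE A C) (hCD : C ≤ D) :
    AbsMassLE A D := fun N => (h N).trans hCD

theorem AbsMassLE.mul {A B : PowerSeries ℝ} {C D : ℝ} (hA : AbsMassLE A C) (hB : AbsMassLE B D) :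
    AbsMassLE (A * B) (C * D) := fun N => by
  refine le_trans (Finset.sum_le_sum fun j _ => ?_) ((hA.massLE.mul hB.massLE).2 N)
  rw [PowerSeries.coeff_mul, PowerSeries.coeff_mul]
  refine (Finset.abs_sum_le_sum_abs _ _).trans (le_of_eq ?_)
  simp [abs_mul]

theorem AbsMassLE.add {A B : PowerSeries ℝ} {C D : ℝ} (hA : AbsMassLE A C) (hB : AbsMassLE B D) :
    AbsMassLE (A + B) (C + D) := fun N => by
  refine le_trans (Finset.sum_le_sum fun j _ => ?_) (le_trans (le_of_eq Finset.sum_add_distrib)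
    (add_le_add (hA N) (hB N)))
  rw [map_add]; exact abs_add_le _ _

theorem AbsMassLE.neg {A : PowerSeries ℝ} {C : ℝ} (hA : AbsMassLE A C) : AbsMassLE (-A) C :=
  fun N => by simpa using hA N

theorem AbsMassLE.sub {A B : PowerSeries ℝ} {C D : ℝ} (hA : AbsMassLE A C) (hB : AbsMassLE B D) :
    AbsMassLE (A - B) (C + D) := by
  rw [sub_eq_add_neg]; exact hA.add hB.neg

theorem absMassLE_X_pow (k : ℕ) : AbsMassLE (PowerSeries.X ^ k) 1 := fun N => by
  have e : ∀ j, |PowerSeries.coeff j (PowerSeries.X ^ k : PowerSeries ℝ)| =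
      if j = k then 1 else 0 := fun j => by
    rw [PowerSeries.coeff_X_pow]; split_ifs <;> simp
  simp only [e, Finset.sum_ite_eq']
  split_ifs <;> norm_num

theorem absMassLE_one : AbsMassLE 1 1 := by simpa using absMassLE_X_pow 0

theorem absMassLE_C (c : ℝ) : AbsMassLE (PowerSeries.C c) |c| := fun N => by
  have e : ∀ j, |PowerSeries.coeff j (PowerSeries.C c)| = if j = 0 then |c| else 0 := fun j => by
    rw [PowerSeries.coeff_C]; split_ifs <;> simp
  simp only [e, Finset.sum_ite_eq']
  split_ifs <;> simp

theorem AbsMassLE.pow {A : PowerSeries ℝ} {C : ℝ} (hA : AbsMassLE A C) (n : ℕ) :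
    AbsMassLE (A ^ n) (C ^ n) := by
  induction n with
  | zero => simpa using absMassLE_one
  | succ n ih => rw [pow_succ, pow_succ]; exact ih.mul hA

theorem AbsMassLE.sum {ι : Type*} (s : Finset ι) {A : ι → PowerSeries ℝ} {C : ι → ℝ}
    (h : ∀ i ∈ s, AbsMassLE (A i) (C i)) : AbsMassLE (∑ i ∈ s, A i) (∑ i ∈ s, C i) := by
  classical
  induction s using Finset.induction_on with
  | empty => intro N; simp
  | insert a s ha ih =>
    rw [Finset.sum_insert ha, Finset.sum_insert ha]
    exact (h a (Finset.mem_insert_self a s)).add (ih fun i hi => h i (Finset.mem_insert_of_mem hi))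

theorem IsLaw.absMassLE (hw : IsLaw w) : AbsMassLE (PowerSeries.mk w) 1 := fun N => by
  simpa [abs_of_nonneg (hw.nonneg _)] using hw.sum_le_one (Finset.range N)

/-- The characteristic function of a series. -/
def serF (A : PowerSeries ℝ) (θ : ℝ) : ℂ := charF (fun j => PowerSeries.coeff j A) θ

theorem serF_mk (w : ℕ → ℝ) (θ : ℝ) : serF (PowerSeries.mk w) θ = charF w θ := by simp [serF]

theorem serF_mul {A B : PowerSeries ℝ} {C D : ℝ} (hA : AbsMassLE A C) (hB : AbsMassLE B D)
    (θ : ℝ) : serF (A * B) θ = serF A θ * serF B θ := by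
  rw [serF, serF, serF, ← charF_conv hA.summable hB.summable]
  congr 1; ext j
  rw [convLaw]; congr 2 <;> ext <;> simp

theorem serF_sub {A B : PowerSeries ℝ} {C D : ℝ} (hA : AbsMassLE A C) (hB : AbsMassLE B D)
    (θ : ℝ) : serF (A - B) θ = serF A θ - serF B θ := by
  rw [serF, serF, serF, charF, charF, charF,
    ← (summable_charF hA.summable θ).of_norm.tsum_sub (summable_charF hB.summable θ).of_norm]
  refine tsum_congr fun j => ?_
  rw [map_sub]; push_cast; ring

theorem serF_X_pow (k : ℕ) (θ : ℝ) : serF (PowerSeries.X ^ k) θ = expI (k * θ) := by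
  rw [serF, charF, tsum_eq_single k]
  · simp [PowerSeries.coeff_X_pow]
  · intro j hj; simp [PowerSeries.coeff_X_pow, hj]

theorem serF_one (θ : ℝ) : serF 1 θ = 1 := by
  have := serF_X_pow 0 θ
  simpa [expI_zero] using this

theorem serF_C (c θ : ℝ) : serF (PowerSeries.C c) θ = c := by
  rw [serF, charF, tsum_eq_single 0]
  · simp [expI_zero]
  · intro j hj; simp [PowerSeries.coeff_C, hj]

theorem serF_pow {A : PowerSeries ℝ} {C : ℝ} (hA : AbsMassLE A C) (n : ℕ) (θ : ℝ) :
    serF (A ^ n) θ = serF A θ ^ n := by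
  induction n with
  | zero => simp [serF_one]
  | succ n ih => rw [pow_succ, pow_succ, serF_mul (hA.pow n) hA, ih]

theorem serF_sum {ι : Type*} (s : Finset ι) {A : ι → PowerSeries ℝ} {C : ι → ℝ}
    (h : ∀ i ∈ s, AbsMassLE (A i) (C i)) (θ : ℝ) : serF (∑ i ∈ s, A i) θ = ∑ i ∈ s, serF (A i) θ := by
  simp only [serF, charF]
  rw [← Summable.tsum_finsetSum fun i hi => (summable_charF (h i hi).summable θ).of_norm]
  refine tsum_congr fun j => ?_
  rw [map_sum]; push_cast; rw [Finset.sum_mul]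

theorem abs_coeff_le {A : PowerSeries ℝ} {C B : ℝ} (hA : AbsMassLE A C)
    (h : ∀ θ, ‖serF A θ‖ ≤ B) (x : ℕ) : |PowerSeries.coeff x A| ≤ B := by
  have h1 := integral_full hA.summable x
  have h2 : ‖∫ θ in (-Real.pi)..Real.pi, charF (fun j => PowerSeries.coeff j A) θ *
      expI (-(x * θ))‖ ≤ B * |Real.pi - -Real.pi| := by
    refine intervalIntegral.norm_integral_le_of_norm_le_const fun t _ => ?_
    rw [norm_mul, norm_expI, mul_one]; exact h t
  have hpi := Real.pi_pos
  rw [h1, Complex.norm_real, Real.norm_eq_abs, abs_mul,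
    abs_of_pos (a := 2 * Real.pi) (by positivity), sub_neg_eq_add,
    abs_of_pos (a := Real.pi + Real.pi) (by positivity)] at h2
  nlinarith

end NatLaw

end

noncomputable section

namespace NatLaw

variable {w : ℕ → ℝ}

/-! ### Almost invariance of a convolution power under a shift -/

-- Let D = X^u - 1 and let E be the average of the first J powers of X^u. Then D E telescopes and
-- has mass at most 2/J. From 1 = E Q + (1 - E)^r with Q of mass at most 2^r, D p splits into a part
-- of small total mass and D (1 - E)^r p. The coefficients of the latter are bounded through its
-- Fourier transform: where 1 - exp(iuθ) is within η of 0, the factor 1 - E is at most Jη, and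
-- elsewhere p is at most ζ. Only this second part pays the number Z of coefficients.
open PowerSeries in
theorem sum_abs_shift_sub_le {p : PowerSeries ℝ} (hp : AbsMassLE p 1) {u J r : ℕ} (hJ : 0 < J)
    {η ζ : ℝ} (hη : 0 ≤ η) (hζ : 0 ≤ ζ) (hp1 : ∀ θ, ‖serF p θ‖ ≤ 1)
    (h : ∀ θ : ℝ, ‖1 - expI (u * θ)‖ ≤ η ∨ ‖serF p θ‖ ≤ ζ) (Z : ℕ) :
    ∑ z ∈ Finset.range Z, |coeff z (((X : PowerSeries ℝ) ^ u - 1) * p)| ≤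
      2 ^ (r + 1) / J + Z * (2 * (J * η) ^ r + 2 ^ (r + 1) * ζ) := by
  have hJ0 : (0 : ℝ) < J := by exact_mod_cast hJ
  set D : PowerSeries ℝ := X ^ u - 1 with hD
  set S : PowerSeries ℝ := ∑ i ∈ Finset.range J, (X ^ u) ^ i with hS
  set E : PowerSeries ℝ := C (1 / (J : ℝ)) * S with hE
  have hDm : AbsMassLE D 2 := by
    have := (absMassLE_X_pow u).sub absMassLE_one
    norm_num at this; exact this
  have hSi : ∀ i ∈ Finset.range J, AbsMassLE ((X ^ u : PowerSeries ℝ) ^ i) 1 := fun i _ => by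
    simpa using (absMassLE_X_pow u).pow i
  have hSm : AbsMassLE S J := by
    have := AbsMassLE.sum (Finset.range J) hSi
    simpa using this
  have hEm : AbsMassLE E 1 := by
    refine ((absMassLE_C _).mul hSm).mono (le_of_eq ?_)
    rw [abs_of_pos (by positivity)]; field_simp
  have hE1 : AbsMassLE (1 - E) 2 := by
    have := absMassLE_one.sub hEm
    norm_num at this; exact this
  have hDE : AbsMassLE (D * E) (2 / J) := by
    have e : D * E = C (1 / (J : ℝ)) * ((X ^ u) ^ J - 1) := by
      rw [hE, mul_left_comm, mul_comm D, hS, hD, geom_sum_mul]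
    rw [e]
    have h2 := ((absMassLE_X_pow u).pow J).sub absMassLE_one
    refine ((absMassLE_C _).mul h2).mono (le_of_eq ?_)
    rw [abs_of_pos (by positivity)]; norm_num; ring
  set Q : PowerSeries ℝ := ∑ i ∈ Finset.range r, (1 - E) ^ i with hQ
  have hQm : AbsMassLE Q (2 ^ r) := by
    refine (AbsMassLE.sum (Finset.range r) fun i _ => hE1.pow i).mono ?_
    have := geom_sum_mul (2 : ℝ) r
    norm_num at this; linarith
  have hdec : D * p = D * E * Q * p + D * (1 - E) ^ r * p := by
    have e : E * Q = 1 - (1 - E) ^ r := by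
      have := mul_neg_geom_sum (1 - E) r
      rwa [sub_sub_cancel] at this
    rw [mul_assoc D E Q, e]; ring
  have hmain : ∀ z, |coeff z (D * (1 - E) ^ r * p)| ≤ 2 * (J * η) ^ r + 2 ^ (r + 1) * ζ := by
    refine abs_coeff_le ((hDm.mul (hE1.pow r)).mul hp) fun θ => ?_
    rw [serF_mul (hDm.mul (hE1.pow r)) hp, serF_mul hDm (hE1.pow r), serF_pow hE1,
      serF_sub absMassLE_one hEm, serF_one, norm_mul, norm_mul, norm_pow]
    have hDn : ‖serF D θ‖ ≤ 2 := by
      rw [hD, serF_sub (absMassLE_X_pow u) absMassLE_one, serF_X_pow, serF_one]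
      refine (norm_sub_le _ _).trans ?_
      simp; norm_num
    have hEf : serF E θ = (1 / J : ℝ) * ∑ i ∈ Finset.range J, expI (u * θ) ^ i := by
      rw [hE, serF_mul (absMassLE_C _) hSm, serF_C, hS, serF_sum _ hSi]
      congr 1
      refine Finset.sum_congr rfl fun i _ => ?_
      rw [serF_pow (absMassLE_X_pow u), serF_X_pow]
    have h1E : 1 - serF E θ = (1 / J : ℝ) * ∑ i ∈ Finset.range J, (1 - expI (u * θ) ^ i) := by
      rw [hEf, Finset.sum_sub_distrib, mul_sub]
      congr 1
      have hJc : (J : ℂ) ≠ 0 := by exact_mod_cast hJ.ne'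
      simp [hJc]
    have hb : ∀ B : ℝ, (∀ i ∈ Finset.range J, ‖1 - expI (u * θ) ^ i‖ ≤ B) → ‖1 - serF E θ‖ ≤ B := by
      intro B hB
      rw [h1E, norm_mul, Complex.norm_real, Real.norm_eq_abs, abs_of_pos (by positivity)]
      have := (norm_sum_le (Finset.range J) fun i => 1 - expI (u * θ) ^ i).trans
        (Finset.sum_le_sum hB)
      rw [Finset.sum_const, Finset.card_range, nsmul_eq_mul] at this
      rw [one_div, inv_mul_le_iff₀ hJ0]; exact this
    rcases h θ with hc | hc
    · have h2 : ‖1 - serF E θ‖ ≤ J * η := by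
        refine hb _ fun i hi => ?_
        have h3 := norm_pow_sub_pow_le (z := 1) (z' := expI (u * θ)) (by simp) (by simp) i
        rw [one_pow] at h3
        refine h3.trans ?_
        have : (i : ℝ) ≤ J := by exact_mod_cast (Finset.mem_range.1 hi).le
        gcongr
      calc ‖serF D θ‖ * ‖1 - serF E θ‖ ^ r * ‖serF p θ‖ ≤ 2 * (J * η) ^ r * 1 := by
            gcongr
            exact hp1 θ
        _ ≤ _ := by rw [mul_one]; exact le_add_of_nonneg_right (by positivity)
    · have h2 : ‖1 - serF E θ‖ ≤ 2 := hb _ fun i _ => by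
        refine (norm_sub_le _ _).trans ?_
        simp; norm_num
      calc ‖serF D θ‖ * ‖1 - serF E θ‖ ^ r * ‖serF p θ‖ ≤ 2 * 2 ^ r * ζ := by gcongr
        _ = 2 ^ (r + 1) * ζ := by rw [pow_succ]; ring
        _ ≤ _ := le_add_of_nonneg_left (by positivity)
  calc ∑ z ∈ Finset.range Z, |coeff z (D * p)|
      ≤ ∑ z ∈ Finset.range Z, (|coeff z (D * E * Q * p)| +
        (2 * (J * η) ^ r + 2 ^ (r + 1) * ζ)) := by
        refine Finset.sum_le_sum fun z _ => ?_
        rw [hdec, map_add]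
        exact (abs_add_le _ _).trans (by gcongr; exact hmain z)
    _ ≤ 2 / J * 2 ^ r * 1 + Z * (2 * (J * η) ^ r + 2 ^ (r + 1) * ζ) := by
        rw [Finset.sum_add_distrib, Finset.sum_const, Finset.card_range, nsmul_eq_mul]
        gcongr
        exact ((hDE.mul hQm).mul hp) Z
    _ = _ := by rw [pow_succ]; ring

/-- A set that is improbable for a block is improbable for a block of a conditioned sum. -/
theorem sum_block_le (hw : IsLaw w) {k m₀ s y : ℕ} (hm : 0 < m₀) (B : ℕ → Prop) [DecidablePred B]
    {β Q : ℝ} (hβ : ∀ N, ∑ z ∈ Finset.range N, (if B z then powLaw w k z else 0) ≤ β)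
    (hy : Real.exp (-Q) ≤ powLaw w (k * m₀ + s) y) :
    PowerSeries.coeff y (PowerSeries.mk (fun z => if B z then powLaw w k z else 0) *
      PowerSeries.mk w ^ (k * (m₀ - 1) + s)) ≤ (2 * β + Q / m₀) * powLaw w (k * m₀ + s) y := by
  set p := powLaw w k with hp
  have hpl : IsLaw p := hw.powLaw k
  have h1 : NonnegSeries.gradedSum (fun z => ({z} : Finset ℕ)) p = PowerSeries.mk w ^ k := by
    ext z; rw [NonnegSeries.coeff_gradedSum]; simp [hp, powLaw]
  have h2 : NonnegSeries.gradedSum (fun z => ({z} : Finset ℕ))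
      (fun z => p z * (if B z then (1 : ℝ) else 0)) =
      PowerSeries.mk (fun z => if B z then p z else 0) := by
    ext z; rw [NonnegSeries.coeff_gradedSum]; simp
  have hR : NonnegSeries.MassLE (PowerSeries.mk w ^ s) 1 := by
    simpa using hw.massLE.pow s
  have hmass : NonnegSeries.MassLE (NonnegSeries.gradedSum (fun z => ({z} : Finset ℕ))
      fun z => p z * Real.exp (if B z then (1 : ℝ) else 0)) (Real.exp (2 * β)) := by
    refine ⟨fun j => ?_, fun N => ?_⟩
    · rw [NonnegSeries.coeff_gradedSum, Finset.sum_singleton]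
      exact mul_nonneg (hpl.nonneg j) (Real.exp_pos _).le
    · simp only [NonnegSeries.coeff_gradedSum, Finset.sum_singleton]
      -- Since e ≤ 3, the exponential moment of the indicator is at most 1 + 2β ≤ exp(2β).
      have h3 : ∀ z ∈ Finset.range N, p z * Real.exp (if B z then (1 : ℝ) else 0) ≤
          p z + 2 * (if B z then p z else 0) := by
        intro z _
        split_ifs
        · have := Real.exp_one_lt_three
          nlinarith [hpl.nonneg z]
        · simp
      refine (Finset.sum_le_sum h3).trans ?_
      rw [Finset.sum_add_distrib, ← Finset.mul_sum]
      have h4 := hpl.sum_le_one (Finset.range N)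
      have h5 := Real.add_one_le_exp (2 * β)
      linarith [hβ N]
  have e1 : PowerSeries.coeff y ((PowerSeries.mk w ^ k) ^ m₀ * PowerSeries.mk w ^ s) =
      powLaw w (k * m₀ + s) y := by rw [powLaw, pow_add, pow_mul]
  have key := NonnegSeries.coeff_tilt_le (Ω := fun z => ({z} : Finset ℕ)) (ρ := p)
    (Y := fun z => if B z then (1 : ℝ) else 0) hpl.nonneg hR (a := 2 * β) (Q := Q) (m := m₀)
    (x := y) hm hmass (by rw [h1, e1]; exact hy)
  rw [h2, h1, e1] at key
  rwa [pow_add, pow_mul, ← mul_assoc]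

/-- Probabilities of a sum hardly change under a shift, if this holds for typical blocks. -/
theorem powLaw_shift_ge (hw : IsLaw w) {k m₀ s y u : ℕ} (hm : 0 < m₀) {β Q δ : ℝ} (hδ0 : 0 ≤ δ)
    (hβ : ∀ N, ∑ z ∈ Finset.range N, (if powLaw w k (z + u) < (1 - δ) * powLaw w k z
      then powLaw w k z else 0) ≤ β)
    (hβ' : ∀ N, ∑ z ∈ Finset.range N, (if (if u ≤ z then powLaw w k (z - u) else 0) <
      (1 - δ) * powLaw w k z then powLaw w k z else 0) ≤ β)
    (hy : Real.exp (-Q) ≤ powLaw w (k * m₀ + s) y) :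
    (1 - δ - 2 * β - Q / m₀) * powLaw w (k * m₀ + s) y ≤ powLaw w (k * m₀ + s) (y + u) ∧
    (1 - δ - 2 * β - Q / m₀) * powLaw w (k * m₀ + s) y ≤
      if u ≤ y then powLaw w (k * m₀ + s) (y - u) else 0 := by
  set p := powLaw w k with hp
  set n := k * m₀ + s with hn
  have hpl : IsLaw p := hw.powLaw k
  have hnn := (hw.powLaw n).nonneg y
  have hqn : ∀ j, 0 ≤ PowerSeries.coeff j (PowerSeries.mk w ^ (k * (m₀ - 1) + s)) :=
    (hw.powLaw _).nonneg
  have hsplit : PowerSeries.mk w ^ n = PowerSeries.mk p * PowerSeries.mk w ^ (k * (m₀ - 1) + s) := by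
    rw [hp, mk_powLaw, ← pow_add, hn]
    congr 1
    obtain ⟨m, rfl⟩ : ∃ m, m₀ = m + 1 := ⟨m₀ - 1, by omega⟩
    simp; ring
  -- Here T stands for the block law shifted in one of the two directions: outside B it dominates (1
  -- - δ) p, and the blocks in B weigh little even after conditioning.
  have hc : ∀ B : ℕ → Prop, ∀ [DecidablePred B], ∀ T : PowerSeries ℝ,
      (∀ z, 0 ≤ PowerSeries.coeff z T) → (∀ z, ¬ B z → (1 - δ) * p z ≤ PowerSeries.coeff z T) →
      (∀ N, ∑ z ∈ Finset.range N, (if B z then p z else 0) ≤ β) →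
      (1 - δ - 2 * β - Q / m₀) * powLaw w n y ≤
        PowerSeries.coeff y (T * PowerSeries.mk w ^ (k * (m₀ - 1) + s)) := by
    intro B _ T hT0 hT hB
    have h1 := sum_block_le hw hm B hB hy
    have h2 : (1 - δ) * powLaw w n y ≤ (1 - δ) * PowerSeries.coeff y
        (PowerSeries.mk (fun z => if B z then p z else 0) *
          PowerSeries.mk w ^ (k * (m₀ - 1) + s)) +
        PowerSeries.coeff y (T * PowerSeries.mk w ^ (k * (m₀ - 1) + s)) := by
      rw [powLaw, hsplit, PowerSeries.coeff_mul, PowerSeries.coeff_mul, PowerSeries.coeff_mul,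
        Finset.mul_sum, Finset.mul_sum, ← Finset.sum_add_distrib]
      refine Finset.sum_le_sum fun q _ => ?_
      rw [← mul_assoc, ← mul_assoc, ← add_mul]
      refine mul_le_mul_of_nonneg_right ?_ (hqn _)
      rw [PowerSeries.coeff_mk, PowerSeries.coeff_mk]
      by_cases hb : B q.1
      · rw [if_pos hb]; exact le_add_of_nonneg_right (hT0 _)
      · rw [if_neg hb, mul_zero, zero_add]; exact hT _ hb
    have h3 : 0 ≤ PowerSeries.coeff y
        (PowerSeries.mk (fun z => if B z then p z else 0) *
          PowerSeries.mk w ^ (k * (m₀ - 1) + s)) := by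
      refine NonnegSeries.coeff_mul_nonneg (fun j => ?_) hqn y
      rw [PowerSeries.coeff_mk]; split_ifs
      · exact hpl.nonneg _
      · exact le_rfl
    nlinarith
  constructor
  · refine (hc (fun z => p (z + u) < (1 - δ) * p z) (PowerSeries.mk fun z => p (z + u))
      (fun z => by simpa using hpl.nonneg _) (fun z hz => by simpa using hz) hβ).trans ?_
    rw [powLaw, hsplit, PowerSeries.coeff_mul, PowerSeries.coeff_mul]
    have hinj : Set.InjOn (fun q : ℕ × ℕ => (q.1 + u, q.2))
        (Finset.HasAntidiagonal.antidiagonal y : Finset (ℕ × ℕ)) := by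
      rintro ⟨a, b⟩ _ ⟨c, d⟩ _ h
      simp only [Prod.mk.injEq, add_left_inj] at h
      rw [h.1, h.2]
    have e := Finset.sum_image (f := fun q : ℕ × ℕ => PowerSeries.coeff q.1 (PowerSeries.mk p) *
      PowerSeries.coeff q.2 (PowerSeries.mk w ^ (k * (m₀ - 1) + s))) hinj
    simp only [PowerSeries.coeff_mk] at e ⊢
    rw [← e]
    refine Finset.sum_le_sum_of_subset_of_nonneg ?_ fun q _ _ =>
      mul_nonneg (by simpa using hpl.nonneg _) (hqn _)
    intro q hq
    simp only [Finset.mem_image, Finset.HasAntidiagonal.mem_antidiagonal] at hq ⊢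
    obtain ⟨a, h1, rfl⟩ := hq
    simp only; omega
  · have h4 := hc (fun z => (if u ≤ z then p (z - u) else 0) < (1 - δ) * p z)
      (PowerSeries.X ^ u * PowerSeries.mk p) (fun z => by
        rw [PowerSeries.coeff_X_pow_mul']; split_ifs
        · simpa using hpl.nonneg _
        · exact le_rfl) (fun z hz => by
        rw [PowerSeries.coeff_X_pow_mul']; simpa using hz) hβ'
    rw [mul_assoc, ← hsplit, PowerSeries.coeff_X_pow_mul'] at h4
    exact h4

/-- Markov's inequality. -/
theorem sum_tail_le {p : ℕ → ℝ} (hp : IsLaw p) {x : ℝ}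
    (hx : HasSum (fun j : ℕ => (j : ℝ) * p j) x) {Z : ℕ} (hZ : 0 < Z) (s : Finset ℕ)
    (hs : ∀ j ∈ s, Z ≤ j) : ∑ j ∈ s, p j ≤ x / Z := by
  have hZ0 : (0 : ℝ) < Z := by exact_mod_cast hZ
  rw [le_div_iff₀ hZ0, Finset.sum_mul]
  refine le_trans (Finset.sum_le_sum fun j hj => ?_)
    (sum_le_hasSum s (fun j _ => mul_nonneg j.cast_nonneg (hp.nonneg j)) hx)
  have : (Z : ℝ) ≤ j := by exact_mod_cast hs j hj
  rw [mul_comm]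
  exact mul_le_mul_of_nonneg_right this (hp.nonneg j)

/-- The points at which a law is far from invariant under a shift are improbable. -/
theorem sum_bad_le {p : ℕ → ℝ} (hp : IsLaw p) {x : ℝ}
    (hx : HasSum (fun j : ℕ => (j : ℝ) * p j) x) {u Z : ℕ} (hZ : 0 < Z) {δ V : ℝ} (hδ : 0 < δ)
    (hV : ∑ z ∈ Finset.range (Z + u), |PowerSeries.coeff z
      (((PowerSeries.X : PowerSeries ℝ) ^ u - 1) * PowerSeries.mk p)| ≤ V) (N : ℕ) :
    ∑ z ∈ Finset.range N, (if p (z + u) < (1 - δ) * p z then p z else 0) ≤ V / δ + x / Z ∧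
    ∑ z ∈ Finset.range N, (if (if u ≤ z then p (z - u) else 0) < (1 - δ) * p z
      then p z else 0) ≤ V / δ + x / Z := by
  have hco : ∀ z, PowerSeries.coeff z
      (((PowerSeries.X : PowerSeries ℝ) ^ u - 1) * PowerSeries.mk p) =
      (if u ≤ z then p (z - u) else 0) - p z := fun z => by
    rw [sub_mul, map_sub, PowerSeries.coeff_X_pow_mul']; simp
  simp only [hco] at hV
  have gen : ∀ (B : ℕ → Prop) [DecidablePred B],
      δ * ∑ z ∈ (Finset.range Z).filter B, p z ≤ V →
      ∑ z ∈ Finset.range N, (if B z then p z else 0) ≤ V / δ + x / Z := by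
    intro B _ h
    rw [← Finset.sum_filter]
    have h1 : ((Finset.range N).filter B) ⊆ ((Finset.range Z).filter B) ∪
        ((Finset.range N).filter fun z => Z ≤ z) := by
      intro z
      simp only [Finset.mem_filter, Finset.mem_union, Finset.mem_range]
      rintro ⟨h1, h2⟩
      rcases lt_or_ge z Z with h3 | h3
      · exact Or.inl ⟨h3, h2⟩
      · exact Or.inr ⟨h1, h3⟩
    refine (Finset.sum_le_sum_of_subset_of_nonneg h1 fun z _ _ => hp.nonneg z).trans ?_
    refine le_trans (le_add_of_nonneg_right (Finset.sum_nonneg fun z _ => hp.nonneg z))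
      (le_trans (le_of_eq Finset.sum_union_inter) ?_)
    refine add_le_add ?_ (sum_tail_le hp hx hZ _ fun j hj => (Finset.mem_filter.1 hj).2)
    rw [le_div_iff₀ hδ]; linarith
  constructor
  · refine gen (fun z => p (z + u) < (1 - δ) * p z) ?_
    refine le_trans ?_ hV
    rw [Finset.mul_sum]
    -- For this direction the loss at z is visible in the coefficient at z + u; hence the range up
    -- to Z + u in the hypothesis.
    have h2 : ∀ z ∈ (Finset.range Z).filter (fun z => p (z + u) < (1 - δ) * p z),
        δ * p z ≤ (fun z => |(if u ≤ z then p (z - u) else 0) - p z|) (z + u) := by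
      intro z hz
      have := (Finset.mem_filter.1 hz).2
      simp only [Nat.le_add_left, if_true, Nat.add_sub_cancel]
      refine le_trans ?_ (le_abs_self _)
      linarith
    refine (Finset.sum_le_sum h2).trans ?_
    rw [← Finset.sum_image (g := fun z => z + u) (f := fun z =>
      |(if u ≤ z then p (z - u) else 0) - p z|) fun a _ b _ h => Nat.add_right_cancel h]
    refine Finset.sum_le_sum_of_subset_of_nonneg ?_ fun _ _ _ => abs_nonneg _
    intro z
    simp only [Finset.mem_image, Finset.mem_filter, Finset.mem_range]
    rintro ⟨a, ⟨h, _⟩, rfl⟩; omega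
  · refine gen (fun z => (if u ≤ z then p (z - u) else 0) < (1 - δ) * p z) ?_
    refine le_trans ?_ hV
    rw [Finset.mul_sum]
    have h2 : ∀ z ∈ (Finset.range Z).filter
        (fun z => (if u ≤ z then p (z - u) else 0) < (1 - δ) * p z),
        δ * p z ≤ |(if u ≤ z then p (z - u) else 0) - p z| := by
      intro z hz
      have := (Finset.mem_filter.1 hz).2
      rw [abs_sub_comm]
      refine le_trans ?_ (le_abs_self _)
      linarith
    refine (Finset.sum_le_sum h2).trans ?_
    refine Finset.sum_le_sum_of_subset_of_nonneg ?_ fun _ _ _ => abs_nonneg _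
    intro z
    simp only [Finset.mem_filter, Finset.mem_range]; omega

end NatLaw

end

noncomputable section

namespace NatLaw

variable {w : ℕ → ℝ}

/-! ### A sum of independent variables does not jump over its mean -/

theorem coeff_mul_mk_one (A : PowerSeries ℝ) (t : ℕ) :
    PowerSeries.coeff t (A * PowerSeries.mk fun _ => 1) =
      ∑ j ∈ Finset.range (t + 1), PowerSeries.coeff j A := by
  rw [PowerSeries.coeff_mul,
    Finset.Nat.sum_antidiagonal_eq_sum_range_succ_mk]
  simp

/-- Off the integer x one has |y - x| ≥ 1, and since x is the mean, E|S - x| is twice the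
expectation of the part below x. -/
theorem one_sub_le_sum_below {p : ℕ → ℝ} (hp : IsLaw p) {x : ℕ}
    (hx : HasSum (fun j : ℕ => (j : ℝ) * p j) x) :
    1 - p x ≤ 2 * ∑ y ∈ Finset.range x, ((x : ℝ) - y) * p y := by
  have h1 : HasSum (fun y : ℕ => if y < x then ((x : ℝ) - y) * p y else 0)
      (∑ y ∈ Finset.range x, ((x : ℝ) - y) * p y) := by
    have := hasSum_sum_of_ne_finset_zero (L := SummationFilter.unconditional ℕ)
      (s := Finset.range x) (f := fun y : ℕ => if y < x then ((x : ℝ) - y) * p y else 0)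
      (fun y hy => if_neg (by simpa using hy))
    rwa [Finset.sum_congr rfl fun y hy => if_pos (Finset.mem_range.1 hy)] at this
  have h2 := (hx.sub (hp.hasSum.mul_left (x : ℝ))).add (h1.mul_left 2)
  have h3 := hp.hasSum.sub (hasSum_ite_eq x (p x))
  have h4 := hasSum_le (fun y => ?_) h3 h2
  · simpa using h4
  · have hp0 := hp.nonneg y
    rcases lt_trichotomy y x with h | h | h
    · rw [if_neg h.ne, if_pos h]
      have : (y : ℝ) + 1 ≤ x := by exact_mod_cast h
      nlinarith
    · subst h; simp
    · rw [if_neg h.ne', if_neg (by omega)]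
      have : (x : ℝ) + 1 ≤ y := by exact_mod_cast h
      nlinarith

/-- With S = S' + X, the expectation of (x - S)₊ is n times the sum of (μ - X) over the event S < x.
Given S', this is at most the mean of the jumps X that lead to x or beyond: jumps above B contribute
at most τ, the others at most B times the probability of landing in [x, x + B]. If the window had
small mass W, `one_sub_le_sum_below` would give 1 ≤ W + 2n(τ + BW), which fails for W < 1/(2(2nB +
1)). -/
theorem exists_window (hw : IsLaw w) {μ τ : ℝ} (hμ : HasSum (fun j : ℕ => (j : ℝ) * w j) μ)
    {n x B : ℕ} (hn : 1 ≤ n) (hx : n * μ = x)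
    (hτ : μ ≤ ∑ j ∈ Finset.range (B + 1), (j : ℝ) * w j + τ) (hnτ : 4 * n * τ ≤ 1) :
    ∃ y, x ≤ y ∧ y ≤ x + B ∧ 1 / (2 * (2 * n * B + 1) * (B + 1)) ≤ powLaw w n y := by
  obtain ⟨n', rfl⟩ : ∃ n', n = n' + 1 := ⟨n - 1, by omega⟩
  set p := powLaw w (n' + 1) with hp
  have hpl : IsLaw p := hw.powLaw _
  have hp' : IsLaw (powLaw w n') := hw.powLaw _
  have hxs : HasSum (fun j : ℕ => (j : ℝ) * p j) x := by
    rw [← hx]; exact hasSum_powLaw_mean hw hμ (n' + 1)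
  have h1 := one_sub_le_sum_below hpl hxs
  set W := ∑ y ∈ Finset.Icc x (x + B), p y with hW
  have hxW : p x ≤ W := Finset.single_le_sum (fun y _ => hpl.nonneg y) (by simp)
  have hτ0 : 0 ≤ τ := by
    have := sum_le_hasSum (Finset.range (B + 1))
      (fun j _ => mul_nonneg j.cast_nonneg (hw.nonneg j)) hμ
    linarith
  have hmain : ∑ y ∈ Finset.range x, ((x : ℝ) - y) * p y ≤ (n' + 1) * (τ + B * W) := by
    rcases Nat.eq_zero_or_pos x with h0 | h0
    · have hW0 : 0 ≤ W := (hpl.nonneg x).trans hxW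
      subst h0; simp; positivity
    set A : PowerSeries ℝ := PowerSeries.mk (fun j : ℕ => (μ - j) * w j) with hA
    have e1 : ∀ y, ((x : ℝ) - y) * p y = (n' + 1) * PowerSeries.coeff y
        (PowerSeries.mk (powLaw w n') * A) := by
      intro y
      have h2 := mul_powLaw w n' y
      have h3 : A = PowerSeries.C μ * PowerSeries.mk w - PowerSeries.mk (fun j : ℕ => (j : ℝ) * w j) := by
        ext j; simp [hA]; ring
      rw [sub_mul, hp, h2, h3, mul_sub, map_sub, mul_left_comm, PowerSeries.coeff_C_mul,
        mk_powLaw, ← pow_succ, ← hx, convLaw, mk_powLaw, powLaw]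
      push_cast; ring
    obtain ⟨x', rfl⟩ : ∃ x', x = x' + 1 := ⟨x - 1, by omega⟩
    rw [Finset.sum_congr rfl fun y _ => e1 y, ← Finset.mul_sum, ← coeff_mul_mk_one, mul_assoc,
      PowerSeries.coeff_mul]
    refine mul_le_mul_of_nonneg_left ?_ (by positivity)
    -- The partial sum of (μ - j) w j up to t is at most the mean carried by jumps larger than t,
    -- since all of w has mass at most one.
    have h4 : ∀ t, PowerSeries.coeff t (A * PowerSeries.mk fun _ => 1) ≤
        τ + B * ∑ j ∈ Finset.Ico (t + 1) (B + 1), w j := by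
      intro t
      rw [coeff_mul_mk_one]
      simp only [hA, PowerSeries.coeff_mk, sub_mul, Finset.sum_sub_distrib, ← Finset.mul_sum]
      have h5 : μ * ∑ j ∈ Finset.range (t + 1), w j ≤ μ * 1 :=
        mul_le_mul_of_nonneg_left (hw.sum_le_one _) (mean_nonneg hw hμ)
      have h6 : ∑ j ∈ Finset.range (B + 1), (j : ℝ) * w j ≤
          ∑ j ∈ Finset.range (t + 1), (j : ℝ) * w j +
            ∑ j ∈ Finset.Ico (t + 1) (B + 1), (j : ℝ) * w j := by
        rw [← Finset.sum_union]
        · refine Finset.sum_le_sum_of_subset_of_nonneg (fun j => ?_)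
            fun j _ _ => mul_nonneg j.cast_nonneg (hw.nonneg j)
          simp only [Finset.mem_union, Finset.mem_range, Finset.mem_Ico]; omega
        · rw [Finset.disjoint_left]; intro j
          simp only [Finset.mem_range, Finset.mem_Ico]; omega
      have h7 : ∑ j ∈ Finset.Ico (t + 1) (B + 1), (j : ℝ) * w j ≤
          B * ∑ j ∈ Finset.Ico (t + 1) (B + 1), w j := by
        rw [Finset.mul_sum]
        refine Finset.sum_le_sum fun j hj => mul_le_mul_of_nonneg_right ?_ (hw.nonneg j)
        have := (Finset.mem_Ico.1 hj).2
        exact_mod_cast Nat.lt_succ_iff.1 this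
      linarith
    calc ∑ q ∈ Finset.HasAntidiagonal.antidiagonal x', PowerSeries.coeff q.1
          (PowerSeries.mk (powLaw w n')) * PowerSeries.coeff q.2 (A * PowerSeries.mk fun _ => 1)
        ≤ ∑ q ∈ Finset.HasAntidiagonal.antidiagonal x', powLaw w n' q.1 *
          (τ + B * ∑ j ∈ Finset.Ico (q.2 + 1) (B + 1), w j) := by
          refine Finset.sum_le_sum fun q _ => ?_
          rw [PowerSeries.coeff_mk]
          exact mul_le_mul_of_nonneg_left (h4 _) (hp'.nonneg _)
      _ = τ * ∑ q ∈ Finset.HasAntidiagonal.antidiagonal x', powLaw w n' q.1 +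
          B * ∑ q ∈ Finset.HasAntidiagonal.antidiagonal x',
            ∑ j ∈ Finset.Ico (q.2 + 1) (B + 1), powLaw w n' q.1 * w j := by
          rw [Finset.mul_sum, Finset.mul_sum, ← Finset.sum_add_distrib]
          refine Finset.sum_congr rfl fun q _ => ?_
          rw [← Finset.mul_sum]; ring
      _ ≤ τ * 1 + B * W := by
          refine add_le_add (mul_le_mul_of_nonneg_left ?_ hτ0)
            (mul_le_mul_of_nonneg_left ?_ B.cast_nonneg)
          · rw [Finset.Nat.sum_antidiagonal_eq_sum_range_succ_mk]
            exact hp'.sum_le_one _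
          -- Every pair of a position at most x' and a jump across x' of size at most B ends in the
          -- window, and the pair determines its end point, so these pairs are part of W.
          · have hWs : W = ∑ a ∈ (Finset.Icc (x' + 1) (x' + 1 + B)).sigma
                fun y => Finset.HasAntidiagonal.antidiagonal y,
                (fun a : (_ : ℕ) × ℕ × ℕ => powLaw w n' a.2.1 * w a.2.2) a := by
              rw [hW, Finset.sum_sigma]
              refine Finset.sum_congr rfl fun y _ => ?_
              rw [hp, powLaw_succ, convLaw, PowerSeries.coeff_mul]; simp
            rw [hWs, Finset.sum_sigma']
            have hinj : Set.InjOn (fun a : (_ : ℕ × ℕ) × ℕ =>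
                (⟨a.1.1 + a.2, (a.1.1, a.2)⟩ : (_ : ℕ) × ℕ × ℕ))
                ((Finset.HasAntidiagonal.antidiagonal x').sigma
                  fun q => Finset.Ico (q.2 + 1) (B + 1) : Finset ((_ : ℕ × ℕ) × ℕ)) := by
              rintro ⟨⟨a, b⟩, c⟩ h1 ⟨⟨d, e⟩, f⟩ h2 h
              simp only [Finset.coe_sigma, Set.mem_sigma_iff, Finset.mem_coe,
                Finset.HasAntidiagonal.mem_antidiagonal] at h1 h2
              simp only [Sigma.mk.injEq, heq_eq_eq, Prod.mk.injEq] at h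
              obtain ⟨-, rfl, rfl⟩ := h
              have : b = e := by omega
              rw [this]
            rw [← Finset.sum_image (f := fun a : (_ : ℕ) × ℕ × ℕ => powLaw w n' a.2.1 * w a.2.2)
              hinj]
            refine Finset.sum_le_sum_of_subset_of_nonneg ?_ fun a _ _ =>
              mul_nonneg (hp'.nonneg _) (hw.nonneg _)
            intro a
            simp only [Finset.mem_image, Finset.mem_sigma, Finset.mem_Ico, Finset.mem_Icc,
              Finset.HasAntidiagonal.mem_antidiagonal]
            rintro ⟨b, ⟨h1, h2⟩, rfl⟩
            exact ⟨⟨by simp only; omega, by simp only; omega⟩, rfl⟩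
      _ = _ := by ring
  by_contra hcon
  push Not at hcon
  have hWlt : W < ∑ y ∈ Finset.Icc x (x + B), 1 / (2 * (2 * ((n' + 1 : ℕ) : ℝ) * B + 1) * (B + 1)) :=
    Finset.sum_lt_sum_of_nonempty (by simp) fun y hy =>
      hcon y (Finset.mem_Icc.1 hy).1 (Finset.mem_Icc.1 hy).2
  rw [Finset.sum_const, Nat.card_Icc, nsmul_eq_mul] at hWlt
  have e2 : ((x + B + 1 - x : ℕ) : ℝ) = B + 1 := by
    rw [show x + B + 1 - x = B + 1 by omega]; push_cast; ring
  rw [e2] at hWlt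
  have hD : (0 : ℝ) < 2 * ((n' + 1 : ℕ) : ℝ) * B + 1 := by positivity
  have e3 : ((B : ℝ) + 1) * (1 / (2 * (2 * ((n' + 1 : ℕ) : ℝ) * B + 1) * (B + 1))) =
      1 / (2 * (2 * ((n' + 1 : ℕ) : ℝ) * B + 1)) := by
    field_simp
  rw [e3, lt_div_iff₀ (by positivity)] at hWlt
  push_cast at hWlt hnτ
  nlinarith

/-! ### Averaging over the length of the arc -/

theorem arcKernel_eq (ε u : ℝ) : arcKernel ε u = 2 * ε * Real.sinc (u * ε) := by
  rw [arcKernel]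
  split_ifs with h
  · simp [h]
  · rcases eq_or_ne ε 0 with h0 | h0
    · simp [h0]
    · rw [Real.sinc_of_ne_zero (mul_ne_zero h h0)]; field_simp

/-- The average of `arcKernel` over lengths `ε + ∑ tᵢ`, where `tᵢ` is uniform on `[-σᵢ, σᵢ]`. -/
def kern (σ : ℕ → ℝ) : ℕ → ℝ → ℝ → ℝ
  | 0, ε, u => arcKernel ε u
  | R + 1, ε, u => Real.sinc (σ R * u) * kern σ R ε u

theorem abs_kern_le (σ : ℕ → ℝ) (R : ℕ) (ε u : ℝ) : |kern σ R ε u| ≤ 2 * |ε| := by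
  induction R with
  | zero =>
    rw [kern, arcKernel_eq, abs_mul, abs_mul, abs_two]
    exact mul_le_of_le_one_right (by positivity) (Real.abs_sinc_le_one _)
  | succ R ih =>
    rw [kern, abs_mul]
    exact (mul_le_of_le_one_left (abs_nonneg _) (Real.abs_sinc_le_one _)).trans ih

theorem continuous_kern (σ : ℕ → ℝ) (R : ℕ) (u : ℝ) : Continuous fun ε => kern σ R ε u := by
  induction R with
  | zero =>
    simp only [kern, arcKernel_eq]
    have := Real.continuous_sinc
    fun_prop
  | succ R ih => simp only [kern]; fun_prop

/-- As a function of the length, the kernel is a sine of frequency u (linear if u = 0); averaging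
over a uniform perturbation of the length multiplies it by a sinc factor. The factors already
collected do not depend on the length. -/
theorem integral_kern (σ : ℕ → ℝ) (R : ℕ) {s : ℝ} (ε u : ℝ) :
    ∫ t in (-s)..s, kern σ R (ε + t) u = 2 * s * (Real.sinc (s * u) * kern σ R ε u) := by
  induction R with
  | zero =>
    simp only [kern, arcKernel]
    split_ifs with h
    · subst h
      simp only [intervalIntegral.integral_const_mul, mul_zero, Real.sinc_zero, one_mul]
      rw [intervalIntegral.integral_add (by simp) (by simp), intervalIntegral.integral_const,
        integral_id]
      simp only [smul_eq_mul]; ring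
    · rcases eq_or_ne s 0 with h0 | h0
      · simp [h0]
      have e : ∀ t : ℝ, 2 * Real.sin (u * (ε + t)) / u = 2 / u * Real.sin (u * ε + u * t) :=
        fun t => by ring_nf
      simp only [e]
      rw [intervalIntegral.integral_const_mul,
        intervalIntegral.integral_comp_add_mul (fun t => Real.sin t) h, integral_sin,
        Real.sinc_of_ne_zero (mul_ne_zero h0 h)]
      rw [mul_neg, ← sub_eq_add_neg, Real.cos_sub, Real.cos_add]
      simp only [smul_eq_mul]
      rw [mul_comm s u]
      field_simp
      ring
  | succ R ih =>
    simp only [kern]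
    rw [intervalIntegral.integral_const_mul, ih]; ring

/-- An upper bound that holds for all lengths in an interval holds for averages. -/
theorem tsum_kern_le {ι : Type*} [Countable ι] {q u : ι → ℝ} (hq : Summable q) {σ : ℕ → ℝ}
    (hσ : ∀ i, 0 < σ i) {a b H : ℝ}
    (h : ∀ ε ∈ Set.Icc a b, ∑' i, q i * arcKernel ε (u i) ≤ H) (R : ℕ) {ε : ℝ}
    (h1 : a + ∑ i ∈ Finset.range R, σ i ≤ ε) (h2 : ε ≤ b - ∑ i ∈ Finset.range R, σ i) :
    ∑' i, q i * kern σ R ε (u i) ≤ H := by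
  induction R generalizing ε with
  | zero => exact h ε ⟨by simpa using h1, by simpa using h2⟩
  | succ R ih =>
    rw [Finset.sum_range_succ] at h1 h2
    have hs := hσ R
    have hsum := intervalIntegral.hasSum_integral_of_dominated_convergence
      (μ := MeasureTheory.volume) (a := -σ R) (b := σ R)
      (F := fun (i : ι) (t : ℝ) => q i * kern σ R (ε + t) (u i))
      (f := fun t => ∑' i, q i * kern σ R (ε + t) (u i))
      (fun i _ => |q i| * (2 * (|ε| + σ R)))
      (fun i => Continuous.aestronglyMeasurable
        (continuous_const.mul ((continuous_kern σ R (u i)).comp (by fun_prop))))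
      (fun i => by
        refine Filter.Eventually.of_forall fun t ht => ?_
        rw [Set.uIoc_of_le (by linarith)] at ht
        rw [norm_mul, Real.norm_eq_abs, Real.norm_eq_abs]
        refine mul_le_mul_of_nonneg_left ((abs_kern_le _ _ _ _).trans ?_) (abs_nonneg _)
        have : |t| ≤ σ R := abs_le.2 ⟨ht.1.le, ht.2⟩
        linarith [abs_add_le ε t])
      (Filter.Eventually.of_forall fun t _ => hq.abs.mul_right _)
      (by simp)
      (by
        refine Filter.Eventually.of_forall fun t _ => Summable.hasSum ?_
        refine Summable.of_norm_bounded (hq.abs.mul_right (2 * |ε + t|)) fun i => ?_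
        rw [norm_mul, Real.norm_eq_abs, Real.norm_eq_abs]
        exact mul_le_mul_of_nonneg_left (abs_kern_le _ _ _ _) (abs_nonneg _))
    simp only [intervalIntegral.integral_const_mul, integral_kern] at hsum
    have e : ∀ i, q i * kern σ (R + 1) ε (u i) =
        (2 * σ R)⁻¹ * (q i * (2 * σ R * (Real.sinc (σ R * u i) * kern σ R ε (u i)))) := by
      intro i; rw [kern]; field_simp
    rw [tsum_congr e, tsum_mul_left, hsum.tsum_eq, inv_mul_le_iff₀ (by positivity)]
    have hint : IntervalIntegrable (fun t => ∑' i, q i * kern σ R (ε + t) (u i))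
        MeasureTheory.volume (-σ R) (σ R) := by
      refine ContinuousOn.intervalIntegrable ?_
      refine continuousOn_tsum (u := fun i => |q i| * (2 * (|ε| + σ R))) (fun i =>
        (continuous_const.mul ((continuous_kern σ R (u i)).comp (by fun_prop))).continuousOn)
        (hq.abs.mul_right _) fun i t ht => ?_
      rw [Set.uIcc_of_le (by linarith)] at ht
      rw [norm_mul, Real.norm_eq_abs, Real.norm_eq_abs]
      refine mul_le_mul_of_nonneg_left ((abs_kern_le _ _ _ _).trans ?_) (abs_nonneg _)
      have : |t| ≤ σ R := abs_le.2 ht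
      linarith [abs_add_le ε t]
    have := intervalIntegral.integral_mono_on (a := -σ R) (b := σ R) (by linarith) hint
      (intervalIntegrable_const (c := H)) fun t ht => ih (ε := ε + t) (by linarith [ht.1])
        (by linarith [ht.2])
    rw [intervalIntegral.integral_const, smul_eq_mul] at this
    linarith

/-- The factor with index i is at most U(i + 1)/(6|u|), hence at most 1/2 as long as i + 1 ≤ 3|u|/U.
The widths 6/(U(i + 1)) are chosen so that their sum grows only like log R / U while the kernel
decays exponentially up to distances of order UR. -/
theorem abs_kern_decay {U : ℝ} (hU : 0 < U) {k R : ℕ} (hk : k ≤ R) {ε u : ℝ} (hu : 0 < |u|)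
    (h : k ≤ 3 * |u| / U) :
    |kern (fun i => 6 / (U * (i + 1))) R ε u| ≤ 2 * |ε| * (1 / 2) ^ k := by
  induction R generalizing k with
  | zero =>
    obtain rfl : k = 0 := by omega
    simpa using abs_kern_le _ 0 ε u
  | succ R ih =>
    rw [kern, abs_mul]
    by_cases hkR : k ≤ R
    · exact (mul_le_of_le_one_left (abs_nonneg _) (Real.abs_sinc_le_one _)).trans (ih hkR h)
    · obtain rfl : k = R + 1 := by omega
      have h1 := ih (k := R) le_rfl (le_trans (by push_cast; linarith) h)
      have h2 : |Real.sinc (6 / (U * (R + 1)) * u)| ≤ 1 / 2 := by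
        have hne : 6 / (U * ((R : ℝ) + 1)) * u ≠ 0 :=
          mul_ne_zero (by positivity) (abs_pos.1 hu)
        rw [Real.sinc_of_ne_zero hne, abs_div, div_le_iff₀ (abs_pos.2 hne), abs_mul,
          abs_of_pos (by positivity : 0 < 6 / (U * ((R : ℝ) + 1)))]
        refine (Real.abs_sin_le_one _).trans ?_
        rw [le_div_iff₀ hU] at h
        push_cast at h
        have : 6 / (U * ((R : ℝ) + 1)) * |u| = 6 * |u| / (U * (R + 1)) := by ring
        rw [this, ← mul_div_assoc, le_div_iff₀ (by positivity)]
        linarith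
      rw [pow_succ]
      calc _ ≤ 1 / 2 * (2 * |ε| * (1 / 2) ^ R) := by gcongr
        _ = _ := by ring

end NatLaw

end

noncomputable section

namespace NatLaw

variable {w : ℕ → ℝ}

/-! ### Symmetric sums and the Fejér kernel -/

/-- The sum over `|j| ≤ k`. -/
def box (f : ℤ → ℝ) (k : ℕ) : ℝ := ∑ j ∈ Finset.Icc (-(k : ℤ)) k, f j

theorem box_zero (f : ℤ → ℝ) : box f 0 = f 0 := by simp [box]

theorem box_succ (f : ℤ → ℝ) (k : ℕ) :
    box f (k + 1) = box f k + (f (k + 1) + f (-(k + 1))) := by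
  have e : Finset.Icc (-((k + 1 : ℕ) : ℤ)) ((k + 1 : ℕ) : ℤ) =
      insert ((k : ℤ) + 1) (insert (-((k : ℤ) + 1)) (Finset.Icc (-(k : ℤ)) k)) := by
    ext j; simp only [Finset.mem_Icc, Finset.mem_insert]; push_cast; omega
  rw [box, e, Finset.sum_insert, Finset.sum_insert, box]
  · ring
  · simp
  · simp only [Finset.mem_insert, Finset.mem_Icc]; omega

theorem box_eq (f : ℤ → ℝ) (k : ℕ) :
    box f k = f 0 + ∑ i ∈ Finset.range k, (f (i + 1) + f (-(i + 1))) := by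
  induction k with
  | zero => simp [box_zero]
  | succ k ih => rw [box_succ, ih, Finset.sum_range_succ]; ring

/-- Both sides give f d the Fejér weight J - |d|. -/
theorem sum_sub_eq_sum_box (f : ℤ → ℝ) (J : ℕ) :
    ∑ i ∈ Finset.range J, ∑ i' ∈ Finset.range J, f ((i : ℤ) - i') =
      ∑ k ∈ Finset.range J, box f k := by
  induction J with
  | zero => simp
  | succ J ih =>
    rw [Finset.sum_range_succ (fun i => ∑ i' ∈ Finset.range (J + 1), f ((i : ℤ) - i')) J,
      Finset.sum_range_succ (box f) J, ← ih]
    simp only [Finset.sum_range_succ _ J, Finset.sum_add_distrib]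
    have h1 : ∑ i ∈ Finset.range J, f ((i : ℤ) - J) = ∑ i ∈ Finset.range J, f (-((i : ℤ) + 1)) := by
      rw [← Finset.sum_range_reflect]
      refine Finset.sum_congr rfl fun i hi => ?_
      have := Finset.mem_range.1 hi
      congr 1; omega
    have h2 : ∑ i ∈ Finset.range J, f ((J : ℤ) - i) = ∑ i ∈ Finset.range J, f ((i : ℤ) + 1) := by
      rw [← Finset.sum_range_reflect]
      refine Finset.sum_congr rfl fun i hi => ?_
      have := Finset.mem_range.1 hi
      congr 1; omega
    rw [h1, h2, box_eq, Finset.sum_add_distrib]; simp; ring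

/-- The sum over pairs is the integral over the arc of cos(cθ)|S(θ)|² with S(θ) the sum of exp(i j
u₀ θ) over j < J. On the arc cos(cθ) ≥ 1/2, so the integrand is nonnegative, and for |θ| ≤ 1/(J u₀)
it is at least J²/8 because |S| ≥ J/2. This short arc alone gives the bound. -/
theorem fejer_arc_ge {J u₀ c : ℕ} (hJ : 0 < J) (hu : 0 < u₀) (hc : c < u₀) {ε : ℝ}
    (h1 : 1 / ((J : ℝ) * u₀) ≤ ε) (h2 : ε * u₀ ≤ 1) :
    1 / (4 * (u₀ : ℝ)) ≤ (1 / (J : ℝ)) * ∑ q : Fin J × Fin J,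
      arcKernel ε ((c : ℝ) + (((q.1 : ℕ) : ℝ) - (q.2 : ℕ)) * u₀) := by
  have hJ0 : (0 : ℝ) < J := by exact_mod_cast hJ
  have hu0 : (0 : ℝ) < u₀ := by exact_mod_cast hu
  have hε : 0 < ε := lt_of_lt_of_le (by positivity) h1
  set S : ℝ → ℂ := fun θ => ∑ i : Fin J, expI (((i : ℕ) : ℝ) * u₀ * θ) with hS
  have hSc : Continuous S := by simp only [hS]; fun_prop
  have e1 : ∀ θ, Real.cos (c * θ) * ‖S θ‖ ^ 2 = ∑ q : Fin J × Fin J,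
      (expI (((c : ℝ) + (((q.1 : ℕ) : ℝ) - (q.2 : ℕ)) * u₀) * θ)).re := by
    intro θ
    have : expI (c * θ) * (S θ * (starRingEnd ℂ) (S θ)) = ∑ q : Fin J × Fin J,
        expI (((c : ℝ) + (((q.1 : ℕ) : ℝ) - (q.2 : ℕ)) * u₀) * θ) := by
      simp only [hS]
      rw [map_sum, Finset.sum_mul_sum, ← Finset.sum_product', Finset.mul_sum]
      refine Finset.sum_congr rfl fun q _ => ?_
      rw [← expI_neg', ← expI_add, ← expI_add]; ring_nf
    rw [← Complex.re_sum, ← this, Complex.mul_conj, Complex.normSq_eq_norm_sq,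
      Complex.re_mul_ofReal, expI_re]
  have e2 : ∫ θ in (-ε)..ε, Real.cos (c * θ) * ‖S θ‖ ^ 2 = ∑ q : Fin J × Fin J,
      arcKernel ε ((c : ℝ) + (((q.1 : ℕ) : ℝ) - (q.2 : ℕ)) * u₀) := by
    simp only [e1]
    rw [intervalIntegral.integral_finsetSum]
    · refine Finset.sum_congr rfl fun q _ => ?_
      have h3 := integral_expI' ((c : ℝ) + (((q.1 : ℕ) : ℝ) - (q.2 : ℕ)) * u₀) ε
      have hci : Continuous fun θ : ℝ => expI (((c : ℝ) + (((q.1 : ℕ) : ℝ) - (q.2 : ℕ)) * u₀) * θ) := by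
        fun_prop
      have h4 := Complex.reCLM.intervalIntegral_comp_comm (hci.intervalIntegrable
        (μ := MeasureTheory.volume) (-ε) ε)
      rw [h3] at h4
      simpa using h4
    · intro q _
      refine Continuous.intervalIntegrable ?_ _ _
      exact Complex.continuous_re.comp (by fun_prop)
  set h : ℝ := 1 / ((J : ℝ) * u₀) with hh
  have hh0 : 0 < h := by positivity
  have hcos : ∀ t : ℝ, |t| ≤ 1 → 1 / 2 ≤ Real.cos t := fun t ht => by
    rw [← Real.cos_pi_div_three, ← Real.cos_abs t]
    have := Real.pi_gt_three
    exact Real.cos_le_cos_of_nonneg_of_le_pi (abs_nonneg _) (by linarith) (by linarith)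
  have hcθ : ∀ θ ∈ Set.Icc (-ε) ε, 1 / 2 ≤ Real.cos (c * θ) := fun θ hθ => by
    refine hcos _ ?_
    rw [abs_mul, Nat.abs_cast]
    have h5 : |θ| ≤ ε := abs_le.2 hθ
    have h6 : (c : ℝ) ≤ u₀ := by exact_mod_cast hc.le
    calc (c : ℝ) * |θ| ≤ u₀ * ε := by gcongr
      _ ≤ 1 := by linarith
  have hint : Continuous fun θ : ℝ => Real.cos (c * θ) * ‖S θ‖ ^ 2 := by fun_prop
  have h7 : (J : ℝ) ^ 2 / 8 * (2 * h) ≤ ∫ θ in (-h)..h, Real.cos (c * θ) * ‖S θ‖ ^ 2 := by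
    have := intervalIntegral.integral_mono_on (a := -h) (b := h) (μ := MeasureTheory.volume)
      (f := fun _ => (J : ℝ) ^ 2 / 8)
      (by linarith) intervalIntegrable_const (hint.intervalIntegrable _ _) fun θ hθ => ?_
    · rw [intervalIntegral.integral_const, smul_eq_mul] at this
      linarith
    · have h8 := hcθ θ ⟨by linarith [hθ.1], by linarith [hθ.2]⟩
      have h9 : (J : ℝ) / 2 ≤ ‖S θ‖ := by
        refine le_trans ?_ (Complex.re_le_norm _)
        simp only [hS, Complex.re_sum, expI_re]
        have : ∀ i : Fin J, i ∈ Finset.univ → (1 / 2 : ℝ) ≤ Real.cos (((i : ℕ) : ℝ) * u₀ * θ) := by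
          intro i _
          refine hcos _ ?_
          rw [abs_mul, abs_of_nonneg (by positivity : (0 : ℝ) ≤ ((i : ℕ) : ℝ) * u₀)]
          have h10 : |θ| ≤ h := abs_le.2 hθ
          have h11 : ((i : ℕ) : ℝ) ≤ J := by exact_mod_cast i.2.le
          calc ((i : ℕ) : ℝ) * u₀ * |θ| ≤ J * u₀ * h := by gcongr
            _ = 1 := by rw [hh]; field_simp
        refine le_trans (le_of_eq ?_) (Finset.sum_le_sum this)
        simp; ring
      calc (J : ℝ) ^ 2 / 8 = 1 / 2 * (J / 2) ^ 2 := by ring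
        _ ≤ _ := by gcongr
  have h12 : ∫ θ in (-h)..h, Real.cos (c * θ) * ‖S θ‖ ^ 2 ≤
      ∫ θ in (-ε)..ε, Real.cos (c * θ) * ‖S θ‖ ^ 2 := by
    refine intervalIntegral.integral_mono_interval (by linarith) (by linarith) h1 ?_
      (hint.intervalIntegrable _ _)
    rw [Filter.EventuallyLE, MeasureTheory.ae_restrict_iff' measurableSet_Ioc]
    refine Filter.Eventually.of_forall fun θ hθ => ?_
    have := hcθ θ ⟨hθ.1.le, hθ.2⟩
    simp only [Pi.zero_apply]
    positivity
  rw [← e2]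
  calc 1 / (4 * (u₀ : ℝ)) = 1 / J * (J ^ 2 / 8 * (2 * h)) := by rw [hh]; field_simp; norm_num
    _ ≤ _ := by gcongr; linarith

theorem exp_neg_two_mul_le {δ : ℝ} (h0 : 0 ≤ δ) (h : δ ≤ 1 / 2) : Real.exp (-(2 * δ)) ≤ 1 - δ := by
  rw [Real.exp_neg, inv_le_comm₀ (Real.exp_pos _) (by linarith)]
  have h1 := Real.add_one_le_exp (2 * δ)
  refine le_trans ?_ h1
  rw [inv_le_iff_one_le_mul₀ (by linarith)]
  nlinarith

/-- A slowly varying positive function, integrated against a rapidly decaying kernel. -/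
theorem slowly_varying_ge {g K : ℤ → ℝ} {δ U C₀ κ : ℝ} {J N : ℕ} (hg : ∀ j, 0 ≤ g j) (hJ : 0 < J)
    (hJN : J ≤ N) (hδ0 : 0 ≤ δ) (hδ : δ ≤ 1 / (2 * J)) (hU : 1 ≤ U) (hJU : 2 * U ≤ J)
    (hup : ∀ j, (1 - δ) * g j ≤ g (j + 1)) (hdown : ∀ j, (1 - δ) * g j ≤ g (j - 1)) (hC : 0 ≤ C₀)
    (hK : ∀ t : ℕ, t < N → |K (t + 1)| ≤ C₀ * Real.exp (-(2 * (t + 1) / U)) ∧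
      |K (-(t + 1))| ≤ C₀ * Real.exp (-(2 * (t + 1) / U)))
    (hκ : κ ≤ (1 / (J : ℝ)) * ∑ k ∈ Finset.range J, box K k) :
    g 0 * (κ - 8 * C₀ * U ^ 2 / J) ≤ box (fun j => g j * K j) N := by
  have hJ0 : (0 : ℝ) < J := by exact_mod_cast hJ
  have hJ1 : (1 : ℝ) ≤ J := by exact_mod_cast hJ
  have hU0 : 0 < U := by linarith
  have hδ2 : δ ≤ 1 / 2 := hδ.trans (by
    rw [div_le_div_iff₀ (by positivity) (by positivity)]; linarith)
  -- As δ ≤ 1/(2J), one step changes g by a factor of at most exp(1/J).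
  have hpow : ∀ t : ℕ, Real.exp (-(t / J)) ≤ (1 - δ) ^ t := fun t => by
    calc Real.exp (-(t / J)) ≤ Real.exp (-(2 * δ)) ^ t := by
          rw [← Real.exp_nat_mul]
          refine Real.exp_le_exp.2 ?_
          rw [mul_neg, neg_le_neg_iff, div_eq_mul_one_div]
          refine mul_le_mul_of_nonneg_left ?_ t.cast_nonneg
          calc 2 * δ ≤ 2 * (1 / (2 * J)) := by gcongr
            _ = 1 / J := by field_simp
      _ ≤ _ := pow_le_pow_left₀ (Real.exp_pos _).le (exp_neg_two_mul_le hδ0 hδ2) t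
  have h1δ : 0 ≤ 1 - δ := by linarith
  have hit : ∀ (s : ℤ), (∀ j, (1 - δ) * g j ≤ g (j + s)) → ∀ (t : ℕ) j,
      (1 - δ) ^ t * g j ≤ g (j + t * s) := by
    intro s hs t
    induction t with
    | zero => intro j; simp
    | succ t ih =>
      intro j
      have h1 := hs (j + t * s)
      have h2 := mul_le_mul_of_nonneg_left (ih j) h1δ
      have e : j + ((t + 1 : ℕ) : ℤ) * s = j + t * s + s := by push_cast; ring
      rw [e, pow_succ]; linarith
  have hlow : ∀ (t : ℕ) (j j' : ℤ), (j' = j + t ∨ j' = j - t) →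
      Real.exp (-(t / J)) * g j ≤ g j' := by
    intro t j j' h
    refine (mul_le_mul_of_nonneg_right (hpow t) (hg j)).trans ?_
    rcases h with rfl | rfl
    · simpa using hit 1 hup t j
    · simpa [sub_eq_add_neg] using hit (-1) (by simpa [sub_eq_add_neg] using hdown) t j
  have hhigh : ∀ (t : ℕ) (j : ℤ), (j = t ∨ j = -t) → g j ≤ g 0 * Real.exp (t / J) := by
    intro t j h
    have := hlow t j 0 (by omega)
    rw [Real.exp_neg, inv_mul_le_iff₀ (Real.exp_pos _)] at this
    linarith
  have hdiff : ∀ (t : ℕ) (j : ℤ), (j = t ∨ j = -t) →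
      |g j - g 0| ≤ g 0 * (t / J * Real.exp (t / J)) := by
    intro t j h
    have h1 := hhigh t j h
    have h2 := hlow t 0 j (by omega)
    have h3 := Real.add_one_le_exp (-((t : ℝ) / J))
    have h4 : Real.exp ((t : ℝ) / J) * Real.exp (-((t : ℝ) / J)) = 1 := by
      rw [← Real.exp_add]; simp
    have h5 : 0 ≤ (t : ℝ) / J := by positivity
    have h6 : 1 ≤ Real.exp ((t : ℝ) / J) := Real.one_le_exp h5
    have h7 := hg 0
    have h8 : Real.exp ((t : ℝ) / J) - 1 ≤ t / J * Real.exp (t / J) := by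
      nlinarith [Real.exp_pos ((t : ℝ) / J)]
    have h9 : (t : ℝ) / J ≤ t / J * Real.exp (t / J) := le_mul_of_one_le_right h5 h6
    rw [abs_le]
    constructor
    · nlinarith
    · nlinarith
  set a : ℕ → ℝ := fun i => (g (i + 1) - g 0) * K (i + 1) + (g (-(i + 1)) - g 0) * K (-(i + 1))
  set b : ℕ → ℝ := fun i => g 0 * (K (i + 1) + K (-(i + 1))) with hb
  set E : ℕ → ℝ := fun i => 4 * C₀ * g 0 * (U / J) * Real.exp (-((i + 1) / (2 * U))) with hE
  -- the total error attached to `±(i + 1)`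
  have hterm : ∀ i < N, |a i| + (i + 1) / J * |b i| ≤ E i := by
    intro i hi
    obtain ⟨hK1, hK2⟩ := hK i hi
    have hg0 := hg 0
    set t : ℝ := (i : ℝ) + 1 with ht
    have ht0 : 0 < t := by positivity
    have d1 := hdiff (i + 1) ((i : ℤ) + 1) (by left; push_cast; ring)
    have d2 := hdiff (i + 1) (-((i : ℤ) + 1)) (by right; push_cast; ring)
    push_cast at d1 d2
    rw [← ht] at d1 d2
    set k := C₀ * Real.exp (-(2 * t / U)) with hk
    have hk0 : 0 ≤ k := by positivity
    have ha : |a i| ≤ 2 * (g 0 * (t / J * Real.exp (t / J)) * k) := by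
      refine (abs_add_le _ _).trans ?_
      rw [abs_mul, abs_mul]
      have m1 : |g (i + 1) - g 0| * |K (i + 1)| ≤ g 0 * (t / J * Real.exp (t / J)) * k := by
        gcongr
      have m2 : |g (-(i + 1)) - g 0| * |K (-(i + 1))| ≤ g 0 * (t / J * Real.exp (t / J)) * k := by
        gcongr
      linarith
    have hbi : |b i| ≤ g 0 * (2 * k) := by
      rw [hb, abs_mul, abs_of_nonneg hg0]
      refine mul_le_mul_of_nonneg_left ((abs_add_le _ _).trans ?_) hg0
      linarith
    have hexp1 : 1 ≤ Real.exp (t / J) := Real.one_le_exp (by positivity)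
    have h3 : t / J * |b i| ≤ 2 * (g 0 * (t / J * Real.exp (t / J)) * k) := by
      calc t / J * |b i| ≤ t / J * (g 0 * (2 * k)) := by gcongr
        _ = 2 * (g 0 * (t / J * 1) * k) := by ring
        _ ≤ _ := by gcongr
    -- The decay exp(-2t/U) of the kernel pays for the factor t, at the price exp(t/U), and for the
    -- growth exp(t/J) ≤ exp(t/(2U)) of g; exp(-t/(2U)) remains and is summable with total at most
    -- 2U.
    have h4 : t ≤ U * Real.exp (t / U) := by
      have := Real.add_one_le_exp (t / U)
      have h5 : t / U ≤ Real.exp (t / U) := by linarith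
      rwa [div_le_iff₀ hU0, mul_comm] at h5
    have h6 : Real.exp (t / J) ≤ Real.exp (t / (2 * U)) := by
      refine Real.exp_le_exp.2 ?_
      gcongr
    have h7 : Real.exp (t / U) * Real.exp (t / (2 * U)) * Real.exp (-(2 * t / U)) =
        Real.exp (-(t / (2 * U))) := by
      rw [← Real.exp_add, ← Real.exp_add]; congr 1; field_simp; norm_num
    calc |a i| + t / J * |b i| ≤ 4 * (g 0 * (t / J * Real.exp (t / J)) * k) := by linarith
      _ ≤ 4 * (g 0 * (U * Real.exp (t / U) / J * Real.exp (t / (2 * U))) * k) := by gcongr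
      _ = 4 * C₀ * g 0 * (U / J) *
          (Real.exp (t / U) * Real.exp (t / (2 * U)) * Real.exp (-(2 * t / U))) := by rw [hk]; ring
      _ = E i := by rw [h7, hE]
  have hEsum : ∑ i ∈ Finset.range N, E i ≤ 8 * C₀ * U ^ 2 / J * g 0 := by
    simp only [hE]
    rw [← Finset.mul_sum]
    set ρ := Real.exp (-(1 / (2 * U))) with hρ
    have hρ0 : 0 < ρ := Real.exp_pos _
    have e1 : ∀ i : ℕ, Real.exp (-(((i : ℝ) + 1) / (2 * U))) = ρ ^ (i + 1) := fun i => by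
      rw [hρ, ← Real.exp_nat_mul]; congr 1; push_cast; ring
    simp only [e1]
    have h8 : ∑ i ∈ Finset.range N, ρ ^ (i + 1) ≤ 2 * U := by
      have h9 := mul_neg_geom_sum ρ N
      have h10 : ∑ i ∈ Finset.range N, ρ ^ (i + 1) = ρ * ∑ i ∈ Finset.range N, ρ ^ i := by
        rw [Finset.mul_sum]; exact Finset.sum_congr rfl fun i _ => pow_succ' ρ i
      have h11 : ρ * (1 + 1 / (2 * U)) ≤ 1 := by
        have h12 := Real.add_one_le_exp (1 / (2 * U))
        have h13 : ρ * Real.exp (1 / (2 * U)) = 1 := by rw [hρ, ← Real.exp_add]; simp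
        nlinarith
      have h14 : 0 ≤ ∑ i ∈ Finset.range N, ρ ^ i := by positivity
      have h15 : 0 ≤ ρ ^ N := by positivity
      rw [h10]
      have h16 : ρ * (1 / (2 * U)) ≤ 1 - ρ := by linarith
      have h17 : ρ * (1 / (2 * U)) * ∑ i ∈ Finset.range N, ρ ^ i ≤ 1 :=
        (mul_le_mul_of_nonneg_right h16 h14).trans (by rw [h9]; linarith)
      calc ρ * ∑ i ∈ Finset.range N, ρ ^ i
          = 2 * U * (ρ * (1 / (2 * U)) * ∑ i ∈ Finset.range N, ρ ^ i) := by field_simp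
        _ ≤ 2 * U * 1 := by gcongr
        _ = _ := mul_one _
    calc 4 * C₀ * g 0 * (U / J) * ∑ i ∈ Finset.range N, ρ ^ (i + 1)
        ≤ 4 * C₀ * g 0 * (U / J) * (2 * U) := by
          have := hg 0
          gcongr
      _ = _ := by ring
  -- comparison with the average of the boxes
  have hbox : ∀ k < J, box (fun j => g j * K j) N - g 0 * box K k =
      ∑ i ∈ Finset.range N, (a i + if k ≤ i then b i else 0) := by
    intro k hk
    rw [box_eq, box_eq, Finset.sum_add_distrib (f := a) (g := fun i => if k ≤ i then b i else 0),
      ← Finset.sum_filter]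
    have e2 : ∑ i ∈ Finset.range N, b i =
        ∑ i ∈ Finset.range k, b i + ∑ i ∈ (Finset.range N).filter (k ≤ ·), b i := by
      rw [← Finset.sum_union]
      · refine Finset.sum_congr ?_ fun _ _ => rfl
        ext i; simp only [Finset.mem_union, Finset.mem_filter, Finset.mem_range]; omega
      · rw [Finset.disjoint_left]; intro i
        simp only [Finset.mem_filter, Finset.mem_range]; omega
    have e3 : ∑ i ∈ Finset.range N, ((fun j => g j * K j) (i + 1) + (fun j => g j * K j) (-(i + 1))) =
        ∑ i ∈ Finset.range N, a i + ∑ i ∈ Finset.range N, b i := by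
      rw [← Finset.sum_add_distrib]
      refine Finset.sum_congr rfl fun i _ => ?_
      simp only [a, b]; ring
    have e4 : ∑ i ∈ Finset.range k, b i =
        g 0 * ∑ i ∈ Finset.range k, (K (i + 1) + K (-(i + 1))) := by
      rw [Finset.mul_sum]
    rw [e3, e2, e4]; ring
  have hfinal : (1 / (J : ℝ)) * ∑ k ∈ Finset.range J, (box (fun j => g j * K j) N - g 0 * box K k) ≥
      -(8 * C₀ * U ^ 2 / J * g 0) := by
    rw [Finset.sum_congr rfl fun k hk => hbox k (Finset.mem_range.1 hk), Finset.sum_comm,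
      Finset.mul_sum]
    have h18 : ∀ i ∈ Finset.range N, -E i ≤
        1 / (J : ℝ) * ∑ k ∈ Finset.range J, (a i + if k ≤ i then b i else 0) := by
      intro i hi
      rw [Finset.sum_add_distrib, Finset.sum_const, Finset.card_range, nsmul_eq_mul,
        ← Finset.sum_filter, Finset.sum_const, nsmul_eq_mul]
      have hcard : ((((Finset.range J).filter (· ≤ i)).card : ℕ) : ℝ) ≤ i + 1 := by
        have : ((Finset.range J).filter (· ≤ i)).card ≤ (Finset.range (i + 1)).card := by
          refine Finset.card_le_card fun k => ?_
          simp only [Finset.mem_filter, Finset.mem_range]; omega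
        rw [Finset.card_range] at this
        exact_mod_cast this
      have h19 := hterm i (Finset.mem_range.1 hi)
      -- The term b i is left out by only those boxes with k ≤ i, that is by a proportion of at most
      -- (i + 1)/J of them.
      have h20 : |1 / (J : ℝ) * (J * a i + (((Finset.range J).filter (· ≤ i)).card : ℝ) * b i)| ≤
          E i := by
        have e5 : 1 / (J : ℝ) * (J * a i + (((Finset.range J).filter (· ≤ i)).card : ℝ) * b i) =
            a i + (((Finset.range J).filter (· ≤ i)).card : ℝ) / J * b i := by field_simp
        rw [e5]
        refine (abs_add_le _ _).trans (le_trans ?_ h19)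
        rw [abs_mul, abs_of_nonneg (by positivity :
          (0 : ℝ) ≤ (((Finset.range J).filter (· ≤ i)).card : ℝ) / J)]
        gcongr
      exact (abs_le.1 h20).1
    have h21 := Finset.sum_le_sum h18
    rw [Finset.sum_neg_distrib] at h21
    linarith
  rw [Finset.sum_sub_distrib, Finset.sum_const, Finset.card_range, nsmul_eq_mul,
    ← Finset.mul_sum, mul_sub] at hfinal
  have e6 : 1 / (J : ℝ) * (J * box (fun j => g j * K j) N) = box (fun j => g j * K j) N := by
    field_simp
  rw [e6] at hfinal
  have h22 := mul_le_mul_of_nonneg_left hκ (hg 0)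
  linarith

end NatLaw

end

/-! ### Arc integrals of slowly varying laws -/

noncomputable section

namespace NatLaw

/-- The extension by zero to the integers. -/
def extZ (p : ℕ → ℝ) (z : ℤ) : ℝ := if 0 ≤ z then p z.toNat else 0

theorem extZ_natCast (p : ℕ → ℝ) (y : ℕ) : extZ p y = p y := by simp [extZ]

/-- Slow variation is known only where p is at least thr. Raising the law to thr everywhere else
makes it hold at all integers, as `slowly_varying_ge` requires. -/
theorem max_extZ_shift {p : ℕ → ℝ} {thr δ : ℝ} {u : ℕ} (h0 : 0 < thr) (hδ0 : 0 ≤ δ)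
    (hsm : ∀ y, thr ≤ p y → (1 - δ) * p y ≤ p (y + u) ∧
      (1 - δ) * p y ≤ if u ≤ y then p (y - u) else 0) (z : ℤ) :
    (1 - δ) * max thr (extZ p z) ≤ max thr (extZ p (z + u)) ∧
    (1 - δ) * max thr (extZ p z) ≤ max thr (extZ p (z - u)) := by
  by_cases hz : thr ≤ extZ p z
  · have hz0 : 0 ≤ z := by
      by_contra hneg
      rw [extZ, if_neg hneg] at hz; linarith
    lift z to ℕ using hz0
    rw [extZ_natCast] at hz ⊢
    obtain ⟨h1, h2⟩ := hsm z hz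
    rw [max_eq_right hz]
    constructor
    · have e : ((z : ℤ) + u) = ((z + u : ℕ) : ℤ) := by push_cast; ring
      rw [e, extZ_natCast]; exact h1.trans (le_max_right _ _)
    · refine h2.trans (le_trans (le_of_eq ?_) (le_max_right _ _))
      split_ifs with hu
      · have e : ((z : ℤ) - u) = ((z - u : ℕ) : ℤ) := by omega
        rw [e, extZ_natCast]
      · rw [extZ, if_neg (by omega)]
  · rw [not_le] at hz
    rw [max_eq_left hz.le]
    have : (1 - δ) * thr ≤ thr := by nlinarith
    exact ⟨this.trans (le_max_left _ _), this.trans (le_max_left _ _)⟩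

theorem half_pow_le {k : ℕ} {s : ℝ} (h : s < k + 1) :
    (1 / 2 : ℝ) ^ k ≤ 2 * Real.exp (-(2 / 3 * s)) := by
  have e : (1 / 2 : ℝ) ^ k = 2 * (1 / 2) ^ (k + 1) := by rw [pow_succ]; ring
  rw [e]
  refine mul_le_mul_of_nonneg_left ?_ (by norm_num)
  have h1 : (1 / 2 : ℝ) ≤ Real.exp (-(2 / 3)) := by
    rw [Real.exp_neg, one_div]
    refine inv_anti₀ (Real.exp_pos _) ?_
    have h2 := Real.log_two_gt_d9
    calc Real.exp (2 / 3) ≤ Real.exp (Real.log 2) := Real.exp_le_exp.2 (by linarith)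
      _ = 2 := Real.exp_log (by norm_num)
  have h3 : (1 / 2 : ℝ) ^ (k + 1) ≤ Real.exp (-(2 / 3)) ^ (k + 1) := by gcongr
  refine h3.trans ?_
  rw [← Real.exp_nat_mul]
  refine Real.exp_le_exp.2 ?_
  push_cast; linarith

/-- Each y at distance less than N u₀ from x is x + c + j u₀ for a unique residue c < u₀ and some
|j| ≤ N. All other y meet a kernel of size at most ζ. -/
theorem window_sum {p : ℕ → ℝ} (hp : IsLaw p) (x u₀ N : ℕ) (hu : 0 < u₀) {K : ℝ → ℝ} {ζ : ℝ}
    (hζ : ∀ v : ℝ, N * u₀ ≤ |v| → |K v| ≤ ζ)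
    (hs : Summable fun y : ℕ => p y * K (y - x)) (hζ0 : 0 ≤ ζ) :
    ∑ c ∈ Finset.range u₀, box (fun j => extZ p (x + c + j * u₀) * K ((c : ℝ) + j * u₀)) N ≤
      ∑' y : ℕ, p y * K (y - x) + ζ := by
  classical
  set Λ := (Finset.range u₀ ×ˢ Finset.Icc (-(N : ℤ)) N).filter
    (fun a => 0 ≤ (x : ℤ) + a.1 + a.2 * u₀) with hΛ
  set pos : ℕ × ℤ → ℕ := fun a => ((x : ℤ) + a.1 + a.2 * u₀).toNat with hpos
  have hu' : (0 : ℤ) < u₀ := by exact_mod_cast hu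
  have hinj : Set.InjOn pos (Λ : Set (ℕ × ℤ)) := by
    rintro ⟨c, j⟩ h1 ⟨c', j'⟩ h2 h
    simp only [hΛ, Finset.coe_filter, Finset.mem_product, Finset.mem_range, Set.mem_ofPred_eq]
      at h1 h2
    simp only [hpos] at h
    have h3 : (c : ℤ) + j * u₀ = c' + j' * u₀ := by omega
    have h4 : ∀ (c : ℕ) (j : ℤ), c < u₀ → ((c : ℤ) + j * u₀) / u₀ = j := fun c j hc => by
      rw [Int.add_mul_ediv_right _ _ hu'.ne', Int.ediv_eq_zero_of_lt (by positivity)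
        (by exact_mod_cast hc), zero_add]
    have h5 : j = j' := by rw [← h4 c j h1.1.1, h3, h4 c' j' h2.1.1]
    subst h5
    have : c = c' := by omega
    rw [this]
  have hval : ∀ a ∈ Λ, (pos a : ℤ) = (x : ℤ) + a.1 + a.2 * u₀ := fun a ha => by
    simp only [hpos]
    exact Int.toNat_of_nonneg (Finset.mem_filter.1 ha).2
  have hfar : ∀ y : ℕ, y ∉ Λ.image pos → (N : ℝ) * u₀ ≤ |(y : ℝ) - x| := by
    intro y hy
    by_contra hlt
    rw [not_le] at hlt
    apply hy
    have hlt' : |(y : ℤ) - x| < N * u₀ := by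
      have : ((|(y : ℤ) - x| : ℤ) : ℝ) < ((N * u₀ : ℤ) : ℝ) := by push_cast; exact hlt
      exact_mod_cast this
    rw [abs_lt] at hlt'
    have hm := Int.emod_nonneg ((y : ℤ) - x) hu'.ne'
    have hm2 := Int.emod_lt_of_pos ((y : ℤ) - x) hu'
    have hd := Int.emod_add_mul_ediv ((y : ℤ) - x) u₀
    set c := ((y : ℤ) - x) % u₀
    set j := ((y : ℤ) - x) / u₀
    have hj1 : -(N : ℤ) ≤ j := by nlinarith
    have hj2 : j ≤ N := by nlinarith
    rw [mul_comm] at hd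
    refine Finset.mem_image.2 ⟨(c.toNat, j), ?_, ?_⟩
    · simp only [hΛ, Finset.mem_filter, Finset.mem_product, Finset.mem_range, Finset.mem_Icc]
      refine ⟨⟨by omega, hj1, hj2⟩, ?_⟩
      rw [Int.toNat_of_nonneg hm]; omega
    · simp only [hpos]
      rw [Int.toNat_of_nonneg hm]; omega
  have h6 : ∑ c ∈ Finset.range u₀, box (fun j => extZ p (x + c + j * u₀) * K ((c : ℝ) + j * u₀)) N =
      ∑ y ∈ Λ.image pos, p y * K (y - x) := by
    rw [Finset.sum_image hinj]
    simp only [box]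
    rw [← Finset.sum_product', hΛ, Finset.sum_filter]
    refine Finset.sum_congr rfl fun a ha => ?_
    split_ifs with h0
    · have := hval a (Finset.mem_filter.2 ⟨ha, h0⟩)
      rw [extZ, if_pos h0]
      have e : ((pos a : ℕ) : ℝ) = x + a.1 + a.2 * u₀ := by exact_mod_cast this
      rw [e]
      simp only [hpos]
      congr 2; ring
    · rw [extZ, if_neg h0, zero_mul]
  rw [h6]
  have h7 := hasSum_sum_of_ne_finset_zero (L := SummationFilter.unconditional ℕ) (s := Λ.image pos)
    (f := fun y : ℕ => if y ∈ Λ.image pos then p y * K (y - x) else 0) (fun y hy => if_neg hy)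
  rw [Finset.sum_congr rfl fun y hy => if_pos hy] at h7
  have h8 := hasSum_le (fun y => ?_) h7 (hs.hasSum.add (hp.hasSum.mul_left ζ))
  · rwa [mul_one] at h8
  · have hp0 := hp.nonneg y
    split_ifs with hy
    · have := mul_nonneg hζ0 hp0; linarith
    · have h9 := abs_le.1 (hζ _ (hfar y hy))
      nlinarith [h9.1]

/-- Rewrites halvings as exponential decay. The constant is 2 · 2 · 8: a factor 2 from the kernel, 2
from rounding down the number of halvings, and 8 ≥ exp 2 from replacing t by t + 1. -/
theorem abs_kern_le_exp {U ε v : ℝ} {R t : ℕ} (hU : 1 ≤ U) (hε0 : 0 < ε) (hε1 : ε ≤ 1)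
    (h1 : (t : ℝ) ≤ |v|) (h3 : 0 < |v|) (hR : 3 * |v| / U ≤ R) :
    |kern (fun i => 6 / (U * ((i : ℝ) + 1))) R ε v| ≤ 32 * Real.exp (-(2 * (t + 1) / U)) := by
  have hU0 : 0 < U := by linarith
  set q := ⌊3 * |v| / U⌋₊ with hq
  have hq1 : (q : ℝ) ≤ 3 * |v| / U := Nat.floor_le (by positivity)
  have hq2 : 3 * |v| / U < q + 1 := Nat.lt_floor_add_one _
  have hqR : q ≤ R := by
    have : (q : ℝ) ≤ R := hq1.trans hR
    exact_mod_cast this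
  have h4 := abs_kern_decay hU0 hqR (ε := ε) h3 hq1
  rw [abs_of_pos hε0] at h4
  have h5 := half_pow_le hq2
  have h6 : Real.exp (-(2 / 3 * (3 * |v| / U))) ≤ Real.exp (2 - 2 * (t + 1) / U) := by
    refine Real.exp_le_exp.2 ?_
    have h8 : 2 / 3 * (3 * |v| / U) = 2 * |v| / U := by ring
    have h9 : 2 * ((t : ℝ) + 1) / U ≤ 2 * |v| / U + 2 := by
      have h10 : 2 / U ≤ 2 := by rw [div_le_iff₀ hU0]; linarith
      have h11 : 2 * ((t : ℝ) + 1) / U = 2 * t / U + 2 / U := by ring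
      have h12 : 2 * (t : ℝ) / U ≤ 2 * |v| / U := by gcongr
      linarith
    rw [h8]; linarith
  have h13 : Real.exp (2 - 2 * (t + 1) / U) ≤ 8 * Real.exp (-(2 * (t + 1) / U)) := by
    rw [sub_eq_add_neg, Real.exp_add]
    refine mul_le_mul_of_nonneg_right ?_ (Real.exp_pos _).le
    have h14 := Real.exp_one_lt_d9
    have h15 : Real.exp 2 = Real.exp 1 * Real.exp 1 := by rw [← Real.exp_add]; norm_num
    rw [h15]; nlinarith [Real.exp_pos 1]
  have h16 : (0 : ℝ) < (1 / 2) ^ q := by positivity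
  have h17 : 2 * ε * (1 / 2) ^ q ≤ 2 * (1 / 2) ^ q :=
    mul_le_mul_of_nonneg_right (by linarith) h16.le
  linarith

/-- If a law is slowly varying along an arithmetic progression wherever it is not tiny, then the
integrals over arcs cannot all be small. -/
theorem le_of_arc_le {p : ℕ → ℝ} (hp : IsLaw p) {x u₀ u₁ J N R k : ℕ} {a b H δ thr U : ℝ}
    (hu₀ : 0 < u₀) (hu₁ : u₁ < u₀) (ha : 0 < a) (hab : a < b) (hb1 : b ≤ 1) (hb : b * u₀ ≤ 1)
    (hH : ∀ ε ∈ Set.Icc a b, ‖∫ θ in (-ε)..ε, charF p θ * expI (-(x * θ))‖ ≤ H)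
    (hthr : 0 < thr) (hδ0 : 0 ≤ δ) (hδ : δ ≤ 1 / (2 * J))
    (hsm : ∀ y, thr ≤ p y → (1 - δ) * p y ≤ p (y + u₀) ∧
      (1 - δ) * p y ≤ if u₀ ≤ y then p (y - u₀) else 0)
    (hU : 1 ≤ U) (hJU : 2048 * u₀ * U ^ 2 ≤ J) (hJa : 1 ≤ a * J) (hJN : J ≤ N)
    (hσ : ∑ i ∈ Finset.range R, 6 / (U * ((i : ℝ) + 1)) ≤ (b - a) / 2)
    (hkR : k ≤ R) (hk : k ≤ 3 * ((N : ℝ) * u₀) / U) (hR : 3 * (((N : ℝ) + 1) * u₀) / U ≤ R) :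
    p (x + u₁) / (8 * u₀) ≤ H + 2 * (1 / 2) ^ k + 2 * thr * (2 * N + 1) * u₀ := by
  have hU0 : 0 < U := by linarith
  have hu0 : (1 : ℝ) ≤ u₀ := by exact_mod_cast hu₀
  have hu0' : (0 : ℝ) < u₀ := by linarith
  have hJ0' : (0 : ℝ) < J := lt_of_lt_of_le (by positivity) hJU
  have hJ0 : 0 < J := by exact_mod_cast hJ0'
  have hN0 : 0 < N := hJ0.trans_le hJN
  have hJU2 : 2 * U ≤ J := by
    refine le_trans ?_ hJU
    have : U * 1 ≤ U * U := mul_le_mul_of_nonneg_left hU hU0.le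
    nlinarith
  set σ : ℕ → ℝ := fun i => 6 / (U * ((i : ℝ) + 1)) with hσdef
  have hσ0 : ∀ i, 0 < σ i := fun i => by simp only [hσdef]; positivity
  set ε := (a + b) / 2 with hε
  have hε0 : 0 < ε := by linarith
  have hε1 : ε ≤ 1 := by linarith
  set K : ℝ → ℝ := kern σ R ε with hK
  have hKle : ∀ v, |K v| ≤ 2 := fun v => by
    have := abs_kern_le σ R ε v
    rw [abs_of_pos hε0] at this
    linarith
  have hps := hp.hasSum.summable
  have hupper : ∑' y : ℕ, p y * K (y - x) ≤ H := by
    refine tsum_kern_le hps hσ0 (a := a) (b := b) (fun e he => ?_) R (by linarith) (by linarith)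
    have h1 := Complex.hasSum_re (hasSum_arc hps e x)
    have h2 : HasSum (fun y : ℕ => p y * arcKernel e (y - x))
        (∫ θ in (-e)..e, charF p θ * expI (-(x * θ))).re := h1.congr_fun' fun y => by
      rw [Complex.re_ofReal_mul, Complex.ofReal_re]
    rw [h2.tsum_eq]
    exact (Complex.re_le_norm _).trans (hH e he)
  have hKs : Summable fun y : ℕ => p y * K (y - x) := by
    refine Summable.of_norm_bounded (hps.mul_right 2) fun y => ?_
    rw [norm_mul, Real.norm_eq_abs, Real.norm_eq_abs, abs_of_nonneg (hp.nonneg y)]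
    exact mul_le_mul_of_nonneg_left (hKle _) (hp.nonneg y)
  have hζ : ∀ v : ℝ, N * u₀ ≤ |v| → |K v| ≤ 2 * (1 / 2) ^ k := fun v hv => by
    have hN0' : (0 : ℝ) < N := by exact_mod_cast hN0
    have hv0 : 0 < |v| := lt_of_lt_of_le (mul_pos hN0' hu0') hv
    have := abs_kern_decay hU0 hkR (ε := ε) hv0 (hk.trans (by gcongr))
    rw [abs_of_pos hε0] at this
    refine this.trans ?_
    have h3 : (0 : ℝ) < (1 / 2) ^ k := by positivity
    nlinarith
  have hwin := window_sum hp x u₀ N hu₀ hζ hKs (by positivity)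
  -- one residue class
  have hclass : ∀ c ∈ Finset.range u₀, max thr (extZ p (x + c)) * (1 / (8 * u₀)) -
      2 * thr * (2 * N + 1) ≤
      box (fun j => extZ p (x + c + j * u₀) * K ((c : ℝ) + j * u₀)) N := by
    intro c hc
    have hcu := Finset.mem_range.1 hc
    have hcu' : (c : ℝ) < u₀ := by exact_mod_cast hcu
    set g : ℤ → ℝ := fun j => max thr (extZ p (x + c + j * u₀)) with hg
    have hg0 : ∀ j, 0 ≤ g j := fun j => hthr.le.trans (le_max_left _ _)
    have hdec : ∀ (t : ℕ) (v : ℝ), (t : ℝ) * u₀ ≤ |v| → |v| ≤ (N + 1) * u₀ → 0 < |v| →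
        |K v| ≤ 32 * Real.exp (-(2 * (t + 1) / U)) := fun t v h1 h2 h3 =>
      abs_kern_le_exp hU hε0 hε1 ((le_mul_of_one_le_right t.cast_nonneg hu0).trans h1) h3
        (le_trans (by gcongr) hR)
    have hslow := slowly_varying_ge (g := g) (K := fun j => K ((c : ℝ) + j * u₀)) (δ := δ)
      (U := U) (C₀ := 32) (κ := 1 / (4 * u₀)) (J := J) (N := N) hg0 hJ0 hJN hδ0 hδ hU
      hJU2 (fun j => by
        have := (max_extZ_shift hthr hδ0 hsm (x + c + j * u₀)).1
        simp only [hg]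
        convert this using 3; ring) (fun j => by
        have := (max_extZ_shift hthr hδ0 hsm (x + c + j * u₀)).2
        simp only [hg]
        convert this using 3; ring) (by norm_num) (fun t ht => by
        have ht' : (t : ℝ) + 1 ≤ N := by exact_mod_cast ht
        have ht0 : (0 : ℝ) ≤ t := t.cast_nonneg
        have hc0 : (0 : ℝ) ≤ c := c.cast_nonneg
        constructor
        · have h1 : (0 : ℝ) < c + ((t : ℤ) + 1 : ℤ) * u₀ := by push_cast; positivity
          refine hdec t _ ?_ ?_ (abs_pos.2 h1.ne')
          · rw [abs_of_pos h1]; push_cast; linarith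
          · rw [abs_of_pos h1]; push_cast
            have := mul_le_mul_of_nonneg_right ht' hu0'.le
            linarith
        · have h1 : (c : ℝ) + (-((t : ℤ) + 1) : ℤ) * u₀ < 0 := by
            have := mul_nonneg ht0 hu0'.le
            push_cast; linarith
          refine hdec t _ ?_ ?_ (abs_pos.2 h1.ne)
          · rw [abs_of_neg h1]; push_cast; linarith
          · rw [abs_of_neg h1]; push_cast
            have := mul_le_mul_of_nonneg_right ht' hu0'.le
            linarith) (by
        rw [← sum_sub_eq_sum_box]
        -- Averaging over lengths transports upper bounds, so the Fejér lower bound is fed in with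
        -- negative weights.
        have hf := tsum_kern_le (ι := Fin J × Fin J) (q := fun _ => -(1 / (J : ℝ)))
          (u := fun q => (c : ℝ) + (((q.1 : ℕ) : ℝ) - (q.2 : ℕ)) * u₀) (hasSum_fintype _).summable
          hσ0 (a := a) (b := b) (H := -(1 / (4 * (u₀ : ℝ)))) (fun e he => by
            rw [tsum_fintype, ← Finset.mul_sum, neg_mul, neg_le_neg_iff]
            refine fejer_arc_ge hJ0 hu₀ hcu ?_ ?_
            · refine le_trans ?_ he.1
              rw [div_le_iff₀ (by positivity), ← mul_assoc]
              exact hJa.trans (le_mul_of_one_le_right (by positivity) hu0)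
            · exact le_trans (mul_le_mul_of_nonneg_right he.2 (by positivity)) hb)
          R (ε := ε) (by linarith) (by linarith)
        rw [tsum_fintype, ← Finset.mul_sum, neg_mul, neg_le_neg_iff] at hf
        refine hf.trans (le_of_eq ?_)
        congr 1
        rw [← Finset.univ_product_univ, Finset.sum_product]
        rw [Finset.sum_range]
        refine Finset.sum_congr rfl fun i _ => ?_
        rw [Finset.sum_range]
        refine Finset.sum_congr rfl fun i' _ => ?_
        simp only [hK]; push_cast; rfl)
    have hcmp : box (fun j => g j * K ((c : ℝ) + j * u₀)) N - 2 * thr * (2 * N + 1) ≤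
        box (fun j => extZ p (x + c + j * u₀) * K ((c : ℝ) + j * u₀)) N := by
      have h1 : ∀ j ∈ Finset.Icc (-(N : ℤ)) N, g j * K ((c : ℝ) + j * u₀) - 2 * thr ≤
          extZ p (x + c + j * u₀) * K ((c : ℝ) + j * u₀) := by
        intro j _
        have h2 := abs_le.1 (hKle ((c : ℝ) + j * u₀))
        have h3 : 0 ≤ extZ p (x + c + j * u₀) := by
          rw [extZ]; split_ifs
          · exact hp.nonneg _
          · exact le_rfl
        have h4 : g j ≤ extZ p (x + c + j * u₀) + thr :=
          max_le (by linarith) (by linarith)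
        have h5 : extZ p (x + c + j * u₀) ≤ g j := le_max_right _ _
        nlinarith [h2.1, h2.2]
      have h6 := Finset.sum_le_sum h1
      rw [Finset.sum_sub_distrib, Finset.sum_const, Int.card_Icc, nsmul_eq_mul] at h6
      have e : (((N : ℤ) + 1 - -(N : ℤ)).toNat : ℝ) = 2 * N + 1 := by
        have : ((N : ℤ) + 1 - -(N : ℤ)).toNat = 2 * N + 1 := by omega
        rw [this]; push_cast; ring
      rw [e] at h6
      simp only [box]
      linarith
    -- The constant 2048 = 8 · 8 · 32 in the hypothesis on J makes the error at most half of the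
    -- Fejér bound.
    have herr : 1 / (8 * (u₀ : ℝ)) ≤ 1 / (4 * u₀) - 8 * 32 * U ^ 2 / J := by
      have h1 : 8 * 32 * U ^ 2 / J ≤ 1 / (8 * (u₀ : ℝ)) := by
        rw [div_le_div_iff₀ hJ0' (by positivity)]; linarith
      have h2 : 1 / (4 * (u₀ : ℝ)) = 1 / (8 * u₀) + 1 / (8 * u₀) := by field_simp; norm_num
      linarith
    have h7 := mul_le_mul_of_nonneg_left herr (hg0 0)
    have h8 : g 0 = max thr (extZ p (x + c)) := by simp [hg]
    rw [← h8]
    linarith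
  have hsum := Finset.sum_le_sum hclass
  rw [Finset.sum_sub_distrib, Finset.sum_const, Finset.card_range, nsmul_eq_mul] at hsum
  have hone : p (x + u₁) * (1 / (8 * u₀)) ≤
      ∑ c ∈ Finset.range u₀, max thr (extZ p (x + c)) * (1 / (8 * (u₀ : ℝ))) := by
    have h1 := Finset.single_le_sum (s := Finset.range u₀)
      (f := fun c : ℕ => max thr (extZ p (x + c)) * (1 / (8 * (u₀ : ℝ))))
      (fun c _ => mul_nonneg (hthr.le.trans (le_max_left _ _)) (by positivity))
      (Finset.mem_range.2 hu₁)
    refine le_trans (mul_le_mul_of_nonneg_right ?_ (by positivity)) h1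
    have e : ((x : ℤ) + u₁) = ((x + u₁ : ℕ) : ℤ) := by push_cast; ring
    rw [e, extZ_natCast]
    exact le_max_right _ _
  rw [div_eq_mul_one_div]
  linarith

end NatLaw

end

noncomputable section

namespace NatLaw

/-! ### Local lower bounds: one value of `n` -/

/-- Comparison of the scales that occur in the argument: `s` stands for a small power of `n`. -/
structure Scale (n : ℕ) (M s : ℝ) : Prop where
  hs : 100 ≤ s
  hM : 1 ≤ M
  hMn : M * s ^ 500 ≤ n
  hn : (n : ℝ) ≤ Real.exp (s / 20)

namespace Scale

variable {n : ℕ} {M s : ℝ}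

theorem one_le (h : Scale n M s) : 1 ≤ s := by linarith [h.hs]

theorem pos (h : Scale n M s) : 0 < s := by linarith [h.hs]

theorem mul_pow_le (h : Scale n M s) {k l : ℕ} (hkl : k ≤ l) : M * s ^ k ≤ M * s ^ l :=
  mul_le_mul_of_nonneg_left (pow_le_pow_right₀ h.one_le hkl) (by linarith [h.hM])

theorem mul_pow_succ_ge (h : Scale n M s) (k : ℕ) : 100 * (M * s ^ k) ≤ M * s ^ (k + 1) := by
  have h1 := mul_le_mul_of_nonneg_left h.hs
    (mul_nonneg (by linarith [h.hM] : (0 : ℝ) ≤ M) (pow_nonneg h.pos.le k))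
  calc 100 * (M * s ^ k) = M * s ^ k * 100 := mul_comm _ _
    _ ≤ M * s ^ k * s := h1
    _ = _ := by rw [pow_succ, mul_assoc]

theorem pow_le_mul_pow (h : Scale n M s) (k : ℕ) : s ^ k ≤ M * s ^ k :=
  le_mul_of_one_le_left (pow_nonneg h.pos.le k) h.hM

theorem pow_le (h : Scale n M s) {k : ℕ} (hk : k ≤ 500) : s ^ k ≤ n :=
  (h.pow_le_mul_pow k).trans ((h.mul_pow_le hk).trans h.hMn)

theorem s_le (h : Scale n M s) : s ≤ n := by simpa using h.pow_le (k := 1) (by norm_num)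

theorem M_le (h : Scale n M s) : M ≤ n := by
  have := (h.mul_pow_le (k := 0) (l := 500) (by norm_num)).trans h.hMn
  simpa using this

theorem n_ge (h : Scale n M s) : (100 : ℝ) ≤ n := h.hs.trans h.s_le

theorem n_pow_le (h : Scale n M s) (k : ℕ) : (n : ℝ) ^ k ≤ Real.exp (k * s / 20) := by
  calc (n : ℝ) ^ k ≤ Real.exp (s / 20) ^ k := pow_le_pow_left₀ n.cast_nonneg h.hn k
    _ = _ := by rw [← Real.exp_nat_mul]; ring_nf

theorem n_pow_le' (h : Scale n M s) {k : ℕ} (hk : k ≤ 20) : (n : ℝ) ^ k ≤ Real.exp s := by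
  refine (h.n_pow_le k).trans (Real.exp_le_exp.2 ?_)
  have : (k : ℝ) ≤ 20 := by exact_mod_cast hk
  have := h.pos
  rw [div_le_iff₀ (by norm_num)]; nlinarith

end Scale

variable {w : ℕ → ℝ}

theorem half_le_exp : (1 / 2 : ℝ) ≤ Real.exp (-(2 / 3)) := by
  rw [Real.exp_neg, one_div]
  refine inv_anti₀ (Real.exp_pos _) ?_
  have h2 := Real.log_two_gt_d9
  calc Real.exp (2 / 3) ≤ Real.exp (Real.log 2) := Real.exp_le_exp.2 (by linarith)
    _ = 2 := Real.exp_log (by norm_num)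

theorem exp_neg_le_half : Real.exp (-1) ≤ 1 / 2 := by
  have h := Real.exp_one_gt_d9
  rw [Real.exp_neg, one_div]
  exact inv_anti₀ (by norm_num) (by linarith)

/-- The assumptions on one law. -/
structure Setup (w : ℕ → ℝ) (n : ℕ) (M μ C : ℝ) (x : ℕ) : Prop where
  law : IsLaw w
  mean : HasSum (fun j : ℕ => (j : ℝ) * w j) μ
  hx : n * μ = x
  hnx : (n : ℝ) ≤ C * x
  hxn : (x : ℝ) ≤ C * n * M
  hexp : ∃ A, HasSum (fun j : ℕ => w j * Real.exp (4 * j)) A ∧ A ≤ Real.exp (C * M)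

/-- Put Q = M s^400. Arcs of order exp(-Q), differentiated over intervals of length exp(-Q/2), give
a real part of at most exp(s - Q/2). The threshold exp(-Q/8) enters squared, so exp(s - Q/4) is left
to beat the cost of the extrapolation. -/
theorem norm_charF_pow_lt_of_arc_le {n x : ℕ} {M s μ C a b : ℝ} (hsc : Scale n M s)
    (hset : Setup w n M μ C x) (hC1 : 1 ≤ C) (hCs : 30 * C ≤ s) (ha : 0 < a) (hb : b ≤ 1)
    (hab : C ≤ s * (b - a))
    (harc : ∀ ε ∈ Set.Icc a b, ‖∫ θ in (-ε)..ε, centF w μ θ ^ n‖ ≤ 4 * Real.pi * powLaw w n x)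
    (hbad : powLaw w n x < Real.exp (-(M * s ^ 400))) :
    ∀ θ ∈ Set.Icc a b, ‖charF w θ‖ ^ n < Real.exp (-(M * s ^ 400 / 8)) := by
  obtain ⟨hw, hμ, hx, hnx, hxn, A, hA, hAC⟩ := hset
  have hs := hsc.hs
  have hM := hsc.hM
  have hs0 := hsc.pos
  have hnge := hsc.n_ge
  have hn0 : (0 : ℝ) < n := by linarith
  have hn1 : 1 ≤ n := by
    have : (1 : ℝ) ≤ n := by linarith
    exact_mod_cast this
  have hba : 0 < b - a := by
    by_contra hcon
    have : s * (b - a) ≤ 0 := mul_nonpos_of_nonneg_of_nonpos hs0.le (by linarith)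
    linarith
  have hxs : 1 ≤ (b - a) * x := by
    have h1 : C * s ≤ C * x * (s * (b - a)) := by
      have h2 : s ≤ C * x := hsc.s_le.trans hnx
      calc C * s = s * C := mul_comm _ _
        _ ≤ (C * x) * (s * (b - a)) := mul_le_mul h2 hab (by linarith) (by positivity)
    have h3 : C * s * 1 ≤ C * s * ((b - a) * x) := by linarith
    exact le_of_mul_le_mul_left h3 (by positivity)
  have hx1 : (1 : ℝ) ≤ x := hxs.trans (mul_le_of_le_one_left x.cast_nonneg (by linarith))
  have hx3 : (x : ℝ) ≤ n ^ 3 := by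
    have h1 : C ≤ n := by linarith [hsc.s_le]
    calc (x : ℝ) ≤ C * n * M := hxn
      _ ≤ n * n * n := by gcongr; exact hsc.M_le
      _ = _ := by ring
  have hμC : μ ≤ C * M := by
    have : (n : ℝ) * μ ≤ n * (C * M) := by rw [hx]; linarith
    exact le_of_mul_le_mul_left this hn0
  set Q := M * s ^ 400 with hQ
  have hQ3 : 1000 * (M * s ^ 3) ≤ Q := by
    have h1 := hsc.mul_pow_succ_ge 3
    have h2 := hsc.mul_pow_succ_ge 4
    have h3 := hsc.mul_pow_le (k := 5) (l := 400) (by norm_num)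
    have h4 : 0 ≤ M * s ^ 3 := by positivity
    norm_num at h1 h2
    linarith
  have hMs1 : 100 ≤ M * s := hs.trans (le_mul_of_one_le_left hs0.le hM)
  have hMs2 : 100 * (M * s) ≤ M * s ^ 2 := by have := hsc.mul_pow_succ_ge 1; simpa using this
  have hMs3 : 100 * (M * s ^ 2) ≤ M * s ^ 3 := hsc.mul_pow_succ_ge 2
  have hsM : s ≤ M * s := le_mul_of_one_le_left hs0.le hM
  have hQn : Q ≤ n := (hsc.mul_pow_le (by norm_num)).trans hsc.hMn
  set ε₁ := Real.exp (-(Q / 8)) with hε₁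
  set h := Real.exp (-(Q / 2)) with hh
  set τ := (4 * Real.pi + 2 * x) * h with hτdef
  have hτ0 : 0 ≤ τ := mul_nonneg (by have := Real.pi_pos; positivity) (Real.exp_pos _).le
  have hτle : τ ≤ Real.exp (s - Q / 2) := by
    rw [sub_eq_add_neg, Real.exp_add, hτdef]
    refine mul_le_mul_of_nonneg_right ?_ (Real.exp_pos _).le
    refine le_trans ?_ (hsc.n_pow_le' (k := 4) (by norm_num))
    have hpi := Real.pi_lt_four
    have : (n : ℝ) ^ 4 = n ^ 3 * n := by ring
    have h3 : (1 : ℝ) ≤ (n : ℝ) ^ 3 := one_le_pow₀ (by linarith)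
    nlinarith
  have hre : ∀ θ ∈ Set.Icc a b, |(centF w μ θ ^ n).re| ≤ τ := by
    intro θ hθ
    have h1 := abs_re_centF_pow_le hw hμ hx (h := h) harc (Real.exp_pos _) (by
      have h2 : h ≤ Real.exp (-s) := Real.exp_le_exp.2 (by linarith)
      have h3 : s * Real.exp (-s) ≤ 1 := by
        have := Real.add_one_le_exp s
        have e : Real.exp s * Real.exp (-s) = 1 := by rw [← Real.exp_add]; simp
        have h5 := mul_le_mul_of_nonneg_right this (Real.exp_pos (-s)).le
        have h6 := Real.exp_pos (-s)
        rw [add_mul, e] at h5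
        linarith
      have h4 : s * h ≤ s * (b - a) :=
        (mul_le_mul_of_nonneg_left h2 hs0.le).trans (by linarith)
      exact le_of_mul_le_mul_left h4 hs0) hθ
    refine h1.trans ?_
    rw [hτdef, add_mul]
    refine add_le_add ?_ le_rfl
    rw [div_le_iff₀ (Real.exp_pos _)]
    have h2 : h * h = Real.exp (-Q) := by rw [hh, ← Real.exp_add]; ring_nf
    have hpi := Real.pi_pos
    calc 4 * Real.pi * powLaw w n x ≤ 4 * Real.pi * (h * h) := by
          rw [h2]; exact mul_le_mul_of_nonneg_left hbad.le (by positivity)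
      _ = _ := by ring
  -- Large enough for 2^(-r) to beat the exponential moments exp(5CM) and the factor n; small enough
  -- for the extrapolation factor (36x(r + 1))^(r + 1) ≤ exp(3 M s²) to be negligible against
  -- exp(Q/4).
  set r := ⌈M * s⌉₊ with hr
  have hr1 : M * s ≤ r := Nat.le_ceil _
  have hr2 : (r : ℝ) < M * s + 1 := Nat.ceil_lt_add_one (by positivity)
  intro θ hθ
  refine norm_charF_pow_lt hw hn1 hμ hx hx1 hA ha hb hre r ?_ ?_ ?_ ?_ hθ
  · rw [div_le_iff₀ (by positivity)]; linarith
  · calc (1 / 2 : ℝ) ^ n ≤ Real.exp (-(2 / 3)) ^ n := by gcongr; exact half_le_exp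
      _ = Real.exp (-(2 / 3 * n)) := by rw [← Real.exp_nat_mul]; ring_nf
      _ ≤ ε₁ := Real.exp_le_exp.2 (by linarith)
  · calc 2 * τ ≤ Real.exp 1 * Real.exp (s - Q / 2) := by
          have := Real.exp_one_gt_d9
          exact mul_le_mul (by linarith) hτle hτ0 (Real.exp_pos _).le
      _ = Real.exp (1 + (s - Q / 2)) := by rw [← Real.exp_add]
      _ < ε₁ := Real.exp_lt_exp.2 (by linarith)
  · have hn8 : 8 * (n : ℝ) ≤ Real.exp (s / 20 + 3) := by
      rw [Real.exp_add]
      have h1 : (8 : ℝ) ≤ Real.exp 3 := by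
        have h2 := Real.exp_one_gt_d9
        have h3 : Real.exp 3 = Real.exp 1 ^ 3 := by rw [← Real.exp_nat_mul]; norm_num
        rw [h3]
        calc (8 : ℝ) = 2 ^ 3 := by norm_num
          _ ≤ _ := by gcongr; linarith
      have h4 := hsc.hn
      calc 8 * (n : ℝ) ≤ Real.exp 3 * Real.exp (s / 20) := by gcongr
        _ = _ := mul_comm _ _
    have hinv : Real.exp (-(s / 20 + 3)) ≤ 1 / (8 * n) := by
      rw [Real.exp_neg, one_div]
      exact inv_anti₀ (by positivity) hn8
    have t1 : (36 * (x : ℝ) * (r + 1)) ^ (r + 1) * (3 * τ / ε₁ ^ 2) ≤ 1 / (8 * n) := by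
      have k1 : 36 * (x : ℝ) * (r + 1) ≤ Real.exp s := by
        refine le_trans ?_ (hsc.n_pow_le' (k := 5) (by norm_num))
        have k2 : (r : ℝ) + 1 ≤ n := by
          have := (hsc.mul_pow_le (k := 2) (l := 500) (by norm_num)).trans hsc.hMn
          linarith
        calc 36 * (x : ℝ) * (r + 1) ≤ n * n ^ 3 * n := by gcongr; linarith
          _ = _ := by ring
      have k3 : (36 * (x : ℝ) * (r + 1)) ^ (r + 1) ≤ Real.exp (3 * (M * s ^ 2)) := by
        calc _ ≤ Real.exp s ^ (r + 1) := pow_le_pow_left₀ (by positivity) k1 _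
          _ = Real.exp ((r + 1) * s) := by rw [← Real.exp_nat_mul]; push_cast; rfl
          _ ≤ _ := by
            refine Real.exp_le_exp.2 ?_
            have : ((r : ℝ) + 1) * s ≤ (M * s + 2) * s := mul_le_mul_of_nonneg_right (by linarith) hs0.le
            have e : (M * s + 2) * s = M * s ^ 2 + 2 * s := by ring
            linarith
      have k4 : 3 * τ / ε₁ ^ 2 ≤ 3 * Real.exp (s - Q / 4) := by
        rw [div_le_iff₀ (by positivity), hε₁, ← Real.exp_nat_mul, mul_assoc, ← Real.exp_add]
        refine mul_le_mul_of_nonneg_left (hτle.trans (Real.exp_le_exp.2 ?_)) (by norm_num)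
        push_cast; linarith
      have k5 : (3 : ℝ) ≤ Real.exp s := by
        have := Real.add_one_le_exp s; linarith
      have hh0 := Real.exp_pos (-(Q / 2))
      calc _ ≤ Real.exp (3 * (M * s ^ 2)) * (Real.exp s * Real.exp (s - Q / 4)) := by
            gcongr
            exact k4.trans (by gcongr)
        _ = Real.exp (3 * (M * s ^ 2) + (s + (s - Q / 4))) := by
          rw [← Real.exp_add, ← Real.exp_add]
        _ ≤ Real.exp (-(s / 20 + 3)) := Real.exp_le_exp.2 (by linarith)
        _ ≤ _ := hinv
    have t2 : (1 / 2 : ℝ) ^ (r + 1) * (Real.exp (4 * μ) * A) ≤ 1 / (8 * n) := by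
      have hA0 : 0 ≤ A := hA.nonneg fun j => mul_nonneg (hw.nonneg j) (Real.exp_pos _).le
      calc (1 / 2 : ℝ) ^ (r + 1) * (Real.exp (4 * μ) * A)
          ≤ Real.exp (-(2 / 3)) ^ (r + 1) * (Real.exp (4 * (C * M)) * Real.exp (C * M)) := by
            gcongr; exact half_le_exp
        _ = Real.exp (-(2 / 3 * (r + 1)) + 5 * (C * M)) := by
          rw [← Real.exp_nat_mul, ← Real.exp_add, ← Real.exp_add]; congr 1; push_cast; ring
        _ ≤ Real.exp (-(s / 20 + 3)) := by
          refine Real.exp_le_exp.2 ?_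
          have : 30 * C * M ≤ s * M := by gcongr
          linarith
        _ ≤ _ := hinv
    have e : 1 / (4 * (n : ℝ)) = 1 / (8 * n) + 1 / (8 * n) := by field_simp; norm_num
    rw [e]; linarith

theorem defect_ge_of_arc_le {n x : ℕ} {M s μ C a b : ℝ} (hsc : Scale n M s)
    (hset : Setup w n M μ C x) (hC1 : 1 ≤ C) (hCs : 30 * C ≤ s) (ha : 0 < a) (hb : b ≤ 1)
    (hab : C ≤ s * (b - a))
    (harc : ∀ ε ∈ Set.Icc a b, ‖∫ θ in (-ε)..ε, centF w μ θ ^ n‖ ≤ 4 * Real.pi * powLaw w n x)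
    (hbad : powLaw w n x < Real.exp (-(M * s ^ 400))) :
    ∀ θ ∈ Set.Icc a b, M * s ^ 400 / (8 * n) ≤ 1 - ‖charF w θ‖ ^ 2 := by
  have hlt := norm_charF_pow_lt_of_arc_le hsc hset hC1 hCs ha hb hab harc hbad
  have hQn : M * s ^ 400 ≤ n := (hsc.mul_pow_le (by norm_num)).trans hsc.hMn
  have hM := hsc.hM
  have hs0 := hsc.pos
  have hn0 : (0 : ℝ) < n := by linarith [hsc.n_ge]
  set Q := M * s ^ 400 with hQ
  have hQ0 : 0 ≤ Q := by positivity
  set ε₁ := Real.exp (-(Q / 8)) with hε₁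
  intro θ hθ
  by_contra hcon
  rw [not_le] at hcon
  have h1 := hlt θ hθ
  set q := Q / (8 * n) with hq
  have hq0 : 0 ≤ q := by positivity
  have hq1 : q ≤ 1 / 2 := by
    rw [hq, div_le_iff₀ (by positivity)]; linarith
  have h2 : Real.exp (-(2 * q)) ≤ ‖charF w θ‖ ^ 2 := by
    have := exp_neg_two_mul_le hq0 hq1; linarith
  have h3 : ε₁ ^ 2 ≤ (‖charF w θ‖ ^ n) ^ 2 := by
    calc ε₁ ^ 2 = Real.exp (-(2 * q)) ^ n := by
          rw [hε₁, ← Real.exp_nat_mul, ← Real.exp_nat_mul]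
          congr 1
          have : (n : ℝ) * (Q / (8 * n)) = Q / 8 := by field_simp
          push_cast
          rw [hq]; linarith
      _ ≤ (‖charF w θ‖ ^ 2) ^ n := by gcongr
      _ = _ := by rw [← pow_mul, ← pow_mul, mul_comm]
  have h4 : (‖charF w θ‖ ^ n) ^ 2 < ε₁ ^ 2 := by gcongr
  linarith

end NatLaw

end

/-! ### Almost invariance of the law of the sum under its period -/

noncomputable section

namespace NatLaw

variable {w : ℕ → ℝ}

/-- Away from the zeros of `1 - e^{iuθ}` the characteristic function of a block is tiny. -/
theorem norm_charF_pow_le_of_defect {k : ℕ} {g θ : ℝ}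
    (h : g ≤ 1 - ‖charF w θ‖ ^ 2) : ‖charF w θ‖ ^ k ≤ Real.exp (-(k * g / 2)) := by
  have h1 : ‖charF w θ‖ ^ 2 ≤ Real.exp (-g) := by
    have := Real.add_one_le_exp (-g); linarith
  have h2 : ‖charF w θ‖ ≤ Real.exp (-(g / 2)) := by
    refine le_of_sq_le_sq ?_ (Real.exp_pos _).le
    rw [← Real.exp_nat_mul]
    refine h1.trans (Real.exp_le_exp.2 ?_)
    push_cast; linarith
  calc ‖charF w θ‖ ^ k ≤ Real.exp (-(g / 2)) ^ k := pow_le_pow_left₀ (norm_nonneg _) h2 k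
    _ = _ := by rw [← Real.exp_nat_mul]; congr 1; ring

theorem Scale.inv_le {n : ℕ} {M s : ℝ} (h : Scale n M s) : 1 / (n : ℝ) ≤ (1 / s) ^ 500 := by
  rw [div_pow, one_pow]
  exact one_div_le_one_div_of_le (pow_pos h.pos _) (h.pow_le le_rfl)

/-- Cut the n variables into about T = M s^200 blocks. A block of n/T variables is long enough: the
defect of order c₁ M s^300/n gives an exponent of order c₁ s^100, so the characteristic function of
the block is at most exp(-s²) off the zeros of 1 - exp(iuθ), and typical values of the block are
almost shift invariant. There are also enough blocks: conditioning on an event of probability exp(-M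
s^100) costs M s^100/T per block, which is negligible. -/
theorem shift_of_dichotomy {n x u r : ℕ} {M s μ c₁ : ℝ} (hw : IsLaw w)
    (hμ : HasSum (fun j : ℕ => (j : ℝ) * w j) μ) (hsc : Scale n M s) (hx : n * μ = x)
    (hx3 : (x : ℝ) ≤ n ^ 3) (hus : (u : ℝ) ≤ s) (hc : 1 ≤ c₁ * s)
    (hr : (n : ℝ) ^ 6 ≤ s ^ (23 * r)) (hr2 : 2 ^ (r + 1) ≤ s)
    (hd : ∀ θ : ℝ, ‖1 - expI (u * θ)‖ ≤ u * (1 / s) ^ 50 ∨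
      c₁ * (M * s ^ 400 / (8 * n)) * ((1 / s) ^ 50) ^ 2 ≤ 1 - ‖charF w θ‖ ^ 2) {y : ℕ}
    (hy : Real.exp (-(M * s ^ 100)) ≤ powLaw w n y) :
    (1 - (1 / s) ^ 8) * powLaw w n y ≤ powLaw w n (y + u) ∧
    (1 - (1 / s) ^ 8) * powLaw w n y ≤ if u ≤ y then powLaw w n (y - u) else 0 := by
  have hs := hsc.hs
  have hM := hsc.hM
  have hs0 := hsc.pos
  have hs1 := hsc.one_le
  have hnge := hsc.n_ge
  have hn0 : (0 : ℝ) < n := by linarith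
  have hM0 : 0 < M := by linarith
  have hc0 : 0 < c₁ := by
    by_contra hcon
    have : c₁ * s ≤ 0 := mul_nonpos_of_nonpos_of_nonneg (by linarith) hs0.le
    linarith
  set t := 1 / s with ht
  have ht0 : 0 < t := by positivity
  have ht1 : t ≤ 1 / 100 := one_div_le_one_div_of_le (by norm_num) hs
  have hst : s * t = 1 := by rw [ht]; field_simp
  have htp : ∀ i : ℕ, t ^ (i + 1) ≤ t ^ i / 100 := fun i => by
    rw [pow_succ]
    have := mul_le_mul_of_nonneg_left ht1 (pow_nonneg ht0.le i)
    linarith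
  have htm : ∀ {i j : ℕ}, i ≤ j → t ^ j ≤ t ^ i := fun h =>
    pow_le_pow_of_le_one ht0.le (by linarith) h
  have hninv : 1 / (n : ℝ) ≤ t ^ 500 := hsc.inv_le
  -- the blocks
  set T := M * s ^ 200 with hT
  have hT1 : 100 ≤ T := by
    have h1 : M * s ≤ T := by simpa using hsc.mul_pow_le (k := 1) (l := 200) (by norm_num)
    have h2 : s ≤ M * s := le_mul_of_one_le_left hs0.le hM
    linarith
  have hT0 : 0 < T := by linarith
  have hTn : 100 * T ≤ n := by
    have h1 := hsc.mul_pow_succ_ge 200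
    exact h1.trans ((hsc.mul_pow_le (by norm_num)).trans hsc.hMn)
  set k := ⌊(n : ℝ) / T⌋₊ with hk
  have hk1 : (k : ℝ) ≤ n / T := Nat.floor_le (by positivity)
  have hk2 : (n : ℝ) / T < k + 1 := Nat.lt_floor_add_one _
  have hnT : 100 ≤ (n : ℝ) / T := by rw [le_div_iff₀ hT0]; exact hTn
  have hk3 : (n : ℝ) / T / 2 ≤ k := by linarith
  have hkpos : 0 < k := by
    have : (0 : ℝ) < k := by linarith
    exact_mod_cast this
  have hk0 : (0 : ℝ) < k := by exact_mod_cast hkpos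
  set m₀ := n / k with hm₀
  set s' := n % k with hs'
  have hnk : n = k * m₀ + s' := (Nat.div_add_mod n k).symm
  have hm₀ge : T - 1 ≤ m₀ := by
    have h1 : (s' : ℝ) ≤ k := by exact_mod_cast (Nat.mod_lt n hkpos).le
    have h2 : (n : ℝ) = k * m₀ + s' := by exact_mod_cast hnk
    have h3 : T * k ≤ n := by rwa [le_div_iff₀ hT0, mul_comm] at hk1
    have h4 : k * T ≤ k * ((m₀ : ℝ) + 1) := by linarith
    have := le_of_mul_le_mul_left h4 hk0
    linarith
  have hm₀pos : 0 < m₀ := by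
    have : (0 : ℝ) < m₀ := by linarith
    exact_mod_cast this
  -- smoothness of a block
  set p := powLaw w k with hp
  have hpl : IsLaw p := hw.powLaw k
  have hpk : PowerSeries.mk p = PowerSeries.mk w ^ k := mk_powLaw w k
  set ζ := Real.exp (-s ^ 2) with hζ
  -- With 2^(r+1) ≤ s, the telescoping part has mass at most s^(-24), while J u s^(-50) ≤ s^(-23);
  -- its r-th power beats n^6 by the hypothesis on r.
  set J := ⌈s ^ 25⌉₊ with hJ
  have hJ1 : s ^ 25 ≤ J := Nat.le_ceil _
  have hJ2 : (J : ℝ) ≤ s ^ 26 := by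
    have h1 := Nat.ceil_lt_add_one (a := s ^ 25) (by positivity)
    have h2 : 1 ≤ s ^ 25 := one_le_pow₀ hs1
    have h3 : s ^ 25 * 100 ≤ s ^ 25 * s := mul_le_mul_of_nonneg_left hs (by positivity)
    rw [pow_succ]; linarith
  have hJ0 : 0 < J := by
    have : (0 : ℝ) < J := lt_of_lt_of_le (by positivity) hJ1
    exact_mod_cast this
  have hdich : ∀ θ : ℝ, ‖1 - expI (u * θ)‖ ≤ u * t ^ 50 ∨ ‖serF (PowerSeries.mk p) θ‖ ≤ ζ := by
    intro θ
    refine (hd θ).imp_right fun h => ?_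
    rw [serF_mk, hp, charF_powLaw hw, norm_pow]
    refine (norm_charF_pow_le_of_defect h).trans (Real.exp_le_exp.2 ?_)
    have e : c₁ * (M * s ^ 400 / (8 * n)) * (t ^ 50) ^ 2 = c₁ * M * s ^ 300 / (8 * n) := by
      have : s ^ 400 * (t ^ 50) ^ 2 = s ^ 300 := by
        rw [← pow_mul, show (400 : ℕ) = 300 + 50 * 2 by norm_num, pow_add, mul_assoc, ← mul_pow, hst]
        simp
      rw [← this]; ring
    rw [e]
    have h1 : (n : ℝ) / T / 2 * (c₁ * M * s ^ 300 / (8 * n)) = c₁ * s ^ 100 / 16 := by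
      have : s ^ 300 = s ^ 100 * s ^ 200 := by rw [← pow_add]
      rw [hT, this]; field_simp; norm_num
    have h2 := mul_le_mul_of_nonneg_right hk3
      (by positivity : 0 ≤ c₁ * M * s ^ 300 / (8 * n))
    rw [h1] at h2
    have h3 : s ^ 99 ≤ c₁ * s ^ 100 := by
      have := mul_le_mul_of_nonneg_right hc (pow_nonneg hs0.le 99)
      calc s ^ 99 = 1 * s ^ 99 := (one_mul _).symm
        _ ≤ c₁ * s * s ^ 99 := this
        _ = _ := by ring
    have h4 : s ^ 2 * 100 ≤ s ^ 99 := by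
      calc s ^ 2 * 100 ≤ s ^ 2 * s := mul_le_mul_of_nonneg_left hs (by positivity)
        _ = s ^ 3 := by ring
        _ ≤ _ := pow_le_pow_right₀ hs1 (by norm_num)
    have h5 : 0 ≤ s ^ 2 := by positivity
    linarith
  -- The mean of a block is at most x ≤ n^3, so by Markov's inequality the values beyond n^4 have
  -- mass at most 1/n.
  set Z := n ^ 4 with hZ
  have hZ0 : 0 < Z := by
    have : 0 < n := by exact_mod_cast hn0
    positivity
  have hV := sum_abs_shift_sub_le (u := u) (r := r) hpl.absMassLE hJ0
    (by positivity : 0 ≤ u * t ^ 50) (Real.exp_pos _).le (fun θ => by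
      rw [serF_mk]; exact norm_charF_le hpl θ) hdich (Z + u)
  have hJt : J * (u * t ^ 50) ≤ t ^ 23 := by
    calc J * (u * t ^ 50) ≤ s ^ 26 * (s * t ^ 50) := by gcongr
      _ = (s * t) ^ 27 * t ^ 23 := by ring
      _ = _ := by rw [hst]; simp
  have hZu : ((Z + u : ℕ) : ℝ) ≤ n ^ 5 := by
    have h1 : (u : ℝ) ≤ n := hus.trans hsc.s_le
    have h2 : (n : ℝ) ≤ n ^ 4 := le_self_pow₀ (by linarith) (by norm_num)
    have h3 : (n : ℝ) ^ 4 * 100 ≤ n ^ 4 * n := mul_le_mul_of_nonneg_left hnge (by positivity)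
    have h4 : (n : ℝ) ^ 5 = n ^ 4 * n := by ring
    rw [hZ]; push_cast; linarith
  have hr' : (n : ℝ) ^ 5 * (t ^ 23) ^ r ≤ 1 / n := by
    rw [le_div_iff₀ hn0]
    calc (n : ℝ) ^ 5 * (t ^ 23) ^ r * n = n ^ 6 * t ^ (23 * r) := by rw [pow_mul]; ring
      _ ≤ s ^ (23 * r) * t ^ (23 * r) := by gcongr
      _ = 1 := by rw [← mul_pow, hst, one_pow]
  have hζ' : (n : ℝ) ^ 5 * (2 ^ (r + 1) * ζ) ≤ 1 / n := by
    rw [le_div_iff₀ hn0]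
    have h1 := hsc.n_pow_le' (k := 7) (by norm_num)
    calc (n : ℝ) ^ 5 * (2 ^ (r + 1) * ζ) * n ≤ (n : ℝ) ^ 5 * (n * ζ) * n := by
          gcongr; exact hr2.trans hsc.s_le
      _ = n ^ 7 * ζ := by ring
      _ ≤ Real.exp s * ζ := by gcongr
      _ = Real.exp (s - s ^ 2) := by rw [hζ, ← Real.exp_add]; ring_nf
      _ ≤ 1 := by rw [Real.exp_le_one_iff]; nlinarith
  have hVle : (2 : ℝ) ^ (r + 1) / J + ((Z + u : ℕ) : ℝ) * (2 * (J * (u * t ^ 50)) ^ r +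
      2 ^ (r + 1) * ζ) ≤ t ^ 23 := by
    have h1 : (2 : ℝ) ^ (r + 1) / J ≤ t ^ 24 := by
      rw [div_le_iff₀ (by exact_mod_cast hJ0)]
      calc (2 : ℝ) ^ (r + 1) ≤ s := hr2
        _ = (s * t) ^ 24 * s := by rw [hst]; simp
        _ = t ^ 24 * s ^ 25 := by ring
        _ ≤ _ := by gcongr
    have h2 : ((Z + u : ℕ) : ℝ) * (2 * (J * (u * t ^ 50)) ^ r + 2 ^ (r + 1) * ζ) ≤ 3 * (1 / n) := by
      calc _ ≤ (n : ℝ) ^ 5 * (2 * (t ^ 23) ^ r + 2 ^ (r + 1) * ζ) := by gcongr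
        _ = 2 * (n ^ 5 * (t ^ 23) ^ r) + n ^ 5 * (2 ^ (r + 1) * ζ) := by ring
        _ ≤ _ := by linarith
    have h3 := htm (i := 24) (j := 500) (by norm_num)
    have h4 := htp 23
    have h5 : 0 ≤ t ^ 23 := by positivity
    linarith
  have hbad := sum_bad_le hpl (hasSum_powLaw_mean hw hμ k) hZ0 (by positivity : 0 < t ^ 9)
    (hV.trans hVle)
  have hβ : t ^ 23 / t ^ 9 + k * μ / (Z : ℕ) ≤ t ^ 13 := by
    have h1 : t ^ 23 / t ^ 9 = t ^ 14 := by
      rw [div_eq_iff (by positivity)]; ring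
    have hμ0 : 0 ≤ μ := mean_nonneg hw hμ
    have h2 : k * μ / (Z : ℕ) ≤ 1 / (n : ℝ) := by
      have hkn : (k : ℝ) ≤ n := by
        exact_mod_cast Nat.floor_le_of_le (by
          rw [div_le_iff₀ hT0]; exact le_mul_of_one_le_right hn0.le (by linarith))
      rw [hZ, div_le_div_iff₀ (by positivity) hn0]
      push_cast
      calc k * μ * n ≤ n * μ * n := by gcongr
        _ ≤ n ^ 3 * n := by rw [hx]; gcongr
        _ = _ := by ring
    have h3 := htm (i := 14) (j := 500) (by norm_num)
    have h4 := htp 13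
    have h5 : 0 ≤ t ^ 13 := by positivity
    rw [h1]; linarith
  have hmain := powLaw_shift_ge (s := s') (y := y) (u := u) hw hm₀pos (by positivity : 0 ≤ t ^ 9)
    (fun N => ((hbad N).1).trans hβ) (fun N => ((hbad N).2).trans hβ) (Q := M * s ^ 100)
    (by rw [← hnk]; exact hy)
  rw [← hnk] at hmain
  have hQm : M * s ^ 100 / m₀ ≤ t ^ 10 := by
    rw [div_le_iff₀ (by exact_mod_cast hm₀pos)]
    have h1 : T / 2 ≤ m₀ := by linarith
    have e : M * s ^ 100 = t ^ 10 * (M * s ^ 110) := by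
      calc M * s ^ 100 = (s * t) ^ 10 * (M * s ^ 100) := by rw [hst]; simp
        _ = _ := by ring
    rw [e]
    refine mul_le_mul_of_nonneg_left (le_trans ?_ h1) (by positivity)
    have h2 : 100 * (M * s ^ 110) ≤ M * s ^ 111 := hsc.mul_pow_succ_ge 110
    have h3 := hsc.mul_pow_le (k := 111) (l := 200) (by norm_num)
    have : 0 ≤ M * s ^ 110 := by positivity
    linarith
  have hfin : 1 - t ^ 8 ≤ 1 - t ^ 9 - 2 * t ^ 13 - M * s ^ 100 / m₀ := by
    have h1 := htp 8
    have h2 := htm (i := 9) (j := 13) (by norm_num)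
    have h3 := htm (i := 9) (j := 10) (by norm_num)
    have h4 : 0 ≤ t ^ 8 := by positivity
    linarith
  have hpn := (hw.powLaw n).nonneg y
  have := mul_le_mul_of_nonneg_right hfin hpn
  exact ⟨this.trans hmain.1, this.trans hmain.2⟩

end NatLaw

end

/-! ### The contradiction for one value of n -/

noncomputable section

namespace NatLaw

variable {w : ℕ → ℝ}

theorem ge_of_shift {p : ℕ → ℝ} {u q z : ℕ} {thr c : ℝ}
    (hsm : ∀ y, thr ≤ p y → 1 / 2 * p y ≤ if u ≤ y then p (y - u) else 0) (hc : 0 ≤ c)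
    (h : thr ≤ c * (1 / 2) ^ q) (hz : c ≤ p (z + u * q)) : c * (1 / 2) ^ q ≤ p z := by
  induction q generalizing c with
  | zero => simpa using hz
  | succ q ih =>
    have h1 : c * (1 / 2) ^ (q + 1) = c / 2 * (1 / 2) ^ q := by ring
    rw [h1] at h ⊢
    refine ih (by linarith) h ?_
    have h2 : thr ≤ c := h.trans (by
      have : (1 / 2 : ℝ) ^ q ≤ 1 := pow_le_one₀ (by norm_num) (by norm_num)
      nlinarith)
    have h3 := hsm _ (h2.trans hz)
    have h4 : z + u * (q + 1) = z + u * q + u := by ring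
    rw [if_pos (by omega), h4, Nat.add_sub_cancel] at h3
    rw [h4] at hz
    linarith

/-- Near the mean there is a point of not too small probability. -/
theorem exists_ge_near_mean {n x : ℕ} {M s μ C : ℝ} (hsc : Scale n M s)
    (hset : Setup w n M μ C x) (hCs : 30 * C ≤ s) :
    ∃ y, x ≤ y ∧ (y : ℝ) ≤ x + 2 * (M * s) ∧ Real.exp (-s) ≤ powLaw w n y := by
  obtain ⟨hw, hμ, hx, hnx, hxn, A, hA, hAC⟩ := hset
  have hs := hsc.hs
  have hM := hsc.hM
  have hs0 := hsc.pos
  have hn0 : (0 : ℝ) < n := by linarith [hsc.n_ge]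
  have hMs : 100 ≤ M * s := hs.trans (le_mul_of_one_le_left hs0.le hM)
  -- Jumps beyond B carry a mean of at most exp(-3B) times the exponential moment exp(CM), which is
  -- far below 1/n because 30C ≤ s.
  set B := ⌈M * s⌉₊ with hB
  have hB1 : M * s ≤ B := Nat.le_ceil _
  have hB2 : (B : ℝ) < M * s + 1 := Nat.ceil_lt_add_one (by positivity)
  have hterm : ∀ j ∉ Finset.range (B + 1), (j : ℝ) * w j ≤
      Real.exp (-(3 * B)) * (w j * Real.exp (4 * j)) := by
    intro j hj
    have hj' : (B : ℝ) + 1 ≤ j := by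
      rw [Finset.mem_range, not_lt] at hj; exact_mod_cast hj
    have h1 : (j : ℝ) ≤ Real.exp j := by have := Real.add_one_le_exp (j : ℝ); linarith
    have h2 : (j : ℝ) ≤ Real.exp (-(3 * B)) * Real.exp (4 * j) := by
      rw [← Real.exp_add]
      exact h1.trans (Real.exp_le_exp.2 (by linarith))
    calc (j : ℝ) * w j ≤ Real.exp (-(3 * B)) * Real.exp (4 * j) * w j :=
          mul_le_mul_of_nonneg_right h2 (hw.nonneg j)
      _ = _ := by ring
  have hτ : μ ≤ ∑ j ∈ Finset.range (B + 1), (j : ℝ) * w j + Real.exp (-(3 * B)) * A := by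
    refine hasSum_le (f := fun j : ℕ => (j : ℝ) * w j) (g := fun j =>
      (if j ∈ Finset.range (B + 1) then (j : ℝ) * w j else 0) +
      Real.exp (-(3 * B)) * (w j * Real.exp (4 * j))) (fun j => ?_) hμ
      (HasSum.add ?_ (hA.mul_left _))
    · have h0 : 0 ≤ Real.exp (-(3 * (B : ℝ))) * (w j * Real.exp (4 * j)) :=
        mul_nonneg (Real.exp_pos _).le (mul_nonneg (hw.nonneg j) (Real.exp_pos _).le)
      by_cases hj : j ∈ Finset.range (B + 1)
      · simp only [hj, if_true]; linarith
      · simp only [hj, if_false, zero_add]; exact hterm j hj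
    · have := hasSum_sum_of_ne_finset_zero (L := SummationFilter.unconditional _)
        (f := fun j : ℕ => if j ∈ Finset.range (B + 1) then (j : ℝ) * w j else 0)
        (s := Finset.range (B + 1)) (fun j hj => by simp only [hj, if_false])
      rwa [Finset.sum_congr rfl (fun j hj => if_pos hj)] at this
  have hn1 : 1 ≤ n := by exact_mod_cast (by linarith [hsc.n_ge] : (1 : ℝ) ≤ n)
  obtain ⟨y, h1, h2, h3⟩ := exists_window hw hμ hn1 hx hτ (by
    have h4 : (4 : ℝ) ≤ Real.exp 2 := by
      have h2 := Real.exp_one_gt_d9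
      have h3 : Real.exp 2 = Real.exp 1 ^ 2 := by rw [← Real.exp_nat_mul]; norm_num
      rw [h3]
      calc (4 : ℝ) = 2 ^ 2 := by norm_num
        _ ≤ _ := by gcongr; linarith
    have hA0 : 0 ≤ A := hA.nonneg fun j => mul_nonneg (hw.nonneg j) (Real.exp_pos _).le
    calc 4 * (n : ℝ) * (Real.exp (-(3 * B)) * A)
        ≤ Real.exp 2 * Real.exp (s / 20) * (Real.exp (-(3 * B)) * Real.exp (C * M)) := by
          gcongr; exact hsc.hn
      _ = Real.exp (2 + s / 20 + (-(3 * B) + C * M)) := by simp only [Real.exp_add]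
      _ ≤ 1 := by
        rw [Real.exp_le_one_iff]
        have : 30 * C * M ≤ s * M := by gcongr
        have : s ≤ M * s := le_mul_of_one_le_left hs0.le hM
        linarith)
  refine ⟨y, h1, ?_, le_trans ?_ h3⟩
  · have : (y : ℝ) ≤ x + B := by exact_mod_cast h2
    linarith
  · have hBn : (B : ℝ) + 1 ≤ n := by
      have e2 : 100 * (M * s) ≤ M * s ^ 2 := by simpa using hsc.mul_pow_succ_ge 1
      have := (hsc.mul_pow_le (k := 2) (l := 500) (by norm_num)).trans hsc.hMn
      linarith
    rw [Real.exp_neg, ← one_div]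
    refine one_div_le_one_div_of_le (by positivity) (le_trans ?_ (hsc.n_pow_le' (k := 5)
      (by norm_num)))
    have hn100 := hsc.n_ge
    calc 2 * (2 * (n : ℝ) * B + 1) * (B + 1) ≤ n * (n * n * n) * n := by
          gcongr
          · linarith
          · have hnn : (n : ℝ) * n ≥ 100 * n := mul_le_mul_of_nonneg_right hn100 hn0.le
            calc 2 * (n : ℝ) * B + 1 ≤ 2 * n * n + n := by
                  have : 2 * (n : ℝ) * B ≤ 2 * n * n := by gcongr; exact_mod_cast (by linarith : (B : ℝ) ≤ n)
                  linarith
              _ ≤ 100 * (n * n) := by linarith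
              _ ≤ n * n * n := by nlinarith
      _ = _ := by ring

theorem Setup.x_le {n x : ℕ} {M s μ C : ℝ} (hsc : Scale n M s) (hset : Setup w n M μ C x)
    (hC1 : 1 ≤ C) (hCs : 30 * C ≤ s) : (x : ℝ) ≤ n ^ 3 := by
  have h1 : C ≤ n := by linarith [hsc.s_le]
  have := hsc.M_le
  have := hsc.hM
  calc (x : ℝ) ≤ C * n * M := hset.hxn
    _ ≤ n * n * n := by gcongr
    _ = _ := by ring

/-- The total perturbation of the arc length for U = s²: a harmonic sum, where log R ≤ s/20. It has
to fit into the interval of admissible lengths. -/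
theorem sum_inv_le {R : ℕ} {s : ℝ} (hs : 100 ≤ s) (hR : (R : ℝ) ≤ Real.exp (s / 20)) :
    ∑ i ∈ Finset.range R, 6 / (s ^ 2 * ((i : ℝ) + 1)) ≤ 1 / s := by
  have h1 := harmonic_le_one_add_log R
  have h2 : Real.log R ≤ s / 20 := by
    rcases Nat.eq_zero_or_pos R with rfl | h0
    · simp; linarith
    · rw [Real.log_le_iff_le_exp (by exact_mod_cast h0)]; exact hR
  have h3 : ∑ i ∈ Finset.range R, 6 / (s ^ 2 * ((i : ℝ) + 1)) = 6 / s ^ 2 * (harmonic R : ℝ) := by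
    rw [harmonic, Rat.cast_sum, Finset.mul_sum]
    refine Finset.sum_congr rfl fun i _ => ?_
    push_cast
    field_simp
  rw [h3]
  have h4 : 6 / s ^ 2 * (harmonic R : ℝ) ≤ 6 / s ^ 2 * (s / 10) := by
    gcongr; linarith
  refine h4.trans ?_
  rw [div_mul_eq_mul_div, div_le_div_iff₀ (by positivity) (by linarith)]
  nlinarith

/-- A law which is smooth along an arithmetic progression, not too small at a point of each class
and tiny at `x` has a large arc integral. -/
theorem false_of_smooth {p : ℕ → ℝ} {n x u₀ u₁ : ℕ} {M s a' b' : ℝ} (hsc : Scale n M s)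
    (hpl : IsLaw p) (hu₀ : 0 < u₀) (hus : 10000 * u₀ ≤ s) (hu₁ : u₁ < u₀)
    (hsm : ∀ y, Real.exp (-(M * s ^ 100)) ≤ p y →
      (1 - (1 / s) ^ 8) * p y ≤ p (y + u₀) ∧
      (1 - (1 / s) ^ 8) * p y ≤ if u₀ ≤ y then p (y - u₀) else 0)
    (hpt : Real.exp (-(M * s ^ 2)) ≤ p (x + u₁)) (hpx : p x ≤ Real.exp (-(M * s ^ 100)))
    (ha' : 0 < a') (hb' : b' ≤ 1) (hbu : b' * u₀ ≤ 1) (has' : 1 ≤ a' * s)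
    (hab' : 2 ≤ s * (b' - a'))
    (harc' : ∀ ε ∈ Set.Icc a' b',
      ‖∫ θ in (-ε)..ε, charF p θ * expI (-(x * θ))‖ ≤ 4 * Real.pi * p x) : False := by
  have hs := hsc.hs
  have hM := hsc.hM
  have hs0 := hsc.pos
  have hs1 := hsc.one_le
  have hM0 : 0 < M := by linarith
  have hnge := hsc.n_ge
  have hn0 : (0 : ℝ) < n := by linarith
  have hu1 : (1 : ℝ) ≤ u₀ := by exact_mod_cast hu₀
  have hus' : (u₀ : ℝ) ≤ s := by linarith
  have e1 : 100 * s ≤ M * s ^ 2 := by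
    have := hsc.mul_pow_succ_ge 1
    have h2 : s ≤ M * s := le_mul_of_one_le_left hs0.le hM
    norm_num at this; linarith
  have e2 : 100 * (M * s ^ 2) ≤ M * s ^ 3 := hsc.mul_pow_succ_ge 2
  have e3 : M * s ^ 3 ≤ M * s ^ 100 := hsc.mul_pow_le (by norm_num)
  have e4 : M * s ^ 100 ≤ M * s ^ 400 := hsc.mul_pow_le (by norm_num)
  have e5 : 100 * (M * s ^ 400) ≤ M * s ^ 401 := hsc.mul_pow_succ_ge 400
  have hs6 : 1 ≤ s ^ 6 := one_le_pow₀ hs1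
  -- With U = s² the Fejér length must satisfy 2048 u₀ s^4 ≤ J, and the smoothness s^(-8) must be at
  -- most 1/(2J); s^6 lies between.
  set J := ⌊s ^ 6⌋₊ with hJ
  have hJ1 : (J : ℝ) ≤ s ^ 6 := Nat.floor_le (by positivity)
  have hJ2 : s ^ 6 < J + 1 := Nat.lt_floor_add_one _
  have hJ3 : 1 ≤ J := by rw [hJ]; exact Nat.le_floor (by simpa using hs6)
  have hJ3' : (1 : ℝ) ≤ J := by exact_mod_cast hJ3
  have hJ4 : s ^ 6 / 2 ≤ J := by linarith
  set k := ⌊3 * ((n : ℝ) * u₀) / s ^ 2⌋₊ with hk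
  have hk1 : (k : ℝ) ≤ 3 * ((n : ℝ) * u₀) / s ^ 2 := Nat.floor_le (by positivity)
  have hk2 : 3 * ((n : ℝ) * u₀) / s ^ 2 < k + 1 := Nat.lt_floor_add_one _
  have hR : 3 * (((n : ℝ) + 1) * u₀) / s ^ 2 ≤ n := by
    rw [div_le_iff₀ (by positivity)]
    calc 3 * (((n : ℝ) + 1) * u₀) ≤ 3 * ((n + n) * s) := by gcongr; linarith
      _ = n * (6 * s) := by ring
      _ ≤ n * s ^ 2 := by
        have : s * 100 ≤ s * s := mul_le_mul_of_nonneg_left hs hs0.le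
        rw [pow_two]; gcongr; linarith
  have hfin := le_of_arc_le (p := p) (x := x) (u₀ := u₀) (u₁ := u₁) (J := J) (N := n) (R := n)
    (k := k) (a := a') (b := b') (H := 4 * Real.pi * p x) (δ := (1 / s) ^ 8)
    (thr := Real.exp (-(M * s ^ 100))) (U := s ^ 2) hpl hu₀ hu₁ ha'
    (by by_contra hle
        have : s * (b' - a') ≤ 0 := mul_nonpos_of_nonneg_of_nonpos hs0.le (by linarith)
        linarith) hb' hbu
    harc' (Real.exp_pos _) (by positivity)
    (by
      rw [div_pow, one_pow, div_le_div_iff₀ (by positivity) (by positivity)]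
      have : s ^ 6 * 100 ≤ s ^ 6 * s := mul_le_mul_of_nonneg_left hs (by positivity)
      have h7 : s ^ 6 * s ≤ s ^ 8 := by
        rw [← pow_succ]; exact pow_le_pow_right₀ hs1 (by norm_num)
      linarith) hsm (one_le_pow₀ hs1)
    (by
      have h1 : 2048 * (u₀ : ℝ) ≤ s ^ 2 / 2 := by
        have : s * 1 ≤ s * s := mul_le_mul_of_nonneg_left hs1 hs0.le
        rw [pow_two]; linarith
      calc 2048 * (u₀ : ℝ) * (s ^ 2) ^ 2 ≤ s ^ 2 / 2 * (s ^ 2) ^ 2 := by gcongr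
        _ = s ^ 6 / 2 := by ring
        _ ≤ _ := hJ4)
    (by
      have h1 : s ≤ J := by
        have h2 : s * s ≤ s ^ 6 := by
          rw [← pow_two]; exact pow_le_pow_right₀ hs1 (by norm_num)
        have : s * 100 ≤ s * s := mul_le_mul_of_nonneg_left hs hs0.le
        linarith
      exact has'.trans (mul_le_mul_of_nonneg_left h1 ha'.le))
    (by exact_mod_cast hJ1.trans (hsc.pow_le (by norm_num)))
    ((sum_inv_le hs hsc.hn).trans (by
      rw [div_le_div_iff₀ hs0 (by norm_num)]; linarith))
    (by
      have : (k : ℝ) ≤ n := hk1.trans (le_trans (by gcongr; linarith) hR)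
      exact_mod_cast this) hk1 hR
  have hpi := Real.pi_lt_four
  have hpi0 := Real.pi_pos
  -- Outside the window of n periods the averaged kernel is at most 2 · 2^(-k), below the threshold
  -- exp(-M s^100).
  have hkbig : M * s ^ 401 ≤ k := by
    have h1 : M * s ^ 402 * s ^ 2 ≤ 3 * ((n : ℝ) * u₀) := by
      calc M * s ^ 402 * s ^ 2 = M * s ^ 404 := by ring
        _ ≤ (n : ℝ) := (hsc.mul_pow_le (by norm_num)).trans hsc.hMn
        _ ≤ _ := by
          have := mul_le_mul_of_nonneg_left hu1 hn0.le
          linarith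
    rw [← le_div_iff₀ (by positivity)] at h1
    have h2 : 100 * (M * s ^ 401) ≤ M * s ^ 402 := hsc.mul_pow_succ_ge 401
    have h3 := hsc.mul_pow_le (k := 1) (l := 401) (by norm_num)
    have h4 : s ≤ M * s := le_mul_of_one_le_left hs0.le hM
    simp only [pow_one] at h3
    linarith
  have hk3 : (1 / 2 : ℝ) ^ k ≤ Real.exp (-(M * s ^ 100)) := by
    calc (1 / 2 : ℝ) ^ k ≤ Real.exp (-(2 / 3)) ^ k := by gcongr; exact half_le_exp
      _ = Real.exp (k * -(2 / 3)) := by rw [Real.exp_nat_mul]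
      _ ≤ _ := Real.exp_le_exp.2 (by
        have : 0 ≤ M * s ^ 100 := by positivity
        linarith)
  set E := Real.exp (-(M * s ^ 100)) with hE
  have hE0 : 0 < E := Real.exp_pos _
  have hun : (u₀ : ℝ) ≤ n := hus'.trans hsc.s_le
  have hR1 : 4 * Real.pi * p x + 2 * (1 / 2) ^ k + 2 * E * (2 * n + 1) * u₀ ≤ n ^ 3 * E := by
    have h1 : 4 * Real.pi * p x ≤ 16 * E := by
      calc 4 * Real.pi * p x ≤ 4 * 4 * E :=
            mul_le_mul (by linarith) hpx (hpl.nonneg x) (by norm_num)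
        _ = 16 * E := by norm_num
    have h2 : 2 * E * (2 * n + 1) * u₀ ≤ E * (6 * n * n) := by
      calc 2 * E * (2 * n + 1) * u₀ ≤ 2 * E * (2 * n + n) * n := by gcongr; linarith
        _ = _ := by ring
    have h3 : 18 + 6 * (n : ℝ) * n ≤ n ^ 3 := by
      have h5 : (n : ℝ) * n * 100 ≤ n * n * n := by gcongr
      have h6 : (100 : ℝ) * 100 ≤ n * n := by gcongr
      have e : (n : ℝ) ^ 3 = n * n * n := by ring
      linarith
    have h4 := mul_le_mul_of_nonneg_right h3 hE0.le
    linarith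
  have h8 : p (x + u₁) ≤ n ^ 5 * E := by
    rw [div_le_iff₀ (by positivity)] at hfin
    calc p (x + u₁) ≤ n ^ 3 * E * (8 * u₀) := hfin.trans (by gcongr)
      _ ≤ n ^ 3 * E * (n * n) := by gcongr; linarith
      _ = _ := by ring
  have h9 : n ^ 5 * E < Real.exp (-(M * s ^ 2)) := by
    calc n ^ 5 * E ≤ Real.exp s * E := by gcongr; exact hsc.n_pow_le' (by norm_num)
      _ = Real.exp (s + -(M * s ^ 100)) := by rw [hE, Real.exp_add]
      _ < _ := Real.exp_lt_exp.2 (by linarith)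
  linarith

/-- The lower bound for the probability of the mean, for one value of `n`. -/
theorem exp_le_powLaw_of_arc_le {n x r u₀ : ℕ} {M s μ C a b a' b' c₁ : ℝ} (hsc : Scale n M s)
    (hset : Setup w n M μ C x) (hC1 : 1 ≤ C) (hCs : 30 * C ≤ s) (ha : 0 < a) (hb : b ≤ 1)
    (hab : C ≤ s * (b - a))
    (harc : ∀ ε ∈ Set.Icc a b, ‖∫ θ in (-ε)..ε, centF w μ θ ^ n‖ ≤ 4 * Real.pi * powLaw w n x)
    (hu₀ : 0 < u₀) (hus : 10000 * u₀ ≤ s) (hc : 1 ≤ c₁ * s)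
    (hper : ∀ (w : ℕ → ℝ), IsLaw w → ∀ q : ℝ, 0 ≤ q →
      (∀ θ ∈ Set.Icc a b, q ≤ 1 - ‖charF w θ‖ ^ 2) → ∀ η : ℝ, 0 < η → ∀ θ : ℝ,
      ‖1 - expI (u₀ * θ)‖ ≤ u₀ * η ∨ c₁ * q * η ^ 2 ≤ 1 - ‖charF w θ‖ ^ 2)
    (hr : (n : ℝ) ^ 6 ≤ s ^ (23 * r)) (hr2 : 2 ^ (r + 1) ≤ s)
    (ha' : 0 < a') (hb' : b' ≤ 1) (hbu : b' * u₀ ≤ 1) (has' : 1 ≤ a' * s)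
    (hab' : 2 ≤ s * (b' - a'))
    (harc' : ∀ ε ∈ Set.Icc a' b',
      ‖∫ θ in (-ε)..ε, centF w μ θ ^ n‖ ≤ 4 * Real.pi * powLaw w n x) :
    Real.exp (-(M * s ^ 400)) ≤ powLaw w n x := by
  by_contra hcon
  rw [not_le] at hcon
  have hw := hset.law
  have hs := hsc.hs
  have hM := hsc.hM
  have hs0 := hsc.pos
  have hs1 := hsc.one_le
  have hM0 : 0 < M := by linarith
  have hnge := hsc.n_ge
  have hn0 : (0 : ℝ) < n := by linarith
  have hu1 : (1 : ℝ) ≤ u₀ := by exact_mod_cast hu₀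
  have hus' : (u₀ : ℝ) ≤ s := by linarith
  have hdef := defect_ge_of_arc_le hsc hset hC1 hCs ha hb hab harc hcon
  have hsm : ∀ y, Real.exp (-(M * s ^ 100)) ≤ powLaw w n y →
      (1 - (1 / s) ^ 8) * powLaw w n y ≤ powLaw w n (y + u₀) ∧
      (1 - (1 / s) ^ 8) * powLaw w n y ≤ if u₀ ≤ y then powLaw w n (y - u₀) else 0 := fun y hy =>
    shift_of_dichotomy hw hset.mean hsc hset.hx (hset.x_le hsc hC1 hCs) hus' hc hr hr2
      (hper w hw _ (by positivity) hdef _ (by positivity)) hy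
  set p := powLaw w n with hp
  have hpl : IsLaw p := hw.powLaw n
  have ht1 : 1 / s ≤ 1 / 100 := one_div_le_one_div_of_le (by norm_num) hs
  have ht8 : (1 / s) ^ 8 ≤ 1 / 2 := by
    calc (1 / s) ^ 8 ≤ (1 / 100) ^ 8 := by gcongr
      _ ≤ 1 / 2 := by norm_num
  have e1 : 100 * s ≤ M * s ^ 2 := by
    have := hsc.mul_pow_succ_ge 1
    have h2 : s ≤ M * s := le_mul_of_one_le_left hs0.le hM
    norm_num at this; linarith
  have e1' : 100 * (M * s) ≤ M * s ^ 2 := by simpa using hsc.mul_pow_succ_ge 1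
  have e2 : 100 * (M * s ^ 2) ≤ M * s ^ 3 := hsc.mul_pow_succ_ge 2
  have e3 : M * s ^ 3 ≤ M * s ^ 100 := hsc.mul_pow_le (by norm_num)
  have e4 : M * s ^ 100 ≤ M * s ^ 400 := hsc.mul_pow_le (by norm_num)
  have e5 : 100 * (M * s ^ 400) ≤ M * s ^ 401 := hsc.mul_pow_succ_ge 400
  -- a point near the mean
  obtain ⟨y, hxy, hyx, hy⟩ := exists_ge_near_mean hsc hset hCs
  -- Write y = x + u₁ + u₀ q. Stepping back q = O(Ms) times by u₀ reaches x + u₁, and each step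
  -- loses at most a factor 2, so the probability there is still at least exp(-M s²).
  set d := y - x with hd
  set u₁ := d % u₀ with hu₁
  set q := d / u₀ with hq
  have hdq : y = x + u₁ + u₀ * q := by
    have := Nat.mod_add_div d u₀
    rw [hu₁, hq, add_assoc, this]; omega
  have hqd : (q : ℝ) ≤ 2 * (M * s) := by
    have h1 : q ≤ d := Nat.div_le_self _ _
    have h2 : (x : ℝ) + d = y := by exact_mod_cast (show x + d = y by omega)
    have h3 : (q : ℝ) ≤ d := by exact_mod_cast h1
    linarith
  have hpow : Real.exp (-(M * s ^ 2)) ≤ Real.exp (-s) * (1 / 2) ^ q := by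
    calc Real.exp (-(M * s ^ 2)) ≤ Real.exp (-s + q * -1) := by
          refine Real.exp_le_exp.2 ?_
          have : 0 ≤ M * s := by positivity
          linarith
      _ = Real.exp (-s) * Real.exp (-1) ^ q := by rw [Real.exp_add, Real.exp_nat_mul]
      _ ≤ _ := by gcongr; exact exp_neg_le_half
  have hthr : Real.exp (-(M * s ^ 100)) ≤ Real.exp (-(M * s ^ 2)) :=
    Real.exp_le_exp.2 (by have : 0 ≤ M * s ^ 2 := by positivity
                          linarith)
  have hpt : Real.exp (-(M * s ^ 2)) ≤ p (x + u₁) := by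
    refine hpow.trans (ge_of_shift (thr := Real.exp (-(M * s ^ 100))) (u := u₀) (fun z hz => ?_)
      (Real.exp_pos _).le (hthr.trans hpow) (by rw [← hdq]; exact hy))
    refine le_trans ?_ (hsm z hz).2
    exact mul_le_mul_of_nonneg_right (by linarith) (hpl.nonneg z)
  have hpx : p x ≤ Real.exp (-(M * s ^ 100)) := hcon.le.trans (Real.exp_le_exp.2 (by linarith))
  refine false_of_smooth hsc hpl hu₀ hus (Nat.mod_lt _ hu₀) hsm hpt hpx ha' hb' hbu has' hab'
    fun ε hε => ?_
  have h1 := harc' ε hε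
  simp only [hp]
  convert h1 using 5 with θ
  rw [centF_pow w n hset.hx, charF_powLaw hw]

end NatLaw

end

/-! ### The local lower bound for sequences of laws -/

noncomputable section

namespace NatLaw

theorem tendsto_natCast_rpow {e : ℝ} (he : 0 < e) :
    Tendsto (fun n : ℕ => (n : ℝ) ^ e) atTop atTop :=
  (tendsto_rpow_atTop he).comp tendsto_natCast_atTop_atTop

/-- Take s = n^e. Since 1000e ≤ κ, s^500 is at most n^(κ/2), and the other half of the gap n^κ
between M and n absorbs C. -/
theorem eventually_scale {M : ℕ → ℝ} {C κ e : ℝ} (hκ : 0 < κ) (he : 0 < e) (heκ : 1000 * e ≤ κ)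
    (hM : ∀ᶠ n : ℕ in atTop, 1 ≤ M n ∧ M n ≤ C * (n : ℝ) ^ (1 - κ)) :
    ∀ᶠ n : ℕ in atTop, Scale n (M n) ((n : ℝ) ^ e) := by
  have h1 := (tendsto_natCast_rpow he).eventually_ge_atTop 100
  have h2 := (tendsto_natCast_rpow (half_pos hκ)).eventually_ge_atTop C
  have h3 : ∀ᶠ n : ℕ in atTop, Real.log n ≤ (n : ℝ) ^ e / 20 := by
    have := ((isLittleO_log_rpow_atTop he).comp_tendsto
      tendsto_natCast_atTop_atTop).bound (by norm_num : (0 : ℝ) < 1 / 20)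
    filter_upwards [this] with n hn
    simp only [Function.comp_apply, Real.norm_eq_abs] at hn
    rw [abs_of_nonneg (Real.rpow_nonneg n.cast_nonneg e)] at hn
    linarith [le_abs_self (Real.log n)]
  filter_upwards [h1, h2, h3, hM, eventually_ge_atTop 1] with n h1 h2 h3 hM hn
  have hn1 : (1 : ℝ) ≤ n := by exact_mod_cast hn
  have hn0 : (0 : ℝ) < n := by linarith
  refine ⟨h1, hM.1, ?_, ?_⟩
  · have e1 : ((n : ℝ) ^ e) ^ 500 = (n : ℝ) ^ (500 * e) := by
      rw [← Real.rpow_natCast, ← Real.rpow_mul hn0.le]; congr 1; push_cast; ring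
    rw [e1]
    calc M n * (n : ℝ) ^ (500 * e) ≤ (n : ℝ) ^ (κ / 2) * (n : ℝ) ^ (1 - κ) * (n : ℝ) ^ (κ / 2) := by
          gcongr ?_ * ?_
          · exact hM.2.trans (by gcongr)
          · exact Real.rpow_le_rpow_of_exponent_le hn1 (by linarith)
      _ = n := by
        rw [← Real.rpow_add hn0, ← Real.rpow_add hn0, show κ / 2 + (1 - κ) + κ / 2 = 1 by ring,
          Real.rpow_one]
  · rw [← Real.log_le_iff_le_exp hn0]; exact h3

/-- Uniform control of all arcs whose length lies in some interval. -/
theorem exists_uniform_arc {w : ℕ → ℕ → ℝ} {μ : ℕ → ℝ} {p : ℕ → ℝ}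
    (hw : ∀ᶠ n in atTop, IsLaw (w n))
    (harc : ∀ ε, 0 < ε → ε < Real.pi / 2 → ∀ᶠ n in atTop,
      ‖∫ θ in (-ε)..ε, centF (w n) (μ n) θ ^ n‖ ≤ p n) {β : ℝ} (hβ : 0 < β) (hβ1 : β ≤ 1) :
    ∃ a b : ℝ, 0 < a ∧ a < b ∧ b < β ∧ ∀ᶠ n in atTop, ∀ ε ∈ Set.Icc a b,
      ‖∫ θ in (-ε)..ε, centF (w n) (μ n) θ ^ n‖ ≤ p n := by
  classical
  -- The category argument needs continuity for every n, but w n is a law only for large n; the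
  -- default value 0 fills the gap.
  obtain ⟨a, b, N, ha, hab, hb, h⟩ := exists_uniform_interval (β₀ := Real.pi / 2) (p := p)
    (a := fun n ε => if IsLaw (w n) then ‖∫ θ in (-ε)..ε, centF (w n) (μ n) θ ^ n‖ else 0)
    (fun n => by
      by_cases hn : IsLaw (w n)
      · simp only [hn, if_true]
        have hc : Continuous fun θ => centF (w n) (μ n) θ ^ n := (continuous_centF hn _).pow n
        have h0 := intervalIntegral.continuous_primitive
          (fun a b => hc.intervalIntegrable (μ := MeasureTheory.volume) a b) 0
        have e : (fun ε : ℝ => ‖∫ θ in (-ε)..ε, centF (w n) (μ n) θ ^ n‖) = fun ε =>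
            ‖(∫ θ in (0 : ℝ)..ε, centF (w n) (μ n) θ ^ n) -
              ∫ θ in (0 : ℝ)..(-ε), centF (w n) (μ n) θ ^ n‖ := by
          ext ε
          rw [intervalIntegral.integral_interval_sub_left (hc.intervalIntegrable _ _)
            (hc.intervalIntegrable _ _)]
        rw [e]
        exact (h0.sub (h0.comp continuous_neg)).norm
      · simp only [hn, if_false]; exact continuous_const)
    (fun ε h0 h1 => by
      filter_upwards [hw, harc ε h0 h1] with n h2 h3
      simp only [h2, if_true, abs_norm]; exact h3) hβ
    (by linarith [Real.pi_gt_three])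
  refine ⟨a, b, ha, hab, hb, ?_⟩
  filter_upwards [hw, eventually_ge_atTop N] with n h1 h2 ε hε
  have := h n h2 ε hε
  simpa only [h1, if_true, abs_norm] using this

/-- If the integrals over all arcs are comparable with the one over the circle, the probability of
the mean is not too small. -/
theorem eventually_exp_le_powLaw {w : ℕ → ℕ → ℝ} {M μ : ℕ → ℝ} {x : ℕ → ℕ} {C κ : ℝ}
    (hC1 : 1 ≤ C) (hκ : 0 < κ)
    (hset : ∀ᶠ n in atTop, Setup (w n) n (M n) (μ n) C (x n))
    (hM : ∀ᶠ n : ℕ in atTop, 1 ≤ M n ∧ M n ≤ C * (n : ℝ) ^ (1 - κ))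
    (harc : ∀ ε, 0 < ε → ε < Real.pi / 2 → ∀ᶠ n in atTop,
      ‖∫ θ in (-ε)..ε, centF (w n) (μ n) θ ^ n‖ ≤ 4 * Real.pi * powLaw (w n) n (x n))
    {c : ℝ} (hc : 0 < c) :
    ∀ᶠ n : ℕ in atTop, Real.exp (-(M n * (n : ℝ) ^ c)) ≤ powLaw (w n) n (x n) := by
  -- The bound for one n has exponent M s^400, so 400e ≤ c is needed; 1000e ≤ κ is for the scale.
  set e := min (c / 400) (κ / 1000) with he
  have he0 : 0 < e := lt_min (by positivity) (by positivity)
  have he1 : 400 * e ≤ c := by have := min_le_left (c / 400) (κ / 1000); linarith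
  have he2 : 1000 * e ≤ κ := by have := min_le_right (c / 400) (κ / 1000); linarith
  have hlaw : ∀ᶠ n in atTop, IsLaw (w n) := hset.mono fun n h => h.law
  obtain ⟨a, b, ha, hab, hb, h1⟩ := exists_uniform_arc hlaw harc one_pos le_rfl
  obtain ⟨u₀, hu₀, c₁, hc₁, hper⟩ := exists_period ha hab hb.le
  have hu0 : (0 : ℝ) < u₀ := by exact_mod_cast hu₀
  have hu1 : (1 : ℝ) ≤ u₀ := by exact_mod_cast hu₀
  -- The first interval of arc lengths determines the period u₀; the Fejér argument then needs arcs
  -- shorter than 1/u₀, so the category argument is applied again.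
  obtain ⟨a', b', ha', hab', hb', h2⟩ := exists_uniform_arc hlaw harc
    (by positivity : (0 : ℝ) < 1 / u₀) (by rw [div_le_one hu0]; exact hu1)
  -- A fixed number of differences suffices: n^6 ≤ s^(23r) because s is a power of n.
  obtain ⟨r, hr⟩ := exists_nat_ge (6 / (23 * e))
  have hs := tendsto_natCast_rpow he0
  filter_upwards [h1, h2, hset, hM, eventually_scale hκ he0 he2 hM, eventually_ge_atTop 1,
    hs.eventually_ge_atTop (30 * C), hs.eventually_ge_atTop (C / (b - a)),
    hs.eventually_ge_atTop (10000 * u₀), hs.eventually_ge_atTop (1 / c₁),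
    hs.eventually_ge_atTop (2 ^ (r + 1)), hs.eventually_ge_atTop (1 / a'),
    hs.eventually_ge_atTop (2 / (b' - a'))] with n h1 h2 hset hM hsc hn s1 s2 s3 s4 s5 s6 s7
  have hn1 : (1 : ℝ) ≤ n := by exact_mod_cast hn
  have hn0 : (0 : ℝ) < n := by linarith
  have hpw : ∀ k : ℕ, ((n : ℝ) ^ e) ^ k = (n : ℝ) ^ (k * e) := fun k => by
    rw [← Real.rpow_natCast, ← Real.rpow_mul hn0.le, mul_comm]
  have hmain := exp_le_powLaw_of_arc_le hsc hset hC1 s1 ha hb.le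
    (by rwa [div_le_iff₀ (by linarith)] at s2) h1 hu₀ s3
    (by rwa [div_le_iff₀ hc₁, mul_comm] at s4) hper (r := r)
    (by
      rw [hpw, ← Real.rpow_natCast]
      refine Real.rpow_le_rpow_of_exponent_le hn1 ?_
      rw [div_le_iff₀ (by positivity)] at hr
      push_cast; linarith) s5 ha'
    (hb'.le.trans (by rw [div_le_one hu0]; exact hu1)) (by rw [← le_div_iff₀ hu0]; exact hb'.le)
    (by rwa [div_le_iff₀ ha', mul_comm] at s6)
    (by rwa [div_le_iff₀ (by linarith)] at s7) h2
  refine le_trans (Real.exp_le_exp.2 (neg_le_neg ?_)) hmain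
  rw [hpw]
  refine mul_le_mul_of_nonneg_left (Real.rpow_le_rpow_of_exponent_le hn1 ?_) (by linarith [hM.1])
  push_cast; exact he1

end NatLaw

end

/-! ### Conditional means of functions of a block, given the sum -/

noncomputable section

namespace NonnegSeries

open PowerSeries Finset

theorem coeff_prod_mk {ι : Type*} [Fintype ι] [DecidableEq ι] (a : ι → ℕ → ℝ) (z : ℕ) :
    coeff z (∏ i, mk (a i)) = ∑ f ∈ piAntidiag univ z, ∏ i, a i (f i) := by
  rw [PowerSeries.coeff_prod]
  refine sum_nbij' (fun f => ⇑f) (fun f => Finsupp.equivFunOnFinite.symm f) ?_ ?_ ?_ ?_ ?_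
  · intro f hf; simpa [mem_finsuppAntidiag] using hf
  · intro f hf; simpa [mem_finsuppAntidiag] using hf
  · intro f _; simp
  · intro f _; simp
  · intro f _; simp

theorem massLE_of_le {A : PowerSeries ℝ} {b : ℕ → ℝ} {C : ℝ} (hA : ∀ j, 0 ≤ coeff j A)
    (hb : ∀ j, coeff j A ≤ b j) (h : HasSum b C) : MassLE A C := by
  refine ⟨hA, fun N => ?_⟩
  exact (sum_le_sum fun j _ => hb j).trans
    (sum_le_hasSum (range N) (fun j _ => (hA j).trans (hb j)) h)

theorem hasSum_coeff_mul {A B : PowerSeries ℝ} {a b : ℝ} (hA : HasSum (fun j => coeff j A) a)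
    (hB : HasSum (fun j => coeff j B) b) : HasSum (fun j => coeff j (A * B)) (a * b) := by
  have := NatLaw.hasSum_conv hA hB
  refine this.congr_fun' fun j => ?_
  simp only [NatLaw.convLaw]
  congr 2 <;> ext i <;> simp

theorem hasSum_coeff_prod {ι : Type*} (s : Finset ι) {A : ι → PowerSeries ℝ} {a : ι → ℝ}
    (h : ∀ i ∈ s, HasSum (fun j => coeff j (A i)) (a i)) :
    HasSum (fun j => coeff j (∏ i ∈ s, A i)) (∏ i ∈ s, a i) := by
  classical
  induction s using Finset.induction_on with
  | empty =>
    have := hasSum_ite_eq (0 : ℕ) (1 : ℝ)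
    simpa [coeff_one] using this
  | insert i s hi ih =>
    rw [prod_insert hi, prod_insert hi]
    exact hasSum_coeff_mul (h i (mem_insert_self i s)) (ih fun j hj => h j (mem_insert_of_mem hj))

theorem exp_le_one_add_add_sq {u : ℝ} (hu : |u| ≤ 1) : Real.exp u ≤ 1 + u + u ^ 2 := by
  have := (abs_le.1 (Real.abs_exp_sub_one_sub_id_le hu)).2
  linarith

theorem coeff_prod_le {ι : Type*} (s : Finset ι) {A B : ι → PowerSeries ℝ}
    (hA : ∀ i j, 0 ≤ coeff j (A i)) (h : ∀ i j, coeff j (A i) ≤ coeff j (B i)) :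
    (∀ j, 0 ≤ coeff j (∏ i ∈ s, A i)) ∧ ∀ j, coeff j (∏ i ∈ s, A i) ≤ coeff j (∏ i ∈ s, B i) := by
  classical
  have hmul : ∀ {A B C D : PowerSeries ℝ}, (∀ j, 0 ≤ coeff j A) → (∀ j, 0 ≤ coeff j C) →
      (∀ j, coeff j A ≤ coeff j B) → (∀ j, coeff j C ≤ coeff j D) →
      ∀ j, coeff j (A * C) ≤ coeff j (B * D) := by
    intro A B C D h1 h2 h3 h4 j
    rw [coeff_mul, coeff_mul]
    exact sum_le_sum fun p _ => mul_le_mul (h3 _) (h4 _) (h2 _) ((h1 _).trans (h3 _))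
  induction s using Finset.induction_on with
  | empty => simpa using coeff_one_nonneg
  | insert i s hi ih =>
    simp only [prod_insert hi]
    exact ⟨coeff_mul_nonneg (hA i) ih.1, hmul (hA i) ih.1 (h i) ih.2⟩

end NonnegSeries

namespace NatLaw

open NonnegSeries Finset

variable {w : ℕ → ℝ}

/-- Conditionally on the sum, the mean of a bounded function of a block of variables is close to its
unconditional mean. -/
theorem abs_coeff_block_sub_le (hw : IsLaw w) {r m x : ℕ} (hm : 0 < m) {h : Fin r → ℕ → ℝ}
    (hh : ∀ i j, 0 ≤ h i j) {y s : Fin r → ℝ} (hy : ∀ i, HasSum (fun j => w j * h i j) (y i))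
    (hs : ∀ i, HasSum (fun j => w j * h i j ^ 2) (s i)) {l Q : ℝ} (hl : 0 < l)
    (hlh : ∀ f : Fin r → ℕ, l * ∏ i, h i (f i) ≤ 1) {n : ℕ} (hn : r * m ≤ n)
    (hp : Real.exp (-Q) ≤ powLaw w n x) :
    |PowerSeries.coeff x ((∏ i, PowerSeries.mk fun j => w j * h i j) *
        PowerSeries.mk w ^ (n - r)) - (∏ i, y i) * powLaw w n x| ≤
      (l * ∏ i, s i + Q / (l * m)) * powLaw w n x := by
  set Ω : ℕ → Finset (Fin r → ℕ) := fun z => piAntidiag univ z with hΩ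
  set ρ : (Fin r → ℕ) → ℝ := fun f => ∏ i, w (f i) with hρdef
  set g : (Fin r → ℕ) → ℝ := fun f => ∏ i, h i (f i) with hg
  have hρ : ∀ f, 0 ≤ ρ f := fun f => prod_nonneg fun i _ => hw.nonneg _
  have hg0 : ∀ f, 0 ≤ g f := fun f => prod_nonneg fun i _ => hh _ _
  have e0 : gradedSum Ω ρ = PowerSeries.mk w ^ r := by
    ext z
    rw [coeff_gradedSum, ← coeff_prod_mk (fun _ => w)]
    simp
  have e1 : gradedSum Ω (fun f => ρ f * g f) = ∏ i, PowerSeries.mk fun j => w j * h i j := by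
    ext z
    rw [coeff_gradedSum, coeff_prod_mk]
    exact sum_congr rfl fun f _ => (prod_mul_distrib).symm
  have e2 : gradedSum Ω (fun f => ρ f * g f ^ 2) =
      ∏ i, PowerSeries.mk fun j => w j * h i j ^ 2 := by
    ext z
    rw [coeff_gradedSum, coeff_prod_mk]
    refine sum_congr rfl fun f _ => ?_
    rw [prod_mul_distrib, prod_pow]
  have s0 : HasSum (fun z => PowerSeries.coeff z (gradedSum Ω ρ)) 1 := by
    rw [e0]; exact (hw.powLaw r).hasSum
  have s1 : HasSum (fun z => PowerSeries.coeff z (gradedSum Ω fun f => ρ f * g f)) (∏ i, y i) := by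
    rw [e1]; exact hasSum_coeff_prod _ fun i _ => by simpa using hy i
  have s2 : HasSum (fun z => PowerSeries.coeff z (gradedSum Ω fun f => ρ f * g f ^ 2))
      (∏ i, s i) := by
    rw [e2]; exact hasSum_coeff_prod _ fun i _ => by simpa using hs i
  -- The sum consists of m blocks of r variables, graded by their sums, and of these leftover
  -- variables.
  set R := PowerSeries.mk w ^ (n - r * m) with hRdef
  have hR : MassLE R 1 := by simpa using hw.massLE.pow (n - r * m)
  have coeffP : PowerSeries.coeff x (gradedSum Ω ρ ^ m * R) = powLaw w n x := by
    rw [e0, hRdef, ← pow_mul, ← pow_add, powLaw]; congr 3; omega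
  -- Tilting by exp(l g) and by exp(-l g) gives the upper and the lower estimate. As l g ≤ 1, the
  -- exponential moment is 1 ± l E g + O(l² E g²).
  have key : ∀ σ : ℝ, σ = 1 ∨ σ = -1 →
      σ * l * PowerSeries.coeff x ((∏ i, PowerSeries.mk fun j => w j * h i j) *
        PowerSeries.mk w ^ (n - r)) ≤
      (σ * l * ∏ i, y i + l ^ 2 * ∏ i, s i + Q / m) * powLaw w n x := by
    intro σ hσ
    have hσ2 : σ ^ 2 = 1 := by rcases hσ with rfl | rfl <;> norm_num
    have hσa : |σ| = 1 := by rcases hσ with rfl | rfl <;> norm_num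
    have hmass : MassLE (gradedSum Ω fun f => ρ f * Real.exp (σ * l * g f))
        (Real.exp (σ * l * ∏ i, y i + l ^ 2 * ∏ i, s i)) := by
      refine MassLE.mono (massLE_of_le (fun z => ?_) (fun z => ?_)
        ((s0.add (s1.mul_left (σ * l))).add (s2.mul_left (l ^ 2)))) ?_
      · rw [coeff_gradedSum]
        exact sum_nonneg fun f _ => mul_nonneg (hρ f) (Real.exp_pos _).le
      · simp only [coeff_gradedSum]
        rw [mul_sum, mul_sum, ← sum_add_distrib, ← sum_add_distrib]
        refine sum_le_sum fun f _ => ?_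
        have hu : |σ * l * g f| ≤ 1 := by
          rw [abs_mul, abs_mul, hσa, one_mul, abs_of_pos hl, abs_of_nonneg (hg0 f)]; exact hlh f
        have h1 := mul_le_mul_of_nonneg_left (exp_le_one_add_add_sq hu) (hρ f)
        have h2 : ρ f * (1 + σ * l * g f + (σ * l * g f) ^ 2) =
            ρ f + σ * l * (ρ f * g f) + l ^ 2 * (ρ f * g f ^ 2) := by
          rw [mul_pow, mul_pow, hσ2]; ring
        linarith
      · have := Real.add_one_le_exp (σ * l * ∏ i, y i + l ^ 2 * ∏ i, s i)
        linarith
    have h := coeff_tilt_le (Y := fun f => σ * l * g f) hρ hR hm hmass (Q := Q) (x := x)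
      (by rw [coeffP]; exact hp)
    rw [coeffP] at h
    refine le_trans (le_of_eq ?_) h
    have e3 : gradedSum Ω (fun f => ρ f * (σ * l * g f)) =
        PowerSeries.C (σ * l) * gradedSum Ω (fun f => ρ f * g f) := by
      ext z
      rw [PowerSeries.coeff_C_mul, coeff_gradedSum, coeff_gradedSum, mul_sum]
      exact sum_congr rfl fun f _ => by ring
    rw [e3, e1, e0, hRdef, mul_assoc (PowerSeries.C _), mul_assoc (PowerSeries.C _),
      PowerSeries.coeff_C_mul, mul_assoc (∏ i, _), ← pow_mul, ← pow_add]
    congr 4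
    obtain ⟨m', rfl⟩ : ∃ m', m = m' + 1 := ⟨m - 1, by omega⟩
    rw [Nat.add_sub_cancel]
    have : r * (m' + 1) = r * m' + r := by ring
    omega
  have hm0 : (0 : ℝ) < m := by exact_mod_cast hm
  have k1 := key 1 (Or.inl rfl)
  have k2 := key (-1) (Or.inr rfl)
  set c := PowerSeries.coeff x ((∏ i, PowerSeries.mk fun j => w j * h i j) *
        PowerSeries.mk w ^ (n - r)) with hc
  set p := powLaw w n x with hpdef
  have e4 : Q / m = l * (Q / (l * m)) := by field_simp
  rw [e4] at k1 k2
  rw [abs_le]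
  constructor
  · refine le_of_mul_le_mul_left ?_ hl
    nlinarith
  · refine le_of_mul_le_mul_left ?_ hl
    nlinarith

theorem prod_sub_prod_le {ι : Type*} (s : Finset ι) {a b : ι → ℝ} {K ε : ℝ} (hK : 1 ≤ K)
    (hb : ∀ i, 0 ≤ b i) (hba : ∀ i, b i ≤ a i) (ha : ∀ i, a i ≤ K) (hab : ∀ i, a i - b i ≤ ε) :
    ∏ i ∈ s, a i - ∏ i ∈ s, b i ≤ s.card * K ^ s.card * ε := by
  classical
  induction s using Finset.induction_on with
  | empty => simp
  | insert i s hi ih =>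
    rw [prod_insert hi, prod_insert hi, card_insert_of_notMem hi]
    have h1 : ∏ i ∈ s, b i ≤ K ^ s.card := by
      rw [← prod_const]
      exact prod_le_prod (fun i _ => hb i) fun i _ => (hba i).trans (ha i)
    have h2 : 0 ≤ ∏ i ∈ s, b i := prod_nonneg fun i _ => hb i
    have hK0 : 0 ≤ K := by linarith
    have hε : 0 ≤ ε := by have := hab i; have := hba i; linarith
    have ha0 : 0 ≤ a i := (hb i).trans (hba i)
    have h0 : 0 ≤ ∏ i ∈ s, a i - ∏ i ∈ s, b i :=
      sub_nonneg.2 (prod_le_prod (fun i _ => hb i) fun i _ => hba i)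
    calc a i * ∏ i ∈ s, a i - b i * ∏ i ∈ s, b i
        = a i * (∏ i ∈ s, a i - ∏ i ∈ s, b i) + (a i - b i) * ∏ i ∈ s, b i := by ring
      _ ≤ K * (s.card * K ^ s.card * ε) + ε * K ^ s.card := by
          refine add_le_add (mul_le_mul (ha i) ih h0 hK0) (mul_le_mul (hab i) h1 h2 hε)
      _ ≤ K * (s.card * K ^ s.card * ε) + K * (ε * K ^ s.card) := by
          refine add_le_add le_rfl (le_mul_of_one_le_left (by positivity) hK)
      _ = _ := by push_cast; ring

/-- The same for functions which are not bounded, compared with truncations. -/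
theorem abs_coeff_sub_le_of_truncation (hw : IsLaw w) {r m x : ℕ} (hm : 0 < m)
    {h h' : Fin r → ℕ → ℝ} (hh' : ∀ i j, 0 ≤ h' i j) (hle : ∀ i j, h' i j ≤ h i j)
    {y y' s : Fin r → ℝ} (hy : ∀ i, HasSum (fun j => w j * h i j) (y i))
    (hy' : ∀ i, HasSum (fun j => w j * h' i j) (y' i))
    (hs : ∀ i, HasSum (fun j => w j * h' i j ^ 2) (s i)) {l Q K ε : ℝ} (hl : 0 < l)
    (hlh : ∀ f : Fin r → ℕ, l * ∏ i, h' i (f i) ≤ 1) {n : ℕ} (hn : r * m ≤ n)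
    (hp : Real.exp (-Q) ≤ powLaw w n x) (hK : 1 ≤ K) (hyK : ∀ i, y i ≤ K)
    (hε : ∀ i, y i - y' i ≤ ε) :
    |PowerSeries.coeff x ((∏ i, PowerSeries.mk fun j => w j * h i j) *
        PowerSeries.mk w ^ (n - r)) - (∏ i, y i) * powLaw w n x| ≤
      (l * ∏ i, s i + Q / (l * m)) * powLaw w n x + r * K ^ r * ε := by
  have h1 := abs_coeff_block_sub_le hw hm hh' hy' hs hl hlh hn hp
  set A := ∏ i, PowerSeries.mk fun j => w j * h i j with hA
  set B := ∏ i, PowerSeries.mk fun j => w j * h' i j with hB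
  have hcoef := coeff_prod_le (univ : Finset (Fin r))
    (A := fun i => PowerSeries.mk fun j => w j * h' i j)
    (B := fun i => PowerSeries.mk fun j => w j * h i j)
    (fun i j => by simpa using mul_nonneg (hw.nonneg j) (hh' i j))
    (fun i j => by simpa using mul_le_mul_of_nonneg_left (hle i j) (hw.nonneg j))
  have hyy : ∀ i, y' i ≤ y i := fun i => hasSum_le
    (fun j => mul_le_mul_of_nonneg_left (hle i j) (hw.nonneg j)) (hy' i) (hy i)
  have hy0 : ∀ i, 0 ≤ y' i := fun i =>
    (hy' i).nonneg fun j => mul_nonneg (hw.nonneg j) (hh' i j)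
  set τ := ∏ i, y i - ∏ i, y' i with hτ
  have hτ0 : 0 ≤ τ := sub_nonneg.2 (prod_le_prod (fun i _ => hy0 i) fun i _ => hyy i)
  have hτle : τ ≤ r * K ^ r * ε := by
    have := prod_sub_prod_le univ hK hy0 hyy hyK hε
    simpa only [card_univ, Fintype.card_fin] using this
  -- The error of truncation is controlled without conditioning, so it enters as an absolute error
  -- and must later be compared with the small probability of the condition.
  have hAB : MassLE (A - B) τ := by
    refine massLE_of_le (fun j => ?_) (fun j => le_rfl) ?_
    · rw [map_sub, sub_nonneg]; exact hcoef.2 j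
    · simp only [map_sub]
      exact (hasSum_coeff_prod _ fun i _ => by simpa using hy i).sub
        (hasSum_coeff_prod _ fun i _ => by simpa using hy' i)
  have hP : MassLE (PowerSeries.mk w ^ (n - r)) 1 := by simpa using hw.massLE.pow (n - r)
  have h2 := (hAB.mul hP).coeff_le x
  have h3 := (hAB.mul hP).1 x
  rw [sub_mul, map_sub] at h2 h3
  have hp1 := (hw.powLaw n).le_one x
  have hp0 := (hw.powLaw n).nonneg x
  rw [abs_le] at h1 ⊢
  have h4 : 0 ≤ τ * powLaw w n x := mul_nonneg hτ0 hp0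
  have h5 : τ * powLaw w n x ≤ τ := mul_le_of_le_one_right hτ0 hp1
  have h6 : (∏ i, y i) * powLaw w n x = (∏ i, y' i) * powLaw w n x + τ * powLaw w n x := by
    rw [hτ]; ring
  constructor <;> linarith [h1.1, h1.2]

end NatLaw

end

/-! ### Conditional factorial moments -/

noncomputable section

namespace NatLaw

open NonnegSeries Finset

theorem descFactorial_le_factorial_mul_exp (j d : ℕ) :
    (j.descFactorial d : ℝ) ≤ d ! * Real.exp j := by
  have h1 : (j.descFactorial d : ℝ) ≤ (j : ℝ) ^ d := by exact_mod_cast Nat.descFactorial_le_pow j d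
  have h2 := Real.pow_div_factorial_le_exp (j : ℝ) j.cast_nonneg d
  rw [div_le_iff₀ (by positivity)] at h2
  linarith

/-- For j ≥ 4d every factor of the falling factorial of order 2d is at least j/2; for smaller j the
constant suffices. So second moments are bounded by factorial moments. -/
theorem descFactorial_sq_le (j d : ℕ) :
    (j.descFactorial d : ℝ) ^ 2 ≤ 4 ^ d * (j.descFactorial (2 * d) : ℝ) + (4 * d) ^ (2 * d) := by
  have h1 : (j.descFactorial d : ℝ) ^ 2 ≤ (j : ℝ) ^ (2 * d) := by
    rw [mul_comm 2 d, pow_mul]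
    gcongr
    exact_mod_cast Nat.descFactorial_le_pow j d
  refine h1.trans ?_
  rcases le_total j (4 * d) with h | h
  · have h2 : (j : ℝ) ≤ 4 * d := by exact_mod_cast h
    calc (j : ℝ) ^ (2 * d) ≤ (4 * d) ^ (2 * d) := by gcongr
      _ ≤ _ := le_add_of_nonneg_left (by positivity)
  · have h2 : (j + 1 - 2 * d) ^ (2 * d) ≤ j.descFactorial (2 * d) :=
      Nat.pow_sub_le_descFactorial j (2 * d)
    have h3 : j ≤ 2 * (j + 1 - 2 * d) := by omega
    have h4 : j ^ (2 * d) ≤ 4 ^ d * j.descFactorial (2 * d) := by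
      calc j ^ (2 * d) ≤ (2 * (j + 1 - 2 * d)) ^ (2 * d) := Nat.pow_le_pow_left h3 _
        _ = 4 ^ d * (j + 1 - 2 * d) ^ (2 * d) := by rw [mul_pow, pow_mul 2 2 d]; norm_num
        _ ≤ _ := Nat.mul_le_mul_left _ h2
    have h5 : (j : ℝ) ^ (2 * d) ≤ 4 ^ d * (j.descFactorial (2 * d) : ℝ) := by exact_mod_cast h4
    linarith [(by positivity : (0 : ℝ) ≤ (4 * d : ℝ) ^ (2 * d))]

/-- The falling factorial moments of several variables, conditionally on the sum, for one `n`. -/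
theorem abs_coeff_descFactorial_sub_le {w : ℕ → ℝ} {n x r D : ℕ} {M μ C Q X l κ₂ : ℝ}
    {y : ℕ → ℝ} (hset : Setup w n M μ C x) (hX : 1 ≤ X)
    (hy : ∀ d, HasSum (fun j : ℕ => w j * (j.descFactorial d : ℝ)) (y d)) {d : Fin r → ℕ}
    (hd : ∑ i, d i = D) (hl : 0 < l) (hlX : l * X ^ D ≤ 1) (hC : 0 ≤ C * M)
    (hκ : ∀ i, 4 ^ d i * y (2 * d i) + (4 * d i) ^ (2 * d i) ≤ κ₂ * M ^ (2 * d i))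
    {m : ℕ} (hm : 0 < m) (hn : r * m ≤ n) (hp : Real.exp (-Q) ≤ powLaw w n x) :
    |PowerSeries.coeff x ((∏ i, PowerSeries.mk fun j => w j * (j.descFactorial (d i) : ℝ)) *
        PowerSeries.mk w ^ (n - r)) - (∏ i, y (d i)) * powLaw w n x| ≤
      (l * (κ₂ ^ r * M ^ (2 * D)) + Q / (l * m)) * powLaw w n x +
        r * (D ! * Real.exp (C * M)) ^ r * (D ! * Real.exp (C * M - 3 * X)) := by
  classical
  have hw := hset.law
  obtain ⟨A, hA, hAC⟩ := hset.hexp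
  have hdD : ∀ i, d i ≤ D := fun i => by
    rw [← hd]; exact single_le_sum (f := d) (fun _ _ => Nat.zero_le _) (mem_univ i)
  have hfac : ∀ i, ((d i)! : ℝ) ≤ D ! := fun i => by exact_mod_cast Nat.factorial_le (hdD i)
  -- Cutting at X bounds the product by X^D, as the tilt with parameter l requires; what is cut off
  -- is exponentially small by the exponential moment.
  set h' : Fin r → ℕ → ℝ := fun i j => if (j : ℝ) ≤ X then (j.descFactorial (d i) : ℝ) else 0
    with hh'
  have hh0 : ∀ i j, 0 ≤ h' i j := fun i j => by simp only [hh']; split_ifs <;> positivity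
  have hle : ∀ i (j : ℕ), h' i j ≤ (j.descFactorial (d i) : ℝ) := fun i j => by
    simp only [hh']; split_ifs <;> simp
  have hhX : ∀ i j, h' i j ≤ X ^ d i := fun i j => by
    simp only [hh']
    split_ifs with hj
    · calc (j.descFactorial (d i) : ℝ) ≤ (j : ℝ) ^ d i := by
            exact_mod_cast Nat.descFactorial_le_pow j (d i)
        _ ≤ _ := by gcongr
    · positivity
  have hsum' : ∀ i, Summable fun j => w j * h' i j := fun i =>
    Summable.of_nonneg_of_le (fun j => mul_nonneg (hw.nonneg j) (hh0 i j))
      (fun j => mul_le_mul_of_nonneg_left (hle i j) (hw.nonneg j)) (hy (d i)).summable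
  have hsq : ∀ i j, w j * h' i j ^ 2 ≤ 4 ^ d i * (w j * (j.descFactorial (2 * d i) : ℝ)) +
      (4 * d i) ^ (2 * d i) * w j := fun i j => by
    have h1 : h' i j ^ 2 ≤ (j.descFactorial (d i) : ℝ) ^ 2 :=
      pow_le_pow_left₀ (hh0 i j) (hle i j) 2
    have h2 := mul_le_mul_of_nonneg_left (h1.trans (descFactorial_sq_le j (d i))) (hw.nonneg j)
    linarith
  have hb : ∀ i, HasSum (fun j : ℕ => 4 ^ d i * (w j * (j.descFactorial (2 * d i) : ℝ)) +
      (4 * d i : ℝ) ^ (2 * d i) * w j) (4 ^ d i * y (2 * d i) + (4 * d i) ^ (2 * d i) * 1) :=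
    fun i => ((hy _).mul_left _).add (hw.hasSum.mul_left _)
  have hsqs : ∀ i, Summable fun j => w j * h' i j ^ 2 := fun i =>
    Summable.of_nonneg_of_le (fun j => mul_nonneg (hw.nonneg j) (by positivity)) (hsq i)
      (hb i).summable
  have hs_le : ∀ i, ∑' j, w j * h' i j ^ 2 ≤ κ₂ * M ^ (2 * d i) := fun i => by
    have := hasSum_le (hsq i) (hsqs i).hasSum (hb i)
    rw [mul_one] at this
    exact this.trans (hκ i)
  have hs_nn : ∀ i, 0 ≤ ∑' j, w j * h' i j ^ 2 := fun i =>
    tsum_nonneg fun j => mul_nonneg (hw.nonneg j) (by positivity)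
  have hA0 : 0 ≤ A := hA.nonneg fun j => mul_nonneg (hw.nonneg j) (Real.exp_pos _).le
  have hyK : ∀ i, y (d i) ≤ D ! * Real.exp (C * M) := fun i => by
    have h1 : y (d i) ≤ D ! * A := hasSum_le (fun j => by
      have h2 := descFactorial_le_factorial_mul_exp j (d i)
      have h3 : Real.exp j ≤ Real.exp (4 * j) := Real.exp_le_exp.2 (by
        have : (0 : ℝ) ≤ j := j.cast_nonneg
        linarith)
      have h4 : (j.descFactorial (d i) : ℝ) ≤ D ! * Real.exp (4 * j) :=
        h2.trans (mul_le_mul (hfac i) h3 (Real.exp_pos _).le (by positivity))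
      calc w j * (j.descFactorial (d i) : ℝ) ≤ w j * (D ! * Real.exp (4 * j)) :=
            mul_le_mul_of_nonneg_left h4 (hw.nonneg j)
        _ = D ! * (w j * Real.exp (4 * j)) := by ring) (hy (d i)) (hA.mul_left _)
    exact h1.trans (by gcongr)
  have hε : ∀ i, y (d i) - ∑' j, w j * h' i j ≤ D ! * Real.exp (C * M - 3 * X) := fun i => by
    have h1 : y (d i) - ∑' j, w j * h' i j ≤ D ! * Real.exp (-(3 * X)) * A :=
      hasSum_le (fun j => by
        simp only [hh']
        split_ifs with hj
        · rw [sub_self]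
          have := hw.nonneg j
          positivity
        · rw [not_le] at hj
          have h2 := descFactorial_le_factorial_mul_exp j (d i)
          have h3 : Real.exp j ≤ Real.exp (-(3 * X)) * Real.exp (4 * j) := by
            rw [← Real.exp_add]; exact Real.exp_le_exp.2 (by linarith)
          have h4 : (j.descFactorial (d i) : ℝ) ≤
              D ! * (Real.exp (-(3 * X)) * Real.exp (4 * j)) :=
            h2.trans (mul_le_mul (hfac i) h3 (Real.exp_pos _).le (by positivity))
          have h5 := mul_le_mul_of_nonneg_left h4 (hw.nonneg j)
          rw [mul_zero, sub_zero]
          refine h5.trans (le_of_eq (by ring))) ((hy (d i)).sub (hsum' i).hasSum) (hA.mul_left _)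
    refine h1.trans ?_
    rw [sub_eq_add_neg, Real.exp_add, mul_assoc, mul_comm (Real.exp (C * M))]
    gcongr
  have hmain := abs_coeff_sub_le_of_truncation hw hm (h := fun i j => (j.descFactorial (d i) : ℝ))
    hh0 hle (fun i => hy (d i)) (fun i => (hsum' i).hasSum) (fun i => (hsqs i).hasSum) hl
    (fun f => by
      refine le_trans (mul_le_mul_of_nonneg_left ?_ hl.le) hlX
      rw [← hd, ← prod_pow_eq_pow_sum]
      exact prod_le_prod (fun i _ => hh0 i _) fun i _ => hhX i _) hn hp
    (K := D ! * Real.exp (C * M)) (by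
      have h1 : (1 : ℝ) ≤ D ! := by exact_mod_cast Nat.one_le_iff_ne_zero.2 (Nat.factorial_ne_zero D)
      have h2 : 1 ≤ Real.exp (C * M) := Real.one_le_exp hC
      nlinarith) hyK hε
  refine hmain.trans ?_
  have hprod : ∏ i, ∑' j, w j * h' i j ^ 2 ≤ κ₂ ^ r * M ^ (2 * D) := by
    calc ∏ i, ∑' j, w j * h' i j ^ 2 ≤ ∏ i : Fin r, κ₂ * M ^ (2 * d i) :=
          prod_le_prod (fun i _ => hs_nn i) fun i _ => hs_le i
      _ = κ₂ ^ r * M ^ (2 * D) := by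
        rw [prod_mul_distrib, prod_pow_eq_pow_sum, ← mul_sum, hd]; simp
  have hp0 := (hw.powLaw n).nonneg x
  gcongr

/-- A sequence of laws to which the moment computations apply. -/
structure GibbsSetup (w : ℕ → ℕ → ℝ) (M μ : ℕ → ℝ) (x : ℕ → ℕ) (C κ : ℝ) (y : ℕ → ℕ → ℝ) :
    Prop where
  hC : 1 ≤ C
  hκ : 0 < κ
  hset : ∀ᶠ n in atTop, Setup (w n) n (M n) (μ n) C (x n)
  hM : ∀ᶠ n : ℕ in atTop, 1 ≤ M n ∧ M n ≤ C * (n : ℝ) ^ (1 - κ)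
  hlow : ∀ c : ℝ, 0 < c → ∀ᶠ n : ℕ in atTop,
    Real.exp (-(M n * (n : ℝ) ^ c)) ≤ powLaw (w n) n (x n)
  hy : ∀ᶠ n in atTop, ∀ d, HasSum (fun j : ℕ => w n j * (j.descFactorial d : ℝ)) (y n d)
  hyM : ∀ d, ∃ K : ℝ, ∀ᶠ n in atTop, y n d ≤ K * M n ^ d

/-- The conditional falling factorial moments are close to the unconditional ones. -/
theorem GibbsSetup.moment {w : ℕ → ℕ → ℝ} {M μ : ℕ → ℝ} {x : ℕ → ℕ} {C κ : ℝ} {y : ℕ → ℕ → ℝ}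
    (h : GibbsSetup w M μ x C κ y) {r : ℕ} (d : Fin r → ℕ) {η : ℝ} (hη : 0 < η) :
    ∀ᶠ n in atTop, |PowerSeries.coeff (x n)
        ((∏ i, PowerSeries.mk fun j => w n j * (j.descFactorial (d i) : ℝ)) *
          PowerSeries.mk (w n) ^ (n - r)) - (∏ i, y n (d i)) * powLaw (w n) n (x n)| ≤
      η * M n ^ (∑ i, d i) * powLaw (w n) n (x n) := by
  set D := ∑ i, d i with hD
  have hC := h.hC
  have hκ := h.hκ
  -- Put N = n^b, X = M N and l = 1/(N X^D). Relative to M^D, the variance term is N^(-(D+1)) up to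
  -- constants; the cost of conditioning is of order M n^(b/2) N^(D+1)/n, which vanishes because M =
  -- O(n^(1-κ)) and N^(D+1) = n^(κ/4). The error of truncation is of order exp(O(M) - 3MN), which
  -- beats the probability exp(-M n^(b/2)).
  set b := κ / (4 * (D + 1)) with hb
  have hb0 : 0 < b := by positivity
  have hbD : b * (D + 1) = κ / 4 := by rw [hb]; field_simp
  choose K hK using h.hyM
  obtain ⟨κ₂, hκ2, hκ₂⟩ : ∃ κ₂ : ℝ, 0 < κ₂ ∧
      ∀ i, 4 ^ d i * |K (2 * d i)| + (4 * d i) ^ (2 * d i) ≤ κ₂ := by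
    refine ⟨∑ i, (4 ^ d i * |K (2 * d i)| + (4 * d i) ^ (2 * d i)) + 1, by positivity, fun i => ?_⟩
    have := single_le_sum (f := fun i => (4 : ℝ) ^ d i * |K (2 * d i)| + (4 * d i) ^ (2 * d i))
      (fun i _ => by positivity) (mem_univ i)
    linarith
  have hKall : ∀ᶠ n in atTop, ∀ i, y n (2 * d i) ≤ K (2 * d i) * M n ^ (2 * d i) :=
    eventually_all.2 fun i => hK _
  have t1 : ∀ᶠ n : ℕ in atTop, κ₂ ^ r ≤ η / 3 * (n : ℝ) ^ b := by
    filter_upwards [(tendsto_natCast_rpow hb0).eventually_ge_atTop (κ₂ ^ r / (η / 3))] with n hn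
    rw [div_le_iff₀ (by positivity)] at hn; linarith
  have t2 : ∀ᶠ n : ℕ in atTop, 2 * (r + 1) * C ≤ η / 3 * (n : ℝ) ^ (κ / 2) := by
    filter_upwards [(tendsto_natCast_rpow (half_pos hκ)).eventually_ge_atTop
      (2 * (r + 1) * C / (η / 3))] with n hn
    rw [div_le_iff₀ (by positivity)] at hn; linarith
  have t3 : ∀ᶠ n : ℕ in atTop, r * (D ! : ℝ) ^ r * D ! ≤ η / 3 * (n : ℝ) ^ b := by
    filter_upwards [(tendsto_natCast_rpow hb0).eventually_ge_atTop
      (r * (D ! : ℝ) ^ r * D ! / (η / 3))] with n hn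
    rw [div_le_iff₀ (by positivity)] at hn; linarith
  filter_upwards [h.hset, h.hM, h.hlow (b / 2) (half_pos hb0), h.hy, hKall, t1, t2, t3,
    eventually_ge_atTop (2 * (r + 1)), (tendsto_natCast_rpow hb0).eventually_ge_atTop
      ((r + 1) * C)] with n hset hM hlow hy hK t1 t2 t3 hn t4
  have hn1 : (1 : ℝ) ≤ n := by
    have : 1 ≤ n := by omega
    exact_mod_cast this
  have hn0 : (0 : ℝ) < n := by linarith
  have hM0 : 0 < M n := by linarith [hM.1]
  have hnb1 : 1 ≤ (n : ℝ) ^ b := Real.one_le_rpow hn1 hb0.le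
  have hnb0 : 0 < (n : ℝ) ^ b := by linarith
  set N := (n : ℝ) ^ b with hN
  set X := M n * N with hXdef
  have hX1 : 1 ≤ X := by
    calc (1 : ℝ) = 1 * 1 := by norm_num
      _ ≤ M n * N := mul_le_mul hM.1 hnb1 zero_le_one hM0.le
  have hX0 : 0 < X := by linarith
  set l := (N * X ^ D)⁻¹ with hldef
  have hl0 : 0 < l := by positivity
  set m := n / (r + 1) with hm
  have hm0 : 0 < m := Nat.div_pos (by omega) (by omega)
  have hmn : r * m ≤ n := by
    have h1 : (r + 1) * m ≤ n := Nat.mul_div_le n (r + 1)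
    have h2 : (r + 1) * m = r * m + m := by ring
    omega
  have hmge : (n : ℝ) ≤ 2 * (r + 1) * m := by
    have h1 : n < (r + 1) * (m + 1) := Nat.lt_mul_div_succ n (by omega)
    have h2 : (r + 1) * (m + 1) ≤ 2 * (r + 1) * m := by nlinarith
    exact_mod_cast (h1.le.trans h2)
  have hNc : (n : ℝ) ^ (b / 2) ≤ N := Real.rpow_le_rpow_of_exponent_le hn1 (by linarith)
  have hmain := abs_coeff_descFactorial_sub_le hset hX1 hy (d := d) hD.symm hl0
    (by
      rw [hldef, mul_inv, mul_assoc, inv_mul_cancel₀ (by positivity), mul_one]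
      exact inv_le_one_of_one_le₀ hnb1) (by nlinarith) (κ₂ := κ₂)
    (fun i => by
      have hMd : 1 ≤ M n ^ (2 * d i) := one_le_pow₀ hM.1
      have h1 : y n (2 * d i) ≤ |K (2 * d i)| * M n ^ (2 * d i) :=
        (hK i).trans (mul_le_mul_of_nonneg_right (le_abs_self _) (by positivity))
      have h2 : (4 * d i : ℝ) ^ (2 * d i) ≤ (4 * d i : ℝ) ^ (2 * d i) * M n ^ (2 * d i) :=
        le_mul_of_one_le_right (by positivity) hMd
      have h3 := mul_le_mul_of_nonneg_left h1 (by positivity : (0 : ℝ) ≤ 4 ^ d i)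
      have h4 := mul_le_mul_of_nonneg_right (hκ₂ i) (by positivity : 0 ≤ M n ^ (2 * d i))
      linarith) hm0 hmn hlow
  refine hmain.trans ?_
  have hp0 := (hset.law.powLaw n).nonneg (x n)
  have hXD : X ^ D = M n ^ D * N ^ D := mul_pow _ _ _
  have a1 : l * (κ₂ ^ r * M n ^ (2 * D)) ≤ η / 3 * M n ^ D := by
    rw [hldef, hXD, inv_mul_le_iff₀ (by positivity)]
    have hND : 1 ≤ N ^ D := one_le_pow₀ hnb1
    calc κ₂ ^ r * M n ^ (2 * D) ≤ η / 3 * N * M n ^ (2 * D) := by gcongr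
      _ ≤ η / 3 * N * M n ^ (2 * D) * N ^ D := le_mul_of_one_le_right (by positivity) hND
      _ = _ := by ring
  have a2 : M n * (n : ℝ) ^ (b / 2) / (l * m) ≤ η / 3 * M n ^ D := by
    have hm0' : (0 : ℝ) < m := by exact_mod_cast hm0
    rw [div_le_iff₀ (by positivity)]
    have e1 : M n * (n : ℝ) ^ (b / 2) * (N * N ^ D) ≤ η / 3 * m := by
      have e2 : (n : ℝ) ^ (b / 2) * (N * N ^ D) ≤ (n : ℝ) ^ (κ / 2) := by
        calc (n : ℝ) ^ (b / 2) * (N * N ^ D) ≤ N * (N * N ^ D) := by gcongr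
          _ = (n : ℝ) ^ (b * (D + 2)) := by
            rw [hN, Real.rpow_mul hn0.le, ← Real.rpow_natCast, show (D : ℝ) + 2 = D + 1 + 1 by ring,
              Real.rpow_add hnb0, Real.rpow_add hnb0, Real.rpow_one]
            ring
          _ ≤ _ := by
            refine Real.rpow_le_rpow_of_exponent_le hn1 ?_
            have : b ≤ κ / 4 := by
              rw [← hbD]; exact le_mul_of_one_le_right hb0.le (by
                have : (0 : ℝ) ≤ D := D.cast_nonneg
                linarith)
            linarith
      have e3 : (n : ℝ) ^ (1 - κ) * (n : ℝ) ^ (κ / 2) * (n : ℝ) ^ (κ / 2) = n := by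
        rw [← Real.rpow_add hn0, ← Real.rpow_add hn0]
        rw [show 1 - κ + κ / 2 + κ / 2 = 1 by ring, Real.rpow_one]
      have e4 : M n * (n : ℝ) ^ (b / 2) * (N * N ^ D) ≤
          C * (n : ℝ) ^ (1 - κ) * (n : ℝ) ^ (κ / 2) := by
        rw [mul_assoc]
        exact mul_le_mul hM.2 e2 (by positivity) (by positivity)
      have e5 := mul_le_mul_of_nonneg_left t2
        (by positivity : 0 ≤ (n : ℝ) ^ (1 - κ) * (n : ℝ) ^ (κ / 2))
      have e6 : (n : ℝ) ^ (1 - κ) * (n : ℝ) ^ (κ / 2) * (η / 3 * (n : ℝ) ^ (κ / 2)) = η / 3 * n := by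
        calc _ = η / 3 * ((n : ℝ) ^ (1 - κ) * (n : ℝ) ^ (κ / 2) * (n : ℝ) ^ (κ / 2)) := by ring
          _ = _ := by rw [e3]
      rw [e6] at e5
      have e7 := mul_le_mul_of_nonneg_left hmge (by positivity : 0 ≤ η / 3)
      have e8 : 2 * ((r : ℝ) + 1) * (M n * (n : ℝ) ^ (b / 2) * (N * N ^ D)) ≤
          2 * (r + 1) * (η / 3 * m) := by
        calc _ ≤ 2 * ((r : ℝ) + 1) * (C * (n : ℝ) ^ (1 - κ) * (n : ℝ) ^ (κ / 2)) := by gcongr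
          _ = (n : ℝ) ^ (1 - κ) * (n : ℝ) ^ (κ / 2) * (2 * (r + 1) * C) := by ring
          _ ≤ η / 3 * n := e5
          _ ≤ η / 3 * (2 * (r + 1) * m) := e7
          _ = _ := by ring
      exact le_of_mul_le_mul_left e8 (by positivity)
    have e9 : η / 3 * M n ^ D * (l * m) = η / 3 * m / (N * N ^ D) := by
      rw [hldef, hXD]; field_simp
    rw [e9, le_div_iff₀ (by positivity)]
    exact e1
  have a3 : r * (D ! * Real.exp (C * M n)) ^ r * (D ! * Real.exp (C * M n - 3 * X)) ≤
      η / 3 * M n ^ D * powLaw (w n) n (x n) := by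
    have e1 : (r : ℝ) * (D ! * Real.exp (C * M n)) ^ r * (D ! * Real.exp (C * M n - 3 * X)) =
        r * (D ! : ℝ) ^ r * D ! * Real.exp ((r + 1) * (C * M n) - 3 * X) := by
      rw [mul_pow, ← Real.exp_nat_mul, show ((r : ℝ) + 1) * (C * M n) - 3 * X =
        r * (C * M n) + (C * M n - 3 * X) by ring, Real.exp_add]
      ring
    rw [e1]
    have e2 : Real.exp ((r + 1) * (C * M n) - 3 * X) ≤
        Real.exp (-N) * Real.exp (-(M n * (n : ℝ) ^ (b / 2))) := by
      rw [← Real.exp_add]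
      refine Real.exp_le_exp.2 ?_
      have e3 : (r + 1) * C * M n ≤ N * M n := mul_le_mul_of_nonneg_right t4 hM0.le
      have e4 : M n * (n : ℝ) ^ (b / 2) ≤ M n * N := mul_le_mul_of_nonneg_left hNc hM0.le
      have e5 : N ≤ M n * N := le_mul_of_one_le_left hnb0.le hM.1
      rw [hXdef]; linarith
    have e3 : N * Real.exp (-N) ≤ 1 := by
      have h1 := Real.add_one_le_exp N
      rw [Real.exp_neg, ← div_eq_mul_inv, div_le_one (Real.exp_pos _)]; linarith
    calc _ ≤ η / 3 * N * (Real.exp (-N) * Real.exp (-(M n * (n : ℝ) ^ (b / 2)))) := by gcongr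
      _ = η / 3 * (N * Real.exp (-N)) * Real.exp (-(M n * (n : ℝ) ^ (b / 2))) := by ring
      _ ≤ η / 3 * 1 * powLaw (w n) n (x n) := by gcongr
      _ ≤ η / 3 * M n ^ D * powLaw (w n) n (x n) := by gcongr; exact one_le_pow₀ hM.1
  have a4 := mul_le_mul_of_nonneg_right (add_le_add a1 a2) hp0
  linarith

end NatLaw

end

/-! ### Weights of multigraphs with prescribed edges -/

noncomputable section

namespace NonnegSeries

open PowerSeries Finset

theorem derivative_prod {V : Type*} [DecidableEq V] (s : Finset V) (A : V → PowerSeries ℝ) :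
    PowerSeries.derivative ℝ (∏ v ∈ s, A v) =
      ∑ v ∈ s, PowerSeries.derivative ℝ (A v) * ∏ u ∈ s.erase v, A u := by
  induction s using Finset.induction_on with
  | empty => simp
  | insert a s ha ih =>
    rw [prod_insert ha, Derivation.leibniz, ih, sum_insert ha, erase_insert ha, smul_eq_mul,
      smul_eq_mul, add_comm, mul_comm]
    congr 1
    rw [mul_sum]
    refine sum_congr rfl fun v hv => ?_
    have hva : v ≠ a := fun h => ha (h ▸ hv)
    rw [erase_insert_of_ne hva.symm, prod_insert fun h => ha (mem_of_mem_erase h)]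
    ring

/-- The product rule for exponential generating functions. Splitting off the value u of the first
point shifts F u by one, which differentiates its generating function; summing over u gives the
derivative of the product. Hence the induction has to run over all F. -/
theorem sum_fin_prod_count {V : Type*} [Fintype V] [DecidableEq V] (N : ℕ) :
    ∀ F : V → ℕ → ℝ, ∑ a : Fin N → V, ∏ v, F v (∑ i, if a i = v then 1 else 0) =
      N ! * coeff N (∏ v, PowerSeries.mk fun i => F v i / (i ! : ℝ)) := by
  induction N with
  | zero =>
    intro F
    rw [coeff_zero_eq_constantCoeff_apply, map_prod]
    simp [← coeff_zero_eq_constantCoeff_apply]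
  | succ N ih =>
    intro F
    have h1 : ∑ a : Fin (N + 1) → V, ∏ v, F v (∑ i, if a i = v then 1 else 0) =
        ∑ u : V, ∑ a : Fin N → V,
          ∏ v, Function.update F u (fun i => F u (i + 1)) v (∑ i, if a i = v then 1 else 0) := by
      rw [← Fintype.sum_prod_type']
      refine (Fintype.sum_equiv (Fin.consEquiv fun _ : Fin (N + 1) => V) _ _ fun p => ?_).symm
      refine prod_congr rfl fun v _ => ?_
      rw [Fin.sum_univ_succ]
      simp only [Fin.consEquiv_apply, Fin.cons_zero, Fin.cons_succ]
      by_cases h : p.1 = v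
      · subst h; simp [add_comm]
      · rw [Function.update_of_ne (Ne.symm h)]; simp [h]
    rw [h1]
    have h2 : (N + 1 : ℝ) * coeff (N + 1) (∏ v, PowerSeries.mk fun i => F v i / (i ! : ℝ)) =
        coeff N (PowerSeries.derivative ℝ (∏ v, PowerSeries.mk fun i => F v i / (i ! : ℝ))) := by
      rw [PowerSeries.coeff_derivative, mul_comm]
    rw [Nat.factorial_succ]
    push_cast
    rw [mul_comm ((N : ℝ) + 1), mul_assoc, h2, derivative_prod, map_sum, mul_sum]
    refine sum_congr rfl fun u _ => ?_
    rw [ih]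
    congr 2
    rw [← mul_prod_erase univ _ (mem_univ u), Function.update_self]
    congr 1
    · ext i
      rw [PowerSeries.coeff_derivative, coeff_mk, coeff_mk, Nat.factorial_succ]
      push_cast
      field_simp
    · refine prod_congr rfl fun v hv => ?_
      rw [Function.update_of_ne (ne_of_mem_erase hv)]

/-- Sums over all functions of a weight that depends on the sizes of the fibres. -/
theorem sum_prod_count {ι V : Type*} [Fintype ι] [DecidableEq ι] [Fintype V] [DecidableEq V]
    (F : V → ℕ → ℝ) : ∑ a : ι → V, ∏ v, F v (∑ i, if a i = v then 1 else 0) =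
      (Fintype.card ι)! *
        coeff (Fintype.card ι) (∏ v, PowerSeries.mk fun i => F v i / (i ! : ℝ)) := by
  rw [← sum_fin_prod_count]
  refine Fintype.sum_equiv (Equiv.arrowCongr (Fintype.equivFin ι) (Equiv.refl V)) _ _ fun a => ?_
  refine prod_congr rfl fun v _ => congrArg _ ?_
  exact Fintype.sum_equiv (Fintype.equivFin ι) _ _ fun i => by simp

/-- With j = d + i one has 1/i! = (j)_d / j!, so a vertex which already has d half-edges contributes
a falling factorial and a factor X^d. -/
theorem coeff_prod_shift {V : Type*} [Fintype V] (δ : ℕ → ℝ) (d : V → ℕ) (N : ℕ) :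
    coeff N (∏ v, PowerSeries.mk fun i => δ (d v + i) / (i ! : ℝ)) =
      coeff (N + ∑ v, d v)
        (∏ v, PowerSeries.mk fun j => δ j * (j.descFactorial (d v) : ℝ) / (j ! : ℝ)) := by
  have h : ∀ v, (PowerSeries.mk fun j => δ j * (j.descFactorial (d v) : ℝ) / (j ! : ℝ)) =
      X ^ d v * PowerSeries.mk fun i => δ (d v + i) / (i ! : ℝ) := fun v => by
    ext j
    rw [coeff_X_pow_mul', coeff_mk]
    split_ifs with hj
    · obtain ⟨i, rfl⟩ := Nat.exists_eq_add_of_le hj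
      rw [coeff_mk, Nat.add_sub_cancel_left]
      have h1 := Nat.factorial_mul_descFactorial hj
      rw [Nat.add_sub_cancel_left] at h1
      have h2 : ((d v + i)! : ℝ) = i ! * ((d v + i).descFactorial (d v) : ℝ) := by
        exact_mod_cast h1.symm
      have h3 : ((d v + i).descFactorial (d v) : ℝ) ≠ 0 := by
        have : (d v + i).descFactorial (d v) ≠ 0 := by
          rw [Ne, Nat.descFactorial_eq_zero_iff_lt]; omega
        exact_mod_cast this
      rw [h2]; field_simp
    · rw [Nat.descFactorial_of_lt (by omega)]; simp
  rw [prod_congr rfl fun v _ => h v, prod_mul_distrib, prod_pow_eq_pow_sum,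
    coeff_X_pow_mul]

theorem coeff_prod_scale {V : Type*} [Fintype V] (c q : ℝ) (a : V → ℕ → ℝ) (N : ℕ) :
    coeff N (∏ v, PowerSeries.mk fun j => c * q ^ j * a v j) =
      c ^ Fintype.card V * q ^ N * coeff N (∏ v, PowerSeries.mk (a v)) := by
  have h : ∀ v, (PowerSeries.mk fun j => c * q ^ j * a v j) =
      PowerSeries.C c * rescale q (PowerSeries.mk (a v)) := fun v => by
    ext j; rw [coeff_C_mul, coeff_rescale, coeff_mk, coeff_mk, mul_assoc]
  rw [prod_congr rfl fun v _ => h v, prod_mul_distrib, prod_const, ← map_prod, ← map_pow,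
    coeff_C_mul, coeff_rescale, card_univ, mul_assoc]

end NonnegSeries

namespace Multigraph

open Finset

variable {V E : Type*} [Fintype V] [DecidableEq V]

/-- Sums over all multigraphs of a weight that depends on the degrees. -/
theorem sum_prod_degree [Fintype E] [DecidableEq E] (F : V → ℕ → ℝ) :
    ∑ G : Multigraph V E, ∏ v, F v (G.degree v) = (2 * Fintype.card E)! *
      PowerSeries.coeff (2 * Fintype.card E)
        (∏ v, PowerSeries.mk fun i => F v i / (i ! : ℝ)) := by
  -- A multigraph is a map from its half-edges to the vertices; degrees are sizes of fibres, so a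
  -- loop counts twice.
  have h := NonnegSeries.sum_prod_count (ι := E ⊕ E) F
  rw [Fintype.card_sum, ← two_mul] at h
  rw [← h]
  refine Fintype.sum_equiv ((Equiv.arrowProdEquivProdArrow E (fun _ => V) (fun _ => V)).trans
    (Equiv.sumArrowEquivProdArrow E E V).symm) _ _ fun G => ?_
  refine prod_congr rfl fun v _ => congrArg _ ?_
  rw [Fintype.sum_sum_type, degree, sum_add_distrib]
  rfl

/-- The degrees in the multigraph formed by some of the edges. -/
def partialDegree (B : Finset E) (G : Multigraph V E) (v : V) : ℕ :=
  ∑ e ∈ B, ((if (G e).1 = v then 1 else 0) + (if (G e).2 = v then 1 else 0))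

theorem sum_partialDegree (B : Finset E) (G : Multigraph V E) :
    ∑ v, partialDegree B G v = 2 * B.card := by
  simp only [partialDegree]
  rw [sum_comm]
  simp only [sum_add_distrib, sum_ite_eq, mem_univ, if_true]
  simp [two_mul]

/-- The total weight of the multigraphs with some prescribed edges. -/
theorem sum_weight_of_prescribed [Fintype E] [DecidableEq E] (δ : ℕ → ℝ) (B : Finset E) (G₀ : Multigraph V E) :
    ∑ G : Multigraph V E, (if ∀ e ∈ B, G e = G₀ e then G.weight δ else 0) =
      (2 * (Fintype.card E - B.card))! * PowerSeries.coeff (2 * Fintype.card E)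
        (∏ v, PowerSeries.mk fun j =>
          δ j * (j.descFactorial (partialDegree B G₀ v) : ℝ) / (j ! : ℝ)) := by
  have hcard : Fintype.card {e // e ∉ B} = Fintype.card E - B.card := by
    rw [Fintype.card_subtype_compl]; simp
  have hle : B.card ≤ Fintype.card E := card_le_univ B
  have e2 : 2 * Fintype.card E =
      2 * (Fintype.card E - B.card) + ∑ v, partialDegree B G₀ v := by
    rw [sum_partialDegree]; omega
  -- The other edges form an unrestricted multigraph in which the prescribed ones only shift the
  -- degrees.
  rw [e2, ← NonnegSeries.coeff_prod_shift, ← hcard]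
  rw [← sum_prod_degree (E := {e // e ∉ B}) fun v i => δ (partialDegree B G₀ v + i)]
  set T := Equiv.piEquivPiSubtypeProd (fun e => e ∈ B) (fun _ => V × V) with hT
  rw [← Fintype.sum_equiv T.symm (fun p => if ∀ e ∈ B, T.symm p e = G₀ e
    then weight δ (V := V) (E := E) (T.symm p) else 0) _ fun p => rfl]
  rw [Fintype.sum_prod_type, sum_comm]
  refine sum_congr rfl fun b _ => ?_
  have hcond : ∀ a, (∀ e ∈ B, T.symm (a, b) e = G₀ e) ↔ a = fun e : {e // e ∈ B} => G₀ e := fun a => by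
    constructor
    · intro h; ext1 e
      have := h e e.2
      simpa [hT, Equiv.piEquivPiSubtypeProd] using this
    · rintro rfl e he
      simp [hT, Equiv.piEquivPiSubtypeProd, he]
  simp only [hcond, sum_ite_eq', mem_univ, if_true]
  refine prod_congr rfl fun v _ => congrArg δ ?_
  rw [degree, ← Fintype.sum_subtype_add_sum_subtype (fun e => e ∈ B), partialDegree,
    ← sum_coe_sort B, degree]
  congr 1
  · refine sum_congr (by ext; simp) fun e _ => ?_
    simp [hT, Equiv.piEquivPiSubtypeProd]
  · refine sum_congr rfl fun e _ => ?_
    simp [hT, Equiv.piEquivPiSubtypeProd, e.2]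

/-- The same, in terms of the law with weights proportional to `δ_j χ ^ j / j!`. -/
theorem sum_weight_of_prescribed_eq [Fintype E] [DecidableEq E] {δ w : ℕ → ℝ} {χ c : ℝ}
    (hw : ∀ j, δ j / (j ! : ℝ) = c * χ⁻¹ ^ j * w j) (B : Finset E)
    (G₀ : Multigraph V E) :
    ∑ G : Multigraph V E, (if ∀ e ∈ B, G e = G₀ e then G.weight δ else 0) =
      c ^ Fintype.card V * χ⁻¹ ^ (2 * Fintype.card E) * (2 * (Fintype.card E - B.card))! *
        PowerSeries.coeff (2 * Fintype.card E) (∏ v, PowerSeries.mk fun j =>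
          w j * (j.descFactorial (partialDegree B G₀ v) : ℝ)) := by
  rw [sum_weight_of_prescribed]
  have h : ∀ v, (PowerSeries.mk fun j =>
      δ j * (j.descFactorial (partialDegree B G₀ v) : ℝ) / (j ! : ℝ)) =
      PowerSeries.mk fun j => c * χ⁻¹ ^ j *
        (w j * (j.descFactorial (partialDegree B G₀ v) : ℝ)) := fun v => by
    ext j
    rw [PowerSeries.coeff_mk, PowerSeries.coeff_mk, mul_div_right_comm, hw]; ring
  rw [prod_congr rfl fun v _ => h v, NonnegSeries.coeff_prod_scale]
  ring

/-- Vertices which are not in the range of `f` contribute powers of the generating function. -/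
theorem prod_descFactorial_eq {ι : Type*} [Fintype ι] (w : ℕ → ℝ) (f : ι ↪ V) (d : V → ℕ)
    (hd : ∀ v, v ∉ Set.range f → d v = 0) :
    (∏ v, PowerSeries.mk fun j => w j * (j.descFactorial (d v) : ℝ)) =
      (∏ i, PowerSeries.mk fun j => w j * (j.descFactorial (d (f i)) : ℝ)) *
        PowerSeries.mk w ^ (Fintype.card V - Fintype.card ι) := by
  rw [← prod_mul_prod_compl (univ.map f), prod_map]
  congr 1
  have h : ∀ v ∈ (univ.map f)ᶜ, (PowerSeries.mk fun j => w j * (j.descFactorial (d v) : ℝ)) =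
      PowerSeries.mk w := fun v hv => by
    rw [hd v (by simpa using hv)]; simp
  rw [prod_congr rfl h, prod_const, card_compl]
  simp

end Multigraph

end

/-! ### From binomial moments to Poisson laws -/

noncomputable section

namespace PoissonLimit

open Finset

/-- A truncated alternating sum of a row of Pascal's triangle is, up to sign, one entry of the row
above, which is at most the first omitted entry. -/
theorem abs_alternating_sum_choose_sub_le (M r : ℕ) :
    |(if M = 0 then (1 : ℝ) else 0) - ∑ i ∈ range r, (-1) ^ i * (M.choose i : ℝ)| ≤ M.choose r := by
  cases r with
  | zero => split_ifs <;> simp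
  | succ r =>
    cases M with
    | zero =>
      rw [sum_range_succ']
      simp
    | succ M =>
      have h := Int.alternating_sum_range_choose_eq_choose (n := M) (m := r)
      have h' : ∑ i ∈ range (r + 1), (-1 : ℝ) ^ i * ((M + 1).choose i : ℝ) =
          (-1) ^ r * (M.choose r : ℝ) := by exact_mod_cast h
      rw [h', if_neg (Nat.succ_ne_zero M), zero_sub, abs_neg, abs_mul, abs_pow, abs_neg, abs_one,
        one_pow, one_mul, Nat.abs_cast, Nat.choose_succ_succ]
      push_cast
      linarith [(M.choose (r + 1)).cast_nonneg (α := ℝ)]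

/-- Since C(t+i, t) C(N, t+i) = C(N, t) C(N-t, i), this is C(N, t) times the case t = 0 for N - t.
-/
theorem abs_indicator_sub_le (N t r : ℕ) :
    |(if N = t then (1 : ℝ) else 0) -
      ∑ i ∈ range r, (-1) ^ i * ((t + i).choose t : ℝ) * (N.choose (t + i) : ℝ)| ≤
      ((t + r).choose t : ℝ) * (N.choose (t + r) : ℝ) := by
  have hc : ∀ i, ((t + i).choose t : ℝ) * (N.choose (t + i) : ℝ) =
      (N.choose t : ℝ) * ((N - t).choose i : ℝ) := fun i => by
    have h := Nat.choose_mul (n := N) (Nat.le_add_right t i)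
    rw [Nat.add_sub_cancel_left, mul_comm] at h
    exact_mod_cast h
  have hs : ∑ i ∈ range r, (-1 : ℝ) ^ i * ((t + i).choose t : ℝ) * (N.choose (t + i) : ℝ) =
      (N.choose t : ℝ) * ∑ i ∈ range r, (-1) ^ i * ((N - t).choose i : ℝ) := by
    rw [mul_sum]
    refine sum_congr rfl fun i _ => ?_
    rw [mul_assoc, hc]; ring
  have hi : (if N = t then (1 : ℝ) else 0) = (N.choose t : ℝ) * if N - t = 0 then 1 else 0 := by
    rcases lt_trichotomy N t with h | h | h
    · rw [if_neg h.ne, Nat.choose_eq_zero_of_lt h]; simp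
    · subst h; simp
    · rw [if_neg h.ne', if_neg (by omega)]; simp
  rw [hs, hi, ← mul_sub, abs_mul, Nat.abs_cast, hc]
  exact mul_le_mul_of_nonneg_left (abs_alternating_sum_choose_sub_le _ _) (Nat.cast_nonneg _)

/-- Bonferroni's inequalities for the number of events which occur. -/
theorem abs_prob_sub_le {Ω : Type*} [Fintype Ω] {π : Ω → ℝ} (hπ : ∀ G, 0 ≤ π G) (N : Ω → ℕ)
    (t r : ℕ) :
    |∑ G, (if N G = t then π G else 0) - ∑ i ∈ range r, (-1) ^ i * ((t + i).choose t : ℝ) *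
      ∑ G, π G * ((N G).choose (t + i) : ℝ)| ≤
      ((t + r).choose t : ℝ) * ∑ G, π G * ((N G).choose (t + r) : ℝ) := by
  have e : ∑ G, (if N G = t then π G else 0) - ∑ i ∈ range r, (-1) ^ i * ((t + i).choose t : ℝ) *
      ∑ G, π G * ((N G).choose (t + i) : ℝ) = ∑ G, π G * ((if N G = t then (1 : ℝ) else 0) -
      ∑ i ∈ range r, (-1) ^ i * ((t + i).choose t : ℝ) * ((N G).choose (t + i) : ℝ)) := by
    simp only [mul_sub, sum_sub_distrib, mul_sum]
    congr 1
    · exact sum_congr rfl fun G _ => by simp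
    · rw [sum_comm]
      exact sum_congr rfl fun G _ => sum_congr rfl fun i _ => by ring
  rw [e, mul_sum]
  refine (abs_sum_le_sum_abs _ _).trans (sum_le_sum fun G _ => ?_)
  rw [abs_mul, abs_of_nonneg (hπ G), mul_left_comm]
  exact mul_le_mul_of_nonneg_left (abs_indicator_sub_le _ _ _) (hπ G)

theorem abs_exp_neg_sub_le {a : ℝ} (ha : 0 ≤ a) {r : ℕ} (hr : 2 * a ≤ r) :
    |Real.exp (-a) - ∑ i ∈ range r, (-1) ^ i * (a ^ i / (i ! : ℝ))| ≤ 2 * (a ^ r / (r ! : ℝ)) := by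
  have h := Complex.exp_bound' (x := ((-a : ℝ) : ℂ)) (n := r) (by
    rw [Complex.norm_real, Real.norm_eq_abs, abs_neg, abs_of_nonneg ha, div_le_iff₀ (by positivity)]
    push_cast; linarith)
  rw [Complex.norm_real, Real.norm_eq_abs, abs_neg, abs_of_nonneg ha] at h
  have e : Complex.exp ((-a : ℝ) : ℂ) - ∑ m ∈ range r, ((-a : ℝ) : ℂ) ^ m / (m ! : ℂ) =
      ((Real.exp (-a) - ∑ i ∈ range r, (-1) ^ i * (a ^ i / (i ! : ℝ)) : ℝ) : ℂ) := by
    push_cast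
    congr 1
    refine sum_congr rfl fun i _ => ?_
    rw [neg_pow]; ring
  rw [e, Complex.norm_real, Real.norm_eq_abs] at h
  linarith

/-- Convergence of the factorial moments implies asymptotic Poisson laws. -/
theorem tendsto_of_factorial_moments {S P : ℕ → ℕ → ℝ} {α : ℕ → ℝ} {A : ℝ}
    (hα : ∀ᶠ n in atTop, 0 ≤ α n ∧ α n ≤ A)
    (hS : ∀ j, Tendsto (fun n => S n j - α n ^ j / (j ! : ℝ)) atTop (𝓝 0))
    (hB : ∀ᶠ n in atTop, ∀ t r, |P n t - ∑ i ∈ range r, (-1) ^ i * ((t + i).choose t : ℝ) *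
      S n (t + i)| ≤ ((t + r).choose t : ℝ) * S n (t + r)) (t : ℕ) :
    Tendsto (fun n => P n t - Real.exp (-α n) * α n ^ t / (t ! : ℝ)) atTop (𝓝 0) := by
  rw [Metric.tendsto_nhds]
  intro ε hε
  have hlim : Tendsto (fun r : ℕ => A ^ t / (t ! : ℝ) * (3 * (A ^ r / (r ! : ℝ)))) atTop (𝓝 0) := by
    have := ((FloorSemiring.tendsto_pow_div_factorial_atTop A).const_mul 3).const_mul
      (A ^ t / (t ! : ℝ))
    simpa using this
  -- The order of truncation is fixed by the bound A, before n; only finitely many moments are then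
  -- needed.
  obtain ⟨r, hr1, hr2⟩ := ((hlim.eventually (gt_mem_nhds (half_pos hε))).and
    (tendsto_natCast_atTop_atTop.eventually_ge_atTop (2 * A))).exists
  have hE : Tendsto (fun n => ∑ i ∈ range r, |((t + i).choose t : ℝ) *
      (S n (t + i) - α n ^ (t + i) / ((t + i)! : ℝ))| + |((t + r).choose t : ℝ) *
      (S n (t + r) - α n ^ (t + r) / ((t + r)! : ℝ))|) atTop (𝓝 0) := by
    have h0 : ∀ i, Tendsto (fun n => |((t + i).choose t : ℝ) *
        (S n (t + i) - α n ^ (t + i) / ((t + i)! : ℝ))|) atTop (𝓝 0) := fun i => by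
      simpa using ((hS (t + i)).const_mul ((t + i).choose t : ℝ)).abs
    simpa using (tendsto_finsetSum (range r) fun i _ => h0 i).add (h0 r)
  filter_upwards [hα, hB, hE.eventually (gt_mem_nhds (half_pos hε))] with n hα hB hE
  rw [Real.dist_eq, sub_zero]
  set a := α n with ha
  have hcf : ∀ i, ((t + i).choose t : ℝ) * (a ^ (t + i) / ((t + i)! : ℝ)) =
      a ^ t / (t ! : ℝ) * (a ^ i / (i ! : ℝ)) := fun i => by
    have h := Nat.add_choose_mul_factorial_mul_factorial i t
    rw [add_comm i t] at h
    have h' : ((t + i)! : ℝ) = ((t + i).choose t : ℝ) * (i ! : ℝ) * (t ! : ℝ) := by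
      exact_mod_cast h.symm
    have hc : ((t + i).choose t : ℝ) ≠ 0 := by
      exact_mod_cast (Nat.choose_pos (Nat.le_add_right t i)).ne'
    rw [h', pow_add]; field_simp
  have h1 := hB t r
  have h2 := abs_exp_neg_sub_le hα.1 (r := r) (by linarith)
  have hat0 : 0 ≤ a ^ t / (t ! : ℝ) := by have := hα.1; positivity
  have har0 : 0 ≤ a ^ r / (r ! : ℝ) := by have := hα.1; positivity
  have hA0 : 0 ≤ A := hα.1.trans hα.2
  have h3 : a ^ t / (t ! : ℝ) * (3 * (a ^ r / (r ! : ℝ))) ≤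
      A ^ t / (t ! : ℝ) * (3 * (A ^ r / (r ! : ℝ))) := by
    have := hα.1
    have := hα.2
    gcongr
  have e1 : ((t + r).choose t : ℝ) * S n (t + r) = ((t + r).choose t : ℝ) *
      (S n (t + r) - a ^ (t + r) / ((t + r)! : ℝ)) + a ^ t / (t ! : ℝ) * (a ^ r / (r ! : ℝ)) := by
    rw [← hcf]; ring
  have e2 : P n t - Real.exp (-a) * a ^ t / (t ! : ℝ) =
      (P n t - ∑ i ∈ range r, (-1) ^ i * ((t + i).choose t : ℝ) * S n (t + i)) +
      ∑ i ∈ range r, (-1) ^ i * (((t + i).choose t : ℝ) *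
        (S n (t + i) - a ^ (t + i) / ((t + i)! : ℝ))) -
      a ^ t / (t ! : ℝ) * (Real.exp (-a) - ∑ i ∈ range r, (-1) ^ i * (a ^ i / (i ! : ℝ))) := by
    have e3 : ∑ i ∈ range r, (-1 : ℝ) ^ i * (((t + i).choose t : ℝ) *
        (S n (t + i) - a ^ (t + i) / ((t + i)! : ℝ))) =
        ∑ i ∈ range r, (-1) ^ i * ((t + i).choose t : ℝ) * S n (t + i) -
        a ^ t / (t ! : ℝ) * ∑ i ∈ range r, (-1) ^ i * (a ^ i / (i ! : ℝ)) := by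
      rw [mul_sum, ← sum_sub_distrib]
      refine sum_congr rfl fun i _ => ?_
      rw [mul_sub, hcf]; ring
    rw [e3]; ring
  have h4 : |∑ i ∈ range r, (-1 : ℝ) ^ i * (((t + i).choose t : ℝ) *
      (S n (t + i) - a ^ (t + i) / ((t + i)! : ℝ)))| ≤ ∑ i ∈ range r, |((t + i).choose t : ℝ) *
      (S n (t + i) - a ^ (t + i) / ((t + i)! : ℝ))| := by
    refine (abs_sum_le_sum_abs _ _).trans (le_of_eq (sum_congr rfl fun i _ => ?_))
    rw [abs_mul, abs_pow, abs_neg, abs_one, one_pow, one_mul]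
  have h5 : |a ^ t / (t ! : ℝ) * (Real.exp (-a) - ∑ i ∈ range r, (-1) ^ i * (a ^ i / (i ! : ℝ)))| ≤
      a ^ t / (t ! : ℝ) * (2 * (a ^ r / (r ! : ℝ))) := by
    rw [abs_mul, abs_of_nonneg hat0]
    exact mul_le_mul_of_nonneg_left h2 hat0
  have h6 := le_abs_self (((t + r).choose t : ℝ) * (S n (t + r) - a ^ (t + r) / ((t + r)! : ℝ)))
  rw [e2]
  have h7 := abs_sub ((P n t - ∑ i ∈ range r, (-1) ^ i * ((t + i).choose t : ℝ) * S n (t + i)) +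
      ∑ i ∈ range r, (-1) ^ i * (((t + i).choose t : ℝ) *
        (S n (t + i) - a ^ (t + i) / ((t + i)! : ℝ))))
      (a ^ t / (t ! : ℝ) * (Real.exp (-a) - ∑ i ∈ range r, (-1) ^ i * (a ^ i / (i ! : ℝ))))
  have h8 := abs_add_le (P n t - ∑ i ∈ range r, (-1) ^ i * ((t + i).choose t : ℝ) * S n (t + i))
      (∑ i ∈ range r, (-1) ^ i * (((t + i).choose t : ℝ) *
        (S n (t + i) - a ^ (t + i) / ((t + i)! : ℝ))))
  linarith

end PoissonLimit

end

/-! ### Labelled copies -/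

noncomputable section

namespace Multigraph

open Finset Function

/-- Tuples of elements of `A` with distinct images, when all fibres have the same size. -/
theorem card_injective_comp {X Y : Type*} [Fintype X] [DecidableEq X] [DecidableEq Y]
    (A : Finset X) (f : X → Y) {q : ℕ} (hq : ∀ y ∈ A.image f, #{x ∈ A | f x = y} = q) (t : ℕ) :
    Nat.card {c : Fin t → X // (∀ i, c i ∈ A) ∧ Injective (f ∘ c)} =
      q ^ t * (#(A.image f)).descFactorial t := by
  classical
  set C := A.image f with hC
  have e : {c : Fin t → X // (∀ i, c i ∈ A) ∧ Injective (f ∘ c)} ≃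
      Σ b : Fin t ↪ {y // y ∈ C}, ∀ i, {x // x ∈ {x ∈ A | f x = (b i : Y)}} :=
    { toFun := fun c => ⟨⟨fun i => ⟨f (c.1 i), mem_image_of_mem f (c.2.1 i)⟩, fun i j h =>
          c.2.2 (congrArg Subtype.val h)⟩, fun i => ⟨c.1 i, mem_filter.2 ⟨c.2.1 i, rfl⟩⟩⟩
      invFun := fun p => ⟨fun i => p.2 i, fun i => (mem_filter.1 (p.2 i).2).1, fun i j h => by
        have h1 := (mem_filter.1 (p.2 i).2).2
        have h2 := (mem_filter.1 (p.2 j).2).2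
        simp only [comp_apply] at h
        exact p.1.injective (Subtype.ext (h1.symm.trans (h.trans h2)))⟩
      left_inv := fun c => rfl
      right_inv := fun p => by
        obtain ⟨b, x⟩ := p
        have hb : (⟨fun i => ⟨f (x i), mem_image_of_mem f (mem_filter.1 (x i).2).1⟩, fun i j h => by
            have h1 := (mem_filter.1 (x i).2).2
            have h2 := (mem_filter.1 (x j).2).2
            exact b.injective (Subtype.ext (h1.symm.trans
              ((congrArg Subtype.val h).trans h2)))⟩ : Fin t ↪ {y // y ∈ C}) = b := by
          ext i; exact (mem_filter.1 (x i).2).2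
        refine Sigma.ext hb ?_
        refine hfunext rfl fun i j hij => ?_
        obtain rfl := eq_of_heq hij
        refine (Subtype.heq_iff_coe_eq fun z => ?_).2 rfl
        change z ∈ ({y ∈ A | f y = f (x i : X)} : Finset X) ↔
          z ∈ ({y ∈ A | f y = (b i : Y)} : Finset X)
        rw [(mem_filter.1 (x i).2).2] }
  rw [Nat.card_congr e, Nat.card_eq_fintype_card, Fintype.card_sigma]
  have h : ∀ b : Fin t ↪ {y // y ∈ C},
      Fintype.card (∀ i, {x // x ∈ {x ∈ A | f x = (b i : Y)}}) = q ^ t := fun b => by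
    rw [Fintype.card_pi]
    simp only [Fintype.card_coe]
    rw [prod_congr rfl fun i _ => hq _ (b i).2]
    simp
  rw [sum_congr rfl fun b _ => h b, sum_const, card_univ, Fintype.card_embedding_eq]
  simp [mul_comm]

variable {V E : Type*} {k l : ℕ}

/-- A labelled copy of `F` in `G`. -/
def IsCopy (oriented : Bool) (F : Multigraph (Fin k) (Fin l)) (G : Multigraph V E)
    (p : (Fin k → V) × (Fin l → E)) : Prop :=
  Injective p.1 ∧ Injective p.2 ∧ ∃ F' : Multigraph (Fin k) (Fin l), Isomorphic oriented F F' ∧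
    ∀ e, G (p.2 e) = (p.1 (F' e).1, p.1 (F' e).2)

/-- The vertices and edges of a labelled copy. -/
def support [DecidableEq V] [DecidableEq E] (p : (Fin k → V) × (Fin l → E)) :
    Finset V × Finset E := (univ.image p.1, univ.image p.2)

variable [DecidableEq V] [DecidableEq E] {oriented : Bool} {F : Multigraph (Fin k) (Fin l)}
  {G : Multigraph V E}

theorem IsCopy.exists_subgraph {p : (Fin k → V) × (Fin l → E)} (h : IsCopy oriented F G p) :
    ∃ H : G.Subgraph, Isomorphic oriented F H.toMultigraph ∧ (H.verts, H.edges) = support p := by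
  obtain ⟨h1, h2, F', ⟨α, β, hF⟩, hG⟩ := h
  have hmem : ∀ e ∈ univ.image p.2, (G e).1 ∈ univ.image p.1 ∧ (G e).2 ∈ univ.image p.1 := by
    intro e he
    obtain ⟨e', -, rfl⟩ := mem_image.1 he
    rw [hG]
    exact ⟨mem_image_of_mem _ (mem_univ _), mem_image_of_mem _ (mem_univ _)⟩
  refine ⟨⟨univ.image p.1, univ.image p.2, fun e he => (hmem e he).1, fun e he => (hmem e he).2⟩,
    ?_, rfl⟩
  let a : Fin k ≃ {v // v ∈ univ.image p.1} :=
    Equiv.ofBijective (fun i => ⟨p.1 i, mem_image_of_mem _ (mem_univ _)⟩)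
      ⟨fun i j h => h1 (congrArg Subtype.val h), fun ⟨v, hv⟩ => by
        obtain ⟨i, -, rfl⟩ := mem_image.1 hv; exact ⟨i, rfl⟩⟩
  let b : Fin l ≃ {e // e ∈ univ.image p.2} :=
    Equiv.ofBijective (fun i => ⟨p.2 i, mem_image_of_mem _ (mem_univ _)⟩)
      ⟨fun i j h => h2 (congrArg Subtype.val h), fun ⟨v, hv⟩ => by
        obtain ⟨i, -, rfl⟩ := mem_image.1 hv; exact ⟨i, rfl⟩⟩
  refine ⟨α.trans a, β.trans b, fun e => ?_⟩
  have h3 := hG (β e)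
  refine (hF e).imp (fun h => ?_) (And.imp_right fun h => ?_)
  all_goals
    rw [h] at h3
    simp only [Subgraph.toMultigraph, Prod.mk.injEq, Subtype.ext_iff, Equiv.trans_apply]
    exact ⟨congrArg Prod.fst h3, congrArg Prod.snd h3⟩

theorem exists_isCopy {H : G.Subgraph} (h : Isomorphic oriented F H.toMultigraph) :
    ∃ p, IsCopy oriented F G p ∧ support p = (H.verts, H.edges) := by
  obtain ⟨α, β, hF⟩ := h
  refine ⟨(fun i => α i, fun i => β i), ⟨fun i j h => α.injective (Subtype.ext h),
    fun i j h => β.injective (Subtype.ext h),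
    fun e => (α.symm (H.toMultigraph (β e)).1, α.symm (H.toMultigraph (β e)).2),
    ⟨Equiv.refl _, Equiv.refl _, fun e => ?_⟩, fun e => ?_⟩, ?_⟩
  · refine (hF e).imp (fun h => ?_) (And.imp_right fun h => ?_) <;> simp [h]
  · simp [Subgraph.toMultigraph]
  · simp only [support, Prod.mk.injEq]
    constructor
    · ext v; simp only [mem_image, mem_univ, true_and]
      exact ⟨by rintro ⟨i, rfl⟩; exact (α i).2, fun hv => ⟨α.symm ⟨v, hv⟩, by simp⟩⟩
    · ext v; simp only [mem_image, mem_univ, true_and]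
      exact ⟨by rintro ⟨i, rfl⟩; exact (β i).2, fun hv => ⟨β.symm ⟨v, hv⟩, by simp⟩⟩

omit [DecidableEq V] [DecidableEq E] in
theorem IsCopy.comp {p : (Fin k → V) × (Fin l → E)} (h : IsCopy oriented F G p)
    (σ : Equiv.Perm (Fin k)) (τ : Equiv.Perm (Fin l)) :
    IsCopy oriented F G (p.1 ∘ σ, p.2 ∘ τ) := by
  obtain ⟨h1, h2, F', ⟨α, β, hF⟩, hG⟩ := h
  refine ⟨h1.comp σ.injective, h2.comp τ.injective,
    fun e => (σ.symm (F' (τ e)).1, σ.symm (F' (τ e)).2),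
    ⟨α.trans σ.symm, β.trans τ.symm, fun e => ?_⟩, fun e => ?_⟩
  · refine (hF e).imp (fun h => ?_) (And.imp_right fun h => ?_) <;> simp [h]
  · simp [hG]

theorem exists_perm_of_image_eq {m : ℕ} {f g : Fin m → V} (hf : Injective f)
    (h : univ.image f = univ.image g) : ∃ σ : Equiv.Perm (Fin m), f = g ∘ σ := by
  have hex : ∀ i, ∃ j, g j = f i := fun i => by
    have : f i ∈ univ.image g := h ▸ mem_image_of_mem f (mem_univ i)
    simpa using this
  choose σ hσ using hex
  have hinj : Injective σ := fun i j hij => hf (by rw [← hσ, ← hσ, hij])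
  exact ⟨Equiv.ofBijective σ (Finite.injective_iff_bijective.1 hinj), by ext1 i; simp [hσ]⟩

variable [Fintype V] [Fintype E]

open Classical in
/-- The set of all labelled copies. -/
def copies (oriented : Bool) (F : Multigraph (Fin k) (Fin l)) (G : Multigraph V E) :
    Finset ((Fin k → V) × (Fin l → E)) := {p | IsCopy oriented F G p}

omit [DecidableEq V] [DecidableEq E] in
theorem mem_copies {p : (Fin k → V) × (Fin l → E)} :
    p ∈ copies oriented F G ↔ IsCopy oriented F G p := by simp [copies]

/-- A subgraph is determined by its sets of vertices and edges, so copies may be counted as supports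
of labelled copies. -/
theorem numCopies_eq : numCopies oriented F G = #((copies oriented F G).image support) := by
  rw [numCopies, ← Fintype.card_coe, ← Nat.card_eq_fintype_card]
  refine Nat.card_eq_of_bijective (fun H => ⟨(H.1.verts, H.1.edges), ?_⟩) ⟨?_, ?_⟩
  · obtain ⟨p, hp, hs⟩ := exists_isCopy H.2
    exact mem_image.2 ⟨p, mem_copies.2 hp, hs⟩
  · rintro ⟨⟨v, e, h1, h2⟩, hH⟩ ⟨⟨v', e', h1', h2'⟩, hH'⟩ h
    simp only [Subtype.mk.injEq, Prod.mk.injEq] at h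
    obtain ⟨rfl, rfl⟩ := h
    rfl
  · rintro ⟨c, hc⟩
    obtain ⟨p, hp, rfl⟩ := mem_image.1 hc
    obtain ⟨H, hH, hs⟩ := (mem_copies.1 hp).exists_subgraph
    exact ⟨⟨H, hH⟩, Subtype.ext hs⟩

/-- Relabellings act freely and transitively on the labelled copies with a given support. They
preserve `IsCopy` because the latter allows any F' isomorphic to F, so automorphisms of F never
enter. -/
theorem card_fiber_support {c : Finset V × Finset E}
    (hc : c ∈ (copies oriented F G).image support) :
    #{p ∈ copies oriented F G | support p = c} = k ! * l ! := by
  obtain ⟨p₀, hp₀, rfl⟩ := mem_image.1 hc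
  have hp := mem_copies.1 hp₀
  have h : {p ∈ copies oriented F G | support p = support p₀} =
      (univ : Finset (Equiv.Perm (Fin k) × Equiv.Perm (Fin l))).image
        fun q => (p₀.1 ∘ q.1, p₀.2 ∘ q.2) := by
    ext p
    simp only [mem_filter, mem_image, mem_univ, true_and, mem_copies]
    constructor
    · rintro ⟨h1, h2⟩
      simp only [support, Prod.mk.injEq] at h2
      obtain ⟨σ, hσ⟩ := exists_perm_of_image_eq h1.1 h2.1
      obtain ⟨τ, hτ⟩ := exists_perm_of_image_eq h1.2.1 h2.2
      exact ⟨(σ, τ), Prod.ext hσ.symm hτ.symm⟩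
    · rintro ⟨⟨σ, τ⟩, rfl⟩
      refine ⟨hp.comp σ τ, ?_⟩
      simp only [support, Prod.mk.injEq]
      constructor
      · ext v; simp only [mem_image, mem_univ, true_and, comp_apply]
        exact ⟨fun ⟨i, h⟩ => ⟨σ i, h⟩, fun ⟨i, h⟩ => ⟨σ.symm i, by simpa using h⟩⟩
      · ext v; simp only [mem_image, mem_univ, true_and, comp_apply]
        exact ⟨fun ⟨i, h⟩ => ⟨τ i, h⟩, fun ⟨i, h⟩ => ⟨τ.symm i, by simpa using h⟩⟩
  rw [h, card_image_of_injective, card_univ, Fintype.card_prod, Fintype.card_perm,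
    Fintype.card_perm, Fintype.card_fin, Fintype.card_fin]
  rintro ⟨σ, τ⟩ ⟨σ', τ'⟩ h
  simp only [Prod.mk.injEq] at h
  refine Prod.ext (Equiv.ext fun i => hp.1 (congrFun h.1 i))
    (Equiv.ext fun i => hp.2.1 (congrFun h.2 i))

theorem card_tuples_eq (oriented : Bool) (F : Multigraph (Fin k) (Fin l)) (G : Multigraph V E)
    (t : ℕ) : Nat.card {c : Fin t → (Fin k → V) × (Fin l → E) //
      (∀ i, IsCopy oriented F G (c i)) ∧ Injective (support ∘ c)} =
      (k ! * l !) ^ t * (numCopies oriented F G).descFactorial t := by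
  rw [numCopies_eq, ← card_injective_comp _ _ (fun c hc => card_fiber_support hc)]
  simp only [mem_copies]

end Multigraph

end

/-! ### Strict balance and overlapping copies -/

noncomputable section

namespace Multigraph

open Finset Function

variable {V E : Type*} {k l : ℕ} [DecidableEq V] [DecidableEq E] {oriented : Bool}
  {F : Multigraph (Fin k) (Fin l)} {G : Multigraph V E}

/-- The excess of edges over the vertices, relative to the density `l / k`. -/
def excess (k l : ℕ) (S : Finset V) (D : Finset E) : ℤ := k * #D - l * #S

omit [DecidableEq V] [DecidableEq E] in
theorem excess_of_strictlyBalanced (hF : F.StrictlyBalanced) (H : F.Subgraph) :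
    excess k l H.verts H.edges ≤ 0 ∧ (excess k l H.verts H.edges = 0 →
      H.verts = ∅ ∨ (H.verts = univ ∧ H.edges = univ)) := by
  have hempty : H.verts = ∅ → H.edges = ∅ := fun h => by
    rw [eq_empty_iff_forall_notMem]
    intro e he
    have := H.fst_mem e he
    rw [h] at this; simp at this
  by_cases h0 : H.verts = ∅
  · simp [excess, h0, hempty h0]
  by_cases h1 : H.verts = univ ∧ H.edges = univ
  · simp only [excess, h1.1, h1.2, card_univ, Fintype.card_fin]
    refine ⟨le_of_eq (by ring), fun _ => Or.inr ⟨trivial, trivial⟩⟩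
  have h := hF H h1
  simp only [density, Fintype.card_coe, Fintype.card_fin] at h
  have hv : (0 : ℝ) < #H.verts := by
    exact_mod_cast card_pos.2 (nonempty_iff_ne_empty.2 h0)
  have hk : (0 : ℝ) < k := by
    have h2 : #H.verts ≤ k := by simpa using card_le_univ H.verts
    have h3 : (#H.verts : ℝ) ≤ k := by exact_mod_cast h2
    linarith
  rw [div_lt_div_iff₀ hv hk] at h
  have h' : #H.edges * k < l * #H.verts := by exact_mod_cast h
  have hz : excess k l H.verts H.edges < 0 := by
    simp only [excess]
    have : ((#H.edges * k : ℕ) : ℤ) < ((l * #H.verts : ℕ) : ℤ) := by exact_mod_cast h'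
    push_cast at this
    linarith
  exact ⟨hz.le, fun h => absurd h hz.ne⟩

/-- Parts of a copy of a strictly balanced multigraph have smaller density. -/
theorem IsCopy.excess_le (hF : F.StrictlyBalanced) {p : (Fin k → V) × (Fin l → E)}
    (h : IsCopy oriented F G p) {S : Finset V} {D : Finset E} (hS : S ⊆ (support p).1)
    (hD : D ⊆ (support p).2) (hSD : ∀ e ∈ D, (G e).1 ∈ S ∧ (G e).2 ∈ S) :
    excess k l S D ≤ 0 ∧ (excess k l S D = 0 → S = ∅ ∨ (S, D) = support p) := by
  obtain ⟨h1, h2, F', ⟨α, β, hiso⟩, hG⟩ := h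
  have hmem : ∀ e, p.2 (β e) ∈ D → p.1 (α (F e).1) ∈ S ∧ p.1 (α (F e).2) ∈ S := by
    intro e he
    have h3 := hSD _ he
    rw [hG] at h3
    rcases hiso e with h | ⟨-, h⟩
    · rw [h] at h3; exact h3
    · rw [h] at h3; exact h3.symm
  let H : F.Subgraph := ⟨{a | p.1 (α a) ∈ S}, {e | p.2 (β e) ∈ D},
    fun e he => by simpa using (hmem e (by simpa using he)).1,
    fun e he => by simpa using (hmem e (by simpa using he)).2⟩
  have hvS : H.verts.image (fun a => p.1 (α a)) = S := by
    ext v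
    simp only [H, mem_image, mem_filter, mem_univ, true_and]
    constructor
    · rintro ⟨a, ha, rfl⟩; exact ha
    · intro hv
      obtain ⟨a, -, rfl⟩ := mem_image.1 (hS hv)
      exact ⟨α.symm a, by simpa using hv, by simp⟩
  have heD : H.edges.image (fun e => p.2 (β e)) = D := by
    ext v
    simp only [H, mem_image, mem_filter, mem_univ, true_and]
    constructor
    · rintro ⟨a, ha, rfl⟩; exact ha
    · intro hv
      obtain ⟨a, -, rfl⟩ := mem_image.1 (hD hv)
      exact ⟨β.symm a, by simpa using hv, by simp⟩
  have e1 : excess k l S D = excess k l H.verts H.edges := by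
    rw [excess, excess, ← hvS, ← heD, card_image_of_injective (f := fun a => p.1 (α a)) _ (h1.comp α.injective),
      card_image_of_injective (f := fun e => p.2 (β e)) _ (h2.comp β.injective)]
  have hb := excess_of_strictlyBalanced hF H
  rw [e1]
  refine ⟨hb.1, fun h => (hb.2 h).imp (fun h => ?_) fun h => ?_⟩
  · rw [← hvS, h, image_empty]
  · rw [← hvS, ← heD, h.1, h.2, support, Prod.mk.injEq]
    constructor
    · ext v; simp only [mem_image, mem_univ, true_and]
      exact ⟨fun ⟨i, h⟩ => ⟨α i, h⟩, fun ⟨i, h⟩ => ⟨α.symm i, by simpa using h⟩⟩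
    · ext v; simp only [mem_image, mem_univ, true_and]
      exact ⟨fun ⟨i, h⟩ => ⟨β i, h⟩, fun ⟨i, h⟩ => ⟨β.symm i, by simpa using h⟩⟩

theorem excess_union (S S' : Finset V) (D D' : Finset E) :
    excess k l (S ∪ S') (D ∪ D') =
      excess k l S D + excess k l S' D' - excess k l (S ∩ S') (D ∩ D') := by
  have h1 : (#(S ∪ S') : ℤ) = #S + #S' - #(S ∩ S') := by
    have := card_union_add_card_inter S S'; omega
  have h2 : (#(D ∪ D') : ℤ) = #D + #D' - #(D ∩ D') := by
    have := card_union_add_card_inter D D'; omega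
  simp only [excess, h1, h2]; ring

theorem IsCopy.mem_support {p : (Fin k → V) × (Fin l → E)} (h : IsCopy oriented F G p) :
    ∀ e ∈ (support p).2, (G e).1 ∈ (support p).1 ∧ (G e).2 ∈ (support p).1 := by
  obtain ⟨H, -, hs⟩ := h.exists_subgraph
  rw [← hs]
  exact fun e he => ⟨H.fst_mem e he, H.snd_mem e he⟩

theorem IsCopy.card_support {p : (Fin k → V) × (Fin l → E)} (h : IsCopy oriented F G p) :
    #(support p).1 = k ∧ #(support p).2 = l := by
  simp [support, card_image_of_injective _ h.1, card_image_of_injective _ h.2.1]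

theorem IsCopy.excess_support {p : (Fin k → V) × (Fin l → E)} (h : IsCopy oriented F G p) :
    excess k l (support p).1 (support p).2 = 0 := by
  rw [excess, h.card_support.1, h.card_support.2]; ring

/-- The excess is modular, a whole copy has excess 0, and the part of it shared with (S, D) has
excess at most 0. -/
theorem excess_union_copy_ge (hF : F.StrictlyBalanced) {p : (Fin k → V) × (Fin l → E)}
    (h : IsCopy oriented F G p) {S : Finset V} {D : Finset E}
    (hSD : ∀ e ∈ D, (G e).1 ∈ S ∧ (G e).2 ∈ S) :
    excess k l S D ≤ excess k l (S ∪ (support p).1) (D ∪ (support p).2) := by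
  rw [excess_union, h.excess_support]
  have := (h.excess_le hF (inter_subset_right (s₁ := S)) (inter_subset_right (s₁ := D))
    fun e he => by
      have h1 := hSD e (mem_inter.1 he).1
      have h2 := h.mem_support e (mem_inter.1 he).2
      exact ⟨mem_inter.2 ⟨h1.1, h2.1⟩, mem_inter.2 ⟨h1.2, h2.2⟩⟩).1
  linarith

/-- If two of several distinct copies overlap, then their union has too many edges. -/
theorem excess_pos_of_overlap (hF : F.StrictlyBalanced) {t : ℕ}
    {c : Fin t → (Fin k → V) × (Fin l → E)} (hc : ∀ i, IsCopy oriented F G (c i))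
    (hinj : Injective (support ∘ c)) {i j : Fin t} (hij : i ≠ j) {v : V}
    (hvi : v ∈ (support (c i)).1) (hvj : v ∈ (support (c j)).1) :
    0 < excess k l (univ.biUnion fun i => (support (c i)).1)
      (univ.biUnion fun i => (support (c i)).2) := by
  set S₀ := (support (c i)).1 ∪ (support (c j)).1 with hS₀
  set D₀ := (support (c i)).2 ∪ (support (c j)).2 with hD₀
  have hcl₀ : ∀ e ∈ D₀, (G e).1 ∈ S₀ ∧ (G e).2 ∈ S₀ := by
    intro e he
    rcases mem_union.1 he with h | h
    · have := (hc i).mem_support e h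
      exact ⟨mem_union_left _ this.1, mem_union_left _ this.2⟩
    · have := (hc j).mem_support e h
      exact ⟨mem_union_right _ this.1, mem_union_right _ this.2⟩
  -- The intersection contains v and is not a whole copy, the two supports being distinct and of
  -- equal size; so its excess is negative and that of the union positive. Adding the other copies
  -- does not decrease it.
  have h0 : 0 < excess k l S₀ D₀ := by
    rw [excess_union, (hc i).excess_support, (hc j).excess_support]
    have h1 := (hc i).excess_le hF (inter_subset_left (s₂ := (support (c j)).1))
      (inter_subset_left (s₂ := (support (c j)).2)) fun e he => by
        have h1 := (hc i).mem_support e (mem_inter.1 he).1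
        have h2 := (hc j).mem_support e (mem_inter.1 he).2
        exact ⟨mem_inter.2 ⟨h1.1, h2.1⟩, mem_inter.2 ⟨h1.2, h2.2⟩⟩
    have h2 : excess k l ((support (c i)).1 ∩ (support (c j)).1)
        ((support (c i)).2 ∩ (support (c j)).2) ≠ 0 := by
      intro h
      rcases h1.2 h with h | h
      · have : v ∈ (support (c i)).1 ∩ (support (c j)).1 := mem_inter.2 ⟨hvi, hvj⟩
        rw [h] at this; simp at this
      · have h3 := congrArg Prod.fst h
        have h4 := congrArg Prod.snd h
        simp only [inter_eq_left] at h3 h4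
        have h5 := eq_of_subset_of_card_le h3
          (by rw [(hc i).card_support.1, (hc j).card_support.1])
        have h6 := eq_of_subset_of_card_le h4
          (by rw [(hc i).card_support.2, (hc j).card_support.2])
        exact hij (hinj (Prod.ext h5 h6))
    have h3 := lt_of_le_of_ne h1.1 h2
    linarith
  have hstep : ∀ s : Finset (Fin t),
      (∀ e ∈ D₀ ∪ s.biUnion (fun i => (support (c i)).2),
        (G e).1 ∈ S₀ ∪ s.biUnion (fun i => (support (c i)).1) ∧
        (G e).2 ∈ S₀ ∪ s.biUnion (fun i => (support (c i)).1)) ∧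
      0 < excess k l (S₀ ∪ s.biUnion fun i => (support (c i)).1)
        (D₀ ∪ s.biUnion fun i => (support (c i)).2) := by
    intro s
    induction s using Finset.induction_on with
    | empty =>
      simp only [biUnion_empty, union_empty]
      exact ⟨hcl₀, h0⟩
    | insert a s ha ih =>
      rw [biUnion_insert, biUnion_insert, union_comm (support (c a)).1, union_comm (support (c a)).2,
        ← union_assoc, ← union_assoc]
      refine ⟨fun e he => ?_, ih.2.trans_le (excess_union_copy_ge hF (hc a) ih.1)⟩
      rcases mem_union.1 he with h | h
      · exact ⟨mem_union_left _ (ih.1 e h).1, mem_union_left _ (ih.1 e h).2⟩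
      · have := (hc a).mem_support e h
        exact ⟨mem_union_right _ this.1, mem_union_right _ this.2⟩
  have h := (hstep univ).2
  have e1 : S₀ ∪ univ.biUnion (fun i => (support (c i)).1) =
      univ.biUnion fun i => (support (c i)).1 := by
    rw [union_eq_right]
    exact union_subset (subset_biUnion_of_mem (fun i => (support (c i)).1) (mem_univ i))
      (subset_biUnion_of_mem (fun i => (support (c i)).1) (mem_univ j))
  have e2 : D₀ ∪ univ.biUnion (fun i => (support (c i)).2) =
      univ.biUnion fun i => (support (c i)).2 := by
    rw [union_eq_right]
    exact union_subset (subset_biUnion_of_mem (fun i => (support (c i)).2) (mem_univ i))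
      (subset_biUnion_of_mem (fun i => (support (c i)).2) (mem_univ j))
  rwa [e1, e2] at h

/-- All vertices and all edges of the members of a tuple are distinct. -/
def Separated {t : ℕ} (c : Fin t → (Fin k → V) × (Fin l → E)) : Prop :=
  Injective (fun q : Fin t × Fin k => (c q.1).1 q.2) ∧
    Injective fun q : Fin t × Fin l => (c q.1).2 q.2

/-- Labels within one copy are injective, so a coincidence involves two different copies; if they
share an edge, they share its end points. -/
theorem excess_pos_of_not_separated (hF : F.StrictlyBalanced) {t : ℕ}
    {c : Fin t → (Fin k → V) × (Fin l → E)} (hc : ∀ i, IsCopy oriented F G (c i))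
    (hinj : Injective (support ∘ c)) (hs : ¬ Separated c) :
    0 < excess k l (univ.biUnion fun i => (support (c i)).1)
      (univ.biUnion fun i => (support (c i)).2) := by
  rw [Separated, not_and_or] at hs
  rcases hs with hs | hs
  · simp only [Injective, not_forall] at hs
    obtain ⟨⟨i, a⟩, ⟨j, b⟩, h, hne⟩ := hs
    have hij : i ≠ j := by
      rintro rfl
      exact hne (Prod.ext rfl ((hc i).1 h))
    refine excess_pos_of_overlap hF hc hinj hij (v := (c i).1 a)
      (mem_image_of_mem _ (mem_univ _)) ?_
    simp only at h
    rw [h]; exact mem_image_of_mem _ (mem_univ _)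
  · simp only [Injective, not_forall] at hs
    obtain ⟨⟨i, a⟩, ⟨j, b⟩, h, hne⟩ := hs
    have hij : i ≠ j := by
      rintro rfl
      exact hne (Prod.ext rfl ((hc i).2.1 h))
    simp only at h
    refine excess_pos_of_overlap hF hc hinj hij (v := (G ((c i).2 a)).1)
      ((hc i).mem_support _ (mem_image_of_mem _ (mem_univ _))).1 ?_
    rw [h]; exact ((hc j).mem_support _ (mem_image_of_mem _ (mem_univ _))).1

theorem Separated.injective_support (hk : 0 < k) {t : ℕ}
    {c : Fin t → (Fin k → V) × (Fin l → E)} (hs : Separated c) : Injective (support ∘ c) := by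
  intro i j h
  have h1 := congrArg Prod.fst h
  simp only [support, comp_apply] at h1
  have h2 : (c i).1 ⟨0, hk⟩ ∈ univ.image (c j).1 := h1 ▸ mem_image_of_mem _ (mem_univ _)
  obtain ⟨b, -, hb⟩ := mem_image.1 h2
  exact (congrArg Prod.fst (@hs.1 (j, b) (i, ⟨0, hk⟩) hb)).symm

end Multigraph

end

/-! ### Probabilities of prescribed copies -/

noncomputable section

namespace Multigraph

open Finset Function NatLaw

variable {V E : Type*} [Fintype V] [DecidableEq V] [Fintype E] [DecidableEq E]

open Classical in
/-- The probability of a property of a random multigraph with the given vertices and edges. -/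
def prob (δ : ℕ → ℝ) (A : Multigraph V E → Prop) : ℝ :=
  (∑ G : Multigraph V E, if A G then G.weight δ else 0) / ∑ G : Multigraph V E, G.weight δ

/-- The relation between the weights and a law. -/
structure IsTilt (δ w : ℕ → ℝ) (χ c : ℝ) : Prop where
  hδ : ∀ j, 0 ≤ δ j
  hχ : 0 < χ
  hc : 0 < c
  hw : ∀ j, δ j / (j ! : ℝ) = c * χ⁻¹ ^ j * w j

variable {δ w : ℕ → ℝ} {χ c : ℝ}

omit [DecidableEq E] in
theorem weight_nonneg (hδ : ∀ j, 0 ≤ δ j) (G : Multigraph V E) : 0 ≤ G.weight δ :=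
  prod_nonneg fun _ _ => hδ _

theorem prob_nonneg (hδ : ∀ j, 0 ≤ δ j) (A : Multigraph V E → Prop) : 0 ≤ prob δ A := by
  refine div_nonneg (sum_nonneg fun G _ => ?_) (sum_nonneg fun G _ => weight_nonneg hδ G)
  split_ifs
  exacts [weight_nonneg hδ G, le_rfl]

theorem prob_mono (hδ : ∀ j, 0 ≤ δ j) {A B : Multigraph V E → Prop} (h : ∀ G, A G → B G) :
    prob δ A ≤ prob δ B := by
  refine div_le_div_of_nonneg_right (sum_le_sum fun G _ => ?_)
    (sum_nonneg fun G _ => weight_nonneg hδ G)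
  have := weight_nonneg hδ G
  by_cases hA : A G
  · simp [hA, h G hA]
  · simp only [hA, if_false]; split_ifs <;> simp [this]

theorem sum_weight_eq (h : IsTilt δ w χ c) : ∑ G : Multigraph V E, G.weight δ =
    c ^ Fintype.card V * χ⁻¹ ^ (2 * Fintype.card E) * (2 * Fintype.card E)! *
      powLaw w (Fintype.card V) (2 * Fintype.card E) := by
  by_cases hne : Nonempty (Multigraph V E)
  · obtain ⟨G₀⟩ := hne
    have h1 := sum_weight_of_prescribed_eq (V := V) (E := E) h.hw ∅ G₀
    simpa [partialDegree, powLaw] using h1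
  · rw [not_nonempty_iff] at hne
    have hE : Nonempty E := by
      by_contra hE
      rw [not_nonempty_iff] at hE
      exact hne.elim isEmptyElim
    have hV : IsEmpty V := by
      by_contra hV
      rw [not_isEmpty_iff] at hV
      obtain ⟨v⟩ := hV
      exact hne.elim fun _ => (v, v)
    have : 2 * Fintype.card E ≠ 0 := by have := Fintype.card_pos (α := E); omega
    rw [Fintype.sum_empty, Fintype.card_eq_zero (α := V), powLaw_zero]
    simp

/-- The normalising factors cancel in the quotient. What remains, besides the factorials, is the
conditional expectation of a product of falling factorials of independent degrees, given that they
sum to twice the number of edges. -/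
theorem prob_prescribed (h : IsTilt δ w χ c) (B : Finset E) (G₀ : Multigraph V E) :
    prob δ (fun G : Multigraph V E => ∀ e ∈ B, G e = G₀ e) =
      (2 * (Fintype.card E - #B))! / (2 * Fintype.card E)! *
        (PowerSeries.coeff (2 * Fintype.card E) (∏ v, PowerSeries.mk fun j =>
          w j * (j.descFactorial (partialDegree B G₀ v) : ℝ)) /
          powLaw w (Fintype.card V) (2 * Fintype.card E)) := by
  have h1 := sum_weight_of_prescribed_eq h.hw B G₀
  have hc := h.hc
  have hχ := h.hχ
  rw [prob, sum_weight_eq h]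
  rw [show (∑ G : Multigraph V E, @ite ℝ (∀ e ∈ B, G e = G₀ e) (Classical.propDecidable _)
    (G.weight δ) 0) = _ from (sum_congr rfl fun G _ => by congr).trans h1]
  have hf : ((2 * Fintype.card E)! : ℝ) ≠ 0 := by positivity
  have hA : c ^ Fintype.card V * χ⁻¹ ^ (2 * Fintype.card E) ≠ 0 := by positivity
  rw [mul_assoc (c ^ Fintype.card V * χ⁻¹ ^ (2 * Fintype.card E)),
    mul_assoc (c ^ Fintype.card V * χ⁻¹ ^ (2 * Fintype.card E)),
    mul_div_mul_left _ _ hA, mul_div_mul_comm]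

variable {k l t : ℕ}

/-- The members of the tuple `p` of labelled multigraphs have the edges prescribed by `F`. -/
def Agrees (p : Fin t → (Fin k → V) × (Fin l → E)) (F : Fin t → Multigraph (Fin k) (Fin l))
    (G : Multigraph V E) : Prop :=
  ∀ i e, G ((p i).2 e) = ((p i).1 (F i e).1, (p i).1 (F i e).2)

-- For given injective labels the multigraph F' can be read off from G, so the events for different
-- F' are disjoint.
open Classical in
theorem prob_isCopy_eq (δ : ℕ → ℝ) {oriented : Bool} {F : Multigraph (Fin k) (Fin l)}
    {p : Fin t → (Fin k → V) × (Fin l → E)} (h1 : ∀ i, Injective (p i).1)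
    (h2 : ∀ i, Injective (p i).2) :
    prob δ (fun G : Multigraph V E => ∀ i, IsCopy oriented F G (p i)) =
      ∑ F' : Fin t → Multigraph (Fin k) (Fin l),
        if ∀ i, Isomorphic oriented F (F' i) then prob δ (Agrees p F') else 0 := by
  simp only [prob]
  have h3 : ∀ F' : Fin t → Multigraph (Fin k) (Fin l),
      (if ∀ i, Isomorphic oriented F (F' i) then
        (∑ G : Multigraph V E, if Agrees p F' G then G.weight δ else 0) /
          ∑ G : Multigraph V E, G.weight δ else 0) =
      (∑ G : Multigraph V E, if (∀ i, Isomorphic oriented F (F' i)) ∧ Agrees p F' G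
        then G.weight δ else 0) / ∑ G : Multigraph V E, G.weight δ := fun F' => by
    by_cases h : ∀ i, Isomorphic oriented F (F' i)
    · simp only [h, implies_true, if_true, true_and]
    · simp only [h, if_false, false_and, sum_const_zero, zero_div]
  rw [sum_congr rfl fun F' _ => h3 F', ← sum_div, sum_comm]
  congr 1
  refine sum_congr rfl fun G _ => ?_
  by_cases h : ∀ i, IsCopy oriented F G (p i)
  · rw [if_pos h]
    choose _ _ F' hF' hG using h
    rw [sum_eq_single F', if_pos ⟨hF', hG⟩]
    · intro F'' _ hne
      refine if_neg fun h4 => hne ?_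
      funext i e
      have h5 := (h4.2 i e).symm.trans (hG i e)
      rw [Prod.mk.injEq] at h5
      exact Prod.ext (h1 i h5.1) (h1 i h5.2)
    · simp
  · rw [if_neg h]
    refine (sum_eq_zero fun F' _ => if_neg fun h4 => h fun i => ?_).symm
    exact ⟨h1 i, h2 i, F' i, h4.1 i, h4.2 i⟩

/-- The probability that separated copies are present depends only on the labelled multigraphs. -/
theorem prob_agrees_of_separated [Nonempty V] (h : IsTilt δ w χ c)
    {p : Fin t → (Fin k → V) × (Fin l → E)} (hs : Separated p)
    (F : Fin t → Multigraph (Fin k) (Fin l)) :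
    prob δ (Agrees p F) = (2 * (Fintype.card E - t * l))! / (2 * Fintype.card E)! *
        (PowerSeries.coeff (2 * Fintype.card E) ((∏ q : Fin t × Fin k, PowerSeries.mk fun j =>
          w j * (j.descFactorial ((F q.1).degree q.2) : ℝ)) *
            PowerSeries.mk w ^ (Fintype.card V - t * k)) /
          powLaw w (Fintype.card V) (2 * Fintype.card E)) := by
  obtain ⟨v₀⟩ := ‹Nonempty V›
  set g : Fin t × Fin l → E := fun q => (p q.1).2 q.2 with hg
  set f : Fin t × Fin k ↪ V := ⟨fun q => (p q.1).1 q.2, hs.1⟩ with hf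
  -- Only the edges in the range of g matter; the others get an arbitrary value, for which a vertex
  -- is needed.
  set G₀ : Multigraph V E := extend g
    (fun q => (f (q.1, (F q.1 q.2).1), f (q.1, (F q.1 q.2).2))) fun _ => (v₀, v₀) with hG₀
  have hG₀g : ∀ q, G₀ (g q) = (f (q.1, (F q.1 q.2).1), f (q.1, (F q.1 q.2).2)) := fun q =>
    hs.2.extend_apply _ _ q
  set B : Finset E := univ.image g with hB
  have hcard : #B = t * l := by rw [hB, card_image_of_injective _ hs.2]; simp
  have hset : Agrees p F = fun G : Multigraph V E => ∀ e ∈ B, G e = G₀ e := by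
    ext G
    simp only [hB, forall_mem_image, mem_univ, forall_const, hG₀g, Prod.forall]
    exact Iff.rfl
  have hdeg : ∀ v, partialDegree B G₀ v = ∑ q : Fin t × Fin l,
      ((if f (q.1, (F q.1 q.2).1) = v then 1 else 0) +
        if f (q.1, (F q.1 q.2).2) = v then 1 else 0) := fun v => by
    rw [partialDegree, hB, sum_image fun a _ b _ hab => hs.2 hab]
    exact sum_congr rfl fun q _ => by rw [hG₀g]
  rw [hset, prob_prescribed h, hcard, prod_descFactorial_eq w f]
  · rw [Fintype.card_prod, Fintype.card_fin, Fintype.card_fin]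
    congr 5
    funext q
    congr 1
    ext j
    congr 3
    rw [hdeg, Fintype.sum_prod_type, sum_eq_single q.1, degree]
    · refine sum_congr rfl fun e _ => ?_
      simp only [EmbeddingLike.apply_eq_iff_eq, Prod.ext_iff, true_and]
    · intro i _ hi
      refine sum_eq_zero fun e _ => ?_
      simp only [EmbeddingLike.apply_eq_iff_eq, Prod.ext_iff, hi, false_and, if_false, add_zero]
    · simp
  · intro v hv
    rw [hdeg]
    refine sum_eq_zero fun q _ => ?_
    rw [if_neg fun h => hv ⟨_, h⟩, if_neg fun h => hv ⟨_, h⟩]; rfl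

/-- The probability that overlapping copies are present. -/
theorem prob_agrees_le (h : IsTilt δ w χ c) {p : Fin t → (Fin k → V) × (Fin l → E)}
    {F : Fin t → Multigraph (Fin k) (Fin l)} {G₁ : Multigraph V E} (hG : Agrees p F G₁) :
    ∃ d : Fin #(univ.biUnion fun i => (support (p i)).1) → ℕ,
      ∑ i, d i = 2 * #(univ.biUnion fun i => (support (p i)).2) ∧
      prob δ (Agrees p F) ≤
        (2 * (Fintype.card E - #(univ.biUnion fun i => (support (p i)).2)))! /
          (2 * Fintype.card E)! *
        (PowerSeries.coeff (2 * Fintype.card E) ((∏ i, PowerSeries.mk fun j =>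
          w j * (j.descFactorial (d i) : ℝ)) * PowerSeries.mk w ^
            (Fintype.card V - #(univ.biUnion fun i => (support (p i)).1))) /
          powLaw w (Fintype.card V) (2 * Fintype.card E)) := by
  set S := univ.biUnion fun i => (support (p i)).1 with hS
  set B := univ.biUnion fun i => (support (p i)).2 with hB
  set f : Fin #S ↪ V := (S.equivFin.symm.toEmbedding).trans (Embedding.subtype _) with hf
  have hrange : ∀ v, v ∉ Set.range f → v ∉ S := fun v hv hvS =>
    hv ⟨S.equivFin ⟨v, hvS⟩, by simp [hf]⟩
  have hmem : ∀ e ∈ B, (G₁ e).1 ∈ S ∧ (G₁ e).2 ∈ S := by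
    intro e he
    obtain ⟨i, -, hi⟩ := mem_biUnion.1 he
    obtain ⟨e', -, rfl⟩ := mem_image.1 hi
    rw [hG i e']
    exact ⟨mem_biUnion.2 ⟨i, mem_univ _, mem_image_of_mem _ (mem_univ _)⟩,
      mem_biUnion.2 ⟨i, mem_univ _, mem_image_of_mem _ (mem_univ _)⟩⟩
  have hzero : ∀ v, v ∉ S → partialDegree B G₁ v = 0 := fun v hv => by
    refine sum_eq_zero fun e he => ?_
    rw [if_neg fun h' => hv (by rw [← h']; exact (hmem e he).1),
      if_neg fun h' => hv (by rw [← h']; exact (hmem e he).2)]; rfl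
  refine ⟨fun i => partialDegree B G₁ (f i), ?_, ?_⟩
  · rw [← sum_partialDegree B G₁, ← sum_map univ f (fun v => partialDegree B G₁ v)]
    refine sum_subset (subset_univ _) fun v _ hv => hzero v (hrange v ?_)
    simpa using hv
  · refine (prob_mono h.hδ (B := fun G => ∀ e ∈ B, G e = G₁ e) fun G hA e he => ?_).trans
      (le_of_eq ?_)
    · obtain ⟨i, -, hi⟩ := mem_biUnion.1 he
      obtain ⟨e', -, rfl⟩ := mem_image.1 hi
      rw [hG i e', hA i e']
    · rw [prob_prescribed h, prod_descFactorial_eq w f _ fun v hv => hzero v (hrange v hv)]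
      simp

end Multigraph

end

/-! ### Binomial moments: separated and overlapping tuples -/

noncomputable section

namespace Multigraph

open Finset Function NatLaw

variable {V E : Type*} [Fintype V] [DecidableEq V] [Fintype E] [DecidableEq E]
variable {k l t : ℕ}

/-- The binomial moment of the number of copies of `F` in a random multigraph. -/
def binomialMoment (V E : Type*) [Fintype V] [DecidableEq V] [Fintype E] [DecidableEq E]
    (δ : ℕ → ℝ) (oriented : Bool) (F : Multigraph (Fin k) (Fin l)) (t : ℕ) : ℝ :=
  (∑ G : Multigraph V E, G.weight δ * ((numCopies oriented F G).choose t : ℝ)) /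
    ∑ G : Multigraph V E, G.weight δ

-- If G has N copies, the t-tuples of labelled copies with distinct supports number (k! l!)^t t!
-- C(N, t).
open Classical in
theorem binomialMoment_eq (δ : ℕ → ℝ) (oriented : Bool) (F : Multigraph (Fin k) (Fin l)) :
    ((k ! * l ! : ℕ) : ℝ) ^ t * (t ! : ℝ) * binomialMoment V E δ oriented F t =
      ∑ c : Fin t → (Fin k → V) × (Fin l → E), if Injective (support ∘ c) then
        prob δ (fun G : Multigraph V E => ∀ i, IsCopy oriented F G (c i)) else 0 := by
  have h1 : ∀ c : Fin t → (Fin k → V) × (Fin l → E), (if Injective (support ∘ c) then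
      prob δ (fun G : Multigraph V E => ∀ i, IsCopy oriented F G (c i)) else 0) =
      (∑ G : Multigraph V E, G.weight δ * if (∀ i, IsCopy oriented F G (c i)) ∧
        Injective (support ∘ c) then 1 else 0) / ∑ G : Multigraph V E, G.weight δ := fun c => by
    by_cases h : Injective (support ∘ c)
    · simp only [h, if_true, and_true, prob, mul_ite, mul_one, mul_zero]
      congr 1
      exact sum_congr rfl fun G _ => by congr
    · simp only [h, if_false, and_false, mul_zero, sum_const_zero, zero_div]
  rw [sum_congr rfl fun c _ => h1 c, ← sum_div, sum_comm, binomialMoment, mul_div_assoc']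
  congr 1
  rw [mul_sum]
  refine sum_congr rfl fun G _ => ?_
  rw [← mul_sum, sum_boole, ← Fintype.card_subtype, ← Nat.card_eq_fintype_card, card_tuples_eq,
    Nat.descFactorial_eq_factorial_mul_choose]
  push_cast
  ring

omit [DecidableEq V] [DecidableEq E] in
theorem card_separated : Nat.card {c : Fin t → (Fin k → V) × (Fin l → E) // Separated c} =
    (Fintype.card V).descFactorial (t * k) * (Fintype.card E).descFactorial (t * l) := by
  have e : {c : Fin t → (Fin k → V) × (Fin l → E) // Separated c} ≃
      ((Fin t × Fin k) ↪ V) × ((Fin t × Fin l) ↪ E) :=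
    { toFun := fun c => (⟨_, c.2.1⟩, ⟨_, c.2.2⟩)
      invFun := fun p => ⟨fun i => (fun a => p.1 (i, a), fun e => p.2 (i, e)),
        p.1.injective, p.2.injective⟩
      left_inv := fun c => rfl
      right_inv := fun p => rfl }
  rw [Nat.card_congr e, Nat.card_eq_fintype_card, Fintype.card_prod, Fintype.card_embedding_eq,
    Fintype.card_embedding_eq]
  simp

/-- Maps weighted by the sizes of their ranges. -/
theorem sum_inv_pow_card_image_le {ι : Type*} [Fintype ι] [DecidableEq ι] (hV : 0 < Fintype.card V) :
    ∑ f : ι → V, ((Fintype.card V : ℝ) ^ #(univ.image f))⁻¹ ≤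
      ∑ v ∈ range (Fintype.card ι + 1), (v : ℝ) ^ Fintype.card ι := by
  classical
  have h1 : ∀ f ∈ (univ : Finset (ι → V)), #(univ.image f) ∈ range (Fintype.card ι + 1) :=
    fun f _ => mem_range.2 (Nat.lt_succ_of_le card_image_le)
  rw [← sum_fiberwise_of_maps_to h1]
  refine sum_le_sum fun v _ => ?_
  have hN : (0 : ℝ) < (Fintype.card V : ℝ) ^ v := by positivity
  rw [sum_congr rfl fun f hf => by rw [(mem_filter.1 hf).2], sum_const, nsmul_eq_mul,
    mul_inv_le_iff₀ hN]
  -- A map with v values factors through `Fin v`, which leaves at most v^|ι| |V|^v maps.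
  have h2 : {f ∈ (univ : Finset (ι → V)) | #(univ.image f) = v} ⊆
      (univ : Finset ((ι → Fin v) × (Fin v → V))).image fun p => p.2 ∘ p.1 := by
    intro f hf
    have hv := (mem_filter.1 hf).2
    let e := (univ.image f).equivFinOfCardEq hv
    refine mem_image.2 ⟨(fun i => e ⟨f i, mem_image_of_mem f (mem_univ i)⟩,
      fun a => (e.symm a : V)), mem_univ _, ?_⟩
    funext i
    simp
  have h3 := (card_le_card h2).trans card_image_le
  rw [card_univ, Fintype.card_prod, Fintype.card_fun, Fintype.card_fun, Fintype.card_fin] at h3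
  exact_mod_cast h3

/-- The joint support of a tuple of copies. -/
def jointSupport (c : Fin t → (Fin k → V) × (Fin l → E)) : Finset V × Finset E :=
  (univ.biUnion fun i => (support (c i)).1, univ.biUnion fun i => (support (c i)).2)

omit [Fintype V] [Fintype E] in
theorem jointSupport_eq (c : Fin t → (Fin k → V) × (Fin l → E)) :
    jointSupport c = (univ.image fun q : Fin t × Fin k => (c q.1).1 q.2,
      univ.image fun q : Fin t × Fin l => (c q.1).2 q.2) := by
  rw [jointSupport]
  congr 1
  · ext v; simp [support]
  · ext v; simp [support]

omit [Fintype V] [Fintype E] in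
theorem card_jointSupport_le (c : Fin t → (Fin k → V) × (Fin l → E)) :
    #(jointSupport c).1 ≤ t * k ∧ #(jointSupport c).2 ≤ t * l := by
  rw [jointSupport_eq]
  constructor <;> refine card_image_le.trans ?_ <;> simp

/-- There are O(n^r m^b) tuples whose joint support has r vertices and b edges, so these weights
have a total which is bounded independently of n and m. -/
theorem sum_inv_jointSupport_le (hV : 0 < Fintype.card V) (hE : 0 < Fintype.card E) :
    ∑ c : Fin t → (Fin k → V) × (Fin l → E), ((Fintype.card V : ℝ) ^ #(jointSupport c).1)⁻¹ *
      ((Fintype.card E : ℝ) ^ #(jointSupport c).2)⁻¹ ≤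
      (∑ v ∈ range (t * k + 1), (v : ℝ) ^ (t * k)) *
        ∑ v ∈ range (t * l + 1), (v : ℝ) ^ (t * l) := by
  let e : (Fin t → (Fin k → V) × (Fin l → E)) ≃ (Fin t × Fin k → V) × (Fin t × Fin l → E) :=
    { toFun := fun c => (fun q => (c q.1).1 q.2, fun q => (c q.1).2 q.2)
      invFun := fun p i => (fun a => p.1 (i, a), fun e => p.2 (i, e))
      left_inv := fun c => rfl
      right_inv := fun p => rfl }
  rw [Fintype.sum_equiv e _ (fun p => ((Fintype.card V : ℝ) ^ #(univ.image p.1))⁻¹ *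
    ((Fintype.card E : ℝ) ^ #(univ.image p.2))⁻¹) fun c => by rw [jointSupport_eq]; rfl,
    Fintype.sum_prod_type]
  dsimp only
  rw [← sum_mul_sum]
  have h1 := sum_inv_pow_card_image_le (ι := Fin t × Fin k) hV
  have h2 := sum_inv_pow_card_image_le (ι := Fin t × Fin l) hE
  simp only [Fintype.card_prod, Fintype.card_fin] at h1 h2
  exact mul_le_mul h1 h2 (sum_nonneg fun _ _ => by positivity) (sum_nonneg fun _ _ => by positivity)

open Classical in
/-- The contribution of the separated tuples. -/
theorem sum_separated [Nonempty V] {δ w : ℕ → ℝ} {χ c : ℝ} (h : IsTilt δ w χ c) (oriented : Bool)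
    (F : Multigraph (Fin k) (Fin l)) :
    ∑ p : Fin t → (Fin k → V) × (Fin l → E), (if Separated p then
      prob δ (fun G : Multigraph V E => ∀ i, IsCopy oriented F G (p i)) else 0) =
      ((Fintype.card V).descFactorial (t * k) * (Fintype.card E).descFactorial (t * l) : ℝ) *
      ((2 * (Fintype.card E - t * l))! / (2 * Fintype.card E)!) *
      ∑ F' : Fin t → Multigraph (Fin k) (Fin l), if ∀ i, Isomorphic oriented F (F' i) then
        PowerSeries.coeff (2 * Fintype.card E) ((∏ q : Fin t × Fin k, PowerSeries.mk fun j =>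
          w j * (j.descFactorial ((F' q.1).degree q.2) : ℝ)) *
            PowerSeries.mk w ^ (Fintype.card V - t * k)) /
          powLaw w (Fintype.card V) (2 * Fintype.card E) else 0 := by
  set Z := ∑ F' : Fin t → Multigraph (Fin k) (Fin l), (if ∀ i, Isomorphic oriented F (F' i) then
        PowerSeries.coeff (2 * Fintype.card E) ((∏ q : Fin t × Fin k, PowerSeries.mk fun j =>
          w j * (j.descFactorial ((F' q.1).degree q.2) : ℝ)) *
            PowerSeries.mk w ^ (Fintype.card V - t * k)) /
          powLaw w (Fintype.card V) (2 * Fintype.card E) else 0) with hZ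
  have h1 : ∀ p : Fin t → (Fin k → V) × (Fin l → E), (if Separated p then
      prob δ (fun G : Multigraph V E => ∀ i, IsCopy oriented F G (p i)) else 0) =
      (((2 * (Fintype.card E - t * l))! / (2 * Fintype.card E)!) * Z) *
        if Separated p then 1 else 0 := fun p => by
    by_cases hs : Separated p
    · rw [if_pos hs, if_pos hs, mul_one, prob_isCopy_eq δ
        (fun i a b hab => congrArg Prod.snd (@hs.1 (i, a) (i, b) hab))
        (fun i a b hab => congrArg Prod.snd (@hs.2 (i, a) (i, b) hab)), hZ, mul_sum]
      refine sum_congr rfl fun F' _ => ?_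
      rw [mul_ite, mul_zero, prob_agrees_of_separated h hs]
    · rw [if_neg hs, if_neg hs, mul_zero]
  rw [sum_congr rfl fun p _ => h1 p, ← mul_sum, sum_boole, ← Fintype.card_subtype,
    Nat.card_eq_fintype_card.symm.trans (card_separated (V := V) (E := E) (k := k) (l := l))]
  push_cast
  ring

open Classical in
/-- The contribution of the overlapping tuples. -/
theorem sum_overlap_le {δ w : ℕ → ℝ} {χ c ρ : ℝ} (h : IsTilt δ w χ c) (oriented : Bool)
    {F : Multigraph (Fin k) (Fin l)} (hF : F.StrictlyBalanced) (hV : 0 < Fintype.card V)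
    (hE : 0 < Fintype.card E) (hρ : 0 ≤ ρ)
    (hb : ∀ r b : ℕ, ∀ d : Fin r → ℕ, ∑ i, d i = 2 * b → r ≤ t * k → b ≤ t * l →
      l * r < k * b → (2 * (Fintype.card E - b))! / (2 * Fintype.card E)! *
        (PowerSeries.coeff (2 * Fintype.card E) ((∏ i, PowerSeries.mk fun j =>
          w j * (j.descFactorial (d i) : ℝ)) * PowerSeries.mk w ^ (Fintype.card V - r)) /
          powLaw w (Fintype.card V) (2 * Fintype.card E)) ≤
        ρ * (((Fintype.card V : ℝ) ^ r)⁻¹ * ((Fintype.card E : ℝ) ^ b)⁻¹)) :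
    ∑ p : Fin t → (Fin k → V) × (Fin l → E), (if Injective (support ∘ p) ∧ ¬ Separated p then
      prob δ (fun G : Multigraph V E => ∀ i, IsCopy oriented F G (p i)) else 0) ≤
      Fintype.card (Fin t → Multigraph (Fin k) (Fin l)) * ρ *
        ((∑ v ∈ range (t * k + 1), (v : ℝ) ^ (t * k)) *
        ∑ v ∈ range (t * l + 1), (v : ℝ) ^ (t * l)) := by
  refine le_trans ?_ (mul_le_mul_of_nonneg_left (sum_inv_jointSupport_le hV hE)
    (by positivity : (0 : ℝ) ≤ Fintype.card (Fin t → Multigraph (Fin k) (Fin l)) * ρ))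
  rw [mul_sum]
  refine sum_le_sum fun p _ => ?_
  set g := ((Fintype.card V : ℝ) ^ #(jointSupport p).1)⁻¹ *
      ((Fintype.card E : ℝ) ^ #(jointSupport p).2)⁻¹ with hg
  have hg0 : 0 ≤ g := by positivity
  by_cases hp : (Injective (support ∘ p) ∧ ¬ Separated p) ∧
      (∀ i, Injective (p i).1) ∧ ∀ i, Injective (p i).2
  · rw [if_pos hp.1, prob_isCopy_eq δ hp.2.1 hp.2.2, mul_assoc, ← nsmul_eq_mul, ← card_univ]
    refine sum_le_card_nsmul _ _ _ fun F' _ => ?_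
    split_ifs with hF'
    · by_cases hG : ∃ G₁ : Multigraph V E, Agrees p F' G₁
      · obtain ⟨G₁, hG₁⟩ := hG
        obtain ⟨d, hd, hle⟩ := prob_agrees_le h hG₁
        have hex := excess_pos_of_not_separated hF (oriented := oriented) (G := G₁) (c := p)
          (fun i => ⟨hp.2.1 i, hp.2.2 i, F' i, hF' i, hG₁ i⟩) hp.1.1 hp.1.2
        refine hle.trans (hb _ _ d hd (card_jointSupport_le p).1 (card_jointSupport_le p).2 ?_)
        rw [excess] at hex
        exact_mod_cast sub_pos.1 hex
      · have : prob δ (Agrees p F') = 0 := by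
          rw [prob, sum_eq_zero fun G _ => if_neg fun hA => hG ⟨G, hA⟩, zero_div]
        rw [this]
        positivity
    · positivity
  · refine le_trans (le_of_eq ?_) (by positivity : (0 : ℝ) ≤ _ * ρ * g)
    split_ifs with hp1
    · rw [prob, sum_eq_zero, zero_div]
      intro G _
      exact if_neg fun hA => hp ⟨hp1, fun i => (hA i).1, fun i => (hA i).2.1⟩
    · rfl

open Classical in
theorem binomialMoment_split (hk : 0 < k) (δ : ℕ → ℝ) (oriented : Bool)
    (F : Multigraph (Fin k) (Fin l)) :
    ((k ! * l ! : ℕ) : ℝ) ^ t * (t ! : ℝ) * binomialMoment V E δ oriented F t =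
      ∑ p : Fin t → (Fin k → V) × (Fin l → E), (if Separated p then
        prob δ (fun G : Multigraph V E => ∀ i, IsCopy oriented F G (p i)) else 0) +
      ∑ p : Fin t → (Fin k → V) × (Fin l → E), (if Injective (support ∘ p) ∧ ¬ Separated p then
        prob δ (fun G : Multigraph V E => ∀ i, IsCopy oriented F G (p i)) else 0) := by
  rw [binomialMoment_eq, ← sum_add_distrib]
  refine sum_congr rfl fun p _ => ?_
  by_cases hs : Separated p
  · simp [hs, hs.injective_support hk]
  · simp [hs]

end Multigraph

end

/-! ### Growth rates -/

noncomputable section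

namespace NatLaw

open Finset PowerSeries

variable {w : ℕ → ℕ → ℝ} {M μ : ℕ → ℝ} {x : ℕ → ℕ} {C κ : ℝ} {y : ℕ → ℕ → ℝ}

theorem GibbsSetup.powLaw_pos (h : GibbsSetup w M μ x C κ y) :
    ∀ᶠ n in atTop, 0 < powLaw (w n) n (x n) :=
  (h.hlow 1 one_pos).mono fun _ hn => (Real.exp_pos _).trans_le hn

theorem GibbsSetup.y_nonneg (h : GibbsSetup w M μ x C κ y) :
    ∀ᶠ n in atTop, ∀ d, 0 ≤ y n d := by
  filter_upwards [h.hy, h.hset] with n hy hs d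
  exact (hy d).nonneg fun j => mul_nonneg (hs.law.nonneg j) (Nat.cast_nonneg _)

theorem GibbsSetup.isBigO_prod_y (h : GibbsSetup w M μ x C κ y) {ι : Type*} [Fintype ι]
    (d : ι → ℕ) : (fun n => ∏ i, y n (d i)) =O[atTop] fun n => M n ^ ∑ i, d i := by
  simp only [← prod_pow_eq_pow_sum]
  refine IsBigO.finsetProd fun i _ => ?_
  obtain ⟨K, hK⟩ := h.hyM (d i)
  refine IsBigO.of_bound K ?_
  filter_upwards [hK, h.y_nonneg, h.hM] with n hK h0 hM
  rw [Real.norm_of_nonneg (h0 _), Real.norm_of_nonneg (by have := hM.1; positivity)]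
  exact hK

theorem GibbsSetup.moment_isLittleO (h : GibbsSetup w M μ x C κ y) {ι : Type*} [Fintype ι]
    (d : ι → ℕ) : (fun n => coeff (x n) ((∏ i, PowerSeries.mk fun j =>
        w n j * (j.descFactorial (d i) : ℝ)) * PowerSeries.mk (w n) ^ (n - Fintype.card ι)) /
          powLaw (w n) n (x n) - ∏ i, y n (d i)) =o[atTop] fun n => M n ^ ∑ i, d i := by
  set e := (Fintype.equivFin ι).symm
  refine isLittleO_iff.2 fun η hη => ?_
  filter_upwards [h.moment (fun i => d (e i)) hη, h.powLaw_pos, h.hM] with n hn hp hM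
  rw [Equiv.prod_comp e fun i => PowerSeries.mk fun j => w n j * (j.descFactorial (d i) : ℝ),
    Equiv.prod_comp e fun i => y n (d i), Equiv.sum_comp e] at hn
  rw [Real.norm_of_nonneg (by have := hM.1; positivity : 0 ≤ M n ^ ∑ i, d i), Real.norm_eq_abs]
  refine le_of_mul_le_mul_right ?_ hp
  rw [← abs_of_pos hp, ← abs_mul, abs_of_pos hp, sub_mul, div_mul_cancel₀ _ hp.ne']
  exact hn

/-- Only finitely many d have sum D, so their constants can be added. The uniformity serves
overlapping tuples, whose degrees are not specified. -/
theorem GibbsSetup.moment_le (h : GibbsSetup w M μ x C κ y) (r D : ℕ) :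
    ∃ K : ℝ, 0 ≤ K ∧ ∀ᶠ n in atTop, ∀ d : Fin r → ℕ, ∑ i, d i = D →
      coeff (x n) ((∏ i, PowerSeries.mk fun j => w n j * (j.descFactorial (d i) : ℝ)) *
        PowerSeries.mk (w n) ^ (n - r)) / powLaw (w n) n (x n) ≤ K * M n ^ D := by
  have h1 : ∀ d : Fin r → ℕ, ∃ K : ℝ, 0 ≤ K ∧ ∀ᶠ n in atTop,
      coeff (x n) ((∏ i, PowerSeries.mk fun j => w n j * (j.descFactorial (d i) : ℝ)) *
        PowerSeries.mk (w n) ^ (n - r)) / powLaw (w n) n (x n) ≤ K * M n ^ ∑ i, d i := by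
    intro d
    have h2 := (h.moment_isLittleO d).isBigO.add (h.isBigO_prod_y d)
    obtain ⟨K, hK0, hK⟩ := h2.exists_nonneg
    refine ⟨K, hK0, ?_⟩
    filter_upwards [hK.bound, h.hM] with n hn hM
    rw [Real.norm_of_nonneg (by have := hM.1; positivity : 0 ≤ M n ^ ∑ i, d i)] at hn
    simpa using (le_abs_self _).trans hn
  choose K hK0 hK using h1
  set T : Finset (Fin r → ℕ) := piAntidiag univ D with hT
  refine ⟨∑ d ∈ T, K d, sum_nonneg fun d _ => hK0 d, ?_⟩
  filter_upwards [(Finset.eventually_all T).2 fun d _ => hK d, h.hM] with n hn hM d hd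
  have hdT : d ∈ T := by simp [hT, hd]
  refine (hn d hdT).trans ?_
  rw [hd]
  have := hM.1
  gcongr
  exact single_le_sum (f := K) (fun d _ => hK0 d) hdT

end NatLaw

namespace Multigraph

open Finset Function NatLaw

/-- The assumptions for the number of copies of a graph with `k` vertices and `l` edges. -/
structure CopySetup (δ : ℕ → ℝ) (w : ℕ → ℕ → ℝ) (χ c M μ : ℕ → ℝ) (m : ℕ → ℕ) (C κ : ℝ)
    (y : ℕ → ℕ → ℝ) (k l : ℕ) : Prop where
  gibbs : GibbsSetup w M μ (fun n => 2 * m n) C κ y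
  tilt : ∀ᶠ n in atTop, IsTilt δ (w n) (χ n) (c n)
  hk : 0 < k
  hl : 0 < l
  hmtop : Tendsto m atTop atTop
  hMm : ∃ K : ℝ, 0 ≤ K ∧ ∀ᶠ n : ℕ in atTop, M n * n ≤ K * m n
  hmn : ∃ K : ℝ, 0 ≤ K ∧ ∀ᶠ n : ℕ in atTop, (m n : ℝ) ≤ K * (n : ℝ) ^ (2 - (k : ℝ) / l)

theorem factorial_ratio_le {m b : ℕ} (hb : 2 * b ≤ m) :
    ((2 * (m - b))! : ℝ) / (2 * m)! ≤ ((m : ℝ) ^ (2 * b))⁻¹ := by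
  have h1 := Nat.factorial_mul_descFactorial (n := 2 * m) (k := 2 * b) (by omega)
  have h2 := Nat.pow_sub_le_descFactorial (2 * m) (2 * b)
  have h3 : m ^ (2 * b) ≤ (2 * m).descFactorial (2 * b) :=
    (Nat.pow_le_pow_left (by omega) _).trans h2
  rw [show 2 * m - 2 * b = 2 * (m - b) by omega] at h1
  rcases Nat.eq_zero_or_pos m with rfl | hm
  · obtain rfl : b = 0 := by omega
    simp
  have h4 : (0 : ℝ) < (m : ℝ) ^ (2 * b) := by positivity
  rw [← h1, div_le_iff₀ (by rw [h1]; positivity), ← div_eq_inv_mul, le_div_iff₀ h4]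
  push_cast
  gcongr
  exact_mod_cast h3

variable {δ : ℕ → ℝ} {w : ℕ → ℕ → ℝ} {χ c M μ : ℕ → ℝ} {m : ℕ → ℕ} {C κ : ℝ}
    {y : ℕ → ℕ → ℝ} {k l : ℕ}

/-- The probability is O((M/m)^(2b)) = O(n^(-2b)). As l r + 1 ≤ k b by integrality, m = O(n^(2 -
k/l)) gives m^b n^r = O(n^(2b - 1/l)): the smallest possible excess is worth a factor n^(-1/l). -/
theorem CopySetup.overlap_bound (h : CopySetup δ w χ c M μ m C κ y k l) {r b : ℕ}
    (hrb : l * r < k * b) : ∃ K : ℝ, 0 ≤ K ∧ ∀ᶠ n : ℕ in atTop, ∀ d : Fin r → ℕ, ∑ i, d i = 2 * b →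
      (2 * (m n - b))! / (2 * m n)! * (PowerSeries.coeff (2 * m n) ((∏ i, PowerSeries.mk fun j =>
          w n j * (j.descFactorial (d i) : ℝ)) * PowerSeries.mk (w n) ^ (n - r)) /
          powLaw (w n) n (2 * m n)) ≤
        K * (n : ℝ) ^ (-(1 / (l : ℝ))) * (((n : ℝ) ^ r)⁻¹ * ((m n : ℝ) ^ b)⁻¹) := by
  obtain ⟨K₁, hK₁, h1⟩ := h.gibbs.moment_le r (2 * b)
  obtain ⟨K₂, hK₂, h2⟩ := h.hMm
  obtain ⟨K₃, hK₃, h3⟩ := h.hmn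
  refine ⟨K₁ * K₂ ^ (2 * b) * K₃ ^ b, by positivity, ?_⟩
  filter_upwards [h1, h2, h3, h.gibbs.hM, h.hmtop.eventually_ge_atTop (2 * b + 1),
    eventually_ge_atTop 1] with n h1 h2 h3 hM hmb hn d hd
  have hm0 : (0 : ℝ) < m n := by have : 0 < m n := by omega
                                 exact_mod_cast this
  have hn1 : (1 : ℝ) ≤ n := by exact_mod_cast hn
  have hn0 : (0 : ℝ) < n := by linarith
  have hl : (0 : ℝ) < l := by exact_mod_cast h.hl
  have hM0 : 0 ≤ M n := by linarith [hM.1]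
  have e1 : (m n : ℝ) ^ b * (n : ℝ) ^ r ≤
      K₃ ^ b * (n : ℝ) ^ (2 * b) * (n : ℝ) ^ (-(1 / (l : ℝ))) := by
    calc (m n : ℝ) ^ b * (n : ℝ) ^ r ≤ (K₃ * (n : ℝ) ^ (2 - (k : ℝ) / l)) ^ b * (n : ℝ) ^ r := by
          gcongr
      _ = K₃ ^ b * (n : ℝ) ^ ((2 - (k : ℝ) / l) * b + r) := by
          rw [mul_pow, ← Real.rpow_natCast ((n : ℝ) ^ _) b, ← Real.rpow_mul hn0.le, mul_assoc,
            ← Real.rpow_natCast (n : ℝ) r, ← Real.rpow_add hn0]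
      _ ≤ K₃ ^ b * (n : ℝ) ^ (((2 * b : ℕ) : ℝ) + -(1 / (l : ℝ))) := by
          gcongr ?_ * ?_
          refine Real.rpow_le_rpow_of_exponent_le hn1 ?_
          have hrb' : (l : ℝ) * r + 1 ≤ k * b := by exact_mod_cast hrb
          have : (r : ℝ) + 1 / l ≤ k / l * b := by
            rw [div_mul_eq_mul_div, le_div_iff₀ hl, add_mul, one_div_mul_cancel hl.ne']; linarith
          push_cast; linarith
      _ = _ := by rw [Real.rpow_add hn0, Real.rpow_natCast, mul_assoc]
  have e2 : M n ^ (2 * b) ≤ K₂ ^ (2 * b) * (m n : ℝ) ^ (2 * b) / (n : ℝ) ^ (2 * b) := by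
    rw [le_div_iff₀ (by positivity), ← mul_pow, ← mul_pow]
    exact pow_le_pow_left₀ (by positivity) h2 _
  calc _ ≤ ((m n : ℝ) ^ (2 * b))⁻¹ * (K₁ * M n ^ (2 * b)) :=
        mul_le_mul_of_nonneg (factorial_ratio_le (by omega)) (h1 d hd) (by positivity)
          (by positivity)
    _ ≤ ((m n : ℝ) ^ (2 * b))⁻¹ *
        (K₁ * (K₂ ^ (2 * b) * (m n : ℝ) ^ (2 * b) / (n : ℝ) ^ (2 * b))) := by gcongr
    _ = K₁ * K₂ ^ (2 * b) * ((n : ℝ) ^ (2 * b))⁻¹ := by field_simp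
    _ ≤ K₁ * K₂ ^ (2 * b) * (K₃ ^ b * (n : ℝ) ^ (-(1 / (l : ℝ))) *
        (((n : ℝ) ^ r)⁻¹ * ((m n : ℝ) ^ b)⁻¹)) := by
          gcongr
          rw [← mul_inv, ← div_eq_mul_inv, le_div_iff₀ (by positivity), inv_mul_le_iff₀ (by positivity)]
          linarith
    _ = _ := by ring

/-- From M = O(m/n) one gets n^k m^(-l) M^(2l) = O(m^l n^(k - 2l)), which is bounded exactly because
m = O(n^(2 - k/l)). -/
theorem CopySetup.isBigO_scale (h : CopySetup δ w χ c M μ m C κ y k l) (t : ℕ) :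
    (fun n : ℕ => ((n : ℝ) ^ k / (4 * m n : ℝ) ^ l) ^ t * M n ^ (2 * (t * l))) =O[atTop]
      fun _ => (1 : ℝ) := by
  obtain ⟨K₂, hK₂, h2⟩ := h.hMm
  obtain ⟨K₃, hK₃, h3⟩ := h.hmn
  have h4 : (fun n : ℕ => (n : ℝ) ^ k / (4 * m n : ℝ) ^ l * M n ^ (2 * l)) =O[atTop]
      fun _ => (1 : ℝ) := by
    refine IsBigO.of_bound (K₃ ^ l * K₂ ^ (2 * l)) ?_
    filter_upwards [h2, h3, h.gibbs.hM, h.hmtop.eventually_ge_atTop 1,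
      eventually_ge_atTop 1] with n h2 h3 hM hmb hn
    have hm0 : (0 : ℝ) < m n := by exact_mod_cast hmb
    have hn0 : (0 : ℝ) < n := by exact_mod_cast hn
    have hl : (0 : ℝ) < l := by exact_mod_cast h.hl
    have hM0 : 0 ≤ M n := by linarith [hM.1]
    rw [norm_one, mul_one, Real.norm_of_nonneg (by positivity)]
    have e1 : (m n : ℝ) ^ l * (n : ℝ) ^ k ≤ K₃ ^ l * (n : ℝ) ^ (2 * l) := by
      calc (m n : ℝ) ^ l * (n : ℝ) ^ k ≤ (K₃ * (n : ℝ) ^ (2 - (k : ℝ) / l)) ^ l * (n : ℝ) ^ k := by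
            gcongr
        _ = K₃ ^ l * (n : ℝ) ^ ((2 - (k : ℝ) / l) * l + k) := by
            rw [mul_pow, ← Real.rpow_natCast ((n : ℝ) ^ _) l, ← Real.rpow_mul hn0.le, mul_assoc,
              ← Real.rpow_natCast (n : ℝ) k, ← Real.rpow_add hn0]
        _ = _ := by
            rw [← Real.rpow_natCast (n : ℝ) (2 * l)]
            congr 2; push_cast; field_simp; ring
    have e2 : M n ^ (2 * l) ≤ K₂ ^ (2 * l) * (m n : ℝ) ^ (2 * l) / (n : ℝ) ^ (2 * l) := by
      rw [le_div_iff₀ (by positivity), ← mul_pow, ← mul_pow]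
      exact pow_le_pow_left₀ (by positivity) h2 _
    calc _ ≤ (n : ℝ) ^ k / (m n : ℝ) ^ l *
          (K₂ ^ (2 * l) * (m n : ℝ) ^ (2 * l) / (n : ℝ) ^ (2 * l)) := by
          gcongr
          linarith
      _ = (m n : ℝ) ^ l * (n : ℝ) ^ k / (n : ℝ) ^ (2 * l) * K₂ ^ (2 * l) := by
          rw [show 2 * l = l + l by ring, pow_add (m n : ℝ)]; field_simp
      _ ≤ _ := by
          gcongr
          rw [div_le_iff₀ (by positivity)]; exact e1
  refine (h4.pow t).congr (fun n => ?_) fun n => one_pow t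
  rw [mul_pow, ← pow_mul]; ring_nf

/-- Falling factorials of fixed order are equivalent to powers, and m^(tl)/(2m)^(2tl) = (4m)^(-tl).
-/
theorem CopySetup.isEquivalent_count (h : CopySetup δ w χ c M μ m C κ y k l) (t : ℕ) :
    (fun n : ℕ => (n.descFactorial (t * k) * (m n).descFactorial (t * l) : ℝ) *
      ((2 * (m n - t * l))! / (2 * m n)!)) ~[atTop]
      fun n : ℕ => ((n : ℝ) ^ k / (4 * m n : ℝ) ^ l) ^ t := by
  have h1 := isEquivalent_descFactorial (t * k)
  have h2 := (isEquivalent_descFactorial (t * l)).comp_tendsto h.hmtop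
  have h3 := ((isEquivalent_descFactorial (2 * (t * l))).comp_tendsto
    (tendsto_id.const_mul_atTop' (two_pos (α := ℕ)) |>.comp h.hmtop)).inv
  refine ((h1.mul h2).mul h3).congr_left ?_ |>.congr_right ?_
  · filter_upwards [h.hmtop.eventually_ge_atTop (t * l)] with n hn
    have h4 := Nat.factorial_mul_descFactorial (n := 2 * m n) (k := 2 * (t * l)) (by omega)
    rw [show 2 * m n - 2 * (t * l) = 2 * (m n - t * l) by omega] at h4
    simp only [Pi.mul_apply, comp_apply, Pi.inv_apply, id]
    congr 1
    rw [← h4]; push_cast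
    rw [div_mul_cancel_left₀ (by positivity)]
  · filter_upwards [h.hmtop.eventually_ge_atTop 1] with n hn
    have hm0 : (0 : ℝ) < m n := by exact_mod_cast hn
    simp only [Pi.mul_apply, comp_apply, Pi.inv_apply, id]
    push_cast
    rw [div_pow, mul_pow, mul_pow, mul_pow, ← pow_mul (n : ℝ), ← pow_mul (m n : ℝ), mul_comm k t,
      mul_comm l t, show (4 : ℝ) = 2 ^ 2 by norm_num, ← pow_mul, ← pow_mul, two_mul (t * l),
      pow_add (m n : ℝ), show 2 * (l * t) = t * l + t * l by ring]
    field_simp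

end Multigraph

end

/-! ### Convergence of the binomial moments -/

noncomputable section

namespace Multigraph

open Finset Function NatLaw

variable {δ : ℕ → ℝ} {w : ℕ → ℕ → ℝ} {χ c M μ : ℕ → ℝ} {m : ℕ → ℕ} {C κ : ℝ}
    {y : ℕ → ℕ → ℝ} {k l : ℕ}

theorem sum_degree (G : Multigraph (Fin k) (Fin l)) : ∑ v, G.degree v = 2 * l := by
  have := sum_partialDegree (univ : Finset (Fin l)) G
  rwa [card_univ, Fintype.card_fin] at this

theorem sum_degree_tuple {t : ℕ} (F : Fin t → Multigraph (Fin k) (Fin l)) :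
    ∑ q : Fin t × Fin k, (F q.1).degree q.2 = 2 * (t * l) := by
  rw [Fintype.sum_prod_type, sum_congr rfl fun i _ => sum_degree (F i)]
  simp; ring

open Classical in
theorem factorial_mul_genFun (oriented : Bool) (F : Multigraph (Fin k) (Fin l)) (n m : ℝ)
    (y : ℕ → ℝ) : ((k ! * l ! : ℕ) : ℝ) * F.genFun oriented n (1 / (2 * m)) y =
      n ^ k / (4 * m) ^ l * ∑ F' : Multigraph (Fin k) (Fin l),
        if Isomorphic oriented F F' then ∏ v, y (F'.degree v) else 0 := by
  rw [genFun, mul_sum, mul_sum]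
  refine sum_congr rfl fun F' _ => ?_
  split_ifs
  · have hk : (k ! : ℝ) ≠ 0 := by positivity
    have hl : (l ! : ℝ) ≠ 0 := by positivity
    rw [show (4 : ℝ) * m = 2 * (2 * m) by ring, mul_pow 2 (2 * m), one_div, inv_pow]
    push_cast
    field_simp
  · simp

open Classical in
theorem genFun_pow (oriented : Bool) (F : Multigraph (Fin k) (Fin l)) (n m : ℝ) (y : ℕ → ℝ)
    (t : ℕ) : ((k ! * l ! : ℕ) : ℝ) ^ t * F.genFun oriented n (1 / (2 * m)) y ^ t =
      (n ^ k / (4 * m) ^ l) ^ t * ∑ F' : Fin t → Multigraph (Fin k) (Fin l),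
        if ∀ i, Isomorphic oriented F (F' i) then
          ∏ q : Fin t × Fin k, y ((F' q.1).degree q.2) else 0 := by
  rw [← mul_pow, factorial_mul_genFun, mul_pow, Fintype.sum_pow]
  congr 1
  refine sum_congr rfl fun F' _ => ?_
  rw [prod_ite_zero, Fintype.prod_prod_type]
  simp

-- With a the exact and b the asymptotic count, X the conditional and Y the unconditional moments,
-- aX - bY = (a - b)X + b(X - Y). Both terms are o(b M^(2tl)), since the degrees in t copies add up
-- to 2tl, and b M^(2tl) is bounded.
open Classical in
theorem CopySetup.tendsto_separated (h : CopySetup δ w χ c M μ m C κ y k l) (oriented : Bool)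
    (F : Multigraph (Fin k) (Fin l)) (t : ℕ) :
    Tendsto (fun n : ℕ => (∑ p : Fin t → (Fin k → Fin n) × (Fin l → Fin (m n)), if Separated p then
      prob δ (fun G : Multigraph (Fin n) (Fin (m n)) => ∀ i, IsCopy oriented F G (p i)) else 0) -
      ((k ! * l ! : ℕ) : ℝ) ^ t * F.genFun oriented n (1 / (2 * m n)) (y n) ^ t) atTop (𝓝 0) ∧
    (fun n : ℕ => ((k ! * l ! : ℕ) : ℝ) ^ t * F.genFun oriented n (1 / (2 * m n)) (y n) ^ t)
      =O[atTop] fun _ => (1 : ℝ) := by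
  set X : ℕ → ℝ := fun n => ∑ F' : Fin t → Multigraph (Fin k) (Fin l),
    if ∀ i, Isomorphic oriented F (F' i) then
        PowerSeries.coeff (2 * m n) ((∏ q : Fin t × Fin k, PowerSeries.mk fun j =>
          w n j * (j.descFactorial ((F' q.1).degree q.2) : ℝ)) *
            PowerSeries.mk (w n) ^ (n - t * k)) / powLaw (w n) n (2 * m n) else 0 with hX
  set Y : ℕ → ℝ := fun n => ∑ F' : Fin t → Multigraph (Fin k) (Fin l),
        if ∀ i, Isomorphic oriented F (F' i) then
          ∏ q : Fin t × Fin k, y n ((F' q.1).degree q.2) else 0 with hY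
  set a : ℕ → ℝ := fun n => (n.descFactorial (t * k) * (m n).descFactorial (t * l) : ℝ) *
      ((2 * (m n - t * l))! / (2 * m n)!) with ha
  set b : ℕ → ℝ := fun n => ((n : ℝ) ^ k / (4 * m n : ℝ) ^ l) ^ t with hb
  have hYO : Y =O[atTop] fun n => M n ^ (2 * (t * l)) := by
    refine IsBigO.fun_sum fun F' _ => ?_
    split_ifs
    · have := h.gibbs.isBigO_prod_y fun q : Fin t × Fin k => (F' q.1).degree q.2
      rwa [sum_degree_tuple] at this
    · exact isBigO_zero _ _
  have hXY : (fun n => X n - Y n) =o[atTop] fun n => M n ^ (2 * (t * l)) := by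
    simp only [hX, hY, ← sum_sub_distrib]
    refine IsLittleO.fun_sum fun F' _ => ?_
    split_ifs
    · have := h.gibbs.moment_isLittleO fun q : Fin t × Fin k => (F' q.1).degree q.2
      rwa [sum_degree_tuple, Fintype.card_prod, Fintype.card_fin, Fintype.card_fin] at this
    · simp
  have hXO : X =O[atTop] fun n => M n ^ (2 * (t * l)) :=
    (hXY.isBigO.add hYO).congr_left fun n => by ring
  have hab : (fun n => a n - b n) =o[atTop] b := h.isEquivalent_count t
  have hbM : (fun n => b n * M n ^ (2 * (t * l))) =O[atTop] fun _ => (1 : ℝ) := h.isBigO_scale t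
  have hlim : (fun n => a n * X n - b n * Y n) =o[atTop] fun _ => (1 : ℝ) := by
    have h1 := ((hab.mul_isBigO hXO).add ((isBigO_refl b _).mul_isLittleO hXY)).trans_isBigO hbM
    exact h1.congr_left fun n => by ring
  have hgen : ∀ n : ℕ, ((k ! * l ! : ℕ) : ℝ) ^ t * F.genFun oriented n (1 / (2 * m n)) (y n) ^ t =
      b n * Y n := fun n => genFun_pow oriented F n (m n) (y n) t
  constructor
  · refine ((isLittleO_one_iff ℝ).1 hlim).congr' ?_
    filter_upwards [h.tilt, eventually_ge_atTop 1] with n hT hn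
    have : Nonempty (Fin n) := ⟨⟨0, hn⟩⟩
    rw [sum_separated hT, hgen]
    simp only [Fintype.card_fin]
    rfl
  · simp only [hgen]
    exact ((isBigO_refl b _).mul hYO).trans hbM

open Classical in
theorem CopySetup.tendsto_overlap (h : CopySetup δ w χ c M μ m C κ y k l) (oriented : Bool)
    {F : Multigraph (Fin k) (Fin l)} (hF : F.StrictlyBalanced) (t : ℕ) :
    Tendsto (fun n => ∑ p : Fin t → (Fin k → Fin n) × (Fin l → Fin (m n)),
      if Injective (support ∘ p) ∧ ¬ Separated p then
      prob δ (fun G : Multigraph (Fin n) (Fin (m n)) => ∀ i, IsCopy oriented F G (p i)) else 0)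
      atTop (𝓝 0) := by
  have h1 : ∀ q : ℕ × ℕ, ∃ K : ℝ, 0 ≤ K ∧ ∀ᶠ n : ℕ in atTop, l * q.1 < k * q.2 →
      ∀ d : Fin q.1 → ℕ, ∑ i, d i = 2 * q.2 →
      (2 * (m n - q.2))! / (2 * m n)! * (PowerSeries.coeff (2 * m n) ((∏ i, PowerSeries.mk fun j =>
          w n j * (j.descFactorial (d i) : ℝ)) * PowerSeries.mk (w n) ^ (n - q.1)) /
          powLaw (w n) n (2 * m n)) ≤
        K * (n : ℝ) ^ (-(1 / (l : ℝ))) * (((n : ℝ) ^ q.1)⁻¹ * ((m n : ℝ) ^ q.2)⁻¹) := fun q => by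
    by_cases hq : l * q.1 < k * q.2
    · obtain ⟨K, hK, h2⟩ := h.overlap_bound hq
      exact ⟨K, hK, h2.mono fun n hn _ => hn⟩
    · exact ⟨0, le_rfl, Eventually.of_forall fun n h3 => absurd h3 hq⟩
  choose K hK0 hK using h1
  set T := range (t * k + 1) ×ˢ range (t * l + 1) with hT
  set K' := ∑ q ∈ T, K q with hK'
  have hK'0 : 0 ≤ K' := sum_nonneg fun q _ => hK0 q
  set A : ℝ := (∑ v ∈ range (t * k + 1), (v : ℝ) ^ (t * k)) *
        ∑ v ∈ range (t * l + 1), (v : ℝ) ^ (t * l) with hA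
  have hl : (0 : ℝ) < 1 / (l : ℝ) := by have := h.hl; positivity
  have hlim : Tendsto (fun n : ℕ => (Fintype.card (Fin t → Multigraph (Fin k) (Fin l)) : ℝ) *
      (K' * (n : ℝ) ^ (-(1 / (l : ℝ)))) * A) atTop (𝓝 0) := by
    have h1 := (((tendsto_rpow_neg_atTop hl).comp tendsto_natCast_atTop_atTop).const_mul
      K').const_mul (Fintype.card (Fin t → Multigraph (Fin k) (Fin l)) : ℝ) |>.mul_const A
    simpa using h1
  refine squeeze_zero' ?_ ?_ hlim
  · filter_upwards [h.tilt] with n hT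
    refine sum_nonneg fun p _ => ?_
    split_ifs
    exacts [prob_nonneg hT.hδ _, le_rfl]
  · filter_upwards [h.tilt, (Finset.eventually_all T).2 fun q _ => hK q, eventually_ge_atTop 1,
      h.hmtop.eventually_ge_atTop 1] with n hT hn hn1 hm1
    refine sum_overlap_le hT oriented hF (by simpa using Nat.pos_of_ne_zero (by omega)) (by simpa using Nat.pos_of_ne_zero (by omega))
      (by positivity) fun r b d hd hr hb hrb => ?_
    have hq : (r, b) ∈ T := mem_product.2 ⟨mem_range.2 (by simp; omega), mem_range.2 (by simp; omega)⟩
    simp only [Fintype.card_fin]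
    refine (hn _ hq hrb d hd).trans ?_
    gcongr
    exact single_le_sum (f := K) (fun q _ => hK0 q) hq

theorem CopySetup.tendsto_binomialMoment (h : CopySetup δ w χ c M μ m C κ y k l) (oriented : Bool)
    {F : Multigraph (Fin k) (Fin l)} (hF : F.StrictlyBalanced) (t : ℕ) :
    Tendsto (fun n : ℕ => binomialMoment (Fin n) (Fin (m n)) δ oriented F t -
      F.genFun oriented n (1 / (2 * m n)) (y n) ^ t / (t ! : ℝ)) atTop (𝓝 0) := by
  have h1 := ((h.tendsto_separated oriented F t).1.add (h.tendsto_overlap oriented hF t)).const_mul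
    (((k ! * l ! : ℕ) : ℝ) ^ t * (t ! : ℝ))⁻¹
  rw [add_zero, mul_zero] at h1
  refine h1.congr fun n => ?_
  have h2 : ((k ! * l ! : ℕ) : ℝ) ^ t * (t ! : ℝ) ≠ 0 := by
    have := Nat.factorial_pos k; have := Nat.factorial_pos l; positivity
  have h3 : (t ! : ℝ) ≠ 0 := by positivity
  have h4 := binomialMoment_split (V := Fin n) (E := Fin (m n)) (t := t) h.hk δ oriented F
  rw [sub_add_eq_add_sub, ← h4, mul_sub, inv_mul_cancel_left₀ h2, mul_inv, mul_assoc _⁻¹]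
  congr 1
  field_simp

theorem CopySetup.isBigO_genFun (h : CopySetup δ w χ c M μ m C κ y k l) (oriented : Bool)
    (F : Multigraph (Fin k) (Fin l)) :
    (fun n : ℕ => F.genFun oriented n (1 / (2 * m n)) (y n)) =O[atTop] fun _ => (1 : ℝ) := by
  have h1 := (h.tendsto_separated oriented F 1).2
  simp only [pow_one] at h1
  have h2 : ((k ! * l ! : ℕ) : ℝ) ≠ 0 := by
    have := Nat.factorial_pos k; have := Nat.factorial_pos l; positivity
  exact (isBigO_const_mul_left_iff h2).1 h1

theorem CopySetup.poisson (h : CopySetup δ w χ c M μ m C κ y k l) (oriented : Bool)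
    {F : Multigraph (Fin k) (Fin l)} (hF : F.StrictlyBalanced) (t : ℕ) :
    Tendsto (fun n : ℕ => F.probCopies oriented δ n (m n) t -
      Real.exp (-F.genFun oriented n (1 / (2 * m n)) (y n)) *
        F.genFun oriented n (1 / (2 * m n)) (y n) ^ t / (t ! : ℝ)) atTop (𝓝 0) := by
  classical
  obtain ⟨A, hA⟩ := (h.isBigO_genFun oriented F).bound
  refine PoissonLimit.tendsto_of_factorial_moments (A := A) (S := fun n t =>
    binomialMoment (Fin n) (Fin (m n)) δ oriented F t) ?_
    (fun j => h.tendsto_binomialMoment oriented hF j) ?_ t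
  · filter_upwards [hA, h.gibbs.y_nonneg] with n hA hy
    rw [norm_one, mul_one] at hA
    refine ⟨sum_nonneg fun G _ => ?_, (le_abs_self _).trans hA⟩
    split_ifs
    · have := prod_nonneg fun v (_ : v ∈ univ) => hy (G.degree v)
      positivity
    · rfl
  · filter_upwards [h.tilt] with n hT t r
    have h1 := PoissonLimit.abs_prob_sub_le (π := fun G : Multigraph (Fin n) (Fin (m n)) =>
      G.weight δ / totalWeight δ n (m n)) (fun G => div_nonneg (weight_nonneg hT.hδ G)
      (sum_nonneg fun G _ => weight_nonneg hT.hδ G)) (fun G => numCopies oriented F G) t r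
    have h2 : ∀ j, ∑ G : Multigraph (Fin n) (Fin (m n)), G.weight δ / totalWeight δ n (m n) *
        ((numCopies oriented F G).choose j : ℝ) =
        binomialMoment (Fin n) (Fin (m n)) δ oriented F j := fun j => by
      rw [binomialMoment, sum_div]
      exact sum_congr rfl fun G _ => by rw [totalWeight]; ring
    simp only [h2] at h1
    convert h1 using 3
    rw [probCopies, sum_div]
    refine sum_congr rfl fun G _ => ?_
    split_ifs <;> simp

end Multigraph

end

/-! ### The weight generating function and its tilted laws -/

noncomputable section

namespace WeightGF

open Finset

variable {δ : ℕ → ℝ}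

theorem apply_real (δ : ℕ → ℝ) (x : ℝ) :
    (weightGF δ : ℝ → ℝ) x = ∑' j, δ j * x ^ j / (j ! : ℝ) := by
  simp [weightGF]

/-- Doubling the radius absorbs the factor j + 1 that differentiation produces, so the series itself
at 2R majorises its derivative. -/
theorem norm_shift_le (hδ : ∀ j, 0 ≤ δ j) {x R : ℝ} (hR : 1 ≤ R) (hx : |x| ≤ R) (j : ℕ) :
    ‖δ (j + 1) * x ^ j / (j ! : ℝ)‖ ≤ δ (j + 1) * (2 * R) ^ (j + 1) / ((j + 1)! : ℝ) := by
  rw [norm_div, norm_mul, norm_pow, Real.norm_eq_abs, Real.norm_eq_abs, abs_of_nonneg (hδ _),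
    Real.norm_natCast, div_le_div_iff₀ (by positivity) (by positivity), Nat.factorial_succ]
  have h1 : ((j + 1 : ℕ) : ℝ) ≤ 2 ^ (j + 1) := by exact_mod_cast Nat.lt_two_pow_self.le
  have h2 : |x| ^ j ≤ R ^ (j + 1) := (pow_le_pow_left₀ (abs_nonneg x) hx j).trans
    (pow_le_pow_right₀ hR (Nat.le_succ j))
  push_cast at h1 ⊢
  calc δ (j + 1) * |x| ^ j * (((j : ℝ) + 1) * j !) =
        δ (j + 1) * (((j : ℝ) + 1) * |x| ^ j) * j ! := by ring
    _ ≤ δ (j + 1) * (2 ^ (j + 1) * R ^ (j + 1)) * j ! := by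
        gcongr
        exact hδ _
    _ = _ := by rw [mul_pow]

theorem summable_succ (hδ : ∀ j, 0 ≤ δ j) (hs : ∀ x : ℝ, Summable fun j => δ j * x ^ j / (j ! : ℝ))
    (x : ℝ) : Summable fun j => δ (j + 1) * x ^ j / (j ! : ℝ) := by
  refine Summable.of_norm_bounded (g := fun j => δ (j + 1) * (2 * (|x| + 1)) ^ (j + 1) /
    ((j + 1)! : ℝ)) ?_ fun j => norm_shift_le hδ (by linarith [abs_nonneg x]) (by linarith) j
  exact (summable_nat_add_iff (f := fun j => δ j * (2 * (|x| + 1)) ^ j / (j ! : ℝ)) 1).2 (hs _)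

theorem summable_shift (hδ : ∀ j, 0 ≤ δ j)
    (hs : ∀ x : ℝ, Summable fun j => δ j * x ^ j / (j ! : ℝ)) (d : ℕ) (x : ℝ) :
    Summable fun j => δ (j + d) * x ^ j / (j ! : ℝ) := by
  induction d generalizing x with
  | zero => exact hs x
  | succ d ih =>
    have h := summable_succ (δ := fun j => δ (j + d)) (fun j => hδ _) ih x
    simpa only [add_assoc, add_comm 1 d] using h

theorem hasDerivAt (hδ : ∀ j, 0 ≤ δ j) (hs : ∀ x : ℝ, Summable fun j => δ j * x ^ j / (j ! : ℝ))
    (x : ℝ) : HasDerivAt (weightGF δ : ℝ → ℝ) ((weightGF (fun j => δ (j + 1)) : ℝ → ℝ) x) x := by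
  set R := |x| + 1 with hR
  have hR1 : 1 ≤ R := by linarith [abs_nonneg x]
  have hu : Summable fun j => δ j * (2 * R) ^ j / (j ! : ℝ) := hs _
  have h1 := hasDerivAt_tsum_of_isPreconnected (g := fun j x => δ j * x ^ j / (j ! : ℝ))
    (g' := fun j x => δ j * (j * x ^ (j - 1)) / (j ! : ℝ)) (t := Metric.ball 0 R) (y₀ := 0)
    (y := x) hu Metric.isOpen_ball (convex_ball 0 R).isPreconnected
    (fun j y _ => ((hasDerivAt_pow j y).const_mul (δ j)).div_const _)
    (fun j y hy => ?_) (Metric.mem_ball_self (by linarith)) (hs 0)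
    (by rw [mem_ball_zero_iff, Real.norm_eq_abs]; linarith)
  · have e1 : (weightGF δ : ℝ → ℝ) = fun z => ∑' j, δ j * z ^ j / (j ! : ℝ) :=
      funext (apply_real δ)
    rw [e1, apply_real]
    have h2 : Summable fun j : ℕ => δ j * (j * x ^ (j - 1)) / (j ! : ℝ) := by
      rw [← summable_nat_add_iff 1]
      refine (summable_succ hδ hs x).congr fun j => ?_
      rw [Nat.factorial_succ, Nat.add_sub_cancel]; push_cast; field_simp
    have h3 : ∑' j : ℕ, δ j * (j * x ^ (j - 1)) / (j ! : ℝ) =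
        ∑' j : ℕ, δ (j + 1) * x ^ j / (j ! : ℝ) := by
      rw [h2.tsum_eq_zero_add]
      simp only [Nat.cast_zero, zero_mul, mul_zero, zero_div, zero_add]
      refine tsum_congr fun j => ?_
      rw [Nat.factorial_succ, Nat.add_sub_cancel]; push_cast; field_simp
    rw [← h3]
    exact h1
  · rw [mem_ball_zero_iff, Real.norm_eq_abs] at hy
    rcases j with _ | j
    · simpa using hδ 0
    · refine le_trans (le_of_eq ?_) (norm_shift_le hδ hR1 hy.le j)
      congr 1
      rw [Nat.factorial_succ, Nat.add_sub_cancel]; push_cast; field_simp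

theorem iteratedDeriv_eq (hδ : ∀ j, 0 ≤ δ j)
    (hs : ∀ x : ℝ, Summable fun j => δ j * x ^ j / (j ! : ℝ)) (d : ℕ) :
    iteratedDeriv d (weightGF δ : ℝ → ℝ) = weightGF fun j => δ (j + d) := by
  induction d with
  | zero => simp
  | succ d ih =>
    rw [iteratedDeriv_succ, ih]
    funext x
    rw [(hasDerivAt (δ := fun j => δ (j + d)) (fun j => hδ _) (summable_shift hδ hs d) x).deriv]
    simp only [add_assoc, add_comm 1 d]

theorem continuous_iteratedDeriv (hδ : ∀ j, 0 ≤ δ j)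
    (hs : ∀ x : ℝ, Summable fun j => δ j * x ^ j / (j ! : ℝ)) (d : ℕ) :
    Continuous (iteratedDeriv d (weightGF δ : ℝ → ℝ)) := by
  rw [iteratedDeriv_eq hδ hs]
  exact continuous_iff_continuousAt.2 fun x =>
    (hasDerivAt (δ := fun j => δ (j + d)) (fun j => hδ _) (summable_shift hδ hs d) x).continuousAt

theorem hasSum_descFactorial (hδ : ∀ j, 0 ≤ δ j)
    (hs : ∀ x : ℝ, Summable fun j => δ j * x ^ j / (j ! : ℝ)) (d : ℕ) (x : ℝ) :
    HasSum (fun j => δ j * x ^ j / (j ! : ℝ) * (j.descFactorial d : ℝ))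
      (x ^ d * iteratedDeriv d (weightGF δ : ℝ → ℝ) x) := by
  rw [iteratedDeriv_eq hδ hs, apply_real]
  have h1 := (summable_shift hδ hs d x).hasSum.mul_left (x ^ d)
  rw [← (add_left_injective d).hasSum_iff]
  · refine h1.congr_fun' fun j => ?_
    have h2 := Nat.factorial_mul_descFactorial (n := j + d) (k := d) (by omega)
    rw [Nat.add_sub_cancel] at h2
    simp only [Function.comp_apply]
    rw [← h2]; push_cast
    have : ((j + d).descFactorial d : ℝ) ≠ 0 := by
      have := Nat.descFactorial_pos.2 (by omega : d ≤ j + d); positivity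
    rw [pow_add]
    field_simp
  · intro j hj
    have : j < d := by
      by_contra h
      exact hj ⟨j - d, by simp; omega⟩
    rw [Nat.descFactorial_of_lt this]; simp

theorem hasSum (hδ : ∀ j, 0 ≤ δ j)
    (hs : ∀ x : ℝ, Summable fun j => δ j * x ^ j / (j ! : ℝ)) (x : ℝ) :
    HasSum (fun j => δ j * x ^ j / (j ! : ℝ)) ((weightGF δ : ℝ → ℝ) x) := by
  simpa using hasSum_descFactorial hδ hs 0 x

theorem pos (hδ : ∀ j, 0 ≤ δ j) (hs : ∀ x : ℝ, Summable fun j => δ j * x ^ j / (j ! : ℝ))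
    {j₀ : ℕ} (hj : δ j₀ ≠ 0) {x : ℝ} (hx : 0 < x) : 0 < (weightGF δ : ℝ → ℝ) x := by
  have h0 : 0 < δ j₀ := lt_of_le_of_ne (hδ _) hj.symm
  have h1 : δ j₀ * x ^ j₀ / (j₀ ! : ℝ) ≤ (weightGF δ : ℝ → ℝ) x :=
    le_hasSum (hasSum hδ hs x) j₀ fun j _ => by have := hδ j; positivity
  exact lt_of_lt_of_le (by positivity) h1

/-- The law obtained by tilting. -/
def law (δ : ℕ → ℝ) (x : ℝ) (j : ℕ) : ℝ := δ j * x ^ j / (j ! : ℝ) / (weightGF δ : ℝ → ℝ) x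

/-- The factorial moments of the tilted laws. -/
def moment (δ : ℕ → ℝ) (x : ℝ) (d : ℕ) : ℝ :=
  x ^ d * iteratedDeriv d (weightGF δ : ℝ → ℝ) x / (weightGF δ : ℝ → ℝ) x

theorem hasSum_law_descFactorial (hδ : ∀ j, 0 ≤ δ j)
    (hs : ∀ x : ℝ, Summable fun j => δ j * x ^ j / (j ! : ℝ)) (x : ℝ) (d : ℕ) :
    HasSum (fun j => law δ x j * (j.descFactorial d : ℝ)) (moment δ x d) :=
  ((hasSum_descFactorial hδ hs d x).div_const _).congr_fun' fun j => by rw [law]; ring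

theorem isLaw (hδ : ∀ j, 0 ≤ δ j) (hs : ∀ x : ℝ, Summable fun j => δ j * x ^ j / (j ! : ℝ))
    {j₀ : ℕ} (hj : δ j₀ ≠ 0) {x : ℝ} (hx : 0 < x) : NatLaw.IsLaw (law δ x) where
  nonneg j := by have := hδ j; have := pos hδ hs hj hx; unfold law; positivity
  hasSum := by
    have h := hasSum_law_descFactorial hδ hs x 0
    rw [moment, pow_zero, one_mul, iteratedDeriv_zero, div_self (pos hδ hs hj hx).ne'] at h
    simpa using h

theorem mean (hδ : ∀ j, 0 ≤ δ j) (hs : ∀ x : ℝ, Summable fun j => δ j * x ^ j / (j ! : ℝ))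
    (x : ℝ) : HasSum (fun j : ℕ => (j : ℝ) * law δ x j) (moment δ x 1) :=
  (hasSum_law_descFactorial hδ hs x 1).congr_fun' fun j => by simp [mul_comm]

theorem hasSum_law_mul_pow (hδ : ∀ j, 0 ≤ δ j)
    (hs : ∀ x : ℝ, Summable fun j => δ j * x ^ j / (j ! : ℝ)) (x q : ℝ) (d : ℕ) :
    HasSum (fun j => law δ x j * q ^ j * (j.descFactorial d : ℝ))
      ((x * q) ^ d * iteratedDeriv d (weightGF δ : ℝ → ℝ) (x * q) / (weightGF δ : ℝ → ℝ) x) :=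
  ((hasSum_descFactorial hδ hs d (x * q)).div_const _).congr_fun' fun j => by
    rw [law, mul_pow]; ring

/-- The mean of the tilted law increases. -/
theorem moment_one_strictMonoOn (hδ : ∀ j, 0 ≤ δ j)
    (hs : ∀ x : ℝ, Summable fun j => δ j * x ^ j / (j ! : ℝ)) (hpoly : {j | δ j ≠ 0}.Infinite) :
    StrictMonoOn (fun x => moment δ x 1) (Set.Ioi 0) := by
  intro x hx z hz hxz
  rw [Set.mem_Ioi] at hx hz
  obtain ⟨j₀, hj₀⟩ := hpoly.nonempty
  set μ := moment δ z 1 with hμ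
  set q := x / z with hq
  have hq0 : 0 < q := by positivity
  have hq1 : q < 1 := (div_lt_one hz).2 hxz
  have hzq : z * q = x := by rw [hq]; field_simp
  have hw := isLaw hδ hs hj₀ hz
  have h1 := hasSum_law_mul_pow hδ hs z q 1
  have h2 := (hasSum_law_mul_pow hδ hs z q 0).mul_left μ
  have h3 := (mean hδ hs z).sub (hw.hasSum.mul_left μ)
  rw [mul_one, sub_self] at h3
  have h4 := (h1.sub h2).sub (h3.mul_left (q ^ μ))
  -- Passing from z to x < z multiplies the law by q^j with q < 1, a decreasing function of j; so j
  -- and q^j are negatively correlated. The infinite support gives a j beyond μ where the inequality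
  -- is strict.
  have hsign : ∀ j : ℕ, ((j : ℝ) - μ) * (q ^ (j : ℝ) - q ^ μ) ≤ 0 := fun j => by
    rcases le_total (j : ℝ) μ with h | h
    · exact mul_nonpos_of_nonpos_of_nonneg (by linarith)
        (sub_nonneg.2 (Real.rpow_le_rpow_of_exponent_ge hq0 hq1.le h))
    · exact mul_nonpos_of_nonneg_of_nonpos (by linarith)
        (sub_nonpos.2 (Real.rpow_le_rpow_of_exponent_ge hq0 hq1.le h))
  have h5 : HasSum (fun j : ℕ => law δ z j * (((j : ℝ) - μ) * (q ^ (j : ℝ) - q ^ μ)))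
      ((z * q) ^ 1 * iteratedDeriv 1 (weightGF δ : ℝ → ℝ) (z * q) / weightGF δ z -
        μ * ((z * q) ^ 0 * iteratedDeriv 0 (weightGF δ : ℝ → ℝ) (z * q) / weightGF δ z) -
        q ^ μ * 0) := h4.congr_fun' fun j => by
    rw [Real.rpow_natCast, Nat.descFactorial_one, Nat.descFactorial_zero]; push_cast; ring
  obtain ⟨j₁, hj₁, hlt⟩ := hpoly.exists_gt ⌈μ⌉₊
  have hj₁μ : μ < j₁ := (Nat.le_ceil μ).trans_lt (by exact_mod_cast hlt)
  have h6 : law δ z j₁ * (((j₁ : ℝ) - μ) * (q ^ (j₁ : ℝ) - q ^ μ)) < 0 := by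
    have h7 : 0 < law δ z j₁ := by
      have h8 := pos hδ hs hj₀ hz
      have h9 : 0 < δ j₁ := lt_of_le_of_ne (hδ _) (Ne.symm hj₁)
      unfold law; positivity
    exact mul_neg_of_pos_of_neg h7 (mul_neg_of_pos_of_neg (by linarith)
      (sub_neg.2 (Real.rpow_lt_rpow_of_exponent_gt hq0 hq1 hj₁μ)))
  have h7 := hasSum_lt (f := fun j : ℕ => law δ z j * (((j : ℝ) - μ) * (q ^ (j : ℝ) - q ^ μ)))
    (g := fun _ => 0) (fun j => mul_nonpos_of_nonneg_of_nonpos (hw.nonneg j) (hsign j)) h6 h5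
    hasSum_zero
  rw [hzq, mul_zero, sub_zero, pow_zero, one_mul, pow_one, iteratedDeriv_zero, mul_div_assoc',
    ← sub_div, div_lt_iff₀ (pos hδ hs hj₀ hz), zero_mul, sub_neg] at h7
  change moment δ x 1 < μ
  rw [moment, pow_one, div_lt_iff₀ (pos hδ hs hj₀ hx)]
  exact h7

theorem exists_least (hpoly : {j | δ j ≠ 0}.Infinite) : ∃ j₀, δ j₀ ≠ 0 ∧ ∀ j < j₀, δ j = 0 := by
  classical
  refine ⟨Nat.find hpoly.nonempty, Nat.find_spec hpoly.nonempty, fun j hj => ?_⟩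
  by_contra h
  exact Nat.find_min hpoly.nonempty hj h

end WeightGF

end

/-! ### Consequences of the ratio condition -/

noncomputable section

namespace WeightGF

open Finset

variable {δ : ℕ → ℝ}

/-- Terms below j₀ vanish and x^j ≤ (x/A)^j₀ A^j for the others. With j₀ the least index of the
support, this shows that quotients by Δ stay bounded near 0, even if Δ vanishes there. -/
theorem pow_mul_iteratedDeriv_le (hδ : ∀ j, 0 ≤ δ j)
    (hs : ∀ x : ℝ, Summable fun j => δ j * x ^ j / (j ! : ℝ)) {j₀ : ℕ} (hj : ∀ j < j₀, δ j = 0)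
    (d : ℕ) {x A : ℝ} (hx : 0 < x) (hxA : x ≤ A) :
    x ^ d * iteratedDeriv d (weightGF δ : ℝ → ℝ) x ≤
      (x / A) ^ j₀ * (A ^ d * iteratedDeriv d (weightGF δ : ℝ → ℝ) A) := by
  have hA : 0 < A := hx.trans_le hxA
  refine hasSum_le (fun j => ?_) (hasSum_descFactorial hδ hs d x)
    ((hasSum_descFactorial hδ hs d A).mul_left _)
  rcases lt_or_ge j j₀ with h | h
  · simp [hj j h]
  · have h1 : (x / A) ^ j ≤ (x / A) ^ j₀ :=
      pow_le_pow_of_le_one (by positivity) ((div_le_one hA).2 hxA) h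
    have h2 : x ^ j = (x / A) ^ j * A ^ j := by rw [div_pow]; field_simp
    have h3 := hδ j
    calc δ j * x ^ j / (j ! : ℝ) * (j.descFactorial d : ℝ) =
          (x / A) ^ j * (δ j * A ^ j / (j ! : ℝ) * (j.descFactorial d : ℝ)) := by rw [h2]; ring
      _ ≤ _ := by gcongr

theorem le_weightGF (hδ : ∀ j, 0 ≤ δ j)
    (hs : ∀ x : ℝ, Summable fun j => δ j * x ^ j / (j ! : ℝ)) (j₀ : ℕ) {x : ℝ} (hx : 0 < x) :
    δ j₀ * x ^ j₀ / (j₀ ! : ℝ) ≤ (weightGF δ : ℝ → ℝ) x :=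
  le_hasSum (hasSum hδ hs x) j₀ fun j _ => by have := hδ j; positivity

theorem iteratedDeriv_nonneg (hδ : ∀ j, 0 ≤ δ j)
    (hs : ∀ x : ℝ, Summable fun j => δ j * x ^ j / (j ! : ℝ)) (d : ℕ) {x : ℝ} (hx : 0 < x) :
    0 ≤ iteratedDeriv d (weightGF δ : ℝ → ℝ) x := by
  rw [iteratedDeriv_eq hδ hs, apply_real]
  exact tsum_nonneg fun j => by have := hδ (j + d); positivity

theorem exists_pow_mul_iteratedDeriv_le (hδ : ∀ j, 0 ≤ δ j)
    (hs : ∀ x : ℝ, Summable fun j => δ j * x ^ j / (j ! : ℝ)) (hpoly : {j | δ j ≠ 0}.Infinite)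
    (d : ℕ) {q : ℝ} (hq : 0 < q) {A : ℝ} (hA : 0 < A) : ∃ K : ℝ, 0 ≤ K ∧ ∀ x, 0 < x → x * q ≤ A →
      (x * q) ^ d * iteratedDeriv d (weightGF δ : ℝ → ℝ) (x * q) ≤ K * (weightGF δ : ℝ → ℝ) x := by
  obtain ⟨j₀, hj₀, hj⟩ := exists_least hpoly
  have h0 : 0 < δ j₀ := lt_of_le_of_ne (hδ _) hj₀.symm
  have h1 := iteratedDeriv_nonneg hδ hs d hA
  refine ⟨(q / A) ^ j₀ * (A ^ d * iteratedDeriv d (weightGF δ : ℝ → ℝ) A) * (j₀ ! / δ j₀),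
    by positivity, fun x hx hxA => ?_⟩
  refine (pow_mul_iteratedDeriv_le hδ hs hj d (by positivity) hxA).trans ?_
  calc (x * q / A) ^ j₀ * (A ^ d * iteratedDeriv d (weightGF δ : ℝ → ℝ) A) =
        (q / A) ^ j₀ * (A ^ d * iteratedDeriv d (weightGF δ : ℝ → ℝ) A) * (j₀ ! / δ j₀) *
          (δ j₀ * x ^ j₀ / (j₀ ! : ℝ)) := by
        rw [mul_div_assoc, mul_pow]; field_simp
    _ ≤ _ := by
        gcongr
        exact le_weightGF hδ hs j₀ hx

/-- The assumptions on the weights. -/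
structure Admissible (δ : ℕ → ℝ) : Prop where
  hδ : ∀ j, 0 ≤ δ j
  hs : ∀ x : ℝ, Summable fun j => δ j * x ^ j / (j ! : ℝ)
  hpoly : {j | δ j ≠ 0}.Infinite
  hratio : ∀ j : ℕ, ∃ L : ℝ, 0 < L ∧
    Tendsto (fun x : ℝ => iteratedDeriv j (weightGF δ : ℝ → ℝ) x / weightGF δ x) atTop (𝓝 L)

namespace Admissible

theorem weightGF_pos (h : Admissible δ) {x : ℝ} (hx : 0 < x) : 0 < (weightGF δ : ℝ → ℝ) x :=
  h.hpoly.nonempty.elim fun _ hj => pos h.hδ h.hs hj hx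

theorem law_isLaw (h : Admissible δ) {x : ℝ} (hx : 0 < x) : NatLaw.IsLaw (law δ x) :=
  h.hpoly.nonempty.elim fun _ hj => isLaw h.hδ h.hs hj hx

theorem moment_nonneg (h : Admissible δ) (d : ℕ) {x : ℝ} (hx : 0 < x) : 0 ≤ moment δ x d :=
  (hasSum_law_descFactorial h.hδ h.hs x d).nonneg fun j =>
    mul_nonneg ((h.law_isLaw hx).nonneg j) (Nat.cast_nonneg _)

theorem moment_eq (d : ℕ) (x : ℝ) : moment δ x d =
    x ^ d * (iteratedDeriv d (weightGF δ : ℝ → ℝ) x / weightGF δ x) := mul_div_assoc _ _ _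

/-- For large x the ratio of derivatives is bounded, so the moment is O(x^d); for bounded x
numerator and denominator vanish at 0 to comparable orders. -/
theorem exists_moment_le (h : Admissible δ) (d : ℕ) :
    ∃ K : ℝ, 0 ≤ K ∧ ∀ x, 0 < x → moment δ x d ≤ K * (1 + x) ^ d := by
  obtain ⟨L, hL, hlim⟩ := h.hratio d
  obtain ⟨A, hA⟩ := eventually_atTop.1 (hlim.eventually_le_const (lt_add_one L))
  have hA1 : 0 < max A 1 := lt_max_of_lt_right one_pos
  obtain ⟨K, hK, hle⟩ := exists_pow_mul_iteratedDeriv_le h.hδ h.hs h.hpoly d one_pos hA1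
  refine ⟨max K (L + 1), by positivity, fun x hx => ?_⟩
  rcases le_total x (max A 1) with hxA | hxA
  · have h1 := hle x hx (by rwa [mul_one])
    rw [mul_one, ← div_le_iff₀ (h.weightGF_pos hx)] at h1
    refine h1.trans ((le_max_left K (L + 1)).trans (le_mul_of_one_le_right (by positivity) ?_))
    exact one_le_pow₀ (by linarith)
  · rw [moment_eq, mul_comm]
    have h1 := hA x ((le_max_left _ _).trans hxA)
    have h2 : (0 : ℝ) ≤ max K (L + 1) := by positivity
    exact mul_le_mul (h1.trans (le_max_right _ _)) (pow_le_pow_left₀ hx.le (by linarith) d)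
      (by positivity) h2

/-- Once Δ'/Δ ≤ L + 1, the function Δ(x) exp(-(L + 1)x) decreases, so multiplying the argument by q
costs at most exp((L + 1)(q - 1)x). For q = exp 4 this is the exponential moment of the tilted law.
-/
theorem exists_weightGF_mul_le (h : Admissible δ) {q : ℝ} (hq : 1 ≤ q) :
    ∃ K : ℝ, 0 ≤ K ∧ ∀ x, 0 < x →
      (weightGF δ : ℝ → ℝ) (x * q) / (weightGF δ : ℝ → ℝ) x ≤ Real.exp (K * (1 + x)) := by
  obtain ⟨L, hL, hlim⟩ := h.hratio 1
  obtain ⟨A, hA⟩ := eventually_atTop.1 (hlim.eventually_le_const (lt_add_one L))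
  set B := max A 1 with hB
  have hB1 : 0 < B := lt_max_of_lt_right one_pos
  have hq0 : 0 < q := by linarith
  obtain ⟨K, hK, hle⟩ := exists_pow_mul_iteratedDeriv_le h.hδ h.hs h.hpoly 0 hq0
    (by positivity : 0 < B * q)
  have hdiff : ∀ x, HasDerivAt (weightGF δ : ℝ → ℝ) (iteratedDeriv 1 (weightGF δ : ℝ → ℝ) x) x :=
    fun x => by rw [iteratedDeriv_eq h.hδ h.hs]; exact hasDerivAt h.hδ h.hs x
  have hanti : AntitoneOn (fun x => (weightGF δ : ℝ → ℝ) x * Real.exp (-((L + 1) * x)))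
      (Set.Ici B) := by
    have hd : ∀ x, HasDerivAt (fun x => (weightGF δ : ℝ → ℝ) x * Real.exp (-((L + 1) * x)))
        (iteratedDeriv 1 (weightGF δ : ℝ → ℝ) x * Real.exp (-((L + 1) * x)) +
          (weightGF δ : ℝ → ℝ) x * (Real.exp (-((L + 1) * x)) * -((L + 1) * 1))) x := fun x =>
      (hdiff x).mul (((hasDerivAt_id x).const_mul (L + 1)).neg.exp)
    refine antitoneOn_of_deriv_nonpos (convex_Ici B)
      (fun x _ => (hd x).continuousAt.continuousWithinAt)
      (fun x _ => (hd x).differentiableAt.differentiableWithinAt) fun x hx => ?_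
    rw [interior_Ici, Set.mem_Ioi] at hx
    rw [(hd x).deriv]
    have h1 := hA x ((le_max_left _ _).trans hx.le)
    rw [div_le_iff₀ (h.weightGF_pos (hB1.trans hx))] at h1
    have h2 := Real.exp_pos (-((L + 1) * x))
    nlinarith
  refine ⟨max K ((L + 1) * q), by positivity, fun x hx => ?_⟩
  have hDx := h.weightGF_pos hx
  rw [div_le_iff₀ hDx]
  rcases le_total x B with hxB | hxB
  · have h1 := hle x hx (by gcongr)
    rw [pow_zero, one_mul, iteratedDeriv_zero] at h1
    refine h1.trans ?_
    gcongr
    calc K ≤ max K ((L + 1) * q) * (1 + x) :=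
          (le_max_left _ _).trans (le_mul_of_one_le_right (by positivity) (by linarith))
      _ ≤ _ := by linarith [Real.add_one_le_exp (max K ((L + 1) * q) * (1 + x))]
  · have hxq : x ≤ x * q := le_mul_of_one_le_right hx.le hq
    have h1 := hanti (Set.mem_Ici.2 hxB) (Set.mem_Ici.2 (hxB.trans hxq)) hxq
    simp only at h1
    rw [Real.exp_neg, Real.exp_neg, ← div_eq_mul_inv, ← div_eq_mul_inv,
      div_le_iff₀ (Real.exp_pos _)] at h1
    refine h1.trans ?_
    rw [div_mul_eq_mul_div, mul_div_assoc, ← Real.exp_sub, mul_comm]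
    gcongr
    have h2 := le_max_right K ((L + 1) * q)
    have h3 : (L + 1) * q * (1 + x) ≤ max K ((L + 1) * q) * (1 + x) := by gcongr
    nlinarith [mul_pos (by linarith : 0 < L + 1) hx, mul_pos (by linarith : 0 < L + 1) hq0]

/-- The limit of Δ'/Δ is positive, so the mean is eventually at least a constant times x. This lets
the scale 1 + χ be bounded by the average degree. -/
theorem exists_le_moment_one (h : Admissible δ) :
    ∃ K : ℝ, 0 ≤ K ∧ ∀ x, 0 < x → 1 + x ≤ K * (1 + moment δ x 1) := by
  obtain ⟨L, hL, hlim⟩ := h.hratio 1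
  obtain ⟨A, hA⟩ := eventually_atTop.1 (hlim.eventually_const_le (half_lt_self hL))
  refine ⟨1 + max A 0 + 2 / L, by positivity, fun x hx => ?_⟩
  have h0 := h.moment_nonneg 1 hx
  rcases le_total x A with hxA | hxA
  · have h1 : x ≤ max A 0 := hxA.trans (le_max_left _ _)
    have h2 : 0 < 2 / L := by positivity
    nlinarith [le_max_right A 0]
  · have h1 := hA x hxA
    have h2 : x * (L / 2) ≤ moment δ x 1 := by
      rw [moment_eq, pow_one]; gcongr
    have h3 : x ≤ 2 / L * moment δ x 1 := by
      calc x = 2 / L * (x * (L / 2)) := by field_simp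
        _ ≤ _ := by gcongr
    have h4 : 0 < 2 / L := by positivity
    nlinarith [le_max_right A 0]

theorem hasSum_law_exp (h : Admissible δ) (x : ℝ) :
    HasSum (fun j : ℕ => law δ x j * Real.exp (4 * j))
      ((weightGF δ : ℝ → ℝ) (x * Real.exp 4) / (weightGF δ : ℝ → ℝ) x) := by
  have h1 := hasSum_law_mul_pow h.hδ h.hs x (Real.exp 4) 0
  rw [pow_zero, one_mul, iteratedDeriv_zero] at h1
  refine h1.congr_fun' fun j => ?_
  rw [Nat.descFactorial_zero, Nat.cast_one, mul_one, ← Real.exp_nat_mul, mul_comm (4 : ℝ)]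

theorem isTilt (h : Admissible δ) {x : ℝ} (hx : 0 < x) :
    Multigraph.IsTilt δ (law δ x) x ((weightGF δ : ℝ → ℝ) x) where
  hδ := h.hδ
  hχ := hx
  hc := h.weightGF_pos hx
  hw j := by
    have := (h.weightGF_pos hx).ne'
    have := hx.ne'
    rw [law, inv_pow]; field_simp

theorem saddleIntegral_eq (h : Admissible δ) {x : ℝ} (hx : 0 < x) {n m : ℕ} {μ : ℝ}
    (hμ : n * μ = (2 * m : ℕ)) (a : ℝ) : saddleIntegral δ x n m a =
      ((weightGF δ : ℝ → ℝ) x : ℂ) ^ n * ∫ θ in (-a)..a, NatLaw.centF (law δ x) μ θ ^ n := by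
  rw [saddleIntegral, ← intervalIntegral.integral_const_mul]
  refine intervalIntegral.integral_congr fun θ _ => ?_
  have hD : ((weightGF δ : ℝ → ℝ) x : ℂ) ≠ 0 := by exact_mod_cast (h.weightGF_pos hx).ne'
  have h1 : weightGF δ ((x : ℂ) * Complex.exp (Complex.I * θ)) =
      ((weightGF δ : ℝ → ℝ) x : ℂ) * NatLaw.charF (law δ x) θ := by
    rw [weightGF, NatLaw.charF, ← tsum_mul_left]
    refine tsum_congr fun j => ?_
    rw [law, NatLaw.expI_nat_mul, mul_pow, NatLaw.expI, mul_comm Complex.I]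
    push_cast
    change Complex.ofReal (δ j) * _ / _ = _
    field_simp
  have h2 : (Complex.exp (2 * m * Complex.I * θ))⁻¹ = NatLaw.expI (-(μ * θ)) ^ n := by
    rw [← NatLaw.expI_nat_mul, show (n : ℝ) * -(μ * θ) = -((2 * m : ℕ) * θ) by rw [← hμ]; ring,
      NatLaw.expI_neg, NatLaw.expI]
    congr 2
    push_cast; ring
  rw [h1, div_eq_mul_inv, h2, NatLaw.centF, mul_pow, mul_pow, mul_assoc]

theorem integral_centF_full {w : ℕ → ℝ} (hw : NatLaw.IsLaw w) {n x : ℕ} {μ : ℝ}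
    (hμ : n * μ = x) : ∫ θ in (-Real.pi)..Real.pi, NatLaw.centF w μ θ ^ n =
      ((2 * Real.pi * NatLaw.powLaw w n x : ℝ) : ℂ) := by
  rw [← NatLaw.integral_full (hw.powLaw n).hasSum.summable]
  refine intervalIntegral.integral_congr fun θ _ => ?_
  rw [NatLaw.charF_powLaw hw, NatLaw.centF, mul_pow, ← NatLaw.expI_nat_mul, ← hμ]
  congr 2; ring

/-- The full circle gives 2π times the probability of the mean, and the equivalence eventually puts
each arc within 100% of this value. Nothing sharper is taken from (C3). -/
theorem eventually_arc_le (h : Admissible δ) {χ μ : ℕ → ℝ} {m : ℕ → ℕ} (hC3 : ConditionC3 δ χ m)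
    (hχ : ∀ᶠ n in atTop, 0 < χ n ∧ n * μ n = (2 * m n : ℕ)) {ε : ℝ} (hε : 0 < ε)
    (hε2 : ε < Real.pi / 2) :
    ∀ᶠ n in atTop, ‖∫ θ in (-ε)..ε, NatLaw.centF (law δ (χ n)) (μ n) θ ^ n‖ ≤
      4 * Real.pi * NatLaw.powLaw (law δ (χ n)) n (2 * m n) := by
  have h1 := (hC3 ε hε hε2).symm.isLittleO.bound one_pos
  filter_upwards [h1, hχ] with n h1 hχ
  have hw := h.law_isLaw hχ.1
  have hD := h.weightGF_pos hχ.1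
  simp only [Pi.sub_apply] at h1
  rw [h.saddleIntegral_eq hχ.1 hχ.2, h.saddleIntegral_eq hχ.1 hχ.2, ← mul_sub, norm_mul, norm_mul,
    one_mul, integral_centF_full hw hχ.2] at h1
  have h2 : 0 < ‖((weightGF δ : ℝ → ℝ) (χ n) : ℂ) ^ n‖ := by
    rw [norm_pos_iff]; exact pow_ne_zero _ (by exact_mod_cast hD.ne')
  have h3 := le_of_mul_le_mul_left h1 h2
  have h4 : 0 ≤ NatLaw.powLaw (law δ (χ n)) n (2 * m n) := (hw.powLaw n).nonneg _
  have h5 : ‖((2 * Real.pi * NatLaw.powLaw (law δ (χ n)) n (2 * m n) : ℝ) : ℂ)‖ =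
      2 * Real.pi * NatLaw.powLaw (law δ (χ n)) n (2 * m n) := by
    rw [Complex.norm_real, Real.norm_of_nonneg (by have := Real.pi_pos; positivity)]
  rw [h5] at h3
  have h6 := norm_le_norm_sub_add (∫ θ in (-ε)..ε, NatLaw.centF (law δ (χ n)) (μ n) θ ^ n)
    ((2 * Real.pi * NatLaw.powLaw (law δ (χ n)) n (2 * m n) : ℝ) : ℂ)
  rw [h5] at h6
  linarith

end Admissible

end WeightGF

end

/-! ### The saddle point along the sequence -/

noncomputable section

namespace WeightGF

open Finset Multigraph

variable {δ : ℕ → ℝ} {χ : ℕ → ℝ} {m : ℕ → ℕ} {k l : ℕ}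

/-- The assumptions of the theorem about sequences. -/
structure SaddleSetup (δ : ℕ → ℝ) (χ : ℕ → ℝ) (m : ℕ → ℕ) (k l : ℕ) : Prop where
  adm : Admissible δ
  hk : 0 < k
  hkl : k ≤ l
  hlow : ∃ a : ℝ, 0 < a ∧ ∀ᶠ n : ℕ in atTop, a * (n : ℝ) ^ (2 - (k : ℝ) / l) ≤ m n
  hup : ∃ K : ℝ, 0 ≤ K ∧ ∀ᶠ n : ℕ in atTop, (m n : ℝ) ≤ K * (n : ℝ) ^ (2 - (k : ℝ) / l)
  hχ : ∀ᶠ n : ℕ in atTop, 0 < χ n ∧ moment δ (χ n) 1 = 2 * (m n : ℝ) / (n : ℝ)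

namespace SaddleSetup

theorem hl (h : SaddleSetup δ χ m k l) : 0 < l := h.hk.trans_le h.hkl

theorem exponent_le (h : SaddleSetup δ χ m k l) : (k : ℝ) / l ≤ 1 := by
  have hl : (0 : ℝ) < l := by exact_mod_cast h.hl
  rw [div_le_one hl]
  exact_mod_cast h.hkl

theorem exponent_pos (h : SaddleSetup δ χ m k l) : 0 < (k : ℝ) / l := by
  have hl : (0 : ℝ) < l := by exact_mod_cast h.hl
  have hk : (0 : ℝ) < k := by exact_mod_cast h.hk
  positivity

theorem exists_mul_le (h : SaddleSetup δ χ m k l) :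
    ∃ a : ℝ, 0 < a ∧ ∀ᶠ n : ℕ in atTop, a * n ≤ m n := by
  obtain ⟨a, ha, hlow⟩ := h.hlow
  refine ⟨a, ha, ?_⟩
  filter_upwards [hlow, eventually_ge_atTop 1] with n hn hn1
  refine le_trans ?_ hn
  gcongr
  have hn1 : (1 : ℝ) ≤ n := by exact_mod_cast hn1
  calc (n : ℝ) = (n : ℝ) ^ (1 : ℝ) := (Real.rpow_one _).symm
    _ ≤ _ := Real.rpow_le_rpow_of_exponent_le hn1 (by linarith [h.exponent_le])

theorem tendsto_m (h : SaddleSetup δ χ m k l) : Tendsto m atTop atTop := by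
  obtain ⟨a, ha, hlow⟩ := h.exists_mul_le
  rw [← tendsto_natCast_atTop_iff (R := ℝ)]
  exact tendsto_atTop_mono' _ hlow (tendsto_natCast_atTop_atTop.const_mul_atTop ha)

/-- The scale is at most the average degree. -/
theorem exists_scale_mul_le (h : SaddleSetup δ χ m k l) :
    ∃ K : ℝ, 0 ≤ K ∧ ∀ᶠ n : ℕ in atTop, (1 + χ n) * n ≤ K * m n := by
  obtain ⟨a, ha, hlow⟩ := h.exists_mul_le
  obtain ⟨K, hK, hle⟩ := h.adm.exists_le_moment_one
  refine ⟨K * (1 / a + 2), by positivity, ?_⟩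
  filter_upwards [hlow, h.hχ, eventually_ge_atTop 1] with n hn hχ hn1
  have hn0 : (0 : ℝ) < n := by exact_mod_cast hn1
  have h1 := hle _ hχ.1
  rw [hχ.2] at h1
  have h2 : (n : ℝ) ≤ 1 / a * m n := by rw [one_div, ← div_eq_inv_mul, le_div_iff₀ ha]; linarith
  calc (1 + χ n) * n ≤ K * (1 + 2 * (m n : ℝ) / n) * n := by gcongr
    _ = K * (n + 2 * m n) := by field_simp
    _ ≤ K * (1 / a * m n + 2 * m n) := by gcongr
    _ = _ := by ring

/-- The scale is M = 1 + χ: factorial moments of order d are O(M^d), the exponential moment is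
exp(O(M)), and M = O(m/n) = O(n^(1 - k/l)), so κ = k/l is the inverse density. The additive 1 keeps
M ≥ 1 when χ is small. -/
theorem copySetup (h : SaddleSetup δ χ m k l) (hC3 : ConditionC3 δ χ m) :
    ∃ C : ℝ, CopySetup δ (fun n => law δ (χ n)) χ (fun n => (weightGF δ : ℝ → ℝ) (χ n))
      (fun n => 1 + χ n) (fun n => 2 * (m n : ℝ) / n) m C ((k : ℝ) / l)
      (fun n => moment δ (χ n)) k l := by
  obtain ⟨a, ha, hmn⟩ := h.exists_mul_le
  obtain ⟨K₁, hK₁, h1⟩ := h.exists_scale_mul_le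
  obtain ⟨K₂, hK₂, h2⟩ := h.adm.exists_moment_le 1
  obtain ⟨K₃, hK₃, h3⟩ := h.adm.exists_weightGF_mul_le (q := Real.exp 4)
    (Real.one_le_exp (by norm_num))
  obtain ⟨K₄, hK₄, h4⟩ := h.hup
  set C := 1 + 1 / a + K₂ + K₃ + K₁ * K₄ with hC
  have ha' : 0 < 1 / a := by positivity
  have hK14 : 0 ≤ K₁ * K₄ := by positivity
  have hC1 : 1 ≤ C := by linarith
  have hM : ∀ᶠ n : ℕ in atTop, 1 ≤ 1 + χ n ∧ 1 + χ n ≤ C * (n : ℝ) ^ (1 - (k : ℝ) / l) := by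
    filter_upwards [h1, h4, h.hχ, eventually_ge_atTop 1] with n h1 h4 hχ hn
    have hn0 : (0 : ℝ) < n := by exact_mod_cast hn
    refine ⟨by linarith [hχ.1], ?_⟩
    rw [← le_div_iff₀ hn0] at h1
    calc 1 + χ n ≤ K₁ * m n / n := h1
      _ ≤ K₁ * (K₄ * (n : ℝ) ^ (2 - (k : ℝ) / l)) / n := by gcongr
      _ = K₁ * K₄ * (n : ℝ) ^ (1 - (k : ℝ) / l) := by
          rw [show 2 - (k : ℝ) / l = (1 - (k : ℝ) / l) + 1 by ring, Real.rpow_add hn0,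
            Real.rpow_one]
          field_simp
      _ ≤ _ := by
          gcongr
          linarith
  have hμ : ∀ᶠ n : ℕ in atTop, 0 < χ n ∧ (n : ℝ) * (2 * (m n : ℝ) / n) = (2 * m n : ℕ) := by
    filter_upwards [h.hχ, eventually_ge_atTop 1] with n hχ hn
    have hn0 : (0 : ℝ) < n := by exact_mod_cast hn
    refine ⟨hχ.1, ?_⟩
    push_cast; field_simp
  have hset : ∀ᶠ n in atTop, NatLaw.Setup (law δ (χ n)) n (1 + χ n) (2 * (m n : ℝ) / n) C
      (2 * m n) := by
    filter_upwards [h.hχ, hμ, hmn, eventually_ge_atTop 1] with n hχ hμ hmn hn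
    have hn0 : (0 : ℝ) < n := by exact_mod_cast hn
    have hM0 : 0 < 1 + χ n := by linarith [hχ.1]
    refine ⟨h.adm.law_isLaw hχ.1, hχ.2 ▸ mean h.adm.hδ h.adm.hs _, hμ.2, ?_, ?_,
      _, h.adm.hasSum_law_exp _, (h3 _ hχ.1).trans ?_⟩
    · push_cast
      calc (n : ℝ) = 1 / a * (a * n) := by field_simp
        _ ≤ 1 / a * m n := by gcongr
        _ ≤ C * m n := by gcongr; linarith
        _ ≤ C * (2 * m n) := by gcongr; linarith [(m n).cast_nonneg (α := ℝ)]
    · rw [← hμ.2]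
      have h5 := h2 _ hχ.1
      rw [hχ.2, pow_one] at h5
      calc (n : ℝ) * (2 * (m n : ℝ) / n) ≤ n * (K₂ * (1 + χ n)) := by gcongr
        _ ≤ n * (C * (1 + χ n)) := by gcongr; linarith
        _ = _ := by ring
    · gcongr
      linarith
  have harc := fun ε (h5 : 0 < ε) h6 => h.adm.eventually_arc_le hC3 hμ (ε := ε) h5 h6
  refine ⟨C, ⟨hC1, h.exponent_pos, hset, hM, fun c hc =>
    NatLaw.eventually_exp_le_powLaw hC1 h.exponent_pos hset hM harc hc,
    Eventually.of_forall fun n d => hasSum_law_descFactorial h.adm.hδ h.adm.hs _ d, fun d => ?_⟩,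
    ?_, h.hk, h.hl, h.tendsto_m, ⟨K₁, hK₁, h1⟩, h.hup⟩
  · obtain ⟨K, -, hK⟩ := h.adm.exists_moment_le d
    exact ⟨K, h.hχ.mono fun n hn => hK _ hn.1⟩
  · exact h.hχ.mono fun n hn => h.adm.isTilt hn.1

theorem tendsto_two_mul_div (h : SaddleSetup δ χ m k l) (hkl : k < l) :
    Tendsto (fun n : ℕ => 2 * (m n : ℝ) / n) atTop atTop := by
  obtain ⟨a, ha, hlow⟩ := h.hlow
  have hl : (0 : ℝ) < l := by exact_mod_cast h.hl
  have he : 0 < 1 - (k : ℝ) / l := by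
    rw [sub_pos, div_lt_one hl]; exact_mod_cast hkl
  refine tendsto_atTop_mono' _ ?_ ((NatLaw.tendsto_natCast_rpow he).const_mul_atTop ha)
  filter_upwards [hlow, eventually_ge_atTop 1] with n hn hn1
  have hn0 : (0 : ℝ) < n := by exact_mod_cast hn1
  rw [le_div_iff₀ hn0, mul_assoc]
  have e : (n : ℝ) ^ (1 - (k : ℝ) / l) * n = (n : ℝ) ^ (2 - (k : ℝ) / l) := by
    rw [show 2 - (k : ℝ) / l = (1 - (k : ℝ) / l) + 1 by ring, Real.rpow_add hn0, Real.rpow_one]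
  rw [e]
  linarith [(m n).cast_nonneg (α := ℝ)]

theorem tendsto_saddle (h : SaddleSetup δ χ m k l) (hkl : k < l) : Tendsto χ atTop atTop := by
  obtain ⟨K, hK, hle⟩ := h.adm.exists_moment_le 1
  refine tendsto_atTop.2 fun B => ?_
  filter_upwards [h.hχ, (h.tendsto_two_mul_div hkl).eventually_gt_atTop (K * (1 + |B|))]
    with n hχ hn
  have h1 := hle _ hχ.1
  rw [hχ.2, pow_one] at h1
  have h2 : K * (1 + |B|) < K * (1 + χ n) := hn.trans_le h1
  have h3 := lt_of_mul_lt_mul_left h2 hK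
  linarith [le_abs_self B]

open Classical in
/-- The parameter when the mean tends to infinity. -/
theorem tendsto_of_lt (h : SaddleSetup δ χ m k l) (hkl : k < l) (oriented : Bool)
    (F : Multigraph (Fin k) (Fin l)) {c : ℝ} (hc0 : 0 < c)
    (hc : Tendsto (fun n : ℕ => (m n : ℝ) / (n : ℝ) ^ (2 - (k : ℝ) / l)) atTop (𝓝 c)) :
    ∃ lam : ℝ, 0 < lam ∧
      Tendsto (fun n : ℕ => F.genFun oriented n (1 / (2 * m n)) (moment δ (χ n))) atTop
        (𝓝 lam) := by
  choose L hL hlim using h.adm.hratio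
  set r : ℕ → ℝ → ℝ := fun j x => iteratedDeriv j (weightGF δ : ℝ → ℝ) x / weightGF δ x with hr
  have hr1 : ∀ j, Tendsto (fun n => r j (χ n)) atTop (𝓝 (L j)) := fun j =>
    (hlim j).comp (h.tendsto_saddle hkl)
  set Λ := ∑ F' : Multigraph (Fin k) (Fin l),
    if Isomorphic oriented F F' then ∏ v, L (F'.degree v) else 0 with hΛ
  have hΛ0 : 0 < Λ := by
    refine sum_pos' (fun F' _ => ?_) ⟨F, mem_univ _, ?_⟩
    · split_ifs
      exacts [prod_nonneg fun v _ => (hL _).le, le_rfl]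
    · rw [if_pos ⟨Equiv.refl _, Equiv.refl _, fun e => Or.inl rfl⟩]
      exact prod_pos fun v _ => hL _
  have hΛlim : Tendsto (fun n => ∑ F' : Multigraph (Fin k) (Fin l),
      if Isomorphic oriented F F' then ∏ v, r (F'.degree v) (χ n) else 0) atTop (𝓝 Λ) := by
    refine tendsto_finsetSum _ fun F' _ => ?_
    split_ifs
    exacts [tendsto_finsetProd _ fun v _ => hr1 _, tendsto_const_nhds]
  have hkl0 : (0 : ℝ) < (k ! * l ! : ℕ) := by
    have := Nat.factorial_pos k; have := Nat.factorial_pos l; positivity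
  have hL1 := hL 1
  refine ⟨((k ! * l ! : ℕ) : ℝ)⁻¹ * ((L 1 ^ (2 * l))⁻¹ * c ^ l * Λ), by positivity, ?_⟩
  refine Tendsto.congr' ?_ (((((hr1 1).pow (2 * l)).inv₀ (pow_ne_zero _ hL1.ne')).mul
    (hc.pow l)).mul hΛlim |>.const_mul ((k ! * l ! : ℕ) : ℝ)⁻¹)
  filter_upwards [h.hχ, eventually_ge_atTop 1, h.tendsto_m.eventually_ge_atTop 1] with n hχ hn hm
  have hn0 : (0 : ℝ) < n := by exact_mod_cast hn
  have hm0 : (0 : ℝ) < m n := by exact_mod_cast hm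
  have hχ0 := hχ.1
  rw [inv_mul_eq_iff_eq_mul₀ hkl0.ne', factorial_mul_genFun]
  -- The saddle point equation. It eliminates χ: the factor χ^(2l) n^k/(4m)^l becomes (m / n^(2 -
  -- k/l))^l divided by the 2l-th power of this ratio.
  have e1 : r 1 (χ n) = 2 * (m n : ℝ) / n / χ n := by
    rw [← hχ.2, Admissible.moment_eq]; field_simp; rfl
  have e2 : ∀ F' : Multigraph (Fin k) (Fin l), ∏ v, moment δ (χ n) (F'.degree v) =
      χ n ^ (2 * l) * ∏ v, r (F'.degree v) (χ n) := fun F' => by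
    rw [← sum_degree F', ← prod_pow_eq_pow_sum, ← prod_mul_distrib]
    exact prod_congr rfl fun v _ => Admissible.moment_eq _ _
  have e3 : (∑ F' : Multigraph (Fin k) (Fin l),
      if Isomorphic oriented F F' then ∏ v, moment δ (χ n) (F'.degree v) else 0) =
      χ n ^ (2 * l) * ∑ F' : Multigraph (Fin k) (Fin l),
      if Isomorphic oriented F F' then ∏ v, r (F'.degree v) (χ n) else 0 := by
    rw [mul_sum]
    exact sum_congr rfl fun F' _ => by rw [e2, mul_ite, mul_zero]
  have hl : (0 : ℝ) < l := by exact_mod_cast h.hl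
  have e4 : ((n : ℝ) ^ (2 - (k : ℝ) / l)) ^ l * (n : ℝ) ^ k = (n : ℝ) ^ (2 * l) := by
    rw [← Real.rpow_natCast ((n : ℝ) ^ _) l, ← Real.rpow_mul hn0.le, ← Real.rpow_natCast (n : ℝ) k,
      ← Real.rpow_add hn0, ← Real.rpow_natCast (n : ℝ) (2 * l)]
    congr 1; push_cast; field_simp; ring
  have hN : 0 < ((n : ℝ) ^ (2 - (k : ℝ) / l)) ^ l := by positivity
  rw [e3, ← mul_assoc]
  congr 1
  rw [e1, div_pow (m n : ℝ), div_pow, div_pow, ← e4, mul_pow, mul_pow, pow_mul (2 : ℝ), two_mul l,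
    pow_add (m n : ℝ)]
  norm_num
  field_simp

end SaddleSetup

end WeightGF

end

/-! ### The limit of the parameter at density one -/

noncomputable section

namespace WeightGF

open Finset Multigraph

variable {δ : ℕ → ℝ} {χ : ℕ → ℝ} {m : ℕ → ℕ} {k l : ℕ}

namespace Admissible

theorem continuousAt_moment (h : Admissible δ) (d : ℕ) {x : ℝ} (hx : 0 < x) :
    ContinuousAt (fun x => moment δ x d) x := by
  have h0 := continuous_iteratedDeriv h.hδ h.hs 0
  rw [iteratedDeriv_zero] at h0
  exact ((continuous_id.pow d).mul (continuous_iteratedDeriv h.hδ h.hs d)).continuousAt.div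
    h0.continuousAt (h.weightGF_pos hx).ne'

/-- The moments have a limit at zero. -/
theorem exists_tendsto_moment_zero (h : Admissible δ) (d : ℕ) :
    ∃ y : ℝ, Tendsto (fun x => moment δ x d) (𝓝[>] 0) (𝓝 y) := by
  obtain ⟨j₀, hj₀, hj⟩ := exists_least h.hpoly
  have h0 : 0 < δ j₀ := lt_of_le_of_ne (h.hδ _) hj₀.symm
  set N := iteratedDeriv d (weightGF δ : ℝ → ℝ) 1 with hN
  have hmem : ∀ᶠ x : ℝ in 𝓝[>] 0, 0 < x ∧ x ≤ 1 :=
    mem_of_superset (Ioc_mem_nhdsGT one_pos) fun x hx => hx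
  -- As x tends to 0 the tilted law concentrates on the least index j₀ of its support; the other
  -- indices contribute O(x).
  refine ⟨j₀.descFactorial d, tendsto_of_tendsto_of_tendsto_of_le_of_le'
    (g := fun _ => (j₀.descFactorial d : ℝ))
    (h := fun x => (j₀.descFactorial d : ℝ) + x * (j₀ ! / δ j₀ * N)) tendsto_const_nhds ?_ ?_ ?_⟩
  · have h1 : ContinuousAt (fun x : ℝ => (j₀.descFactorial d : ℝ) + x * (j₀ ! / δ j₀ * N)) 0 := by
      fun_prop
    have h2 := h1.tendsto
    rw [zero_mul, add_zero] at h2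
    exact h2.mono_left nhdsWithin_le_nhds
  · filter_upwards [hmem] with x hx
    have hw := h.law_isLaw hx.1
    have h1 := hw.hasSum.mul_right (j₀.descFactorial d : ℝ)
    rw [one_mul] at h1
    refine hasSum_le (fun j => ?_) h1 (hasSum_law_descFactorial h.hδ h.hs x d)
    rcases lt_or_ge j j₀ with hlt | hge
    · simp [law, hj j hlt]
    · have := hw.nonneg j
      have := Nat.descFactorial_le d hge
      gcongr
  · filter_upwards [hmem] with x hx
    have hw := h.law_isLaw hx.1
    have h1 := hw.hasSum.mul_right (j₀.descFactorial d : ℝ)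
    have h2 := ((hasSum_descFactorial h.hδ h.hs d 1).mul_left (j₀ ! / δ j₀)).mul_left x
    rw [one_pow, one_mul] at h2
    rw [one_mul] at h1
    refine hasSum_le (fun j => ?_) (hasSum_law_descFactorial h.hδ h.hs x d) (h1.add h2)
    have hδj := h.hδ j
    have hx0 := hx.1
    rcases lt_trichotomy j j₀ with hlt | rfl | hgt
    · simp [law, hj j hlt]
    · have : 0 ≤ x * ((j ! : ℝ) / δ j * (δ j * 1 ^ j / (j ! : ℝ) * (j.descFactorial d : ℝ))) := by
        positivity
      linarith
    · have h3 : 0 ≤ law δ x j * (j₀.descFactorial d : ℝ) :=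
        mul_nonneg (hw.nonneg j) (Nat.cast_nonneg _)
      have h4 : law δ x j ≤ x * ((j₀ ! : ℝ) / δ j₀ * (δ j * 1 ^ j / (j ! : ℝ))) := by
        have h5 := le_weightGF h.hδ h.hs j₀ hx0
        have h6 : x ^ j ≤ x * x ^ j₀ := by
          rw [← pow_succ']; exact pow_le_pow_of_le_one hx0.le hx.2 hgt
        calc law δ x j ≤ δ j * (x * x ^ j₀) / (j ! : ℝ) / (δ j₀ * x ^ j₀ / (j₀ ! : ℝ)) := by
              rw [law]; gcongr
          _ = _ := by rw [one_pow]; field_simp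
      have h7 := mul_le_mul_of_nonneg_right h4 (Nat.cast_nonneg (α := ℝ) (j.descFactorial d))
      linarith

/-- The moments converge together with the mean. -/
theorem exists_tendsto_moment (h : Admissible δ) (hχ : ∀ᶠ n in atTop, 0 < χ n) {μ : ℝ}
    (hμ : Tendsto (fun n => moment δ (χ n) 1) atTop (𝓝 μ)) (d : ℕ) :
    ∃ y : ℝ, Tendsto (fun n => moment δ (χ n) d) atTop (𝓝 y) := by
  have hmono := moment_one_strictMonoOn h.hδ h.hs h.hpoly
  have hbdd : ∀ᶠ n in atTop, χ n ≤ h.exists_le_moment_one.choose * (1 + (μ + 1)) := by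
    obtain ⟨hK, hle⟩ := h.exists_le_moment_one.choose_spec
    filter_upwards [hχ, hμ.eventually_le_const (lt_add_one μ)] with n hn h1
    have h2 := hle _ hn
    have h3 : h.exists_le_moment_one.choose * (1 + moment δ (χ n) 1) ≤
      h.exists_le_moment_one.choose * (1 + (μ + 1)) := by gcongr
    linarith
  -- If χ kept crossing from below a to above b, the limit μ of the means would be at least the mean
  -- at b and at most... the crossing inequalities give moment at b ≤ μ ≤ moment at a, against
  -- strict monotonicity.
  obtain ⟨z, hz⟩ : ∃ z, Tendsto χ atTop (𝓝 z) := by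
    refine tendsto_of_no_upcrossings dense_univ (fun a _ b _ hab hfr => ?_)
      ⟨_, eventually_map.2 hbdd⟩ ⟨0, eventually_map.2 (hχ.mono fun n hn => hn.le)⟩
    obtain ⟨n, hn⟩ := (hfr.1.and_eventually hχ).exists
    have ha : 0 < a := hn.2.trans hn.1
    have h1 : μ ≤ moment δ a 1 := le_of_tendsto_of_frequently hμ
      ((hfr.1.and_eventually hχ).mono fun n hn => (hmono hn.2 ha hn.1).le)
    have h2 : moment δ b 1 ≤ μ := ge_of_tendsto_of_frequently hμ
      (hfr.2.mono fun n hn => (hmono (ha.trans hab) ((ha.trans hab).trans hn) hn).le)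
    exact absurd (hmono ha (ha.trans hab) hab) (not_lt.2 (h2.trans h1))
  have hz0 : 0 ≤ z := ge_of_tendsto hz (hχ.mono fun n hn => hn.le)
  rcases hz0.eq_or_lt with rfl | hz0
  · obtain ⟨y, hy⟩ := h.exists_tendsto_moment_zero d
    exact ⟨y, hy.comp (tendsto_nhdsWithin_iff.2 ⟨hz, hχ⟩)⟩
  · exact ⟨_, (h.continuousAt_moment d hz0).tendsto.comp hz⟩

end Admissible

open Classical in
/-- The parameter when the mean has a finite limit. -/
theorem SaddleSetup.tendsto_of_eq (h : SaddleSetup δ χ m k l) (hkl : k = l) (oriented : Bool)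
    (F : Multigraph (Fin k) (Fin l)) {c : ℝ} (hc0 : 0 < c)
    (hc : Tendsto (fun n : ℕ => (m n : ℝ) / (n : ℝ) ^ (2 - (k : ℝ) / l)) atTop (𝓝 c)) :
    ∃ lam : ℝ,
      Tendsto (fun n : ℕ => F.genFun oriented n (1 / (2 * m n)) (moment δ (χ n))) atTop
        (𝓝 lam) := by
  subst hkl
  have hk : (k : ℝ) ≠ 0 := by have := h.hk; positivity
  rw [div_self hk] at hc
  have hc1 : Tendsto (fun n : ℕ => (m n : ℝ) / n) atTop (𝓝 c) := by
    refine hc.congr fun n => ?_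
    rw [show (2 : ℝ) - 1 = 1 by norm_num, Real.rpow_one]
  have hμ : Tendsto (fun n => moment δ (χ n) 1) atTop (𝓝 (2 * c)) := by
    refine (hc1.const_mul 2).congr' ?_
    filter_upwards [h.hχ] with n hn
    rw [hn.2, mul_div_assoc]
  choose y hy using fun d => h.adm.exists_tendsto_moment (h.hχ.mono fun n hn => hn.1) hμ d
  have hlim : Tendsto (fun n => ∑ F' : Multigraph (Fin k) (Fin k),
      if Isomorphic oriented F F' then ∏ v, moment δ (χ n) (F'.degree v) else 0) atTop
      (𝓝 (∑ F' : Multigraph (Fin k) (Fin k),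
        if Isomorphic oriented F F' then ∏ v, y (F'.degree v) else 0)) := by
    refine tendsto_finsetSum _ fun F' _ => ?_
    split_ifs
    exacts [tendsto_finsetProd _ fun v _ => hy _, tendsto_const_nhds]
  refine ⟨_, Tendsto.congr (fun n => ?_) (((((hc1.const_mul 4).pow k).inv₀
    (by positivity)).mul hlim).const_mul ((k ! * k ! : ℕ) : ℝ)⁻¹)⟩
  have hkl0 : ((k ! * k ! : ℕ) : ℝ) ≠ 0 := by
    have := Nat.factorial_pos k; positivity
  rw [inv_mul_eq_iff_eq_mul₀ hkl0, factorial_mul_genFun]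
  congr 1
  rw [mul_div_assoc', div_pow, inv_div]

end WeightGF

end

/-! ### The theorem -/

theorem mainTheorem9
    -- nonnegative weights, infinite radius of convergence, not a polynomial
    (δ : ℕ → ℝ) (hδ : ∀ j, 0 ≤ δ j)
    (hradius : ∀ x : ℝ, Summable fun j => δ j * x ^ j / (j ! : ℝ))
    (hpoly : {j | δ j ≠ 0}.Infinite)
    (hratio : ∀ j : ℕ, ∃ L : ℝ, 0 < L ∧
      Tendsto (fun x : ℝ => iteratedDeriv j (weightGF δ : ℝ → ℝ) x / weightGF δ x) atTop (𝓝 L))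
    -- a strictly balanced multigraph of density at least one
    {k l : ℕ} (F : Multigraph (Fin k) (Fin l)) (hF : F.StrictlyBalanced) (hd : 1 ≤ F.density)
    (m : ℕ → ℕ)
    (hm : (fun n => (m n : ℝ)) =Θ[atTop] fun n : ℕ => (n : ℝ) ^ (2 - 1 / F.density))
    (χ : ℕ → ℝ)
    (hχ : ∀ᶠ n : ℕ in atTop, 0 < χ n ∧
      χ n * deriv (weightGF δ : ℝ → ℝ) (χ n) / weightGF δ (χ n) = 2 * (m n : ℝ) / (n : ℝ))
    (hC3 : ConditionC3 δ χ m)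
    -- isomorphism of multigraphs with or without respect for the orientation of edges
    (oriented : Bool) :
    -- the parameters are bounded, and the law is asymptotically Poisson with these parameters
    ((fun n => poissonParam oriented δ F (χ n) n (m n)) =O[atTop] fun _ => (1 : ℝ)) ∧
    (∀ t : ℕ, Tendsto (fun n => F.probCopies oriented δ n (m n) t -
      Real.exp (-poissonParam oriented δ F (χ n) n (m n)) *
        poissonParam oriented δ F (χ n) n (m n) ^ t / (t ! : ℝ)) atTop (𝓝 0)) ∧
    -- when the parameters have a limit, the limit law is the Poisson law of that parameter
    (∀ lam : ℝ, Tendsto (fun n => poissonParam oriented δ F (χ n) n (m n)) atTop (𝓝 lam) →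
      ∀ t : ℕ, Tendsto (fun n => F.probCopies oriented δ n (m n) t) atTop
        (𝓝 (Real.exp (-lam) * lam ^ t / (t ! : ℝ)))) ∧
    -- they have a limit as soon as `m / n ^ (2 - 1 / d)` has one
    (∀ c : ℝ, Tendsto (fun n : ℕ => (m n : ℝ) / (n : ℝ) ^ (2 - 1 / F.density)) atTop (𝓝 c) →
      ∃ lam : ℝ, (1 < F.density → 0 < lam) ∧
        Tendsto (fun n => poissonParam oriented δ F (χ n) n (m n)) atTop (𝓝 lam)) := by
  have hk : k ≠ 0 := by
    rintro rfl
    norm_num [Multigraph.density] at hd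
  have hk0 : (0 : ℝ) < k := by positivity
  have hdens : F.density = (l : ℝ) / k := by simp [Multigraph.density]
  have hinv : 1 / F.density = (k : ℝ) / l := by rw [hdens, one_div_div]
  rw [hdens, one_le_div₀ hk0] at hd
  rw [hinv] at hm
  have hm1 : ∃ a : ℝ, 0 < a ∧ ∀ᶠ n : ℕ in atTop, a * (n : ℝ) ^ (2 - (k : ℝ) / l) ≤ m n := by
    obtain ⟨K, hK, h⟩ := hm.2.exists_pos
    refine ⟨K⁻¹, by positivity, h.bound.mono fun n hn => ?_⟩
    rw [Real.norm_of_nonneg (by positivity), Real.norm_natCast] at hn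
    rwa [inv_mul_le_iff₀ hK]
  have hm2 : ∃ K : ℝ, 0 ≤ K ∧ ∀ᶠ n : ℕ in atTop,
      (m n : ℝ) ≤ K * (n : ℝ) ^ (2 - (k : ℝ) / l) := by
    obtain ⟨K, hK, h⟩ := hm.1.exists_nonneg
    refine ⟨K, hK, h.bound.mono fun n hn => ?_⟩
    rwa [Real.norm_of_nonneg (by positivity : 0 ≤ (n : ℝ) ^ (2 - (k : ℝ) / l)),
      Real.norm_natCast] at hn
  have h : WeightGF.SaddleSetup δ χ m k l :=
    ⟨⟨hδ, hradius, hpoly, hratio⟩, Nat.pos_of_ne_zero hk, by exact_mod_cast hd, hm1, hm2,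
      hχ.mono fun n hn => ⟨hn.1, by
        rw [← hn.2, WeightGF.moment, pow_one, iteratedDeriv_one]⟩⟩
  obtain ⟨C, hS⟩ := h.copySetup hC3
  have hP : ∀ t : ℕ, Tendsto (fun n => F.probCopies oriented δ n (m n) t -
      Real.exp (-poissonParam oriented δ F (χ n) n (m n)) *
        poissonParam oriented δ F (χ n) n (m n) ^ t / (t ! : ℝ)) atTop (𝓝 0) :=
    fun t => hS.poisson oriented hF t
  refine ⟨hS.isBigO_genFun oriented F, hP, fun lam hlam t => ?_, fun c hc => ?_⟩
  · have h1 := (hP t).add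
      (((Real.continuous_exp.tendsto _).comp hlam.neg).mul (hlam.pow t) |>.div_const (t ! : ℝ))
    rw [zero_add] at h1
    exact h1.congr fun n => sub_add_cancel _ _
  · rw [hinv] at hc
    have hc0 : 0 < c := by
      obtain ⟨a, ha, hle⟩ := hm1
      refine ha.trans_le (ge_of_tendsto hc ?_)
      filter_upwards [hle, eventually_ge_atTop 1] with n hn hn1
      have hn0 : (0 : ℝ) < n := by exact_mod_cast hn1
      rwa [le_div_iff₀ (by positivity)]
    -- If k < l the saddle point tends to infinity and the limiting ratios are positive. If k = l it
    -- stays bounded and may tend to 0, where limiting moments can vanish; so no positivity is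
    -- claimed there.
    rcases (show k ≤ l by exact_mod_cast hd).eq_or_lt with hkl | hkl
    · obtain ⟨lam, hlam⟩ := h.tendsto_of_eq hkl oriented F hc0 hc
      refine ⟨lam, fun h1 => ?_, hlam⟩
      rw [hdens, one_lt_div hk0] at h1
      exact absurd (by exact_mod_cast hkl : (k : ℝ) = l) h1.ne
    · obtain ⟨lam, hlam0, hlam⟩ := h.tendsto_of_lt hkl oriented F hc0 hc
      exact ⟨lam, fun _ => hlam0, hlam⟩
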